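/- Let $p\ge 5$ be a prime, $G_{\mathbb{Q}_p}=\mathrm{Gal}(\overline{\mathbb{Q}}_p/\mathbb{Q}_p)$, $G=\mathrm{GL}_2(\mathbb{Q}_p)$ with centre $Z$, $K=\mathrm{GL}_2(\mathbb{Z}_p)$, $I\subset K$ the Iwahori subgroup of matrices that are upper triangular mod $p$, $\alpha=\begin{pmatrix}1&0\\0&p\end{pmatrix}$, $\beta=\begin{pmatrix}0&1\\p&0\end{pmatrix}$, and $[t]\in\mathbb{Z}_p$ the Teichmüller lift of $t\in\mathbb{F}_p$. All representations are over $\overline{\mathbb{F}}_p$, which is identified with the residue field of $\overline{\mathbb{Q}}_p$. For a representation $\sigma$ of $H\in\{K,I\}$, extended to $HZ$ by letting $p\in Z$ act trivially, $\mathrm{ind}_{HZ}^G\sigma$ is the space of functions $f$ on $G$ with $f(hg)=\sigma(h)f(g)$ for $h\in HZ$ and with support compact mod $HZ$, where $G$ acts by right translation; $\llbracket g,v\rrbracket$ is the function supported on $HZg^{-1}$ with $\llbracket g,v\rrbracket(g')=\sigma(g'g)v$ there. For $0\le r\le p-1$ let $d^r$ be the character $\begin{pmatrix}a&b\\c&d\end{pmatrix}\mapsto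 d^r \bmod p$ of $I$, and put on $\mathrm{ind}_{IZ}^G d^r$ $$T_{1,0}\llbracket g,v\rrbracket=\llbracket g\beta,v\rrbracket,\quad T_{-1,0}\llbracket g,v\rrbracket=\sum_{t\in\mathbb{F}_p}\llbracket g\begin{pmatrix}p&[t]\\0&1\end{pmatrix},v\rrbracket,\quad T_{1,2}\llbracket g,v\rrbracket=\sum_{t\in\mathbb{F}_p}\llbracket g\begin{pmatrix}1&0\\p[t]&p\end{pmatrix},v\rrbracket .$$ ($T_{1,0}$ is used only for $r=0,p-1$.) For $\lambda\in\overline{\mathbb{F}}_p$ and a smooth character $\eta:\mathbb{Q}_p^*\to\overline{\mathbb{F}}_p^*$ put $$\pi(r,\lambda,\eta)=\frac{\mathrm{ind}_{IZ}^G\,d^r}{\mathrm{Im}(T_{-1,0}+\delta_{r,p-1}T_{1,0})+\mathrm{Im}(T_{1,2}+\delta_{r,0}T_{1,0}-\lambda)}\otimes(\eta\circ\det).$$ Let $V_r$ be the space of homogeneous polynomials $v(X,Y)$ of degree $r$, with $\begin{pmatrix}a&b\\c&d\end{pmatrix}v=v(aX+cY,bX+dY)$, and put $\pi^{\mathrm{sph}}(r,\lambda,\eta)=\big(\mathrm{ind}_{KZ}^GV_r/\mathrm{Im}(T-\lambda)\big)\otimes(\eta\circ\det)$,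 where $T\llbracket g,v\rrbracket=\sum_{t\in\mathbb{F}_p}\llbracket g\begin{pmatrix}p&[t]\\0&1\end{pmatrix},v(X,-[t]X+pY)\rrbracket+\llbracket g\alpha,v(pX,Y)\rrbracket$. On the Galois side, characters of $\mathbb{Q}_p^*$ are viewed as characters of $G_{\mathbb{Q}_p}$ through the Artin map (uniformizers correspond to geometric Frobenius elements); $\omega$ is the mod $p$ cyclotomic character; $\mu_\lambda$ is the unramified character sending the geometric Frobenius to $\lambda$; $\omega_2$ is the fundamental character of level $2$ of inertia; and, for $p+1\nmid c$, $\mathrm{ind}\,\omega_2^c$ is induced to $G_{\mathbb{Q}_p}$ from a smooth character of $\mathrm{Gal}(\overline{\mathbb{Q}}_p/\mathbb{Q}_{p^2})$ that extends $\omega_2^c$ and is such that $\det(\mathrm{ind}\,\omega_2^c)=\omega^c$. For an integer $a$, $[a]\in\{0,\dots,p-2\}$ is its class mod $p-1$; $\mathrm{ss}$ denotes semisimplification. Breuil's semisimple mod $p$ local Langlands correspondence is defined, for $0\le r\le p-1$, smooth $\eta$ and $\lambda\in\overline{\mathbb{F}}_p^*$, by $(\mathrm{ind}\,\omega_2^{r+1})\otimes\eta\mapsto\pi^{\mathrm{sph}}(r,0,\eta)$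 and $(\mu_\lambda\omega^{r+1}\oplus\mu_{\lambda^{-1}})\otimes\eta\mapsto\pi^{\mathrm{sph}}(r,\lambda,\eta)^{\mathrm{ss}}\oplus\pi^{\mathrm{sph}}([p-3-r],\lambda^{-1},\eta\omega^{r+1})^{\mathrm{ss}}$. **Theorem.** This is a well-defined one-to-one correspondence between isomorphism classes of these smooth representations of $G_{\mathbb{Q}_p}$ and of certain smooth representations of $G$, and it is given by Iwahori induction as follows. Let $r\in\{0,\dots,p-1\}$ and let $\eta:\mathbb{Q}_p^*\to\overline{\mathbb{F}}_p^*$ be a smooth character. 1. (The required extension of $\omega_2^{r+1}$ exists, and) the image of $(\mathrm{ind}\,\omega_2^{r+1})\otimes\eta$ is the isomorphism class of $\pi(r,0,\eta)$. 2. If $\lambda\in\overline{\mathbb{F}}_p^*$, then $\pi(r,\lambda,\eta)$ and $\pi([p-3-r],\lambda^{-1},\eta\omega^{r+1})$ have finite length, and the image of $(\mu_\lambda\omega^{r+1}\oplus\mu_{\lambda^{-1}})\otimes\eta$ is the isomorphism class of $\pi(r,\lambda,\eta)^{\mathrm{ss}}\oplus\pi([p-3-r],\lambda^{-1},\eta\omega^{r+1})^{\mathrm{ss}}$.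 -/

import Mathlib

namespace ModPLLC

noncomputable section

open Polynomial

/-- The absolute Galois group of `ℚ_p`. -/
abbrev GalQp (p : ℕ) [Fact p.Prime] : Type := Gal(PadicAlgCl p/ℚ_[p])

/-- The field `𝔽̄_p`. -/
abbrev Fpbar (p : ℕ) [Fact p.Prime] : Type := AlgebraicClosure (ZMod p)

lemma norm_galQp {p : ℕ} [Fact p.Prime] (σ : GalQp p) (x : PadicAlgCl p) : ‖σ x‖ = ‖x‖ := by
  rw [← PadicAlgCl.spectralNorm_eq, ← PadicAlgCl.spectralNorm_eq]
  exact (spectralNorm_eq_of_equiv σ x).symm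

lemma norm_rootOfUnity {p : ℕ} [Fact p.Prime] {N : ℕ} (hN : N ≠ 0) {x : PadicAlgCl p}
    (hx : x ^ N = 1) : ‖x‖ = 1 := by
  have : ‖x‖ ^ N = 1 := by rw [← norm_pow, hx, norm_one]
  exact (pow_eq_one_iff_of_nonneg (norm_nonneg x) hN).1 this

/-- Roots of unity of order prime to `p` which are congruent modulo the maximal ideal are equal. -/
lemma rootOfUnity_eq_one {p : ℕ} [Fact p.Prime] {N : ℕ} (hN : p.Coprime N) {x : PadicAlgCl p}
    (hx : x ^ N = 1) (h : ‖x - 1‖ < 1) : x = 1 := by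
  by_contra hne
  have hp : p.Prime := Fact.out
  have hN0 : N ≠ 0 := by
    rintro rfl
    exact hp.one_lt.ne' (by simpa using hN)
  have hn : ‖x‖ = 1 := norm_rootOfUnity hN0 hx
  have hgeom : ∑ j ∈ Finset.range N, x ^ j = 0 := by
    have := mul_geom_sum x N
    rw [hx, sub_self] at this
    exact (mul_eq_zero.1 this).resolve_left (sub_ne_zero.2 hne)
  have hlt : ∀ j, ‖x ^ j - 1‖ < 1 := by
    intro j
    rw [← mul_geom_sum, norm_mul]
    have : ‖∑ i ∈ Finset.range j, x ^ i‖ ≤ 1 := by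
      apply IsUltrametricDist.norm_sum_le_of_forall_le_of_nonneg zero_le_one
      intro i _
      rw [norm_pow, hn, one_pow]
    calc ‖x - 1‖ * _ ≤ ‖x - 1‖ * 1 := by gcongr
      _ < 1 := by simpa using h
  have h2 : ‖(∑ j ∈ Finset.range N, (x ^ j - 1))‖ < 1 := by
    obtain ⟨i, _, hi⟩ := IsUltrametricDist.exists_norm_finsetSum_le (Finset.range N)
      (fun j => x ^ j - 1)
    exact hi.trans_lt (hlt i)
  rw [Finset.sum_sub_distrib, hgeom, zero_sub, norm_neg] at h2
  have h3 : ‖((N : ℚ_[p]) : PadicAlgCl p)‖ = 1 := by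
    rw [PadicAlgCl.norm_extends]
    exact Padic.norm_natCast_eq_one_iff.2 hN
  simp at h2 h3
  linarith


/-- An endomorphism of a field of characteristic `p` acts on the elements of `𝔽_{pⁿ}` through a
power of Frobenius. -/
lemma exists_frobenius_pow {p : ℕ} [Fact p.Prime] {κ : Type*} [Field κ] [CharP κ p]
    (s : κ →+* κ) {n : ℕ} (hn : n ≠ 0) {z : κ} (hz : z ^ p ^ n = z) :
    ∃ m : ℕ, s z = z ^ p ^ m := by
  have : ExpChar κ p := ExpChar.prime Fact.out
  have hshift : ∏ i ∈ Finset.range n, (X - C (z ^ p ^ (i + 1)))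
      = ∏ i ∈ Finset.range n, (X - C (z ^ p ^ i)) := by
    obtain ⟨k, rfl⟩ := Nat.exists_eq_succ_of_ne_zero hn
    rw [Finset.prod_range_succ, Finset.prod_range_succ', hz]
    simp
  have hF : (∏ i ∈ Finset.range n, (X - C (z ^ p ^ i))).map (frobenius κ p)
      = ∏ i ∈ Finset.range n, (X - C (z ^ p ^ i)) := by
    rw [Polynomial.map_prod, ← hshift]
    refine Finset.prod_congr rfl fun i _ => ?_
    rw [Polynomial.map_sub, map_X, map_C, frobenius_def, ← pow_mul, ← pow_succ]
  have hs : (∏ i ∈ Finset.range n, (X - C (z ^ p ^ i))).map s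
      = ∏ i ∈ Finset.range n, (X - C (z ^ p ^ i)) := by
    ext j
    have h1 := congrArg (fun q => q.coeff j) hF
    simp only [coeff_map, frobenius_def] at h1 ⊢
    have h2 := (Subfield.mem_bot_iff_pow_eq_self κ p).2 h1
    have h3 : (⊥ : Subfield κ) ≤ s.eqLocusField (RingHom.id κ) := bot_le
    exact h3 h2
  have h0 : (∏ i ∈ Finset.range n, (X - C (z ^ p ^ i))).eval z = 0 := by
    rw [eval_prod]
    exact Finset.prod_eq_zero (Finset.mem_range.2 (Nat.pos_of_ne_zero hn)) (by simp)
  have h1 : (∏ i ∈ Finset.range n, (X - C (z ^ p ^ i))).eval (s z) = 0 := by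
    rw [← hs, eval_map, eval₂_at_apply, h0, map_zero]
  rw [eval_prod, Finset.prod_eq_zero_iff] at h1
  obtain ⟨m, _, hm⟩ := h1
  exact ⟨m, by simpa [sub_eq_zero] using hm⟩

/-- Every `σ` acts on the `(pⁿ - 1)`-th roots of unity of `ℚ̄_p` through a power of Frobenius. -/
lemma exists_frobenius_pow_galQp {p : ℕ} [Fact p.Prime] (σ : GalQp p) {n : ℕ} (hn : n ≠ 0) :
    ∃ m : ℕ, ∀ ζ : PadicAlgCl p, ζ ^ (p ^ n - 1) = 1 → σ ζ = ζ ^ p ^ m := by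
  have hp : p.Prime := Fact.out
  have hpn : 1 < p ^ n := Nat.one_lt_pow hn hp.one_lt
  have hN : p.Coprime (p ^ n - 1) := by
    apply Nat.Coprime.coprime_dvd_left (dvd_pow_self p hn)
    rw [Nat.coprime_self_sub_right hpn.le]
    exact Nat.coprime_one_right _
  have : NeZero (p ^ n - 1) := ⟨by omega⟩
  set A := (PadicAlgCl.valued p).v.valuationSubring with hA
  have hmem : ∀ x : PadicAlgCl p, x ∈ A ↔ ‖x‖ ≤ 1 := fun x => Iff.rfl
  have hmax : ∀ x : A, x ∈ IsLocalRing.maximalIdeal A ↔ ‖(x : PadicAlgCl p)‖ < 1 := by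
    intro x
    exact Valuation.mem_maximalIdeal_iff _ _
  let f : A →+* A := (σ : PadicAlgCl p →+* PadicAlgCl p).restrict A A
    (fun x hx => by rw [hmem] at hx ⊢; exact (norm_galQp σ x).trans_le hx)
  have hf : ∀ x : A, (f x : PadicAlgCl p) = σ x := fun x => rfl
  have : IsLocalHom f := by
    constructor
    intro a ha
    by_contra hna
    have h1 := (hmax a).1 hna
    have h2 : f a ∈ IsLocalRing.maximalIdeal A := (hmax _).2 (by rwa [hf, norm_galQp])
    exact h2 ha
  have : CharP (IsLocalRing.ResidueField A) p := by
    have h1 : (p : IsLocalRing.ResidueField A) = 0 := by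
      rw [← map_natCast (IsLocalRing.residue A), IsLocalRing.residue_eq_zero_iff, hmax]
      have : ‖((p : ℚ_[p]) : PadicAlgCl p)‖ < 1 := by
        rw [PadicAlgCl.norm_extends]
        exact Padic.norm_p_lt_one
      simpa using this
    exact (CharP.charP_iff_prime_eq_zero hp).2 h1
  obtain ⟨ζ, hζ⟩ := HasEnoughRootsOfUnity.exists_primitiveRoot (PadicAlgCl p) (p ^ n - 1)
  have hζA : ζ ∈ A := (hmem _).2 (norm_rootOfUnity (NeZero.ne _) hζ.pow_eq_one).le
  have hζA1 : (⟨ζ, hζA⟩ : A) ^ p ^ n = ⟨ζ, hζA⟩ := by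
    apply Subtype.ext
    change ζ ^ p ^ n = ζ
    conv_lhs => rw [← Nat.sub_add_cancel hpn.le, pow_succ, hζ.pow_eq_one, one_mul]
  obtain ⟨m, hm⟩ := exists_frobenius_pow (IsLocalRing.ResidueField.map f) hn
    (z := IsLocalRing.residue A ⟨ζ, hζA⟩) (by rw [← map_pow, hζA1])
  rw [IsLocalRing.ResidueField.map_residue, ← map_pow, ← sub_eq_zero, ← map_sub,
    IsLocalRing.residue_eq_zero_iff, hmax] at hm
  have hm : ‖σ ζ - ζ ^ p ^ m‖ < 1 := hm
  have hζ0 : ζ ≠ 0 := hζ.ne_zero (NeZero.ne _)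
  have hgen : σ ζ = ζ ^ p ^ m := by
    have h0 : ζ ^ p ^ m ≠ 0 := pow_ne_zero _ hζ0
    have : σ ζ / ζ ^ p ^ m = 1 := by
      apply rootOfUnity_eq_one hN
      · rw [div_pow, ← map_pow, pow_right_comm, hζ.pow_eq_one, map_one, one_pow, div_one]
      · have : σ ζ / ζ ^ p ^ m - 1 = (σ ζ - ζ ^ p ^ m) / ζ ^ p ^ m := by field_simp
        rw [this, norm_div, norm_pow, norm_rootOfUnity (NeZero.ne _) hζ.pow_eq_one, one_pow,
          div_one]
        exact hm
    exact (div_eq_one_iff_eq h0).1 this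
  refine ⟨m, fun ξ hξ => ?_⟩
  obtain ⟨i, _, rfl⟩ := hζ.eq_pow_of_pow_eq_one hξ
  rw [map_pow, hgen, pow_right_comm]

lemma orderOf_ne_zero {p : ℕ} [Fact p.Prime] (a : (Fpbar p)ˣ) : orderOf a ≠ 0 := by
  have hint : IsIntegral (ZMod p) (a : Fpbar p) := Algebra.IsIntegral.isIntegral _
  have := IntermediateField.adjoin.finiteDimensional hint
  have : Finite (IntermediateField.adjoin (ZMod p) {(a : Fpbar p)}) :=
    Module.finite_of_finite (ZMod p)
  set b : IntermediateField.adjoin (ZMod p) {(a : Fpbar p)} :=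
    ⟨a, IntermediateField.mem_adjoin_simple_self _ _⟩ with hb
  have hb0 : b ≠ 0 := fun h => a.ne_zero (congrArg Subtype.val h)
  have h1 : IsOfFinOrder (Units.mk0 b hb0) := isOfFinOrder_of_finite _
  rw [isOfFinOrder_iff_pow_eq_one] at h1
  obtain ⟨n, hn, h⟩ := h1
  have h2 : IsOfFinOrder a := isOfFinOrder_iff_pow_eq_one.2 ⟨n, hn, by
    ext
    have := congrArg (fun u => ((u : (IntermediateField.adjoin (ZMod p) {(a : Fpbar p)})ˣ) :
      IntermediateField.adjoin (ZMod p) {(a : Fpbar p)})) h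
    simpa using congrArg Subtype.val this⟩
  exact h2.orderOf_pos.ne'

lemma modEq_of_pow_modEq {p : ℕ} [Fact p.Prime] {n a b : ℕ} (hn : n ≠ 0)
    (h : p ^ a ≡ p ^ b [MOD p ^ n - 1]) : a ≡ b [MOD n] := by
  have hp : 1 < p := (Fact.out : p.Prime).one_lt
  rcases Nat.lt_or_ge 1 n with hn1 | hn1
  swap
  · obtain rfl : n = 1 := by omega
    exact Nat.modEq_one
  have hpn : 1 < p ^ n := Nat.one_lt_pow hn hp
  have h1 : p ^ n ≡ 1 [MOD p ^ n - 1] := ((Nat.modEq_iff_dvd' hpn.le).2 dvd_rfl).symm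
  have key : ∀ c, p ^ c ≡ p ^ (c % n) [MOD p ^ n - 1] := by
    intro c
    conv_lhs => rw [← Nat.div_add_mod c n, pow_add, pow_mul]
    simpa using (h1.pow (c / n)).mul_right (p ^ (c % n))
  have hlt : ∀ c, p ^ (c % n) < p ^ n - 1 := by
    intro c
    have h2 : p ^ (c % n) ≤ p ^ (n - 1) :=
      Nat.pow_le_pow_right hp.le (by have := Nat.mod_lt c (Nat.pos_of_ne_zero hn); omega)
    have h3 : p ^ n = p ^ (n - 1) * p := by rw [← pow_succ]; congr 1; omega
    have h4 : 1 < p ^ (n - 1) := Nat.one_lt_pow (by omega) hp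
    have h5 : p ^ (n - 1) * 2 ≤ p ^ (n - 1) * p := Nat.mul_le_mul_left _ hp
    omega
  have h6 : p ^ (a % n) ≡ p ^ (b % n) [MOD p ^ n - 1] := ((key a).symm.trans h).trans (key b)
  have h7 := Nat.ModEq.eq_of_lt_of_lt h6 (hlt a) (hlt b)
  exact Nat.pow_right_injective hp h7

/-- An exponent `m` such that `σ` acts on `𝔽_{pⁿ}`, where `n` is the order of `a`, as the `m`-th
power of the arithmetic Frobenius `x ↦ x ^ p`. -/
lemma exists_frobExp {p : ℕ} [Fact p.Prime] (a : (Fpbar p)ˣ) (σ : GalQp p) :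
    ∃ m : ℕ, ∀ ζ : PadicAlgCl p, ζ ^ (p ^ orderOf a - 1) = 1 → σ ζ = ζ ^ p ^ m :=
  exists_frobenius_pow_galQp σ (orderOf_ne_zero a)

lemma pow_eq_of_frobExp {p : ℕ} [Fact p.Prime] (a : (Fpbar p)ˣ) (σ : GalQp p) {m m' : ℕ}
    (h : ∀ ζ : PadicAlgCl p, ζ ^ (p ^ orderOf a - 1) = 1 → σ ζ = ζ ^ p ^ m)
    (h' : ∀ ζ : PadicAlgCl p, ζ ^ (p ^ orderOf a - 1) = 1 → σ ζ = ζ ^ p ^ m') :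
    a ^ m = a ^ m' := by
  have hn := orderOf_ne_zero a
  have hpn : 1 < p ^ orderOf a := Nat.one_lt_pow hn (Fact.out : p.Prime).one_lt
  have : NeZero (p ^ orderOf a - 1) := ⟨by omega⟩
  obtain ⟨ζ, hζ⟩ := HasEnoughRootsOfUnity.exists_primitiveRoot (PadicAlgCl p) (p ^ orderOf a - 1)
  have h1 : ζ ^ p ^ m = ζ ^ p ^ m' := by rw [← h ζ hζ.pow_eq_one, h' ζ hζ.pow_eq_one]
  rw [pow_eq_pow_iff_modEq]
  apply modEq_of_pow_modEq (p := p) hn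
  have h2 := hζ.eq_orderOf
  have hu : IsUnit ζ := hζ.isUnit (NeZero.ne _)
  rw [h2]
  have h3 : hu.unit ^ p ^ m = hu.unit ^ p ^ m' := by ext; simpa using h1
  rw [pow_eq_pow_iff_modEq] at h3
  rwa [← orderOf_units, hu.unit_spec] at h3

/-- The unramified character `μ_a` of `Gal(ℚ̄_p/ℚ_p)` which sends the geometric Frobenius to `a`: if
`σ` acts on the unramified extension generated by the roots of unity of order `pⁿ - 1`, where `n` is
the order of `a`, as `ζ ↦ ζ ^ (p ^ m)`, then `μ_a(σ) = a ^ (-m)`. -/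
def unramChar {p : ℕ} [Fact p.Prime] (a : (Fpbar p)ˣ) : GalQp p →* (Fpbar p)ˣ where
  toFun σ := (a ^ (exists_frobExp a σ).choose)⁻¹
  map_one' := by
    rw [inv_eq_one]
    exact (pow_eq_of_frobExp a 1 (exists_frobExp a 1).choose_spec (m' := 0)
      (fun ζ _ => by simp)).trans (pow_zero a)
  map_mul' σ τ := by
    rw [← mul_inv, ← pow_add, inv_inj]
    refine pow_eq_of_frobExp a (σ * τ) (exists_frobExp a (σ * τ)).choose_spec fun ζ hζ => ?_
    rw [AlgEquiv.mul_apply, (exists_frobExp a τ).choose_spec ζ hζ, map_pow,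
      (exists_frobExp a σ).choose_spec ζ hζ, ← pow_mul, ← pow_add]

lemma unramChar_apply {p : ℕ} [Fact p.Prime] (a : (Fpbar p)ˣ) (σ : GalQp p) (m : ℕ)
    (h : ∀ ζ : PadicAlgCl p, ζ ^ (p ^ orderOf a - 1) = 1 → σ ζ = ζ ^ p ^ m) :
    unramChar a σ = (a ^ m)⁻¹ :=
  congrArg Inv.inv (pow_eq_of_frobExp a σ (exists_frobExp a σ).choose_spec h)

/-! ### Generalities on representations -/

/-- A representation of a topological group is smooth if all vectors have open stabilizer. -/
def IsSmoothRep {k G V : Type*} [CommRing k] [Group G] [TopologicalSpace G] [AddCommGroup V]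
    [Module k V] (ρ : Representation k G V) : Prop :=
  ∀ v : V, IsOpen {g : G | ρ g v = v}

/-- A character is smooth if its kernel is open. -/
def IsSmoothChar {k G : Type*} [CommRing k] [Group G] [TopologicalSpace G] (χ : G →* kˣ) : Prop :=
  IsOpen (χ.ker : Set G)

/-- The one-dimensional representation attached to a character. -/
def charRep {k G : Type*} [CommRing k] [Group G] (χ : G →* kˣ) : Representation k G k where
  toFun g := (χ g : k) • LinearMap.id
  map_one' := by ext; simp
  map_mul' g h := by ext; simp [mul_comm]

/-- The twist `ρ ⊗ χ` of a representation by a character. -/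
def twist {k G V : Type*} [CommRing k] [Group G] [AddCommGroup V] [Module k V]
    (ρ : Representation k G V) (χ : G →* kˣ) : Representation k G V where
  toFun g := (χ g : k) • ρ g
  map_one' := by simp
  map_mul' g h := by
    ext v
    simp [smul_smul, mul_comm]

/-- `σ` is the semisimplification of `ρ`: there is a composition series of `ρ` (in particular `ρ` has
finite length) such that `σ` is the direct sum of its successive quotients. -/
def IsSemisimplification {k G V W : Type*} [CommRing k] [Group G] [AddCommGroup V] [Module k V]
    [AddCommGroup W] [Module k W] (ρ : Representation k G V) (σ : Representation k G W) : Prop :=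
  ∃ s : CompositionSeries (Submodule (MonoidAlgebra k G) ρ.asModule),
    s.head = ⊥ ∧ s.last = ⊤ ∧
    Nonempty (σ.asModule ≃ₗ[MonoidAlgebra k G]
      ((i : Fin s.length) → (s i.succ ⧸ (s i.castSucc).submoduleOf (s i.succ))))

/-! ### The group `GL₂(ℚ_p)` and compact induction -/

/-- The group `G = GL₂(ℚ_p)`. -/
abbrev GL2Qp (p : ℕ) [Fact p.Prime] : Type := GL (Fin 2) ℚ_[p]

/-- The group `K = GL₂(ℤ_p)`. -/
abbrev GL2Zp (p : ℕ) [Fact p.Prime] : Type := GL (Fin 2) ℤ_[p]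

/-- The inclusion of `K` in `G`. -/
def inclK (p : ℕ) [Fact p.Prime] : GL2Zp p →* GL2Qp p :=
  Matrix.GeneralLinearGroup.map (algebraMap ℤ_[p] ℚ_[p])

/-- The reduction `ℤ_p → 𝔽_p ⊆ 𝔽̄_p`. -/
def toFpbar (p : ℕ) [Fact p.Prime] : ℤ_[p] →+* Fpbar p :=
  (algebraMap (ZMod p) (Fpbar p)).comp PadicInt.toZMod

/-- The element `p` of `ℚ_pˣ`. -/
def pUnit (p : ℕ) [Fact p.Prime] : ℚ_[p]ˣ :=
  Units.mk0 (p : ℚ_[p]) (by exact_mod_cast (Fact.out : p.Prime).ne_zero)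

/-- The scalar matrix `p` in the centre `Z` of `G`. -/
def pScalar (p : ℕ) [Fact p.Prime] : GL2Qp p :=
  Matrix.GeneralLinearGroup.scalar (Fin 2) (pUnit p)

lemma pScalar_zpow_mul_comm {p : ℕ} [Fact p.Prime] (n : ℤ) (g : GL2Qp p) :
    pScalar p ^ n * g = g * pScalar p ^ n := by
  have h : Commute (pScalar p) g := by
    ext i j
    simp [pScalar, Matrix.GeneralLinearGroup.scalar, mul_comm]
  exact (h.zpow_left n).eq

/-- The powers of `p` and the elements of `K` are independent. -/
lemma pScalar_zpow_mul_inj {p : ℕ} [Fact p.Prime] {n m : ℤ} {a b : GL2Zp p}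
    (h : pScalar p ^ n * inclK p a = pScalar p ^ m * inclK p b) : n = m ∧ a = b := by
  have hp : p.Prime := Fact.out
  have hdet : ∀ (n : ℤ) (a : GL2Zp p),
      ‖((pScalar p ^ n * inclK p a).det : ℚ_[p])‖ = ((p : ℝ)⁻¹ ^ (2 : ℕ)) ^ n := by
    intro n a
    have h1 : ‖((inclK p a).det : ℚ_[p])‖ = 1 := by
      have h2 : ((inclK p a).det : ℚ_[p]) = ((a.det : ℤ_[p]) : ℚ_[p]) := by
        rw [inclK, Matrix.GeneralLinearGroup.map_det]
        rfl
      rw [h2, PadicInt.padic_norm_e_of_padicInt]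
      exact PadicInt.norm_units _
    have h2 : ‖((pScalar p).det : ℚ_[p])‖ = (p : ℝ)⁻¹ ^ (2 : ℕ) := by
      have h3 : ((pScalar p).det : ℚ_[p]) = (p : ℚ_[p]) ^ 2 := by
        simp [pScalar, Matrix.GeneralLinearGroup.scalar, pUnit, Matrix.det_fin_two, Matrix.natCast_apply, sq]
      rw [h3, norm_pow, Padic.norm_p]
    rw [map_mul, map_zpow, Units.val_mul, Units.val_zpow_eq_zpow_val, norm_mul, norm_zpow, h1, h2,
      mul_one]
  have hnm : n = m := by
    have h1 := hdet n a
    rw [h, hdet m b] at h1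
    have hp1 : (1 : ℝ) < p := by exact_mod_cast hp.one_lt
    have h2 : (0 : ℝ) < (p : ℝ)⁻¹ ^ 2 := by positivity
    have h3 : (p : ℝ)⁻¹ ^ 2 ≠ 1 := by
      have : (p : ℝ)⁻¹ < 1 := inv_lt_one_of_one_lt₀ hp1
      exact (pow_lt_one₀ (by positivity) this (by norm_num)).ne
    exact (zpow_right_injective₀ h2 h3 h1).symm
  subst hnm
  refine ⟨rfl, ?_⟩
  have h1 := mul_left_cancel h
  ext i j
  have h2 := congrArg (fun x : GL2Qp p => (x : Matrix (Fin 2) (Fin 2) ℚ_[p]) i j) h1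
  exact Subtype.ext h2

section CompactInduction

variable {p : ℕ} [Fact p.Prime] {H : Subgroup (GL2Zp p)} {V : Type} [AddCommGroup V]
  [Module (Fpbar p) V]

/-- The space of the compact induction `ind_{HZ}^G σ`, where `σ` is a representation of a subgroup
`H ⊆ K` containing the scalars `ℤ_pˣ`, extended to `HZ = H p^ℤ` by letting `p` act trivially: the
functions `f : G → V` which satisfy `f (h g) = σ h (f g)` for `h ∈ HZ` and whose support is contained
in finitely many cosets `HZ s`. -/
def cInd (σ : Representation (Fpbar p) H V) : Submodule (Fpbar p) (GL2Qp p → V) where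
  carrier := {f | (∀ (h : H) (g : GL2Qp p), f (inclK p h * g) = σ h (f g)) ∧
    (∀ g : GL2Qp p, f (pScalar p * g) = f g) ∧
    ∃ S : Finset (GL2Qp p), ∀ g, f g ≠ 0 →
      ∃ s ∈ S, ∃ (n : ℤ) (h : H), g = pScalar p ^ n * inclK p h * s}
  zero_mem' := ⟨by simp, by simp, ∅, by simp⟩
  add_mem' := by
    classical
    rintro f f' ⟨h1, h2, S, h3⟩ ⟨h1', h2', S', h3'⟩
    refine ⟨fun h g => by simp [h1, h1'], fun g => by simp [h2, h2'], S ∪ S', fun g hg => ?_⟩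
    by_cases hf : f g = 0
    · have hf' : f' g ≠ 0 := fun h0 => hg (by simp [hf, h0])
      obtain ⟨s, hs, h⟩ := h3' g hf'
      exact ⟨s, Finset.mem_union_right _ hs, h⟩
    · obtain ⟨s, hs, h⟩ := h3 g hf
      exact ⟨s, Finset.mem_union_left _ hs, h⟩
  smul_mem' := by
    rintro c f ⟨h1, h2, S, h3⟩
    refine ⟨fun h g => by simp [h1], fun g => by simp [h2], S, fun g hg => h3 g fun h0 => hg ?_⟩
    simp [h0]

/-- The action of `G` on `ind_{HZ}^G σ` by right translation: `(g • f) g' = f (g' g)`. -/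
def cIndRep (σ : Representation (Fpbar p) H V) :
    Representation (Fpbar p) (GL2Qp p) (cInd σ) where
  toFun g :=
    { toFun := fun f => ⟨fun g' => (f : GL2Qp p → V) (g' * g), by
        classical
        obtain ⟨f, h1, h2, S, h3⟩ := f
        refine ⟨fun h x => by simp only [mul_assoc, h1], fun x => by simp only [mul_assoc, h2],
          S.image (· * g⁻¹), fun x hx => ?_⟩
        obtain ⟨s, hs, n, h, hh⟩ := h3 _ hx
        exact ⟨s * g⁻¹, Finset.mem_image_of_mem _ hs, n, h, by
          rw [← mul_assoc, ← hh, mul_inv_cancel_right]⟩⟩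
      map_add' := fun _ _ => rfl
      map_smul' := fun _ _ => rfl }
  map_one' := by
    ext f g
    simp
  map_mul' g h := by
    ext f x
    simp [mul_assoc]

open Classical in
/-- The function underlying `⟦g, v⟧`. -/
def elemFun (σ : Representation (Fpbar p) H V) (g : GL2Qp p) (v : V) (g' : GL2Qp p) : V :=
  if hh : ∃ x : ℤ × H, g' * g = pScalar p ^ x.1 * inclK p x.2 then σ hh.choose.2 v else 0

lemma elemFun_of_eq (σ : Representation (Fpbar p) H V) {g : GL2Qp p} (v : V) {g' : GL2Qp p}
    {n : ℤ} {h : H} (e : g' * g = pScalar p ^ n * inclK p h) : elemFun σ g v g' = σ h v := by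
  have hh : ∃ x : ℤ × H, g' * g = pScalar p ^ x.1 * inclK p x.2 := ⟨(n, h), e⟩
  rw [elemFun, dif_pos hh]
  have := (pScalar_zpow_mul_inj (hh.choose_spec.symm.trans e)).2
  rw [Subtype.ext this]

lemma elemFun_of_not (σ : Representation (Fpbar p) H V) {g : GL2Qp p} (v : V) {g' : GL2Qp p}
    (e : ¬ ∃ (n : ℤ) (h : H), g' * g = pScalar p ^ n * inclK p h) : elemFun σ g v g' = 0 := by
  rw [elemFun, dif_neg]
  rintro ⟨x, hx⟩
  exact e ⟨_, _, hx⟩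

/-- The elementary function `⟦g, v⟧` of `ind_{HZ}^G σ`, supported on `HZ g⁻¹`, with
`⟦g, v⟧ g' = σ (g' g) v` for `g' g ∈ HZ`. -/
def elem (σ : Representation (Fpbar p) H V) (g : GL2Qp p) (v : V) : cInd σ :=
  ⟨elemFun σ g v, by
    refine ⟨fun h g' => ?_, fun g' => ?_, {g⁻¹}, fun g' hg' => ?_⟩
    · by_cases e : ∃ (n : ℤ) (h : H), g' * g = pScalar p ^ n * inclK p h
      · obtain ⟨n, h', e⟩ := e
        rw [elemFun_of_eq σ v e, elemFun_of_eq σ v (n := n) (h := h * h'), map_mul]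
        · rfl
        · rw [mul_assoc, e, ← mul_assoc, ← pScalar_zpow_mul_comm, mul_assoc, Subgroup.coe_mul,
            map_mul]
      · rw [elemFun_of_not σ v e, elemFun_of_not, map_zero]
        rintro ⟨n, h', e'⟩
        refine e ⟨n, h⁻¹ * h', ?_⟩
        rw [Subgroup.coe_mul, map_mul, ← mul_assoc, pScalar_zpow_mul_comm, mul_assoc, ← e',
          Subgroup.coe_inv, map_inv]
        group
    · by_cases e : ∃ (n : ℤ) (h : H), g' * g = pScalar p ^ n * inclK p h
      · obtain ⟨n, h', e⟩ := e
        rw [elemFun_of_eq σ v e, elemFun_of_eq σ v (n := 1 + n) (h := h')]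
        rw [mul_assoc, e, zpow_add, zpow_one, mul_assoc]
      · rw [elemFun_of_not σ v e, elemFun_of_not]
        rintro ⟨n, h', e'⟩
        refine e ⟨-1 + n, h', ?_⟩
        rw [zpow_add, mul_assoc, ← e', zpow_neg_one]
        group
    · by_contra hcon
      refine hg' (elemFun_of_not σ v ?_)
      rintro ⟨n, h, e⟩
      exact hcon ⟨g⁻¹, by simp, n, h, by rw [← e, mul_inv_cancel_right]⟩⟩

lemma cIndRep_elem (σ : Representation (Fpbar p) H V) (g x : GL2Qp p) (v : V) :
    cIndRep σ x (elem σ g v) = elem σ (x * g) v := by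
  ext g'
  change elemFun σ g v (g' * x) = elemFun σ (x * g) v g'
  by_cases e : ∃ (n : ℤ) (h : H), g' * x * g = pScalar p ^ n * inclK p h
  · obtain ⟨n, h, e⟩ := e
    rw [elemFun_of_eq σ v e, elemFun_of_eq σ v (by rw [← mul_assoc, e])]
  · rw [elemFun_of_not σ v e, elemFun_of_not σ v (by rwa [← mul_assoc])]

/-- The elementary functions span the compact induction, so that an endomorphism is determined by
its values on them, and its image is spanned by these values. -/
lemma span_elem (σ : Representation (Fpbar p) H V) :
    Submodule.span (Fpbar p) {f : cInd σ | ∃ g v, f = elem σ g v} = ⊤ := by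
  classical
  have key : ∀ (N : ℕ) (f : cInd σ) (S : Finset (GL2Qp p)), S.card = N →
      (∀ g, (f : GL2Qp p → V) g ≠ 0 →
        ∃ s ∈ S, ∃ (n : ℤ) (h : H), g = pScalar p ^ n * inclK p h * s) →
      f ∈ Submodule.span (Fpbar p) {f : cInd σ | ∃ g v, f = elem σ g v} := by
    intro N
    induction N with
    | zero =>
      intro f S hS hf
      have : f = 0 := by
        ext g
        by_contra h0
        obtain ⟨s, hs, _⟩ := hf g h0
        rw [Finset.card_eq_zero.1 hS] at hs
        simp at hs
      rw [this]
      exact zero_mem _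
    | succ N ih =>
      intro f S hS hf
      obtain ⟨s, T, hs, rfl, hT⟩ := Finset.card_eq_succ.1 hS
      have hz : ∀ (n : ℤ) (g : GL2Qp p), (f : GL2Qp p → V) (pScalar p ^ n * g)
          = (f : GL2Qp p → V) g := by
        intro n
        induction n with
        | zero => simp
        | succ n ih =>
          intro g
          rw [add_comm, zpow_add, zpow_one, mul_assoc, f.2.2.1, ih]
        | pred n ih =>
          intro g
          rw [← f.2.2.1, ← mul_assoc, ← zpow_one_add, add_sub_cancel, ih]
      have hmem : elem σ s⁻¹ ((f : GL2Qp p → V) s) ∈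
          Submodule.span (Fpbar p) {f : cInd σ | ∃ g v, f = elem σ g v} :=
        Submodule.subset_span ⟨_, _, rfl⟩
      rw [← sub_add_cancel f (elem σ s⁻¹ ((f : GL2Qp p → V) s))]
      refine add_mem (ih _ T hT fun g hg => ?_) hmem
      have hg' : (f : GL2Qp p → V) g - elemFun σ s⁻¹ ((f : GL2Qp p → V) s) g ≠ 0 := hg
      by_cases e : ∃ (n : ℤ) (h : H), g * s⁻¹ = pScalar p ^ n * inclK p h
      · obtain ⟨n, h, e⟩ := e
        refine absurd ?_ hg'
        have hgs : g = pScalar p ^ n * (inclK p h * s) := by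
          rw [← mul_assoc, ← e, inv_mul_cancel_right]
        rw [elemFun_of_eq σ _ e, hgs, hz, f.2.1 h s, sub_self]
      · rw [elemFun_of_not σ _ e, sub_zero] at hg'
        obtain ⟨t, ht, n, h, hh⟩ := hf g hg'
        rcases Finset.mem_insert.1 ht with rfl | ht
        · exact absurd ⟨n, h, by rw [hh, mul_inv_cancel_right]⟩ e
        · exact ⟨t, ht, n, h, hh⟩
  rw [eq_top_iff]
  rintro f -
  obtain ⟨S, hS⟩ := f.2.2.2
  exact key _ f S rfl hS

/-- The quotient of `ind_{HZ}^G σ` by the span of a family of elements which is permuted by `G`. -/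
def cIndQuot (σ : Representation (Fpbar p) H V) (R : Set (cInd σ))
    (hR : ∀ g, ∀ f ∈ R, cIndRep σ g f ∈ R) :
    Representation (Fpbar p) (GL2Qp p) (cInd σ ⧸ Submodule.span (Fpbar p) R) :=
  (cIndRep σ).quotient (Submodule.span (Fpbar p) R) fun g =>
    Submodule.span_le.2 fun f hf => Submodule.subset_span (hR g f hf)

end CompactInduction

/-! ### The representations `π(r, a, η)` -/

/-- The Teichmüller representative `[t] ∈ ℤ_p` of `t ∈ 𝔽_p`. -/
def teich {p : ℕ} [Fact p.Prime] (t : ZMod p) : ℤ_[p] :=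
  WittVector.equiv p (WittVector.teichmuller p t)

/-- The matrix `(a, b; c, d) ∈ GL₂(ℚ_p)` with entries in `ℤ_p` and determinant `± p`. -/
def mkG {p : ℕ} [Fact p.Prime] (a b c d : ℤ_[p]) (h : a * d - b * c ≠ 0) : GL2Qp p :=
  Matrix.GeneralLinearGroup.mkOfDetNeZero !![(a : ℚ_[p]), b; c, d] (by
    rw [Matrix.det_fin_two_of]
    intro h0
    exact h (Subtype.ext (by push_cast; exact h0)))

lemma natCast_p_ne_zero {p : ℕ} [Fact p.Prime] : (p : ℤ_[p]) ≠ 0 := by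
  exact_mod_cast (Fact.out : p.Prime).ne_zero

/-- The matrix `(p, [t]; 0, 1)`. -/
def matX {p : ℕ} [Fact p.Prime] (t : ZMod p) : GL2Qp p :=
  mkG (p : ℤ_[p]) (teich t) 0 1 (by simpa using natCast_p_ne_zero)

/-- The matrix `(1, 0; p [t], p)`. -/
def matY {p : ℕ} [Fact p.Prime] (t : ZMod p) : GL2Qp p :=
  mkG 1 0 (p * teich t) p (by simpa using natCast_p_ne_zero)

/-- The matrix `α = (1, 0; 0, p)`. -/
def matAlpha (p : ℕ) [Fact p.Prime] : GL2Qp p :=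
  mkG 1 0 0 p (by simpa using natCast_p_ne_zero)

/-- The matrix `β = (0, 1; p, 0)`. -/
def matBeta (p : ℕ) [Fact p.Prime] : GL2Qp p :=
  mkG 0 1 p 0 (by simpa using natCast_p_ne_zero)

/-- The space of homogeneous polynomials of degree `r` over `𝔽̄_p` in `X = X₀` and `Y = X₁`. -/
def SymV (p : ℕ) [Fact p.Prime] (r : ℕ) : Type :=
  MvPolynomial.homogeneousSubmodule (Fin 2) (Fpbar p) r

instance (p : ℕ) [Fact p.Prime] (r : ℕ) : AddCommGroup (SymV p r) :=
  inferInstanceAs (AddCommGroup (MvPolynomial.homogeneousSubmodule (Fin 2) (Fpbar p) r))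

instance (p : ℕ) [Fact p.Prime] (r : ℕ) : Module (Fpbar p) (SymV p r) :=
  inferInstanceAs (Module (Fpbar p) (MvPolynomial.homogeneousSubmodule (Fin 2) (Fpbar p) r))

/-- The substitution `v (X, Y) ↦ v (a X + c Y, b X + d Y)` attached to `M = (a, b; c, d)`. -/
def symSubst (p : ℕ) [Fact p.Prime] (M : Matrix (Fin 2) (Fin 2) (Fpbar p)) :
    MvPolynomial (Fin 2) (Fpbar p) →ₐ[Fpbar p] MvPolynomial (Fin 2) (Fpbar p) :=
  MvPolynomial.aeval fun j : Fin 2 => ∑ i : Fin 2, MvPolynomial.C (M i j) * MvPolynomial.X i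

lemma symSubst_mem {p : ℕ} [Fact p.Prime] {r : ℕ} (M : Matrix (Fin 2) (Fin 2) (Fpbar p))
    {v : MvPolynomial (Fin 2) (Fpbar p)}
    (hv : v ∈ MvPolynomial.homogeneousSubmodule (Fin 2) (Fpbar p) r) :
    symSubst p M v ∈ MvPolynomial.homogeneousSubmodule (Fin 2) (Fpbar p) r := by
  have h := MvPolynomial.IsHomogeneous.aeval (m := r) (n := 1) (φ := v) (R := Fpbar p)
    ((MvPolynomial.mem_homogeneousSubmodule r v).1 hv)
    (fun j : Fin 2 => ∑ i : Fin 2, MvPolynomial.C (M i j) * MvPolynomial.X i)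
    (fun j => MvPolynomial.IsHomogeneous.sum _ _ _ fun i _ =>
      (MvPolynomial.isHomogeneous_X _ i).C_mul _)
  rw [one_mul] at h
  exact (MvPolynomial.mem_homogeneousSubmodule r _).2 h

lemma symSubst_one (p : ℕ) [Fact p.Prime] : symSubst p 1 = AlgHom.id _ _ := by
  ext1 j
  fin_cases j <;> simp [symSubst]

lemma symSubst_mul {p : ℕ} [Fact p.Prime] (M N : Matrix (Fin 2) (Fin 2) (Fpbar p)) :
    symSubst p (M * N) = (symSubst p M).comp (symSubst p N) := by
  ext1 j
  simp only [symSubst, MvPolynomial.aeval_X, AlgHom.comp_apply, Fin.sum_univ_two, map_add, map_mul,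
    MvPolynomial.algHom_C, MvPolynomial.algebraMap_eq, Matrix.mul_apply]
  ring

/-- The action of `2 × 2` matrices over `𝔽̄_p` on homogeneous polynomials of degree `r`:
`(a, b; c, d) • v (X, Y) = v (a X + c Y, b X + d Y)`. -/
def symAct (p : ℕ) [Fact p.Prime] (r : ℕ) :
    Matrix (Fin 2) (Fin 2) (Fpbar p) →* Module.End (Fpbar p) (SymV p r) where
  toFun M :=
    { toFun := fun v => ⟨symSubst p M v.1, symSubst_mem M v.2⟩
      map_add' := fun v w => Subtype.ext (map_add (symSubst p M) v.1 w.1)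
      map_smul' := fun c v => Subtype.ext (map_smul (symSubst p M) c v.1) }
  map_one' := by
    refine LinearMap.ext fun v => Subtype.ext ?_
    change symSubst p 1 v.1 = v.1
    rw [symSubst_one]
    rfl
  map_mul' M N := by
    refine LinearMap.ext fun v => Subtype.ext ?_
    change symSubst p (M * N) v.1 = symSubst p M (symSubst p N v.1)
    rw [symSubst_mul]
    rfl

/-- The reduction of matrices over `ℤ_p`, as matrices over `𝔽̄_p`. -/
def redMat (p : ℕ) [Fact p.Prime] :
    Matrix (Fin 2) (Fin 2) ℤ_[p] →+* Matrix (Fin 2) (Fin 2) (Fpbar p) :=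
  (toFpbar p).mapMatrix

/-- The representation `V_r = Sym^r` of `K`. -/
def symRep (p : ℕ) [Fact p.Prime] (r : ℕ) : Representation (Fpbar p) (⊤ : Subgroup (GL2Zp p))
    (SymV p r) :=
  (((symAct p r).comp (redMat p).toMonoidHom).comp (Units.coeHom _)).comp (Subgroup.subtype _)

/-- The value of the spherical Hecke operator
`T ⟦g, v⟧ = ∑_t ⟦g (p, [t]; 0, 1), v (X, -[t] X + p Y)⟧ + ⟦g α, v (p X, Y)⟧`
of `ind_{KZ}^G V_r` on the elementary function `⟦g, v⟧`. -/
def heckeT (p : ℕ) [Fact p.Prime] (r : ℕ) (g : GL2Qp p)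
    (v : SymV p r) : cInd (symRep p r) :=
  ∑ t : ZMod p, elem (symRep p r) (g * matX t)
      (symAct p r (redMat p !![1, -teich t; 0, (p : ℤ_[p])]) v)
    + elem (symRep p r) (g * matAlpha p) (symAct p r (redMat p !![(p : ℤ_[p]), 0; 0, 1]) v)

/-- The elements `(T - a) ⟦g, v⟧`; they span the image of `T - a`. -/
def sphericalRel (p : ℕ) [Fact p.Prime] (r : ℕ) (a : Fpbar p) : Set (cInd (symRep p r)) :=
  {f | ∃ g v, f = heckeT p r g v - a • elem (symRep p r) g v}

lemma sphericalRel_stable {p : ℕ} [Fact p.Prime] (r : ℕ) (a : Fpbar p) (x : GL2Qp p) :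
    ∀ f ∈ sphericalRel p r a, cIndRep (symRep p r) x f ∈ sphericalRel p r a := by
  rintro _ ⟨g, v, rfl⟩
  refine ⟨x * g, v, ?_⟩
  simp only [heckeT, map_sub, map_add, map_sum, map_smul, cIndRep_elem, mul_assoc]

/-- The representation `π(r, a, η) = (ind_{KZ}^G V_r / (T - a)) ⊗ (η ∘ det)` defined by spherical
induction. -/
def sphericalPi (p : ℕ) [Fact p.Prime] (r : ℕ) (a : Fpbar p) (η : ℚ_[p]ˣ →* (Fpbar p)ˣ) :
    Representation (Fpbar p) (GL2Qp p)
      (cInd (symRep p r) ⧸ Submodule.span (Fpbar p) (sphericalRel p r a)) :=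
  twist (cIndQuot (symRep p r) (sphericalRel p r a) (sphericalRel_stable r a))
    (η.comp Matrix.GeneralLinearGroup.det)

/-- The Iwahori subgroup `I` of matrices in `K` which are upper triangular modulo `p`. -/
def iwahori (p : ℕ) [Fact p.Prime] : Subgroup (GL2Zp p) where
  carrier := {g | PadicInt.toZMod (g 1 0) = 0}
  one_mem' := by simp
  mul_mem' := by
    intro g h hg hh
    simp only [Set.mem_ofPred_eq] at hg hh ⊢
    simp [Matrix.mul_apply, Fin.sum_univ_two, hg, hh]
  inv_mem' := by
    intro g hg
    simp only [Set.mem_ofPred_eq] at hg ⊢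
    simp [Matrix.inv_def, Matrix.adjugate_fin_two, hg]

/-- The character `(a, b; c, d) ↦ d mod p` of `I`. -/
def iwahoriChar (p : ℕ) [Fact p.Prime] : iwahori p →* (Fpbar p)ˣ :=
  MonoidHom.toHomUnits
    { toFun := fun g => toFpbar p ((g : GL2Zp p) 1 1)
      map_one' := by simp
      map_mul' := by
        intro g h
        have hg : PadicInt.toZMod ((g : GL2Zp p) 1 0) = 0 := g.2
        simp [toFpbar, Matrix.mul_apply, Fin.sum_univ_two, hg] }

/-- The representation `d^r` of `I`. -/
def dRep (p : ℕ) [Fact p.Prime] (r : ℕ) : Representation (Fpbar p) (iwahori p) (Fpbar p) :=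
  charRep (iwahoriChar p ^ r)

/-- The value `T_{1,0} ⟦g, v⟧ = ⟦g β, v⟧` of the Iwahori-Hecke operator `T_{1,0}`. -/
def heckeT10 (p : ℕ) [Fact p.Prime] (r : ℕ) (g : GL2Qp p) (v : Fpbar p) : cInd (dRep p r) :=
  elem (dRep p r) (g * matBeta p) v

/-- The value `T_{-1,0} ⟦g, v⟧ = ∑_t ⟦g (p, [t]; 0, 1), v⟧` of the Iwahori-Hecke operator
`T_{-1,0}`. -/
def heckeTm10 (p : ℕ) [Fact p.Prime] (r : ℕ) (g : GL2Qp p) (v : Fpbar p) : cInd (dRep p r) :=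
  ∑ t : ZMod p, elem (dRep p r) (g * matX t) v

/-- The value `T_{1,2} ⟦g, v⟧ = ∑_t ⟦g (1, 0; p [t], p), v⟧` of the Iwahori-Hecke operator
`T_{1,2}`. -/
def heckeT12 (p : ℕ) [Fact p.Prime] (r : ℕ) (g : GL2Qp p) (v : Fpbar p) : cInd (dRep p r) :=
  ∑ t : ZMod p, elem (dRep p r) (g * matY t) v

/-- The elements `(T_{-1,0} + δ_{r,p-1} T_{1,0}) ⟦g, v⟧` and
`(T_{1,2} + δ_{r,0} T_{1,0} - a) ⟦g, v⟧`; they span the sum of the images of the two operators. -/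
def iwahoriRel (p : ℕ) [Fact p.Prime] (r : ℕ) (a : Fpbar p) : Set (cInd (dRep p r)) :=
  {f | ∃ g v, f = heckeTm10 p r g v + (if r = p - 1 then (1 : Fpbar p) else 0) • heckeT10 p r g v} ∪
  {f | ∃ g v, f = heckeT12 p r g v + (if r = 0 then (1 : Fpbar p) else 0) • heckeT10 p r g v
    - a • elem (dRep p r) g v}

lemma iwahoriRel_stable {p : ℕ} [Fact p.Prime] (r : ℕ) (a : Fpbar p) (x : GL2Qp p) :
    ∀ f ∈ iwahoriRel p r a, cIndRep (dRep p r) x f ∈ iwahoriRel p r a := by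
  rintro _ (⟨g, v, rfl⟩ | ⟨g, v, rfl⟩)
  · refine Or.inl ⟨x * g, v, ?_⟩
    simp only [heckeTm10, heckeT10, map_add, map_sum, map_smul, cIndRep_elem, mul_assoc]
  · refine Or.inr ⟨x * g, v, ?_⟩
    simp only [heckeT12, heckeT10, map_sub, map_add, map_sum, map_smul, cIndRep_elem, mul_assoc]

/-- The representation
`π(r, a, η) = ind_{IZ}^G d^r / ((T_{-1,0} + δ_{r,p-1} T_{1,0}) + (T_{1,2} + δ_{r,0} T_{1,0} - a)) ⊗ η`
defined by Iwahori induction. -/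
def iwahoriPi (p : ℕ) [Fact p.Prime] (r : ℕ) (a : Fpbar p) (η : ℚ_[p]ˣ →* (Fpbar p)ˣ) :
    Representation (Fpbar p) (GL2Qp p)
      (cInd (dRep p r) ⧸ Submodule.span (Fpbar p) (iwahoriRel p r a)) :=
  twist (cIndQuot (dRep p r) (iwahoriRel p r a) (iwahoriRel_stable r a))
    (η.comp Matrix.GeneralLinearGroup.det)

/-! ### The Galois side -/

/-- The `p`-adic cyclotomic character of `Gal(ℚ̄_p/ℚ_p)`. -/
def cyclo (p : ℕ) [Fact p.Prime] : GalQp p →* ℤ_[p]ˣ :=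
  (cyclotomicCharacter (PadicAlgCl p) p).comp
    { toFun := fun σ => (σ : PadicAlgCl p ≃+* PadicAlgCl p)
      map_one' := rfl
      map_mul' := fun _ _ => rfl }

/-- The fundamental character `ω` of level `1` of `Gal(ℚ̄_p/ℚ_p)`: the mod `p` cyclotomic
character. -/
def omega (p : ℕ) [Fact p.Prime] : GalQp p →* (Fpbar p)ˣ :=
  (Units.map (toFpbar p).toMonoidHom).comp (cyclo p)

/-- The unit part `x p^{-v(x)}` of `x ∈ ℚ_pˣ`. -/
def unitPart (p : ℕ) [Fact p.Prime] : ℚ_[p]ˣ →* ℤ_[p]ˣ where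
  toFun x := PadicInt.mkUnits (u := (x : ℚ_[p]) * (p : ℚ_[p]) ^ (-(x : ℚ_[p]).valuation)) (by
    have hp : (p : ℝ) ≠ 0 := by exact_mod_cast (Fact.out : p.Prime).ne_zero
    rw [norm_mul, Padic.norm_eq_zpow_neg_valuation x.ne_zero, norm_zpow, Padic.norm_p, inv_zpow',
      neg_neg, ← zpow_add₀ hp, neg_add_cancel, zpow_zero])
  map_one' := by
    refine Units.ext (Subtype.ext ?_)
    change ((1 : ℚ_[p]ˣ) : ℚ_[p]) * (p : ℚ_[p]) ^ (-((1 : ℚ_[p]ˣ) : ℚ_[p]).valuation) = 1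
    simp
  map_mul' x y := by
    have hp : (p : ℚ_[p]) ≠ 0 := by exact_mod_cast (Fact.out : p.Prime).ne_zero
    refine Units.ext (Subtype.ext ?_)
    change ((x * y : ℚ_[p]ˣ) : ℚ_[p]) * (p : ℚ_[p]) ^ (-((x * y : ℚ_[p]ˣ) : ℚ_[p]).valuation)
      = ((x : ℚ_[p]) * (p : ℚ_[p]) ^ (-(x : ℚ_[p]).valuation)) *
        ((y : ℚ_[p]) * (p : ℚ_[p]) ^ (-(y : ℚ_[p]).valuation))
    rw [Units.val_mul, Padic.valuation_mul x.ne_zero y.ne_zero, neg_add, zpow_add₀ hp]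
    ring

/-- The character `ω` viewed as the character `x ↦ x p^{-v(x)} mod p` of `ℚ_pˣ` through the Artin
map, normalized so that uniformizers correspond to geometric Frobenius elements. -/
def omegaQp (p : ℕ) [Fact p.Prime] : ℚ_[p]ˣ →* (Fpbar p)ˣ :=
  (Units.map (toFpbar p).toMonoidHom).comp (unitPart p)

/-- A smooth character `η` of `ℚ_pˣ` viewed as a character of `Gal(ℚ̄_p/ℚ_p)` through the Artin map,
normalized so that uniformizers correspond to geometric Frobenius elements. Explicitly, the Artin map
sends `p ^ n u`, with `u` a unit, to the automorphism of the maximal abelian extension which acts on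
roots of unity of order prime to `p` as `ζ ↦ ζ ^ (p ^ (-n))`, and on roots of unity of `p`-power
order as `ζ ↦ ζ ^ u`. -/
def galChar {p : ℕ} [Fact p.Prime] (η : ℚ_[p]ˣ →* (Fpbar p)ˣ) : GalQp p →* (Fpbar p)ˣ :=
  (η.comp ((Units.map (algebraMap ℤ_[p] ℚ_[p]).toMonoidHom).comp (cyclo p))) *
    unramChar (η (pUnit p))

/-- The ring of integers of `ℚ̄_p`. -/
abbrev Zpbar (p : ℕ) [Fact p.Prime] : Type := integralClosure ℤ_[p] (PadicAlgCl p)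

/-- `σ` lies in the inertia subgroup: it acts trivially on the residue field. -/
def IsInertia {p : ℕ} [Fact p.Prime] (red : Zpbar p →+* Fpbar p) (σ : GalQp p) : Prop :=
  ∀ x y : Zpbar p, (y : PadicAlgCl p) = σ x → red y = red x

/-- The subgroup `Gal(ℚ̄_p/ℚ_{p²})`; the field `ℚ_{p²}` is generated by the roots of unity of order
`p² - 1`. -/
def galQp2 (p : ℕ) [Fact p.Prime] : Subgroup (GalQp p) :=
  (IntermediateField.adjoin ℚ_[p]
    {ζ : PadicAlgCl p | ζ ^ (p ^ 2 - 1) = 1}).fixingSubgroup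

lemma exists_varpi2 (p : ℕ) [Fact p.Prime] : ∃ x : PadicAlgCl p, x ^ (p ^ 2 - 1) = p :=
  IsAlgClosed.exists_pow_nat_eq (p : PadicAlgCl p) (n := p ^ 2 - 1) (by
    have h := Nat.one_lt_pow two_ne_zero (Fact.out : p.Prime).one_lt
    omega)

/-- A root `ϖ` of `x ^ (p² - 1) = p`. -/
def varpi2 (p : ℕ) [Fact p.Prime] : PadicAlgCl p := (exists_varpi2 p).choose

lemma varpi2_pow (p : ℕ) [Fact p.Prime] : varpi2 p ^ (p ^ 2 - 1) = p :=
  (exists_varpi2 p).choose_spec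

/-- The quotient `σ(ϖ)/ϖ`, a root of unity of order dividing `p² - 1`. -/
def kummer2 (p : ℕ) [Fact p.Prime] (σ : GalQp p) : Zpbar p :=
  ⟨σ (varpi2 p) / varpi2 p, by
    have h := Nat.one_lt_pow two_ne_zero (Fact.out : p.Prime).one_lt
    have hp : (p : PadicAlgCl p) ≠ 0 := by exact_mod_cast (Fact.out : p.Prime).ne_zero
    refine IsIntegral.of_pow (n := p ^ 2 - 1) (by omega) ?_
    rw [div_pow, ← map_pow, varpi2_pow, map_natCast, div_self hp]
    exact isIntegral_one⟩

/-- The fundamental character `ω₂` of level `2`: `ω₂(σ)` is the image in `𝔽̄_p` of `σ(ϖ)/ϖ`, where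
`ϖ ^ (p² - 1) = p`. It is used on the inertia subgroup only, where it is a character which does not
depend on `ϖ`. -/
def omega2 {p : ℕ} [Fact p.Prime] (red : Zpbar p →+* Fpbar p) (σ : GalQp p) : Fpbar p :=
  red (kummer2 p σ)

/-- The representation of `Gal(ℚ̄_p/ℚ_p)` induced from a character of `Gal(ℚ̄_p/ℚ_{p²})`. -/
def indQp2 {p : ℕ} [Fact p.Prime] (χ : galQp2 p →* (Fpbar p)ˣ) :
    Representation (Fpbar p) (GalQp p)
      (Representation.coindV (galQp2 p).subtype (charRep χ)) :=
  Representation.coind (galQp2 p).subtype (charRep χ)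

/-- `χ` is the extension of `ω₂ ^ c` to a smooth character of `Gal(ℚ̄_p/ℚ_{p²})` which is used to form
`ind(ω₂ ^ c)`: the determinant of the representation of `Gal(ℚ̄_p/ℚ_p)` induced from `χ` is
`ω ^ c`. -/
def IsOmega2Extension {p : ℕ} [Fact p.Prime] (red : Zpbar p →+* Fpbar p) (c : ℕ)
    (χ : galQp2 p →* (Fpbar p)ˣ) : Prop :=
  IsSmoothChar χ ∧
  (∀ σ : galQp2 p, IsInertia red (σ : GalQp p) → (χ σ : Fpbar p) = omega2 red (σ : GalQp p) ^ c) ∧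
  ∀ σ : GalQp p, LinearMap.det (indQp2 χ σ) = ((omega p σ ^ c : (Fpbar p)ˣ) : Fpbar p)

/-- The representation `(μ_a ω^{r+1} ⊕ μ_{a⁻¹}) ⊗ η`. -/
def reducibleGal {p : ℕ} [Fact p.Prime] (r : ℕ) (a : (Fpbar p)ˣ) (η : ℚ_[p]ˣ →* (Fpbar p)ˣ) :
    Representation (Fpbar p) (GalQp p) (Fpbar p × Fpbar p) :=
  twist ((charRep (unramChar a * omega p ^ (r + 1))).prod (charRep (unramChar a⁻¹))) (galChar η)

/-- The representative `[a] ∈ {0, …, p - 2}` of the class of `a` modulo `p - 1`. -/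
def bracket (p : ℕ) (a : ℤ) : ℕ := (a % ((p : ℤ) - 1)).toNat

/-- Breuil's semisimple mod `p` local Langlands correspondence for `GL₂(ℚ_p)`, as a relation between
representations `ρ` of `Gal(ℚ̄_p/ℚ_p)` and representations `Π` of `GL₂(ℚ_p)` over `𝔽̄_p`. It is
defined with the representations `π(r, a, η)` constructed by spherical induction:
`ind(ω₂^{r+1}) ⊗ η` corresponds to `π(r, 0, η)`, and `(μ_a ω^{r+1} ⊕ μ_{a⁻¹}) ⊗ η` to
`π(r, a, η)^ss ⊕ π([p-3-r], a⁻¹, η ω^{r+1})^ss`. -/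
def BreuilLLC {p : ℕ} [Fact p.Prime] (red : Zpbar p →+* Fpbar p)
    {V W : Type} [AddCommGroup V] [Module (Fpbar p) V] [AddCommGroup W] [Module (Fpbar p) W]
    (ρ : Representation (Fpbar p) (GalQp p) V) (Pi : Representation (Fpbar p) (GL2Qp p) W) : Prop :=
  (∃ (r : ℕ) (η : ℚ_[p]ˣ →* (Fpbar p)ˣ) (χ : galQp2 p →* (Fpbar p)ˣ),
    r ≤ p - 1 ∧ IsSmoothChar η ∧ IsOmega2Extension red (r + 1) χ ∧
    Nonempty (ρ.Equiv (twist (indQp2 χ) (galChar η))) ∧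
    Nonempty (Pi.Equiv (sphericalPi p r 0 η))) ∨
  (∃ (r : ℕ) (a : (Fpbar p)ˣ) (η : ℚ_[p]ˣ →* (Fpbar p)ˣ),
    r ≤ p - 1 ∧ IsSmoothChar η ∧
    Nonempty (ρ.Equiv (reducibleGal r a η)) ∧
    ∃ (S S' : Type) (_ : AddCommGroup S) (_ : Module (Fpbar p) S) (_ : AddCommGroup S')
      (_ : Module (Fpbar p) S') (τ : Representation (Fpbar p) (GL2Qp p) S)
      (τ' : Representation (Fpbar p) (GL2Qp p) S'),
      IsSemisimplification (sphericalPi p r a η) τ ∧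
      IsSemisimplification
        (sphericalPi p (bracket p (p - 3 - r)) (a⁻¹ : (Fpbar p)ˣ) (η * omegaQp p ^ (r + 1))) τ' ∧
      Nonempty (Pi.Equiv (τ.prod τ')))

end

end ModPLLC

namespace ModPLLC

noncomputable section

open Polynomial Topology
open Module.End (mul_apply)
open MonoidHom (pow_apply comp_apply inv_apply)
open Units (val_mul val_one val_pow_eq_pow_val)
open Submodule (span span_le subset_span)
open Matrix.GeneralLinearGroup (det)
open PadicInt (toZMod)

variable {p : ℕ} [Fact p.Prime]

set_option hygiene false

/-- The field `𝔽̄_p`. -/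
local notation "κ" => Fpbar p

/-- Characters of `ℚ_pˣ`. -/
local notation:max "QpChar" => ℚ_[p]ˣ →* (Fpbar p)ˣ

/-- Representations of `GL₂(ℚ_p)`. -/
local notation:max "GL2Rep" => Representation (Fpbar p) (GL2Qp p)

/-- The inclusion of `𝔽_p` into `𝔽̄_p`. -/
local notation:max "ofFp" => algebraMap (ZMod p) (Fpbar p)

set_option hygiene true

section CompactInductionLift

variable {H : Subgroup (GL2Zp p)} {V : Type} [AddCommGroup V]
  [Module κ V]

lemma pScalar_zpow_commute (n : ℤ) (g : GL2Qp p) : Commute (pScalar p ^ n) g :=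
  pScalar_zpow_mul_comm n g

/-- The subgroup `HZ` of `G`, with `Z` replaced by the powers of `p`. -/
def subgroupHZ (H : Subgroup (GL2Zp p)) : Subgroup (GL2Qp p) where
  carrier := {g | ∃ (n : ℤ) (h : H), g = pScalar p ^ n * inclK p h}
  one_mem' := ⟨0, 1, by simp⟩
  mul_mem' := by
    rintro _ _ ⟨n, h, rfl⟩ ⟨m, h', rfl⟩
    refine ⟨n + m, h * h', ?_⟩
    rw [Subgroup.coe_mul, map_mul, zpow_add, mul_assoc, mul_assoc, ← mul_assoc (inclK p h),
      ← (pScalar_zpow_commute m (inclK p h)).eq, mul_assoc]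
  inv_mem' := by
    rintro _ ⟨n, h, rfl⟩
    refine ⟨-n, h⁻¹, ?_⟩
    rw [mul_inv_rev, Subgroup.coe_inv, map_inv, zpow_neg, ← zpow_neg,
      (pScalar_zpow_commute (-n) _).eq]

lemma cInd_pScalar_zpow {σ : Representation κ H V} (f : cInd σ) (n : ℤ) (g : GL2Qp p) :
    (f : GL2Qp p → V) (pScalar p ^ n * g) = (f : GL2Qp p → V) g := by
  induction n generalizing g with
  | zero => simp
  | succ n ih => rw [add_comm, zpow_add, zpow_one, mul_assoc, f.2.2.1, ih]
  | pred n ih => rw [← f.2.2.1, ← mul_assoc, ← zpow_one_add, add_sub_cancel, ih]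

lemma cInd_mul {σ : Representation κ H V} (f : cInd σ) (n : ℤ) (h : H) (g : GL2Qp p) :
    (f : GL2Qp p → V) (pScalar p ^ n * inclK p h * g) = σ h ((f : GL2Qp p → V) g) := by
  rw [mul_assoc, cInd_pScalar_zpow, f.2.1]

variable {X : Type*} [AddCommGroup X] [Module κ X] {σ : Representation κ H V}
  {ρ : GL2Rep X}

lemma rep_pScalar_zpow {x : X} (hx : ρ (pScalar p) x = x) (n : ℤ) : ρ (pScalar p ^ n) x = x := by
  induction n with
  | zero => simp
  | succ n ih => rw [zpow_add, zpow_one, map_mul, mul_apply, hx, ih]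
  | pred n ih =>
    rw [zpow_sub, zpow_one, map_mul, mul_apply]
    have : ρ (pScalar p)⁻¹ x = x := by
      conv_lhs => rw [← hx]
      simp
    rw [this, ih]

/-- Frobenius reciprocity for compact induction. -/
theorem exists_cInd_lift (φ : V →ₗ[κ] X) (hφ : ∀ (h : H) v, φ (σ h v) = ρ (inclK p h) (φ v))
    (hp : ∀ v, ρ (pScalar p) (φ v) = φ v) :
    ∃ L : cInd σ →ₗ[κ] X, ∀ g v, L (elem σ g v) = ρ g (φ v) := by
  classical
  let T : cInd σ → (GL2Qp p ⧸ subgroupHZ H) → X := fun f c =>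
    ρ c.out (φ ((f : GL2Qp p → V) c.out⁻¹))
  have hT : ∀ (f : cInd σ) (g : GL2Qp p),
      T f (QuotientGroup.mk g) = ρ g (φ ((f : GL2Qp p → V) g⁻¹)) := by
    intro f g
    obtain ⟨⟨x, n, h, rfl⟩, hx⟩ := QuotientGroup.mk_out_eq_mul (subgroupHZ H) g
    change ρ (Quotient.out _) (φ ((f : GL2Qp p → V) (Quotient.out _)⁻¹)) = _
    rw [hx]
    have e : (g * (pScalar p ^ n * inclK p h))⁻¹
        = pScalar p ^ (-n) * inclK p ((h⁻¹ : H) : GL2Zp p) * g⁻¹ := by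
      rw [mul_inv_rev, mul_inv_rev, Subgroup.coe_inv, map_inv, zpow_neg, ← zpow_neg,
        (pScalar_zpow_commute (-n) _).eq]
    change ρ (g * (pScalar p ^ n * inclK p h))
      (φ ((f : GL2Qp p → V) (g * (pScalar p ^ n * inclK p h))⁻¹)) = _
    rw [e, cInd_mul, hφ, map_mul, map_mul, mul_apply, mul_apply,
      Subgroup.coe_inv, map_inv, Representation.self_inv_apply, rep_pScalar_zpow (hp _)]
  have hfin : ∀ f : cInd σ, (Function.support (T f)).Finite := by
    intro f
    obtain ⟨S, hS⟩ := f.2.2.2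
    refine (S.image fun s => (QuotientGroup.mk s⁻¹ : GL2Qp p ⧸ subgroupHZ H)).finite_toSet.subset ?_
    intro c hc
    obtain ⟨g, rfl⟩ := QuotientGroup.mk_surjective c
    rw [Function.mem_support, hT] at hc
    have h0 : (f : GL2Qp p → V) g⁻¹ ≠ 0 := fun h0 => hc (by rw [h0, map_zero, map_zero])
    obtain ⟨s, hs, n, h, e⟩ := hS _ h0
    rw [Finset.coe_image]
    refine ⟨s, hs, ?_⟩
    rw [QuotientGroup.eq]
    refine inv_mem_iff.1 ⟨n, h, ?_⟩
    rw [mul_inv_rev, inv_inv, e, mul_inv_cancel_right]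
  refine ⟨{ toFun := fun f => ∑ᶠ c, T f c, map_add' := ?_, map_smul' := ?_ }, ?_⟩
  · intro f f'
    rw [← finsum_add_distrib (hfin f) (hfin f')]
    refine finsum_congr fun c => ?_
    simp [T]
  · intro a f
    rw [RingHom.id_apply, smul_finsum' _ (hfin f)]
    refine finsum_congr fun c => ?_
    simp [T]
  · intro g v
    change ∑ᶠ c, T (elem σ g v) c = _
    rw [finsum_eq_single _ (QuotientGroup.mk g)]
    · rw [hT]
      change ρ g (φ (elemFun σ g v g⁻¹)) = _
      rw [elemFun_of_eq σ v (n := 0) (h := 1) (by simp)]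
      simp
    · intro c hc
      obtain ⟨g', rfl⟩ := QuotientGroup.mk_surjective c
      rw [hT]
      change ρ g' (φ (elemFun σ g v g'⁻¹)) = _
      rw [elemFun_of_not, map_zero, map_zero]
      rintro ⟨n, h, e⟩
      exact hc (QuotientGroup.eq.2 ⟨n, h, e⟩)

lemma cInd_induction {P : cInd σ → Prop} (h0 : P 0) (hadd : ∀ f f', P f → P f' → P (f + f'))
    (hsmul : ∀ (a : κ) f, P f → P (a • f)) (helem : ∀ g v, P (elem σ g v)) (f : cInd σ) :
    P f := by
  have h := span_elem σ
  have hf : f ∈ span κ {f : cInd σ | ∃ g v, f = elem σ g v} := by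
    rw [h]; trivial
  induction hf using Submodule.span_induction with
  | mem x hx => obtain ⟨g, v, rfl⟩ := hx; exact helem g v
  | zero => exact h0
  | add x y _ _ hx hy => exact hadd x y hx hy
  | smul a x _ hx => exact hsmul a x hx

lemma cInd_linearMap_ext {X : Type*} [AddCommGroup X] [Module κ X]
    {L L' : cInd σ →ₗ[κ] X} (h : ∀ g v, L (elem σ g v) = L' (elem σ g v)) : L = L' := by
  refine LinearMap.ext fun f => ?_
  induction f using cInd_induction with
  | h0 => simp
  | hadd f f' hf hf' => rw [map_add, map_add, hf, hf']
  | hsmul a f hf => rw [map_smul, map_smul, hf]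
  | helem g v => exact h g v

lemma elem_add (g : GL2Qp p) (v w : V) : elem σ g (v + w) = elem σ g v + elem σ g w := by
  ext g'
  change elemFun σ g (v + w) g' = elemFun σ g v g' + elemFun σ g w g'
  by_cases e : ∃ (n : ℤ) (h : H), g' * g = pScalar p ^ n * inclK p h
  · obtain ⟨n, h, e⟩ := e
    simp only [elemFun_of_eq σ _ e, map_add]
  · simp only [elemFun_of_not σ _ e, add_zero]

lemma elem_smul (g : GL2Qp p) (a : κ) (v : V) : elem σ g (a • v) = a • elem σ g v := by
  ext g'
  change elemFun σ g (a • v) g' = a • elemFun σ g v g'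
  by_cases e : ∃ (n : ℤ) (h : H), g' * g = pScalar p ^ n * inclK p h
  · obtain ⟨n, h, e⟩ := e
    simp only [elemFun_of_eq σ _ e, map_smul]
  · simp only [elemFun_of_not σ _ e, smul_zero]

/-- `v ↦ ⟦g, v⟧` as a linear map. -/
def elemL (σ : Representation κ H V) (g : GL2Qp p) : V →ₗ[κ] cInd σ where
  toFun := elem σ g
  map_add' := elem_add g
  map_smul' := elem_smul g

lemma elem_mul_inclK (g : GL2Qp p) (h : H) (v : V) :
    elem σ (g * inclK p h) v = elem σ g (σ h v) := by
  ext g'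
  change elemFun σ (g * inclK p h) v g' = elemFun σ g (σ h v) g'
  by_cases e : ∃ (n : ℤ) (h : H), g' * g = pScalar p ^ n * inclK p h
  · obtain ⟨n, h', e⟩ := e
    rw [elemFun_of_eq σ _ e, elemFun_of_eq σ v (n := n) (h := h' * h), map_mul]
    · rfl
    · rw [← mul_assoc, e, Subgroup.coe_mul, map_mul, mul_assoc]
  · rw [elemFun_of_not σ _ e, elemFun_of_not]
    rintro ⟨n, h', e'⟩
    refine e ⟨n, h' * h⁻¹, ?_⟩
    rw [Subgroup.coe_mul, Subgroup.coe_inv, map_mul, map_inv, ← mul_assoc (pScalar p ^ n), ← e']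
    group

lemma elem_mul_pScalar (g : GL2Qp p) (v : V) : elem σ (g * pScalar p) v = elem σ g v := by
  ext g'
  change elemFun σ (g * pScalar p) v g' = elemFun σ g v g'
  have hc : ∀ x : GL2Qp p, x * pScalar p = pScalar p * x := fun x => by
    simpa using (pScalar_zpow_mul_comm 1 x).symm
  by_cases e : ∃ (n : ℤ) (h : H), g' * g = pScalar p ^ n * inclK p h
  · obtain ⟨n, h', e⟩ := e
    rw [elemFun_of_eq σ _ e, elemFun_of_eq σ v (n := 1 + n) (h := h')]
    rw [← mul_assoc, hc, e, zpow_add, zpow_one, mul_assoc]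
  · rw [elemFun_of_not σ _ e, elemFun_of_not]
    rintro ⟨n, h', e'⟩
    refine e ⟨-1 + n, h', ?_⟩
    rw [zpow_add, mul_assoc, ← e', ← mul_assoc g', hc, zpow_neg_one, inv_mul_cancel_left]

/-- Frobenius reciprocity for the quotients of compact inductions. -/
theorem exists_cIndQuot_lift (R : Set (cInd σ)) (hR : ∀ g, ∀ f ∈ R, cIndRep σ g f ∈ R)
    (φ : V →ₗ[κ] X) (hφ : ∀ (h : H) v, φ (σ h v) = ρ (inclK p h) (φ v))
    (hp : ∀ v, ρ (pScalar p) (φ v) = φ v)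
    (hrel : ∀ L : cInd σ →ₗ[κ] X, (∀ g v, L (elem σ g v) = ρ g (φ v)) → ∀ f ∈ R, L f = 0) :
    ∃ Φ : (cIndQuot σ R hR).IntertwiningMap ρ,
      ∀ v, Φ (Submodule.Quotient.mk (elem σ 1 v)) = φ v := by
  obtain ⟨L, hL⟩ := exists_cInd_lift φ hφ hp
  have hker : span κ R ≤ LinearMap.ker L :=
    span_le.2 fun f hf => hrel L hL f hf
  refine ⟨⟨(span κ R).liftQ L hker, fun g => ?_⟩, fun v => ?_⟩
  · refine Submodule.linearMap_qext _ (cInd_linearMap_ext fun x v => ?_)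
    change L (cIndRep σ g (elem σ x v)) = ρ g (L (elem σ x v))
    rw [cIndRep_elem, hL, hL, map_mul]
    rfl
  · change L (elem σ 1 v) = φ v
    rw [hL, map_one]
    rfl

lemma cIndQuot_mk_elem (R : Set (cInd σ)) (hR : ∀ g, ∀ f ∈ R, cIndRep σ g f ∈ R) (x g : GL2Qp p)
    (v : V) : cIndQuot σ R hR x (Submodule.Quotient.mk (elem σ g v))
      = Submodule.Quotient.mk (elem σ (x * g) v) := by
  rw [← cIndRep_elem]
  rfl

end CompactInductionLift

section Matrices

lemma ringHom_padicInt_eq_toZMod (f : ℤ_[p] →+* ZMod p) : f = toZMod := by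
  ext x
  obtain ⟨n, hn⟩ : ∃ n : ℕ, toZMod x = n :=
    ⟨(toZMod x).val, (ZMod.natCast_zmod_val _).symm⟩
  have h : x - n ∈ RingHom.ker (toZMod : ℤ_[p] →+* ZMod p) := by
    rw [RingHom.mem_ker, map_sub, hn, map_natCast, sub_self]
  rw [PadicInt.ker_toZMod, PadicInt.maximalIdeal_eq_span_p, Ideal.mem_span_singleton] at h
  obtain ⟨y, hy⟩ := h
  rw [sub_eq_iff_eq_add] at hy
  rw [hn, hy, map_add, map_mul, map_natCast, map_natCast]
  simp

lemma toZMod_teich (t : ZMod p) : toZMod (teich t) = t := by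
  have h := ringHom_padicInt_eq_toZMod
    ((WittVector.constantCoeff (p := p)).comp (WittVector.equiv p).symm.toRingHom)
  rw [← h, teich]
  simp [WittVector.constantCoeff_apply]

lemma toFpbar_teich (t : ZMod p) : toFpbar p (teich t) = ofFp t := by
  rw [toFpbar, RingHom.comp_apply, toZMod_teich]

lemma toFpbar_eq_zero_iff {x : ℤ_[p]} : toFpbar p x = 0 ↔ toZMod x = 0 := by
  rw [toFpbar, RingHom.comp_apply, map_eq_zero]

lemma toZMod_eq_zero_iff {x : ℤ_[p]} : toZMod x = 0 ↔ ∃ y, x = p * y := by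
  rw [← RingHom.mem_ker, PadicInt.ker_toZMod, PadicInt.maximalIdeal_eq_span_p,
    Ideal.mem_span_singleton]
  rfl

lemma isUnit_iff_toZMod_ne_zero {x : ℤ_[p]} : IsUnit x ↔ toZMod x ≠ 0 := by
  rw [Ne, ← RingHom.mem_ker, PadicInt.ker_toZMod, IsLocalRing.mem_maximalIdeal, mem_nonunits_iff,
    not_not]

/-- The matrix `(a, b; c, d)` of `K`. -/
def mkK (a b c d : ℤ_[p]) (h : IsUnit (a * d - b * c)) : GL2Zp p :=
  Matrix.GeneralLinearGroup.mk'' !![a, b; c, d] (by rwa [Matrix.det_fin_two_of])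

/-- The matrix `(a, b; c, d)` of `G`. -/
def mkQ (a b c d : ℚ_[p]) (h : a * d - b * c ≠ 0) : GL2Qp p :=
  Matrix.GeneralLinearGroup.mkOfDetNeZero !![a, b; c, d] (by rwa [Matrix.det_fin_two_of])

@[simp] lemma coe_mkK (a b c d : ℤ_[p]) (h : IsUnit (a * d - b * c)) :
    (mkK a b c d h : Matrix (Fin 2) (Fin 2) ℤ_[p]) = !![a, b; c, d] := rfl

@[simp] lemma coe_mkQ (a b c d : ℚ_[p]) (h : a * d - b * c ≠ 0) :
    (mkQ a b c d h : Matrix (Fin 2) (Fin 2) ℚ_[p]) = !![a, b; c, d] := rfl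

@[simp] lemma coe_mkG (a b c d : ℤ_[p]) (h : a * d - b * c ≠ 0) :
    (mkG a b c d h : Matrix (Fin 2) (Fin 2) ℚ_[p]) = !![(a : ℚ_[p]), b; c, d] := rfl

lemma coe_inclK (k : GL2Zp p) : (inclK p k : Matrix (Fin 2) (Fin 2) ℚ_[p])
    = !![((k 0 0 : ℤ_[p]) : ℚ_[p]), (k 0 1 : ℤ_[p]); (k 1 0 : ℤ_[p]), (k 1 1 : ℤ_[p])] := by
  ext i j
  fin_cases i <;> fin_cases j <;> rfl

@[simp] lemma coe_inclK_mkK (a b c d : ℤ_[p]) (h : IsUnit (a * d - b * c)) :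
    (inclK p (mkK a b c d h) : Matrix (Fin 2) (Fin 2) ℚ_[p]) = !![(a : ℚ_[p]), b; c, d] := by
  rw [coe_inclK]; rfl

@[simp] lemma coe_pScalar : (pScalar p : Matrix (Fin 2) (Fin 2) ℚ_[p])
    = !![(p : ℚ_[p]), 0; 0, p] := by
  ext i j
  fin_cases i <;> fin_cases j <;>
    simp [pScalar, pUnit, Matrix.GeneralLinearGroup.scalar, Matrix.natCast_apply]

lemma isUnit_det (k : GL2Zp p) : IsUnit (k 0 0 * k 1 1 - k 0 1 * k 1 0 : ℤ_[p]) := by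
  have h := (Matrix.isUnit_iff_isUnit_det _).1 k.isUnit
  rwa [Matrix.det_fin_two] at h

/-- The upper triangular unipotent matrix `(1, b; 0, 1)`. -/
def uni (b : ℚ_[p]) : GL2Qp p := mkQ 1 b 0 1 (by simp)

lemma uni_add (b c : ℚ_[p]) : uni (b + c) = uni b * uni c := by
  refine Units.ext ?_
  rw [val_mul]
  simp [uni, add_comm]

lemma uni_zero : (uni 0 : GL2Qp p) = 1 := by
  refine Units.ext ?_
  simp [uni, Matrix.one_fin_two]

lemma padic_p_ne_zero : (p : ℚ_[p]) ≠ 0 := by exact_mod_cast (Fact.out : p.Prime).ne_zero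

/-- The matrix `(p, 0; 0, 1)`. -/
def matF (p : ℕ) [Fact p.Prime] : GL2Qp p := mkQ p 0 0 1 (by simpa using padic_p_ne_zero)

/-- The matrix `([t], 1; 1, 0)` of `K`. -/
def matK (t : ZMod p) : GL2Zp p := mkK (teich t) 1 1 0 (by simp)

lemma matF_mul_uni (b : ℚ_[p]) : matF p * uni b = uni ((p : ℚ_[p]) * b) * matF p := by
  refine Units.ext ?_
  rw [val_mul, val_mul]
  simp [uni, matF]

lemma matX_eq (t : ZMod p) : matX t = inclK p (matK t) * matBeta p := by
  refine Units.ext ?_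
  rw [val_mul]
  simp [matX, matK, matBeta]

lemma matX_eq_uni (t : ZMod p) : matX t = uni (teich t : ℤ_[p]) * matF p := by
  refine Units.ext ?_
  rw [val_mul]
  simp [matX, uni, matF]

lemma matY_eq (t : ZMod p) : matY t = matBeta p * inclK p (matK t) := by
  refine Units.ext ?_
  rw [val_mul]
  simp [matY, matK, matBeta]

lemma matBeta_mul_self : matBeta p * matBeta p = pScalar p := by
  refine Units.ext ?_
  rw [val_mul]
  simp [matBeta]

lemma matAlpha_mul_matK_zero : matAlpha p * inclK p (matK 0) = matBeta p := by
  refine Units.ext ?_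
  rw [val_mul]
  simp [matAlpha, matK, matBeta, teich]

lemma matK_zero_mul_matBeta : inclK p (matK 0) * matBeta p = matF p := by
  refine Units.ext ?_
  rw [val_mul]
  simp [matF, matK, matBeta, teich]

lemma matK_eq_uni (t : ZMod p) : inclK p (matK t) = uni (teich t : ℤ_[p]) * inclK p (matK 0) := by
  refine Units.ext ?_
  rw [val_mul]
  simp [uni, matK, teich]

lemma mem_iwahori {k : GL2Zp p} : k ∈ iwahori p ↔ toZMod (k 1 0 : ℤ_[p]) = 0 := Iff.rfl

/-- Conjugation by `β` normalizes the Iwahori subgroup and swaps the diagonal entries. -/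
lemma exists_iwahori_mul_matBeta (k : iwahori p) :
    ∃ k' : iwahori p, inclK p k * matBeta p = matBeta p * inclK p k' ∧
      (k' : GL2Zp p) 0 0 = (k : GL2Zp p) 1 1 ∧ (k' : GL2Zp p) 1 1 = (k : GL2Zp p) 0 0 := by
  obtain ⟨k, hk⟩ := k
  obtain ⟨c, hc⟩ := toZMod_eq_zero_iff.1 (mem_iwahori.1 hk)
  have hdet := isUnit_det k
  refine ⟨⟨mkK (k 1 1) c (p * k 0 1) (k 0 0) ?_, ?_⟩, ?_, rfl, rfl⟩
  · convert hdet using 1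
    rw [hc]
    ring
  · rw [mem_iwahori]
    simp
  · refine Units.ext ?_
    rw [val_mul, val_mul]
    simp [coe_inclK, hc, matBeta, mul_comm]

lemma matK_mul_matK (s t u : ZMod p) (h : s * t + 1 = u * t) :
    ∃ k : iwahori p, matK s * matK t = matK u * (k : GL2Zp p) ∧
      toFpbar p ((k : GL2Zp p) 0 0) = ofFp t ∧
      toFpbar p ((k : GL2Zp p) 1 1) = ofFp (s - u) := by
  refine ⟨⟨mkK (teich t) 1 (teich s * teich t + 1 - teich u * teich t) (teich s - teich u) ?_, ?_⟩,
    ?_, toFpbar_teich t, ?_⟩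
  · have : (teich t * (teich s - teich u) - 1 * (teich s * teich t + 1 - teich u * teich t) : ℤ_[p])
      = -1 := by ring
    rw [this]
    exact isUnit_one.neg
  · rw [mem_iwahori]
    simp [toZMod_teich, h]
  · refine Units.ext ?_
    rw [val_mul, val_mul]
    simp [matK]
  · simp [toFpbar_teich]

/-- The Bruhat decomposition of `K` relative to the Iwahori subgroup. -/
lemma mem_iwahori_or_exists_matK (k : GL2Zp p) :
    k ∈ iwahori p ∨ ∃ (t : ZMod p) (k' : iwahori p), k = matK t * (k' : GL2Zp p) := by
  by_cases hk : toZMod (k 1 0 : ℤ_[p]) = 0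
  · exact Or.inl hk
  · right
    set t : ZMod p := toZMod (k 0 0 : ℤ_[p]) * (toZMod (k 1 0 : ℤ_[p]))⁻¹ with ht
    have hdet := isUnit_det k
    refine ⟨t, ⟨mkK (k 1 0) (k 1 1) (k 0 0 - teich t * k 1 0) (k 0 1 - teich t * k 1 1) ?_, ?_⟩, ?_⟩
    · convert hdet.neg using 1
      ring
    · rw [mem_iwahori]
      simp [toZMod_teich, ht, hk]
    · refine Units.ext ?_
      rw [val_mul]
      simp only [matK, coe_mkK, Matrix.mul_fin_two]
      ext i j
      fin_cases i <;> fin_cases j <;> simp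

end Matrices

section PolynomialSpan

lemma choose_cast_ne_zero {r i : ℕ} (hr : r ≤ p - 1) (hi : i ≤ r) :
    ((r.choose i : ℕ) : κ) ≠ 0 := by
  have hp : p.Prime := Fact.out
  rw [Ne, CharP.cast_eq_zero_iff κ p]
  intro h
  have h1 : p ∣ r.factorial := by
    rw [← Nat.choose_mul_factorial_mul_factorial hi, mul_assoc]
    exact h.mul_right _
  have := (hp.dvd_factorial).1 h1
  have := hp.two_le
  omega

lemma eq_zero_of_natDegree_lt_of_eval_algebraMap {P : κ[X]} (hP : P.natDegree < p)
    (h : ∀ s : ZMod p, P.eval (ofFp s) = 0) : P = 0 := by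
  refine Polynomial.eq_zero_of_natDegree_lt_card_of_eval_eq_zero P
    (f := ofFp) (ofFp).injective h ?_
  rwa [ZMod.card]

/-- For `r ≤ p - 1`, the polynomials `(X - s) ^ r` with `s ∈ 𝔽_p` span the polynomials of degree at
most `r`. -/
theorem mem_span_X_sub_C_pow {r : ℕ} (hr : r ≤ p - 1) {P : κ[X]} (hP : P.natDegree ≤ r) :
    P ∈ span κ
      (Set.range fun s : ZMod p => (X - C (ofFp s)) ^ r) := by
  have hp : p.Prime := Fact.out
  by_contra hcon
  obtain ⟨φ, hφP, hφ⟩ := Submodule.exists_le_ker_of_notMem hcon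
  refine hφP ?_
  have hexp : ∀ a : κ, φ ((X - C a) ^ r)
      = ∑ i ∈ Finset.range (r + 1), φ (X ^ i) * ((-1) ^ (r - i) * r.choose i) * a ^ (r - i) := by
    intro a
    rw [sub_eq_add_neg, add_pow, map_sum]
    refine Finset.sum_congr rfl fun i _ => ?_
    have : (X : κ[X]) ^ i * (-C a) ^ (r - i) * (r.choose i : κ[X])
        = ((-a) ^ (r - i) * r.choose i) • X ^ i := by
      rw [← C_neg, ← C_pow, ← C_eq_natCast, mul_assoc, ← C_mul, mul_comm, ← smul_eq_C_mul]
    rw [this, map_smul, smul_eq_mul, neg_pow]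
    ring
  set Q : κ[X] := ∑ i ∈ Finset.range (r + 1),
    C (φ (X ^ i) * ((-1) ^ (r - i) * r.choose i)) * X ^ (r - i) with hQ
  have hQ0 : Q = 0 := by
    apply eq_zero_of_natDegree_lt_of_eval_algebraMap
    · have : Q.natDegree ≤ r := by
        refine natDegree_sum_le_of_forall_le _ _ fun i _ => ?_
        exact (natDegree_C_mul_X_pow_le _ _).trans (Nat.sub_le _ _)
      have := hp.two_le
      omega
    · intro s
      have h1 : (X - C (ofFp s)) ^ r ∈ LinearMap.ker φ :=
        hφ (subset_span ⟨s, rfl⟩)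
      rw [LinearMap.mem_ker, hexp] at h1
      rw [hQ, eval_finsetSum, ← h1]
      simp
  have hcoef : ∀ i ≤ r, φ (X ^ i) = 0 := by
    intro i hi
    have h1 : Q.coeff (r - i) = φ (X ^ i) * ((-1) ^ (r - i) * r.choose i) := by
      rw [hQ, finsetSum_coeff, Finset.sum_eq_single i]
      · rw [coeff_C_mul_X_pow, if_pos rfl]
      · intro j hj hji
        rw [coeff_C_mul_X_pow, if_neg]
        have := Finset.mem_range.1 hj
        omega
      · intro h
        exact absurd (Finset.mem_range.2 (by omega)) h
    rw [hQ0, coeff_zero] at h1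
    rcases mul_eq_zero.1 h1.symm with h | h
    · exact h
    · rcases mul_eq_zero.1 h with h | h
      · exact absurd h (pow_ne_zero _ (neg_ne_zero.2 one_ne_zero))
      · exact absurd h (choose_cast_ne_zero hr hi)
  rw [P.as_sum_range' (r + 1) (by omega), map_sum]
  refine Finset.sum_eq_zero fun i hi => ?_
  rw [← C_mul_X_pow_eq_monomial, ← smul_eq_C_mul, map_smul, hcoef i (by
    have := Finset.mem_range.1 hi; omega), smul_zero]

/-- A linear map which takes the same value at all `(X - s) ^ r` with `s ∈ 𝔽_p` is a multiple of the
`r`-th coefficient on polynomials of degree at most `r ≤ p - 1`. -/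
theorem linearMap_eq_coeff_smul {r : ℕ} (hr : r ≤ p - 1) {W : Type*} [AddCommGroup W]
    [Module κ W] (Λ : κ[X] →ₗ[κ] W) (w : W)
    (h : ∀ s : ZMod p, Λ ((X - C (ofFp s)) ^ r) = w)
    {P : κ[X]} (hP : P.natDegree ≤ r) : Λ P = P.coeff r • w := by
  have hm := mem_span_X_sub_C_pow hr hP
  clear hP
  induction hm using Submodule.span_induction with
  | mem x hx =>
    obtain ⟨s, rfl⟩ := hx
    have h1 : ((X - C (ofFp s)) ^ r).coeff r = 1 := by
      have := (monic_X_sub_C (ofFp s)).pow r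
      have h2 := this.coeff_natDegree
      rwa [natDegree_pow, natDegree_X_sub_C, mul_one] at h2
    rw [h1, one_smul]
    exact h s
  | zero => simp
  | add x y _ _ hx hy => rw [map_add, hx, hy, coeff_add, add_smul]
  | smul a x _ hx => rw [map_smul, hx, coeff_smul, smul_eq_mul, mul_smul]

end PolynomialSpan

section HeckeVectors

variable {W : Type*} [AddCommGroup W] [Module κ W]

/-- The vector `v` is an eigenvector of the Iwahori subgroup which satisfies the relations of the
generator of `π(r, a, 1)`. -/
structure HeckeVec (ρ : GL2Rep W) (r : ℕ) (a : κ) (v : W) :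
    Prop where
  iwahori : ∀ k : iwahori p, ρ (inclK p k) v = toFpbar p ((k : GL2Zp p) 0 0) ^ r • v
  pScalar : ρ (pScalar p) v = v
  sum_matK : ∑ t : ZMod p, ρ (inclK p (matK t)) v
    + (if r = p - 1 then (1 : κ) else 0) • v = 0
  sum_matX : ∑ t : ZMod p, ρ (matX t) v
    + (if r = 0 then (1 : κ) else 0) • ρ (matBeta p) v = a • v

variable {ρ : GL2Rep W} {r : ℕ} {a : κ} {v : W}

namespace HeckeVec

lemma pScalar_smul (h : HeckeVec ρ r a v) (g : GL2Qp p) :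
    ρ (ModPLLC.pScalar p) (ρ g v) = ρ g v := by
  rw [← mul_apply, ← map_mul]
  have : ModPLLC.pScalar p * g = g * ModPLLC.pScalar p := by simpa using pScalar_zpow_mul_comm 1 g
  rw [this, map_mul, mul_apply, h.pScalar]

lemma matBeta_matBeta (h : HeckeVec ρ r a v) : ρ (matBeta p) (ρ (matBeta p) v) = v := by
  rw [← mul_apply, ← map_mul, matBeta_mul_self, h.pScalar]

lemma iwahori_matBeta (h : HeckeVec ρ r a v) (k : ModPLLC.iwahori p) :
    ρ (inclK p k) (ρ (matBeta p) v) = toFpbar p ((k : GL2Zp p) 1 1) ^ r • ρ (matBeta p) v := by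
  obtain ⟨k', h1, h2, -⟩ := exists_iwahori_mul_matBeta k
  rw [← mul_apply, ← map_mul, h1, map_mul, mul_apply, h.iwahori, map_smul, h2]

lemma uni_smul (h : HeckeVec ρ r a v) (b : ℤ_[p]) : ρ (uni (b : ℚ_[p])) v = v := by
  have hk : mkK 1 b 0 1 (by simp) ∈ ModPLLC.iwahori p := by rw [mem_iwahori]; simp
  have := h.iwahori ⟨_, hk⟩
  have e : inclK p (mkK 1 b 0 1 (by simp)) = uni (b : ℚ_[p]) := by
    refine Units.ext ?_
    rw [coe_inclK_mkK]
    simp [uni]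
  simpa [e] using this

lemma uni_smul_matBeta (h : HeckeVec ρ r a v) (b : ℤ_[p]) :
    ρ (uni (b : ℚ_[p])) (ρ (matBeta p) v) = ρ (matBeta p) v := by
  have hk : mkK 1 b 0 1 (by simp) ∈ ModPLLC.iwahori p := by rw [mem_iwahori]; simp
  have := h.iwahori_matBeta ⟨_, hk⟩
  have e : inclK p (mkK 1 b 0 1 (by simp)) = uni (b : ℚ_[p]) := by
    refine Units.ext ?_
    rw [coe_inclK_mkK]
    simp [uni]
  simpa [e] using this

lemma matK_matK (h : HeckeVec ρ r a v) {s t u : ZMod p} (e : s * t + 1 = u * t) :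
    ρ (inclK p (matK s)) (ρ (inclK p (matK t)) v)
      = ofFp t ^ r • ρ (inclK p (matK u)) v := by
  obtain ⟨k, h1, h2, -⟩ := matK_mul_matK s t u e
  rw [← mul_apply, ← map_mul, ← map_mul, h1, map_mul, map_mul, mul_apply,
    h.iwahori, map_smul, h2]

lemma matK_matX (h : HeckeVec ρ r a v) {s t u : ZMod p} (e : s * t + 1 = u * t) :
    ρ (inclK p (matK s)) (ρ (matX t) v)
      = ofFp (s - u) ^ r • ρ (matX u) v := by
  obtain ⟨k, h1, -, h2⟩ := matK_mul_matK s t u e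
  rw [← mul_apply, ← map_mul, matX_eq, ← mul_assoc, ← map_mul, h1, map_mul, map_mul,
    map_mul, mul_apply, mul_apply, h.iwahori_matBeta, map_smul, h2, matX_eq,
    map_mul, mul_apply]

lemma matK_matK_zero (s : ZMod p) :
    inclK p (matK s) * inclK p (matK 0) = uni (teich s : ℤ_[p]) := by
  refine Units.ext ?_
  rw [val_mul]
  simp [uni, matK, teich]

/-- Reindexing a sum over `𝔽_p` through `t ↦ s + t⁻¹`. -/
lemma sum_inv_add {M : Type*} [AddCommMonoid M] (s : ZMod p) (f : ZMod p → M) :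
    ∑ t : ZMod p, f (s + t⁻¹) = ∑ u : ZMod p, f u :=
  Fintype.sum_equiv ((Equiv.inv (ZMod p)).trans (Equiv.addLeft s)) _ _ fun _ => rfl

lemma add_sum_matK (h : HeckeVec ρ r a v) (hr : r ≤ p - 1) (s : ZMod p) :
    v + ∑ u : ZMod p, ofFp (u - s) ^ (p - 1 - r) •
      ρ (inclK p (matK u)) v = 0 := by
  have h0 := congrArg (ρ (inclK p (matK s))) h.sum_matK
  rw [map_zero, map_add, map_sum, map_smul] at h0
  obtain ⟨D, hD⟩ : ∃ D : ZMod p → W, ∀ u, D u = if u = s then 0 else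
      ofFp (u - s) ^ (p - 1 - r) • ρ (inclK p (matK u)) v :=
    ⟨_, fun _ => rfl⟩
  have key : ∀ t : ZMod p, ρ (inclK p (matK s)) (ρ (inclK p (matK t)) v)
      = (if t = 0 then v else 0) + D (s + t⁻¹) := by
    intro t
    by_cases ht : t = 0
    · subst ht
      rw [if_pos rfl, inv_zero, add_zero, hD, if_pos rfl, add_zero, ← mul_apply, ← map_mul,
        matK_matK_zero, h.uni_smul]
    · have hne : s + t⁻¹ ≠ s := by simpa using ht
      rw [if_neg ht, zero_add, hD, if_neg hne, h.matK_matK (u := s + t⁻¹) (by field_simp)]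
      congr 1
      rw [← map_pow, ← map_pow, add_sub_cancel_left]
      congr 1
      have h1 : t ^ (p - 1 - r) * t ^ r = 1 := by
        rw [← pow_add, Nat.sub_add_cancel hr]
        exact ZMod.pow_card_sub_one_eq_one ht
      rw [inv_pow]
      exact (inv_eq_of_mul_eq_one_right h1).symm
  simp_rw [key] at h0
  rw [Finset.sum_add_distrib, Finset.sum_ite_eq' Finset.univ (0 : ZMod p) (fun _ => v),
    if_pos (Finset.mem_univ _), sum_inv_add, add_assoc] at h0
  rw [← h0]
  congr 1
  have h1 : (if r = p - 1 then (1 : κ) else 0) • ρ (inclK p (matK s)) v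
      = ∑ u : ZMod p, if u = s then
        (if r = p - 1 then (1 : κ) else 0) • ρ (inclK p (matK u)) v else 0 := by
    simp
  rw [h1, ← Finset.sum_add_distrib]
  refine Finset.sum_congr rfl fun u _ => ?_
  rw [hD]
  by_cases hu : u = s
  · subst hu
    rw [if_pos rfl, if_pos rfl, zero_add, sub_self, map_zero]
    congr 1
    split_ifs with hrp
    · rw [hrp, Nat.sub_self, pow_zero]
    · rw [zero_pow (by omega)]
  · rw [if_neg hu, if_neg hu, add_zero]

lemma matBeta_add_sum_matX (h : HeckeVec ρ r a v) (s : ZMod p) :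
    ρ (matBeta p) v + ∑ u : ZMod p, ofFp (s - u) ^ r • ρ (matX u) v
      = a • ρ (inclK p (matK s)) v := by
  have h0 := congrArg (ρ (inclK p (matK s))) h.sum_matX
  rw [map_smul, map_add, map_sum, map_smul] at h0
  obtain ⟨D, hD⟩ : ∃ D : ZMod p → W, ∀ u, D u = if u = s then 0 else
      ofFp (s - u) ^ r • ρ (matX u) v :=
    ⟨_, fun _ => rfl⟩
  have key : ∀ t : ZMod p, ρ (inclK p (matK s)) (ρ (matX t) v)
      = (if t = 0 then ρ (matBeta p) v else 0) + D (s + t⁻¹) := by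
    intro t
    by_cases ht : t = 0
    · subst ht
      rw [if_pos rfl, inv_zero, add_zero, hD, if_pos rfl, add_zero, matX_eq, ← mul_apply,
        ← map_mul, ← mul_assoc, matK_matK_zero, map_mul, mul_apply, h.uni_smul_matBeta]
    · have hne : s + t⁻¹ ≠ s := by simpa using ht
      rw [if_neg ht, zero_add, hD, if_neg hne, h.matK_matX (u := s + t⁻¹) (by field_simp)]
  simp_rw [key] at h0
  rw [Finset.sum_add_distrib, Finset.sum_ite_eq' Finset.univ (0 : ZMod p)
    (fun _ => ρ (matBeta p) v), if_pos (Finset.mem_univ _), sum_inv_add, add_assoc] at h0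
  rw [← h0]
  congr 1
  have h1 : (if r = 0 then (1 : κ) else 0) • ρ (inclK p (matK s)) (ρ (matBeta p) v)
      = ∑ u : ZMod p, if u = s then
        (if r = 0 then (1 : κ) else 0) • ρ (matX u) v else 0 := by
    simp [matX_eq]
  rw [h1, ← Finset.sum_add_distrib]
  refine Finset.sum_congr rfl fun u _ => ?_
  rw [hD]
  by_cases hu : u = s
  · subst hu
    rw [if_pos rfl, if_pos rfl, zero_add, sub_self, map_zero]
    congr 1
    split_ifs with hrp
    · rw [hrp, pow_zero]
    · rw [zero_pow hrp]
  · rw [if_neg hu, if_neg hu, add_zero]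

/-- Intertwining maps preserve the relations. -/
lemma map {W' : Type*} [AddCommGroup W'] [Module κ W']
    {ρ' : GL2Rep W'} (h : HeckeVec ρ r a v) (f : ρ.IntertwiningMap ρ') :
    HeckeVec ρ' r a (f v) where
  iwahori k := by rw [← f.isIntertwining, h.iwahori, map_smul]
  pScalar := by rw [← f.isIntertwining, h.pScalar]
  sum_matK := by
    simp_rw [← f.isIntertwining]
    rw [← map_sum, ← map_smul, ← map_add, h.sum_matK, map_zero]
  sum_matX := by
    simp_rw [← f.isIntertwining]
    rw [← map_sum, ← map_smul, ← map_add, h.sum_matX, map_smul]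

end HeckeVec

/-- The orbit of `v` generates `W`. -/
def Generates (ρ : GL2Rep W) (v : W) : Prop :=
  span κ (Set.range fun g => ρ g v) = ⊤

lemma Generates.hom_ext {W' : Type*} [AddCommGroup W'] [Module κ W']
    {ρ' : GL2Rep W'} (hv : Generates ρ v)
    {f f' : ρ.IntertwiningMap ρ'} (h : f v = f' v) (w : W) : f w = f' w := by
  have hw : w ∈ span κ (Set.range fun g => ρ g v) := by rw [hv]; trivial
  induction hw using Submodule.span_induction with
  | mem x hx => obtain ⟨g, rfl⟩ := hx; rw [f.isIntertwining, f'.isIntertwining, h]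
  | zero => rw [map_zero, map_zero]
  | add x y _ _ hx hy => rw [map_add, map_add, hx, hy]
  | smul c x _ hx => rw [map_smul, map_smul, hx]

/-- The data `(ρ, v)` satisfy the universal property of `π(r, a, 1)`. -/
structure IsUniversal (ρ : GL2Rep W) (r : ℕ) (a : κ) (v : W) :
    Prop where
  heckeVec : HeckeVec ρ r a v
  generates : Generates ρ v
  exists_lift : ∀ {W' : Type} [AddCommGroup W'] [Module κ W']
    {ρ' : GL2Rep W'} {v' : W'}, HeckeVec ρ' r a v' →
    ∃ f : ρ.IntertwiningMap ρ', f v = v'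

/-- Two representations with generators that can be mapped to each other are equivalent. -/
lemma nonempty_equiv_of_generates {W' : Type*} [AddCommGroup W'] [Module κ W']
    {ρ' : GL2Rep W'} {v' : W'} (hv : Generates ρ v)
    (hv' : Generates ρ' v') (f : ρ.IntertwiningMap ρ') (f' : ρ'.IntertwiningMap ρ)
    {c c' : κ} (hc : c ≠ 0) (hc' : c' ≠ 0) (h : f' (f v) = c • v)
    (h' : f (f' v') = c' • v') :
    Nonempty (ρ.Equiv ρ') := by
  have h1 : ∀ w, f' (f w) = c • w :=
    hv.hom_ext (f := f'.comp f) (f' := c • Representation.IntertwiningMap.id ρ) h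
  have h2 : ∀ w, f (f' w) = c' • w :=
    hv'.hom_ext (f := f.comp f') (f' := c' • Representation.IntertwiningMap.id ρ') h'
  refine ⟨Representation.IntertwiningMap.ofBijective f ⟨?_, ?_⟩⟩
  · intro x y hxy
    have := (h1 x).symm.trans ((congrArg f' hxy).trans (h1 y))
    exact smul_right_injective _ hc this
  · intro w
    exact ⟨c'⁻¹ • f' w, by rw [map_smul, h2, smul_smul, inv_mul_cancel₀ hc', one_smul]⟩

lemma HeckeVec.matX_matBeta (h : HeckeVec ρ r a v) (t : ZMod p) :
    ρ (matX t) (ρ (matBeta p) v) = ρ (inclK p (matK t)) v := by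
  rw [matX_eq, map_mul, mul_apply, h.matBeta_matBeta]

lemma matK_matBeta_apply (ρ : GL2Rep W) (t : ZMod p) (x : W) :
    ρ (inclK p (matK t)) (ρ (matBeta p) x) = ρ (matX t) x := by
  rw [matX_eq, map_mul, mul_apply]

end HeckeVectors

section IwahoriUniversal

/-- The representation `π(r, a, 1)` defined by Iwahori induction. -/
abbrev iwahoriQuot (p : ℕ) [Fact p.Prime] (r : ℕ) (a : κ) :=
  cIndQuot (dRep p r) (iwahoriRel p r a) (iwahoriRel_stable r a)

/-- The representation `π(r, a, 1)` defined by spherical induction. -/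
abbrev sphericalQuot (p : ℕ) [Fact p.Prime] (r : ℕ) (a : κ) :=
  cIndQuot (symRep p r) (sphericalRel p r a) (sphericalRel_stable r a)

lemma dRep_apply (r : ℕ) (k : iwahori p) (c : κ) :
    dRep p r k c = toFpbar p ((k : GL2Zp p) 1 1) ^ r * c := by
  change (((iwahoriChar p ^ r) k : κˣ) : κ) * c = _
  rw [pow_apply, val_pow_eq_pow_val]
  rfl

lemma cIndQuot_generates {H : Subgroup (GL2Zp p)} {V : Type} [AddCommGroup V] [Module κ V]
    {σ : Representation κ H V} {R : Set (cInd σ)}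
    {hR : ∀ g, ∀ f ∈ R, cIndRep σ g f ∈ R} {w : cInd σ ⧸ span κ R}
    (h : ∀ (g : GL2Qp p) (v : V), Submodule.Quotient.mk (elem σ g v) ∈
      span κ (Set.range fun g => cIndQuot σ R hR g w)) :
    Generates (cIndQuot σ R hR) w := by
  rw [Generates, eq_top_iff]
  rintro x -
  obtain ⟨f, rfl⟩ := Submodule.Quotient.mk_surjective _ x
  induction f using cInd_induction with
  | h0 => exact zero_mem _
  | hadd f f' hf hf' => exact add_mem hf hf'
  | hsmul a f hf => exact Submodule.smul_mem _ a hf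
  | helem g v => exact h g v

lemma heckeVec_matBeta {W : Type*} [AddCommGroup W] [Module κ W]
    {ρ : GL2Rep W} {r : ℕ} {a : κ} {e : W}
    (hk : ∀ k : iwahori p, ρ (inclK p k) e = toFpbar p ((k : GL2Zp p) 1 1) ^ r • e)
    (hpe : ρ (pScalar p) e = e)
    (h1 : ∑ t : ZMod p, ρ (matX t) e + (if r = p - 1 then (1 : κ) else 0) • ρ (matBeta p) e = 0)
    (h2 : ∑ t : ZMod p, ρ (matY t) e + (if r = 0 then (1 : κ) else 0) • ρ (matBeta p) e
      = a • e) :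
    HeckeVec ρ r a (ρ (matBeta p) e) := by
  have hpg : ∀ g, ρ (pScalar p) (ρ g e) = ρ g e := by
    intro g
    have : pScalar p * g = g * pScalar p := by simpa using pScalar_zpow_mul_comm 1 g
    rw [← mul_apply, ← map_mul, this, map_mul, mul_apply, hpe]
  refine ⟨?_, hpg _, ?_, ?_⟩
  · intro k
    obtain ⟨k', h1, -, h2⟩ := exists_iwahori_mul_matBeta k
    rw [← mul_apply, ← map_mul, h1, map_mul, mul_apply, hk, map_smul, h2]
  · simpa only [matX_eq, map_mul, mul_apply] using h1
  · have := congrArg (ρ (matBeta p)) h2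
    rw [map_add, map_sum, map_smul, map_smul] at this
    rw [← this]
    congr 1
    refine Finset.sum_congr rfl fun t _ => ?_
    rw [← mul_apply, ← mul_apply, ← map_mul, ← map_mul, matX_eq, matY_eq,
      mul_assoc, matBeta_mul_self, ← mul_assoc, matBeta_mul_self, map_mul, map_mul,
      mul_apply, mul_apply, hpe, hpg]

lemma heckeVec_iwahoriQuot (r : ℕ) (a : κ) :
    HeckeVec (iwahoriQuot p r a) r a (Submodule.Quotient.mk (elem (dRep p r) (matBeta p) 1)) := by
  have hge : ∀ g, iwahoriQuot p r a g (Submodule.Quotient.mk (elem (dRep p r) 1 1))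
      = (span κ (iwahoriRel p r a)).mkQ (elem (dRep p r) g 1) := by
    intro g
    rw [cIndQuot_mk_elem, mul_one]
    rfl
  have e : (Submodule.Quotient.mk (elem (dRep p r) (matBeta p) 1) :
      cInd (dRep p r) ⧸ span κ (iwahoriRel p r a))
      = iwahoriQuot p r a (matBeta p) (Submodule.Quotient.mk (elem (dRep p r) 1 1)) := (hge _).symm
  rw [e]
  refine heckeVec_matBeta ?_ ?_ ?_ ?_
  · intro k
    have := elem_mul_inclK (σ := dRep p r) 1 k 1
    rw [one_mul, dRep_apply, ← smul_eq_mul, elem_smul] at this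
    rw [hge, this, map_smul]
    rfl
  · have := elem_mul_pScalar (σ := dRep p r) 1 1
    rw [one_mul] at this
    rw [hge, this]
    rfl
  · have h0 : (span κ (iwahoriRel p r a)).mkQ (heckeTm10 p r 1 1 +
        (if r = p - 1 then (1 : κ) else 0) • heckeT10 p r 1 1) = 0 :=
      (Submodule.Quotient.mk_eq_zero _).2 (subset_span (Or.inl ⟨1, 1, rfl⟩))
    rw [map_add, map_smul, heckeTm10, heckeT10, map_sum] at h0
    simp_rw [hge]
    simpa only [one_mul] using h0
  · have h0 : (span κ (iwahoriRel p r a)).mkQ (heckeT12 p r 1 1 +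
        (if r = 0 then (1 : κ) else 0) • heckeT10 p r 1 1 - a • elem (dRep p r) 1 1) = 0 :=
      (Submodule.Quotient.mk_eq_zero _).2 (subset_span (Or.inr ⟨1, 1, rfl⟩))
    rw [map_sub, map_add, map_smul, map_smul, heckeT12, heckeT10, map_sum, sub_eq_zero] at h0
    simp_rw [hge]
    simp only [one_mul] at h0
    exact h0

lemma generates_iwahoriQuot (r : ℕ) (a : κ) :
    Generates (iwahoriQuot p r a) (Submodule.Quotient.mk (elem (dRep p r) (matBeta p) 1)) := by
  refine cIndQuot_generates fun g c => ?_
  have h1 : elem (dRep p r) g c = c • elem (dRep p r) (g * (matBeta p)⁻¹ * matBeta p) 1 := by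
    rw [← elem_smul, smul_eq_mul, mul_one, inv_mul_cancel_right]
  have h2 : (Submodule.Quotient.mk (elem (dRep p r) g c) :
      cInd (dRep p r) ⧸ span κ (iwahoriRel p r a))
      = c • iwahoriQuot p r a (g * (matBeta p)⁻¹)
        (Submodule.Quotient.mk (elem (dRep p r) (matBeta p) 1)) := by
    rw [h1, cIndQuot_mk_elem]
    rfl
  rw [h2]
  exact Submodule.smul_mem _ _ (subset_span ⟨_, rfl⟩)

lemma exists_iwahoriQuot_lift {r : ℕ} {a : κ} {W' : Type*} [AddCommGroup W']
    [Module κ W'] {ρ' : GL2Rep W'} {v' : W'}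
    (h : HeckeVec ρ' r a v') : ∃ f : (iwahoriQuot p r a).IntertwiningMap ρ',
      f (Submodule.Quotient.mk (elem (dRep p r) (matBeta p) 1)) = v' := by
  have hX := h.matX_matBeta
  have hY : ∀ t : ZMod p, ρ' (matY t) (ρ' (matBeta p) v')
      = ρ' (matBeta p) (ρ' (matX t) v') := by
    intro t
    rw [matY_eq, matX_eq, map_mul, map_mul, mul_apply, mul_apply]
  obtain ⟨Φ, hΦ⟩ := exists_cIndQuot_lift (σ := dRep p r) (ρ := ρ') (iwahoriRel p r a)
    (iwahoriRel_stable r a) (LinearMap.toSpanSingleton κ W' (ρ' (matBeta p) v'))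
    (by
      intro k c
      simp only [LinearMap.toSpanSingleton_apply]
      rw [map_smul, h.iwahori_matBeta, dRep_apply, smul_smul, mul_comm])
    (by
      intro c
      simp only [LinearMap.toSpanSingleton_apply]
      rw [map_smul, h.pScalar_smul])
    (by
      rintro L hL f (⟨g, c, rfl⟩ | ⟨g, c, rfl⟩)
      · simp only [heckeTm10, heckeT10, map_add, map_sum, map_smul, hL,
          LinearMap.toSpanSingleton_apply, map_mul, mul_apply, hX, h.matBeta_matBeta]
        have := congrArg (fun w => c • ρ' g w) h.sum_matK
        simp only [map_zero, smul_zero, map_add, map_sum, map_smul, smul_add] at this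
        rw [← this, Finset.smul_sum, smul_comm]
      · simp only [heckeT12, heckeT10, map_add, map_sub, map_sum, map_smul, hL,
          LinearMap.toSpanSingleton_apply, map_mul, mul_apply, hY, h.matBeta_matBeta]
        have := congrArg (fun w => c • ρ' g (ρ' (matBeta p) w)) h.sum_matX
        simp only [map_add, map_sum, map_smul, smul_add, h.matBeta_matBeta] at this
        rw [sub_eq_zero, smul_comm a, ← this, Finset.smul_sum, smul_comm])
  refine ⟨Φ, ?_⟩
  have e : (Submodule.Quotient.mk (elem (dRep p r) (matBeta p) 1) :
      cInd (dRep p r) ⧸ span κ (iwahoriRel p r a))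
      = iwahoriQuot p r a (matBeta p) (Submodule.Quotient.mk (elem (dRep p r) 1 1)) := by
    rw [cIndQuot_mk_elem, mul_one]
  rw [e, Φ.isIntertwining, hΦ]
  simp [h.matBeta_matBeta]

theorem isUniversal_iwahoriQuot (r : ℕ) (a : κ) :
    IsUniversal (iwahoriQuot p r a) r a (Submodule.Quotient.mk (elem (dRep p r) (matBeta p) 1)) :=
  ⟨heckeVec_iwahoriQuot r a, generates_iwahoriQuot r a, exists_iwahoriQuot_lift⟩

end IwahoriUniversal

section SymmetricPowers

/-- The element `(c X + d Y) ^ r` of `V_r`. -/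
def symLin (r : ℕ) (c d : κ) : SymV p r :=
  ⟨(MvPolynomial.C c * MvPolynomial.X 0 + MvPolynomial.C d * MvPolynomial.X 1) ^ r, by
    rw [MvPolynomial.mem_homogeneousSubmodule]
    have h : (MvPolynomial.C c * MvPolynomial.X 0 + MvPolynomial.C d * MvPolynomial.X 1 :
        MvPolynomial (Fin 2) κ).IsHomogeneous 1 :=
      ((MvPolynomial.isHomogeneous_X _ _).C_mul _).add ((MvPolynomial.isHomogeneous_X _ _).C_mul _)
    simpa using h.pow r⟩

lemma symAct_symLin (r : ℕ) (M : Matrix (Fin 2) (Fin 2) κ) (c d : κ) :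
    symAct p r M (symLin r c d) = symLin r (M 0 0 * c + M 0 1 * d) (M 1 0 * c + M 1 1 * d) := by
  refine Subtype.ext ?_
  change symSubst p M ((_ + _) ^ r) = (_ + _) ^ r
  simp only [symSubst, map_pow, map_add, map_mul, MvPolynomial.algHom_C, MvPolynomial.aeval_X,
    MvPolynomial.algebraMap_eq, Fin.sum_univ_two]
  congr 1
  ring

lemma symLin_smul (r : ℕ) (e c d : κ) : symLin r (e * c) (e * d) = e ^ r • symLin r c d := by
  refine Subtype.ext ?_
  change (_ + _) ^ r = e ^ r • ((_ + _) ^ r : MvPolynomial (Fin 2) κ)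
  rw [MvPolynomial.smul_eq_C_mul, map_pow, ← mul_pow, map_mul, map_mul]
  congr 1
  ring

/-- The dehomogenization `v (X, Y) ↦ v (-1, T)`. -/
def dehom (p : ℕ) [Fact p.Prime] (r : ℕ) : SymV p r →ₗ[κ] κ[X] :=
  (MvPolynomial.aeval (![-1, X] : Fin 2 → κ[X])).toLinearMap ∘ₗ
    (MvPolynomial.homogeneousSubmodule (Fin 2) κ r).subtype

lemma dehom_symLin (r : ℕ) (c d : κ) : dehom p r (symLin r c d) = (C d * X - C c) ^ r := by
  change MvPolynomial.aeval (![-1, X] : Fin 2 → κ[X]) ((_ + _) ^ r) = _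
  simp only [map_pow, map_add, map_mul, MvPolynomial.algHom_C, MvPolynomial.aeval_X]
  simp
  congr 1
  ring

lemma dehom_symLin_one (r : ℕ) (c : κ) : dehom p r (symLin r c 1) = (X - C c) ^ r := by
  rw [dehom_symLin, C_1, one_mul]

lemma dehom_eq_sum {r : ℕ} (v : SymV p r) :
    dehom p r v = ∑ d ∈ MvPolynomial.support v.1,
      C (MvPolynomial.coeff d v.1 * (-1) ^ d 0) * X ^ d 1 := by
  change MvPolynomial.aeval (![-1, X] : Fin 2 → κ[X]) v.1 = _
  rw [MvPolynomial.aeval_def, MvPolynomial.eval₂_eq']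
  refine Finset.sum_congr rfl fun d _ => ?_
  simp [Fin.prod_univ_two, mul_assoc]

lemma symV_degree {r : ℕ} (v : SymV p r) {d : Fin 2 →₀ ℕ} (hd : d ∈ MvPolynomial.support v.1) :
    d 0 + d 1 = r := by
  have h := (MvPolynomial.mem_homogeneousSubmodule r v.1).1 v.2
  have := h (MvPolynomial.mem_support_iff.1 hd)
  rw [Finsupp.weight_apply, Finsupp.sum_fintype _ _ (by simp)] at this
  simpa [Fin.sum_univ_two] using this

lemma natDegree_dehom_le {r : ℕ} (v : SymV p r) : (dehom p r v).natDegree ≤ r := by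
  rw [dehom_eq_sum]
  refine natDegree_sum_le_of_forall_le _ _ fun d hd => ?_
  refine (natDegree_C_mul_X_pow_le _ _).trans ?_
  have := symV_degree v hd
  omega

lemma dehom_injective (r : ℕ) : Function.Injective (dehom p r) := by
  rw [injective_iff_map_eq_zero]
  intro v hv
  refine Subtype.ext ?_
  change v.1 = 0
  by_contra hne
  obtain ⟨d, hd⟩ := MvPolynomial.support_nonempty.2 hne
  have h1 := congrArg (fun P => Polynomial.coeff P (d 1)) hv
  simp only [coeff_zero] at h1
  rw [dehom_eq_sum, finsetSum_coeff, Finset.sum_eq_single d] at h1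
  · rw [coeff_C_mul_X_pow, if_pos rfl] at h1
    rcases mul_eq_zero.1 h1 with h | h
    · exact MvPolynomial.mem_support_iff.1 hd h
    · exact pow_ne_zero _ (neg_ne_zero.2 one_ne_zero) h
  · intro d' hd' hne'
    rw [coeff_C_mul_X_pow, if_neg]
    intro h
    apply hne'
    have h2 := symV_degree v hd
    have h3 := symV_degree v hd'
    ext i
    fin_cases i
    · simp; omega
    · exact h.symm
  · intro h
    exact absurd hd h

/-- For `r ≤ p - 1`, the elements `(t X + Y) ^ r` with `t ∈ 𝔽_p` span `V_r`. -/
lemma symV_induction {r : ℕ} (hr : r ≤ p - 1) {P : SymV p r → Prop} (h0 : P 0)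
    (hadd : ∀ v w, P v → P w → P (v + w)) (hsmul : ∀ (a : κ) v, P v → P (a • v))
    (hlin : ∀ t : ZMod p, P (symLin r (ofFp t) 1)) (v : SymV p r) :
    P v := by
  have hv : v ∈ span κ
      (Set.range fun t : ZMod p => symLin r (ofFp t) 1) := by
    have h1 := mem_span_X_sub_C_pow hr (natDegree_dehom_le v)
    have h2 : (Set.range fun s : ZMod p => (X - C (ofFp s)) ^ r)
        = dehom p r '' (Set.range fun t : ZMod p =>
          symLin r (ofFp t) 1) := by
      rw [← Set.range_comp]
      congr 1
      funext t
      exact (dehom_symLin_one r _).symm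
    rw [h2, Submodule.span_image] at h1
    obtain ⟨w, hw, e⟩ := h1
    rwa [dehom_injective r e] at hw
  induction hv using Submodule.span_induction with
  | mem x hx => obtain ⟨t, rfl⟩ := hx; exact hlin t
  | zero => exact h0
  | add x y _ _ hx hy => exact hadd x y hx hy
  | smul a x _ hx => exact hsmul a x hx

lemma symRep_apply (r : ℕ) (k : (⊤ : Subgroup (GL2Zp p))) (v : SymV p r) :
    symRep p r k v = symAct p r (redMat p ((k : GL2Zp p) : Matrix (Fin 2) (Fin 2) ℤ_[p])) v := rfl

end SymmetricPowers

section SphericalUniversal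

variable {W : Type*} [AddCommGroup W] [Module κ W]
  {ρ : GL2Rep W} {r : ℕ} {a : κ} {v : W}

lemma X_sub_C_pow_pred (s : κ) :
    (X - C s) ^ (p - 1) = ∑ i ∈ Finset.range p, X ^ i * C s ^ (p - 1 - i) := by
  have hp : p.Prime := Fact.out
  refine mul_right_cancel₀ (X_sub_C_ne_zero s) ?_
  rw [geom_sum₂_mul, ← pow_succ, Nat.sub_add_cancel hp.one_le, sub_pow_char]

/-- The map `s ↦ k_s v` is polynomial of degree at most `r`, with leading coefficient `v`. -/
lemma HeckeVec.exists_matK_eq_sum (h : HeckeVec ρ r a v) (hr : r ≤ p - 1) :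
    ∃ d : ℕ → W, d r = v ∧ ∀ s : ZMod p, ρ (inclK p (matK s)) v
      = ∑ j ∈ Finset.range (r + 1), ofFp s ^ j • d j := by
  have hp : p.Prime := Fact.out
  have hp1 := hp.one_lt
  let Λ : κ[X] →ₗ[κ] W := ∑ u : ZMod p,
    ((LinearMap.id (R := κ) (M := κ)).smulRight (ρ (inclK p (matK u)) v)) ∘ₗ
      Polynomial.leval (ofFp u)
  have hΛ : ∀ P, Λ P = ∑ u : ZMod p,
      P.eval (ofFp u) • ρ (inclK p (matK u)) v := by
    intro P
    simp [Λ]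
  have hlow : ∀ P : κ[X], P.natDegree ≤ p - 1 - r → Λ P = P.coeff (p - 1 - r) • (-v) := by
    intro P hP
    refine linearMap_eq_coeff_smul (by omega) Λ (-v) (fun s => ?_) hP
    rw [hΛ, eq_neg_iff_add_eq_zero, add_comm, ← h.add_sum_matK hr s]
    simp
  refine ⟨fun j => (if j = 0 then Λ 1 else 0) - Λ (X ^ (p - 1 - j)), ?_, fun s => ?_⟩
  · have h1 : Λ (X ^ (p - 1 - r)) = - v := by
      rw [hlow _ (natDegree_X_pow_le _), coeff_X_pow_self, one_smul]
    change (if r = 0 then Λ 1 else 0) - Λ (X ^ (p - 1 - r)) = v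
    rw [h1, sub_neg_eq_add, add_eq_right]
    split_ifs with h0
    · rw [hlow _ (by simp), coeff_one, if_neg (by omega), zero_smul]
    · rfl
  · have h1 : Λ ((X - C (ofFp s)) ^ (p - 1))
        = Λ 1 - ρ (inclK p (matK s)) v := by
      have h2 : ρ (inclK p (matK s)) v = ∑ u : ZMod p, if u = s then ρ (inclK p (matK u)) v
          else 0 := by simp
      rw [h2, hΛ, hΛ, ← Finset.sum_sub_distrib]
      refine Finset.sum_congr rfl fun u _ => ?_
      by_cases hu : u = s
      · simp [hu, show p - 1 ≠ 0 by omega]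
      · have : (ofFp u - ofFp s) ^ (p - 1)
            = 1 := by
          rw [← map_sub, ← map_pow, ZMod.pow_card_sub_one_eq_one (sub_ne_zero.2 hu), map_one]
        simp [hu, this]
    rw [X_sub_C_pow_pred, map_sum, eq_sub_iff_add_eq, ← eq_sub_iff_add_eq'] at h1
    rw [h1, ← Finset.sum_range_reflect]
    have hsub : Finset.range (r + 1) ⊆ Finset.range p := Finset.range_subset_range.2 (by omega)
    have h3 : ∑ j ∈ Finset.range (r + 1), ofFp s ^ j •
        ((if j = 0 then Λ 1 else 0) - Λ (X ^ (p - 1 - j)))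
        = ∑ j ∈ Finset.range p, ofFp s ^ j •
        ((if j = 0 then Λ 1 else 0) - Λ (X ^ (p - 1 - j))) := by
      refine Finset.sum_subset hsub fun j hj hj' => ?_
      rw [Finset.mem_range] at hj hj'
      rw [if_neg (by omega), hlow _ ((natDegree_X_pow_le _).trans (by omega)), coeff_X_pow,
        if_neg (by omega), zero_smul, sub_zero, smul_zero]
    rw [h3]
    have h4 : Λ 1 = ∑ j ∈ Finset.range p, if j = 0 then Λ 1 else 0 := by
      rw [Finset.sum_ite_eq', if_pos (by simp [hp.pos])]
    conv_lhs => rw [h4]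
    rw [← Finset.sum_sub_distrib]
    refine Finset.sum_congr rfl fun j hj => ?_
    rw [Finset.mem_range] at hj
    rw [smul_sub]
    congr 1
    · by_cases hj0 : j = 0 <;> simp [hj0]
    · rw [← C_pow, mul_comm, ← smul_eq_C_mul, map_smul]
      congr 2
      omega

lemma symLin_one_zero_smul (r : ℕ) (c : κ) : symLin r c 0 = c ^ r • symLin r 1 0 := by
  rw [← symLin_smul, mul_one, mul_zero]

/-- The `K`-equivariant map `V_r → W` which sends `X ^ r` to `v`. -/
theorem HeckeVec.exists_symV_map (h : HeckeVec ρ r a v) (hr : r ≤ p - 1) :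
    ∃ j : SymV p r →ₗ[κ] W, j (symLin r 1 0) = v ∧
      (∀ t : ZMod p, j (symLin r (ofFp t) 1) = ρ (inclK p (matK t)) v) ∧
      ∀ (k : GL2Zp p) (w : SymV p r), j (symAct p r (redMat p k) w) = ρ (inclK p k) (j w) := by
  obtain ⟨d, hdr, hd⟩ := h.exists_matK_eq_sum hr
  let L : κ[X] →ₗ[κ] W := ∑ i ∈ Finset.range (r + 1),
    (LinearMap.id (R := κ) (M := κ)).smulRight
      ((((r.choose i : ℕ) : κ)⁻¹ * (-1) ^ (r - i)) • d (r - i)) ∘ₗ Polynomial.lcoeff κ i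
  have hL : ∀ P, L P = ∑ i ∈ Finset.range (r + 1),
      P.coeff i • (((r.choose i : ℕ) : κ)⁻¹ * (-1) ^ (r - i)) • d (r - i) := by
    intro P
    simp [L]
  have hsgn : ∀ n : ℕ, ((-1 : κ) ^ n) * (-1) ^ n = 1 := fun n => by
    rw [← mul_pow]; simp
  have h1 : L (dehom p r (symLin r 1 0)) = v := by
    rw [hL, Finset.sum_eq_single 0]
    · rw [dehom_symLin, C_0, zero_mul, zero_sub, C_1, ← C_1, ← C_neg, ← C_pow, coeff_C_zero,
        Nat.choose_zero_right, Nat.cast_one, inv_one, one_mul, Nat.sub_zero, smul_smul, hsgn,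
        one_smul, hdr]
    · intro i _ hi
      rw [dehom_symLin, C_0, zero_mul, zero_sub, C_1, ← C_1, ← C_neg, ← C_pow, coeff_C, if_neg hi,
        zero_smul]
    · simp
  have h2 : ∀ t : ZMod p, L (dehom p r (symLin r (ofFp t) 1))
      = ρ (inclK p (matK t)) v := by
    intro t
    rw [hL, dehom_symLin_one, hd, ← Finset.sum_range_reflect]
    refine Finset.sum_congr rfl fun i hi => ?_
    rw [Finset.mem_range] at hi
    have hi' : i ≤ r := by omega
    rw [Nat.add_sub_cancel]
    have e : r - (r - i) = i := by omega
    rw [e, smul_smul, sub_eq_add_neg, ← C_neg, coeff_X_add_C_pow, Nat.choose_symm hi']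
    congr 1
    rw [e, neg_pow]
    have := choose_cast_ne_zero hr hi'
    field_simp
    rw [pow_two, hsgn, one_mul]
  have h3 : ∀ k : GL2Zp p, L (dehom p r (symAct p r (redMat p k) (symLin r 1 0)))
      = ρ (inclK p k) v := by
    intro k
    have e : ∀ k : GL2Zp p, symAct p r (redMat p k) (symLin r 1 0)
        = symLin r (toFpbar p (k 0 0)) (toFpbar p (k 1 0)) := by
      intro k
      rw [symAct_symLin]
      simp [redMat]
    rcases mem_iwahori_or_exists_matK k with hk | ⟨t, k', rfl⟩
    · rw [e, toFpbar_eq_zero_iff.2 hk, symLin_one_zero_smul, map_smul, map_smul, h1]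
      exact (h.iwahori ⟨k, hk⟩).symm
    · have hk' : toFpbar p ((k' : GL2Zp p) 1 0) = 0 := toFpbar_eq_zero_iff.2 k'.2
      have e1 : toFpbar p ((matK t * (k' : GL2Zp p)) 0 0)
          = toFpbar p ((k' : GL2Zp p) 0 0) * ofFp t := by
        simp [matK, Matrix.mul_apply, Fin.sum_univ_two, toFpbar_teich, hk', mul_comm]
      have e2 : toFpbar p ((matK t * (k' : GL2Zp p)) 1 0)
          = toFpbar p ((k' : GL2Zp p) 0 0) * 1 := by
        simp [matK, Matrix.mul_apply, Fin.sum_univ_two]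
      rw [e, e1, e2, symLin_smul, map_smul, map_smul, h2, map_mul, map_mul, mul_apply,
        h.iwahori, map_smul]
  refine ⟨L ∘ₗ dehom p r, h1, h2, fun k w => ?_⟩
  induction w using symV_induction hr with
  | h0 => simp
  | hadd v w hv hw => simp only [map_add, hv, hw]
  | hsmul c v hv => simp only [map_smul, hv]
  | hlin t =>
    have e : symLin r (ofFp t) 1
        = symAct p r (redMat p (matK t)) (symLin r 1 0) := by
      rw [symAct_symLin]
      simp [redMat, matK, toFpbar_teich]
    rw [e, ← mul_apply, ← map_mul, ← map_mul, ← val_mul]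
    change L (dehom p r (symAct p r (redMat p ↑(k * matK t)) (symLin r 1 0)))
      = ρ (inclK p k) (L (dehom p r (symAct p r (redMat p (matK t)) (symLin r 1 0))))
    rw [h3, h3, map_mul, map_mul, mul_apply]

end SphericalUniversal

section SphericalUniversal

lemma sum_sub_pow_eq (r : ℕ) (hr : r ≤ p - 1) (x : ZMod p) :
    ∑ t : ZMod p, (x - t) ^ r + (if r = p - 1 then 1 else 0) = 0 := by
  have hp : p.Prime := Fact.out
  have e : ∑ t : ZMod p, (x - t) ^ r = ∑ t : ZMod p, t ^ r :=
    Fintype.sum_equiv (Equiv.subLeft x) _ _ fun _ => rfl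
  rw [e]
  split_ifs with h
  · subst h
    have : ∀ t : ZMod p, t ^ (p - 1) = 1 - if t = 0 then 1 else 0 := by
      intro t
      split_ifs with ht
      · rw [ht, zero_pow (by have := hp.one_lt; omega), sub_self]
      · rw [ZMod.pow_card_sub_one_eq_one ht, sub_zero]
    simp [this]
  · rw [FiniteField.sum_pow_lt_card_sub_one _ _ (by rw [ZMod.card]; omega), add_zero]

lemma neg_one_pow_pred : (-1 : κ) ^ (p - 1) = 1 := by
  have := ZMod.pow_card_sub_one_eq_one (p := p) (a := -1) (neg_ne_zero.2 one_ne_zero)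
  rw [← map_one ofFp, ← map_neg, ← map_pow, this]

lemma sum_symLin_one (r : ℕ) (hr : r ≤ p - 1) :
    ∑ t : ZMod p, symLin r (ofFp t) 1
      + (if r = p - 1 then (1 : κ) else 0) • symLin r 1 0 = 0 := by
  have hp : p.Prime := Fact.out
  refine dehom_injective r ?_
  rw [map_zero]
  refine eq_zero_of_natDegree_lt_of_eval_algebraMap ?_ fun s => ?_
  · have := natDegree_dehom_le (∑ t : ZMod p, symLin r (ofFp t) 1
      + (if r = p - 1 then (1 : κ) else 0) • symLin r 1 0)
    have := hp.one_lt
    omega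
  · rw [map_add, map_sum, map_smul, dehom_symLin]
    simp_rw [dehom_symLin_one]
    rw [eval_add, eval_finsetSum, eval_smul]
    simp only [eval_pow, eval_sub, eval_X, eval_C, C_0, zero_mul, zero_sub, eval_neg, C_1, eval_one]
    have h := congrArg ofFp (sum_sub_pow_eq r hr s)
    rw [map_add, map_sum, map_zero] at h
    refine Eq.trans ?_ h
    congr 1
    · refine Finset.sum_congr rfl fun t _ => ?_
      rw [map_pow, map_sub]
    · split_ifs with h0
      · rw [h0, neg_one_pow_pred]; simp
      · simp

lemma symLin_zero_zero (r : ℕ) :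
    symLin r (0 : κ) 0 = (if r = 0 then (1 : κ) else 0) • symLin r 1 0 := by
  rw [symLin_one_zero_smul, zero_pow_eq]

lemma symLin_zero_eq (c d c' d' : κ) : symLin 0 c d = symLin 0 c' d' :=
  Subtype.ext (by change _ ^ 0 = _ ^ 0; rw [pow_zero, pow_zero])

lemma elem_top_mul_inclK (r : ℕ) (g : GL2Qp p) (k : GL2Zp p) (v : SymV p r) :
    elem (symRep p r) (g * inclK p k) v
      = elem (symRep p r) g (symAct p r (redMat p k) v) :=
  elem_mul_inclK (σ := symRep p r) g ⟨k, trivial⟩ v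

lemma redMat_hecke (t : ZMod p) : redMat p !![1, -teich t; 0, (p : ℤ_[p])]
    = !![1, -ofFp t; 0, 0] := by
  ext i j
  fin_cases i <;> fin_cases j <;> simp [redMat, toFpbar_teich]

lemma redMat_hecke' : redMat p !![(p : ℤ_[p]), 0; 0, 1] = !![0, 0; 0, 1] := by
  ext i j
  fin_cases i <;> fin_cases j <;> simp [redMat]

lemma heckeVec_sphericalQuot {r : ℕ} (hr : r ≤ p - 1) (a : κ) :
    HeckeVec (sphericalQuot p r a) r a
      (Submodule.Quotient.mk (elem (symRep p r) 1 (symLin r 1 0))) := by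
  obtain ⟨E, hE⟩ : ∃ E : GL2Qp p → SymV p r →ₗ[κ]
      (cInd (symRep p r) ⧸ span κ (sphericalRel p r a)),
      ∀ g v, E g v = Submodule.Quotient.mk (elem (symRep p r) g v) :=
    ⟨fun g => (Submodule.mkQ _) ∘ₗ elemL (symRep p r) g, fun _ _ => rfl⟩
  have hg : ∀ g x v, sphericalQuot p r a g (E x v) = E (g * x) v := by
    intro g x v
    rw [hE, hE, cIndQuot_mk_elem]
  have hK : ∀ g (k : GL2Zp p) v, E (g * inclK p k) v = E g (symAct p r (redMat p k) v) := by
    intro g k v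
    rw [hE, hE, elem_top_mul_inclK]
  rw [← hE]
  refine ⟨fun k => ?_, ?_, ?_, ?_⟩
  · have hk : toFpbar p ((k : GL2Zp p) 1 0) = 0 := toFpbar_eq_zero_iff.2 k.2
    rw [hg, mul_one, ← one_mul (inclK p _), hK, symAct_symLin, ← map_smul, ← symLin_one_zero_smul]
    simp [redMat, hk]
  · rw [hg, hE, hE, mul_one, ← one_mul (pScalar p), elem_mul_pScalar]
  · have : ∀ t : ZMod p, sphericalQuot p r a (inclK p (matK t)) (E 1 (symLin r 1 0))
        = E 1 (symLin r (ofFp t) 1) := by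
      intro t
      rw [hg, mul_one, ← one_mul (inclK p _), hK, symAct_symLin]
      simp [redMat, matK, toFpbar_teich]
    simp_rw [this]
    rw [← map_sum, ← map_smul, ← map_add, sum_symLin_one r hr, map_zero]
  · have h0 : (span κ (sphericalRel p r a)).mkQ (heckeT p r 1 (symLin r 1 0)
        - a • elem (symRep p r) 1 (symLin r 1 0)) = 0 :=
      (Submodule.Quotient.mk_eq_zero _).2 (subset_span ⟨1, _, rfl⟩)
    rw [map_sub, map_smul, heckeT, map_add, map_sum, sub_eq_zero] at h0
    simp_rw [hg]
    refine Eq.trans ?_ (h0.trans (by rw [hE]; rfl))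
    congr 1
    · refine Finset.sum_congr rfl fun t _ => ?_
      rw [hE, redMat_hecke, symAct_symLin, mul_one, one_mul]
      simp
    · rw [redMat_hecke', symAct_symLin]
      simp only [Matrix.of_apply, Matrix.cons_val', Matrix.cons_val_zero, Matrix.cons_val_one,
        Matrix.cons_val_fin_one, mul_zero, mul_one, add_zero, one_mul]
      rw [symLin_zero_zero, elem_smul, map_smul]
      by_cases hr0 : r = 0
      · subst hr0
        rw [← matAlpha_mul_matK_zero, hK, symAct_symLin, symLin_zero_eq _ _ 1 0, hE]
        rfl
      · rw [if_neg hr0, zero_smul, zero_smul]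

lemma generates_sphericalQuot {r : ℕ} (hr : r ≤ p - 1) (a : κ) :
    Generates (sphericalQuot p r a)
      (Submodule.Quotient.mk (elem (symRep p r) 1 (symLin r 1 0))) := by
  refine cIndQuot_generates fun g v => ?_
  induction v using symV_induction hr with
  | h0 =>
    have : elem (symRep p r) g 0 = 0 := (elemL (symRep p r) g).map_zero
    rw [this]
    exact zero_mem _
  | hadd v w hv hw =>
    rw [elem_add]
    exact add_mem hv hw
  | hsmul c v hv =>
    rw [elem_smul]
    exact Submodule.smul_mem _ c hv
  | hlin t =>
    have e : symLin r (ofFp t) 1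
        = symAct p r (redMat p (matK t)) (symLin r 1 0) := by
      rw [symAct_symLin]
      simp [redMat, matK, toFpbar_teich]
    refine subset_span ⟨g * inclK p (matK t), ?_⟩
    rw [e, ← elem_top_mul_inclK]
    exact (cIndQuot_mk_elem _ _ _ _ _).trans (by rw [mul_one])

lemma exists_sphericalQuot_lift {r : ℕ} (hr : r ≤ p - 1) {a : κ} {W' : Type*}
    [AddCommGroup W'] [Module κ W'] {ρ' : GL2Rep W'} {v' : W'}
    (h : HeckeVec ρ' r a v') : ∃ f : (sphericalQuot p r a).IntertwiningMap ρ',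
      f (Submodule.Quotient.mk (elem (symRep p r) 1 (symLin r 1 0))) = v' := by
  obtain ⟨j, hj1, hjt, hjK⟩ := h.exists_symV_map hr
  have hrel : ∀ (g : GL2Qp p) (w : SymV p r),
      ∑ t : ZMod p, ρ' (g * matX t) (j (symAct p r (redMat p !![1, -teich t; 0, (p : ℤ_[p])]) w))
        + ρ' (g * matAlpha p) (j (symAct p r (redMat p !![(p : ℤ_[p]), 0; 0, 1]) w))
        = a • ρ' g (j w) := by
    intro g w
    induction w using symV_induction hr with
    | h0 => simp
    | hadd v w hv hw =>
      simp only [map_add, Finset.sum_add_distrib, smul_add]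
      rw [← hv, ← hw]
      abel
    | hsmul c v hv =>
      simp only [map_smul]
      rw [← Finset.smul_sum, ← smul_add, hv, smul_comm]
    | hlin t =>
      have h0 := congrArg (ρ' g) (h.matBeta_add_sum_matX t)
      rw [map_smul, map_add, map_sum, ← hjt] at h0
      rw [← h0, add_comm]
      congr 1
      · have e : symAct p r (redMat p !![(p : ℤ_[p]), 0; 0, 1])
            (symLin r (ofFp t) 1)
            = symAct p r (redMat p (matK 0 : GL2Zp p)) (symLin r 1 0) := by
          rw [redMat_hecke', symAct_symLin, symAct_symLin]
          simp [redMat, matK, toFpbar_teich]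
        rw [e, hjK, hj1, ← mul_apply, ← mul_apply, ← map_mul, ← map_mul,
          mul_assoc, matAlpha_mul_matK_zero]
      · refine Finset.sum_congr rfl fun s _ => ?_
        have e : symAct p r (redMat p !![1, -teich s; 0, (p : ℤ_[p])])
            (symLin r (ofFp t) 1)
            = ofFp (t - s) ^ r • symLin r 1 0 := by
          rw [redMat_hecke, symAct_symLin, ← symLin_one_zero_smul]
          simp [sub_eq_add_neg]
        rw [e, map_smul, hj1, map_smul, map_smul, map_mul, mul_apply]
  obtain ⟨Φ, hΦ⟩ := exists_cIndQuot_lift (σ := symRep p r) (ρ := ρ') (sphericalRel p r a)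
    (sphericalRel_stable r a) j (fun k w => hjK k w)
    (by
      intro w
      induction w using symV_induction hr with
      | h0 => simp
      | hadd v w hv hw => simp only [map_add, hv, hw]
      | hsmul c v hv => simp only [map_smul, hv]
      | hlin t => rw [hjt, h.pScalar_smul])
    (by
      rintro L hL f ⟨g, w, rfl⟩
      rw [map_sub, map_smul, heckeT, map_add, map_sum, hL, hL, sub_eq_zero, ← hrel]
      simp_rw [hL])
  exact ⟨Φ, (hΦ _).trans hj1⟩

theorem isUniversal_sphericalQuot {r : ℕ} (hr : r ≤ p - 1) (a : κ) :
    IsUniversal (sphericalQuot p r a) r a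
      (Submodule.Quotient.mk (elem (symRep p r) 1 (symLin r 1 0))) :=
  ⟨heckeVec_sphericalQuot hr a, generates_sphericalQuot hr a, exists_sphericalQuot_lift hr⟩

lemma IsUniversal.nonempty_equiv {W W' : Type} [AddCommGroup W] [Module κ W]
    [AddCommGroup W'] [Module κ W'] {ρ : GL2Rep W}
    {ρ' : GL2Rep W'} {r : ℕ} {a : κ} {v : W} {v' : W'}
    (h : IsUniversal ρ r a v) (h' : IsUniversal ρ' r a v') : Nonempty (ρ.Equiv ρ') := by
  obtain ⟨f, hf⟩ := h.exists_lift h'.heckeVec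
  obtain ⟨f', hf'⟩ := h'.exists_lift h.heckeVec
  exact nonempty_equiv_of_generates h.generates h'.generates f f' one_ne_zero one_ne_zero
    (by rw [hf, hf', one_smul]) (by rw [hf', hf, one_smul])

lemma equiv_twist {G V V' : Type*} [Group G] [AddCommGroup V] [Module κ V]
    [AddCommGroup V'] [Module κ V'] {ρ : Representation κ G V}
    {ρ' : Representation κ G V'} (h : Nonempty (ρ.Equiv ρ')) (χ : G →* κˣ) :
    Nonempty ((twist ρ χ).Equiv (twist ρ' χ)) := by
  obtain ⟨e⟩ := h
  refine ⟨Representation.Equiv.mk e.toLinearEquiv fun g => LinearMap.ext fun v => ?_⟩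
  change e ((χ g : κ) • ρ g v) = (χ g : κ) • ρ' g (e v)
  rw [map_smul]
  congr 1
  exact Representation.IntertwiningMap.isIntertwining _ _ e.toIntertwiningMap g v

/-- Iwahori and spherical induction give the same representations. -/
theorem nonempty_iwahoriPi_equiv_sphericalPi {r : ℕ} (hr : r ≤ p - 1) (a : κ)
    (η : QpChar) : Nonempty ((iwahoriPi p r a η).Equiv (sphericalPi p r a η)) :=
  equiv_twist ((isUniversal_iwahoriQuot r a).nonempty_equiv
    (isUniversal_sphericalQuot hr a)) _

end SphericalUniversal

section Characters

/-- The inclusion of `ℤ_pˣ` in `ℚ_pˣ`. -/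
def unitQ (p : ℕ) [Fact p.Prime] : ℤ_[p]ˣ →* ℚ_[p]ˣ :=
  Units.map (algebraMap ℤ_[p] ℚ_[p]).toMonoidHom

@[simp] lemma coe_unitQ (u : ℤ_[p]ˣ) : ((unitQ p u : ℚ_[p]ˣ) : ℚ_[p]) = ((u : ℤ_[p]) : ℚ_[p]) := rfl

@[simp] lemma coe_pUnit : ((pUnit p : ℚ_[p]ˣ) : ℚ_[p]) = p := rfl

lemma valuation_unitQ (u : ℤ_[p]ˣ) : ((unitQ p u : ℚ_[p]ˣ) : ℚ_[p]).valuation = 0 := by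
  have h : ‖((unitQ p u : ℚ_[p]ˣ) : ℚ_[p])‖ = 1 := by
    rw [coe_unitQ, PadicInt.padic_norm_e_of_padicInt]
    exact PadicInt.norm_units u
  rw [Padic.norm_eq_zpow_neg_valuation (Units.ne_zero _)] at h
  have hp : (1 : ℝ) < p := by exact_mod_cast (Fact.out : p.Prime).one_lt
  have := (zpow_eq_one_iff_right₀ (by linarith) hp.ne').1 h
  omega

/-- Every element of `ℚ_pˣ` is a power of `p` times a unit. -/
lemma eq_pUnit_zpow_mul (x : ℚ_[p]ˣ) :
    x = pUnit p ^ (x : ℚ_[p]).valuation * unitQ p (unitPart p x) := by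
  refine Units.ext ?_
  have h : ((unitPart p x : ℤ_[p]) : ℚ_[p]) = (x : ℚ_[p]) * (p : ℚ_[p]) ^ (-(x : ℚ_[p]).valuation) :=
    rfl
  rw [val_mul, coe_unitQ, h, Units.val_zpow_eq_zpow_val, coe_pUnit, zpow_neg]
  have := zpow_ne_zero (x : ℚ_[p]).valuation (padic_p_ne_zero (p := p))
  field_simp

lemma char_ext {A : Type*} [Group A] {χ χ' : ℚ_[p]ˣ →* A} (hp : χ (pUnit p) = χ' (pUnit p))
    (hu : ∀ u, χ (unitQ p u) = χ' (unitQ p u)) : χ = χ' := by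
  ext1 x
  rw [eq_pUnit_zpow_mul x, map_mul, map_mul, map_zpow, map_zpow, hp, hu]

lemma unitPart_unitQ (u : ℤ_[p]ˣ) : unitPart p (unitQ p u) = u := by
  refine Units.ext (Subtype.ext ?_)
  change ((unitQ p u : ℚ_[p]ˣ) : ℚ_[p]) * (p : ℚ_[p]) ^ (-((unitQ p u : ℚ_[p]ˣ) : ℚ_[p]).valuation)
    = _
  rw [valuation_unitQ, neg_zero, zpow_zero, mul_one]
  rfl

lemma unitPart_pUnit : unitPart p (pUnit p) = 1 := by
  refine Units.ext (Subtype.ext ?_)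
  change ((pUnit p : ℚ_[p]ˣ) : ℚ_[p]) * (p : ℚ_[p]) ^ (-((pUnit p : ℚ_[p]ˣ) : ℚ_[p]).valuation) = 1
  rw [coe_pUnit, Padic.valuation_p, zpow_neg, zpow_one, mul_inv_cancel₀ padic_p_ne_zero]

lemma omegaQp_unitQ (u : ℤ_[p]ˣ) : (omegaQp p (unitQ p u) : κ) = toFpbar p u := by
  change toFpbar p (unitPart p (unitQ p u) : ℤ_[p]ˣ) = _
  rw [unitPart_unitQ]

lemma omegaQp_pUnit : omegaQp p (pUnit p) = 1 := by
  rw [omegaQp, comp_apply, unitPart_pUnit, map_one]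

/-- The unramified character `x ↦ a ^ val(x)` of `ℚ_pˣ`. -/
def unrQp (a : κˣ) : QpChar where
  toFun x := a ^ (x : ℚ_[p]).valuation
  map_one' := by simp
  map_mul' x y := by rw [val_mul, Padic.valuation_mul x.ne_zero y.ne_zero, zpow_add]

@[simp] lemma unrQp_unitQ (a : κˣ) (u : ℤ_[p]ˣ) : unrQp a (unitQ p u) = 1 := by
  change a ^ ((unitQ p u : ℚ_[p]ˣ) : ℚ_[p]).valuation = 1
  rw [valuation_unitQ, zpow_zero]

@[simp] lemma unrQp_pUnit (a : κˣ) : unrQp a (pUnit p) = a := by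
  change a ^ ((pUnit p : ℚ_[p]ˣ) : ℚ_[p]).valuation = a
  rw [coe_pUnit, Padic.valuation_p, zpow_one]

lemma det_inclK (k : GL2Zp p) :
    det (inclK p k) = unitQ p (det k) :=
  Matrix.GeneralLinearGroup.map_det _ _

lemma det_matK (t : ZMod p) : det (matK t) = -1 :=
  Units.ext (by simp [matK])

lemma det_matX (t : ZMod p) : det (matX t) = pUnit p :=
  Units.ext (by simp [matX])

lemma det_matF : det (matF p) = pUnit p :=
  Units.ext (by simp [matF])

lemma det_uni (b : ℚ_[p]) : det (uni b) = 1 :=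
  Units.ext (by simp [uni])

lemma det_matBeta : det (matBeta p) = unitQ p (-1) * pUnit p :=
  Units.ext (by simp [matBeta])

lemma det_pScalar : det (pScalar p) = pUnit p * pUnit p :=
  Units.ext (by
    rw [Matrix.GeneralLinearGroup.val_det_apply, coe_pScalar]
    simp)

lemma toFpbar_det_iwahori (k : iwahori p) :
    toFpbar p ((det (k : GL2Zp p) : ℤ_[p]ˣ) : ℤ_[p])
      = toFpbar p ((k : GL2Zp p) 0 0) * toFpbar p ((k : GL2Zp p) 1 1) := by
  have hk : toFpbar p ((k : GL2Zp p) 1 0) = 0 := toFpbar_eq_zero_iff.2 k.2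
  rw [Matrix.GeneralLinearGroup.val_det_apply, Matrix.det_fin_two, map_sub, map_mul, map_mul, hk,
    mul_zero, sub_zero]

lemma toFpbar_pow_pred (k : iwahori p) : toFpbar p ((k : GL2Zp p) 0 0) ^ (p - 1) = 1 := by
  have h2 : toFpbar p ((det (k : GL2Zp p) : ℤ_[p]ˣ) : ℤ_[p]) ≠ 0 :=
    ((Units.isUnit _).map (toFpbar p)).ne_zero
  rw [toFpbar_det_iwahori] at h2
  have h3 := fun h0 => left_ne_zero_of_mul h2 (toFpbar_eq_zero_iff.2 h0)
  rw [toFpbar, RingHom.comp_apply, ← map_pow, ZMod.pow_card_sub_one_eq_one h3, map_one]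

end Characters

section Twists

variable {W : Type*} [AddCommGroup W] [Module κ W]
  {ρ : GL2Rep W} {r : ℕ} {a : κ} {v : W}

lemma twist_apply {G : Type*} [Group G] (ρ : Representation κ G W) (χ : G →* κˣ)
    (g : G) (w : W) : twist ρ χ g w = (χ g : κ) • ρ g w := rfl

lemma twist_twist {G : Type*} [Group G] (ρ : Representation κ G W)
    (χ χ' : G →* κˣ) : twist (twist ρ χ) χ' = twist ρ (χ * χ') := by
  refine MonoidHom.ext fun g => LinearMap.ext fun w => ?_
  change (χ' g : κ) • (χ g : κ) • ρ g w = ((χ g * χ' g : κˣ) : κ) • ρ g w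
  rw [smul_smul, val_mul, mul_comm]

lemma twist_one {G : Type*} [Group G] (ρ : Representation κ G W) : twist ρ 1 = ρ := by
  refine MonoidHom.ext fun g => LinearMap.ext fun w => ?_
  change ((1 : κˣ) : κ) • ρ g w = ρ g w
  rw [val_one, one_smul]

/-- Twisting by an unramified character with values `±1`. -/
lemma HeckeVec.twist_unramified (h : HeckeVec ρ r a v) {χ : QpChar}
    (hu : ∀ u, χ (unitQ p u) = 1) (hp : χ (pUnit p) * χ (pUnit p) = 1) :
    HeckeVec (twist ρ (χ.comp det)) r (χ (pUnit p) * a) v where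
  iwahori k := by
    rw [twist_apply, comp_apply, det_inclK, hu, val_one, one_smul, h.iwahori]
  pScalar := by
    rw [twist_apply, comp_apply, det_pScalar, map_mul, hp, val_one, one_smul,
      h.pScalar]
  sum_matK := by
    simp only [twist_apply, comp_apply, det_inclK, hu, val_one, one_smul]
    exact h.sum_matK
  sum_matX := by
    simp only [twist_apply, comp_apply, det_matX, det_matBeta, map_mul, hu, one_mul]
    rw [← Finset.smul_sum, smul_comm, ← smul_add, h.sum_matX, mul_smul]

/-- If `v` satisfies the relations of `π(r, 0, 1)`, then `β v` satisfies, after a twist, those of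
`π(p - 1 - r, 0, 1)`. -/
lemma HeckeVec.matBeta_twist (h : HeckeVec ρ r 0 v) (hr : r ≤ p - 1) {χ : QpChar}
    (hu : ∀ u, (χ (unitQ p u) : κ) * toFpbar p u ^ r = 1)
    (hp : χ (pUnit p) * χ (pUnit p) = 1) :
    HeckeVec (twist ρ (χ.comp det)) (p - 1 - r) 0 (ρ (matBeta p) v) := by
  have hp2 := (Fact.out : p.Prime).two_le
  have hm1 : r = 0 ∨ r = p - 1 → (χ (unitQ p (-1)) : κ) = 1 := by
    intro hr0
    have := hu (-1)
    rw [Units.val_neg, val_one, map_neg, map_one] at this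
    rcases hr0 with rfl | rfl
    · simpa using this
    · rwa [neg_one_pow_pred, mul_one] at this
  refine ⟨fun k => ?_, ?_, ?_, ?_⟩
  · rw [twist_apply, comp_apply, det_inclK, h.iwahori_matBeta, smul_smul]
    congr 1
    have h1 := hu (det (k : GL2Zp p))
    rw [toFpbar_det_iwahori, mul_pow] at h1
    have h3 := toFpbar_pow_pred k
    have hne : toFpbar p ((k : GL2Zp p) 0 0) ≠ 0 := fun h0 => by
      rw [h0, zero_pow (by omega)] at h3
      exact zero_ne_one h3
    refine mul_right_cancel₀ (pow_ne_zero r hne) ?_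
    rw [← pow_add, Nat.sub_add_cancel hr, h3, ← h1]
    ring
  · rw [twist_apply, comp_apply, det_pScalar, map_mul, hp, val_one, one_smul,
      h.pScalar_smul]
  · simp only [twist_apply, comp_apply, det_inclK, det_matK]
    simp_rw [← mul_apply, ← map_mul, ← matX_eq]
    rw [← Finset.smul_sum]
    have h0 := h.sum_matX
    rw [zero_smul] at h0
    by_cases hr0 : r = 0
    · rw [hm1 (Or.inl hr0), one_smul, ← h0]
      congr 2
      simp [hr0]
    · rw [if_neg hr0, zero_smul, add_zero] at h0
      rw [h0, if_neg (by omega), smul_zero, zero_smul, zero_add]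
  · simp only [twist_apply, comp_apply, det_matX, det_matBeta, map_mul]
    simp_rw [h.matX_matBeta]
    rw [h.matBeta_matBeta, ← Finset.smul_sum, zero_smul]
    have h0 := h.sum_matK
    by_cases hr0 : r = p - 1
    · rw [if_pos (by omega), one_smul, val_mul, hm1 (Or.inr hr0), one_mul, ← smul_add]
      rw [if_pos hr0, one_smul] at h0
      rw [h0, smul_zero]
    · rw [if_neg hr0, zero_smul, add_zero] at h0
      rw [h0, if_neg (by omega), smul_zero, zero_smul, zero_add]

lemma HeckeVec.iwahori_trivial (h : HeckeVec ρ r a v) (hr : r = 0 ∨ r = p - 1)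
    (k : ModPLLC.iwahori p) :
    ρ (inclK p k) v = v := by
  have h1 : toFpbar p ((k : GL2Zp p) 0 0) ^ r = 1 := by
    rcases hr with rfl | rfl
    · exact pow_zero _
    · exact toFpbar_pow_pred k
  rw [h.iwahori, h1, one_smul]

lemma HeckeVec.iwahori_matBeta_trivial (h : HeckeVec ρ r a v) (hr : r = 0 ∨ r = p - 1)
    (k : ModPLLC.iwahori p) : ρ (inclK p k) (ρ (matBeta p) v) = ρ (matBeta p) v := by
  obtain ⟨k', h1, -, -⟩ := exists_iwahori_mul_matBeta k
  rw [← mul_apply, ← map_mul, h1, map_mul, mul_apply, h.iwahori_trivial hr]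

/-- The vector `a v - β v` satisfies the relations for `p - 1` if `v` satisfies those for `0`. -/
lemma HeckeVec.sub_matBeta (h : HeckeVec ρ 0 a v) :
    HeckeVec ρ (p - 1) a (a • v - ρ (matBeta p) v) := by
  have hp2 := (Fact.out : p.Prime).two_le
  have h0 := h.sum_matK
  rw [if_neg (by omega), zero_smul, add_zero] at h0
  have h1 := h.sum_matX
  rw [if_pos rfl, one_smul] at h1
  refine ⟨fun k => ?_, ?_, ?_, ?_⟩
  · rw [toFpbar_pow_pred, one_smul, map_sub, map_smul, h.iwahori_trivial (Or.inl rfl),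
      h.iwahori_matBeta_trivial (Or.inl rfl)]
  · rw [map_sub, map_smul, h.pScalar, h.pScalar_smul]
  · simp_rw [map_sub, map_smul, matK_matBeta_apply]
    rw [Finset.sum_sub_distrib, ← Finset.smul_sum, h0, smul_zero, if_pos trivial, one_smul, ← h1]
    abel
  · simp_rw [map_sub, map_smul, h.matX_matBeta]
    rw [Finset.sum_sub_distrib, ← Finset.smul_sum, h0, if_neg (by omega), zero_smul, add_zero,
      sub_zero, ← h1, add_sub_cancel_right]

/-- The vector `a v + β v` satisfies the relations for `0` if `v` satisfies those for `p - 1`. -/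
lemma HeckeVec.add_matBeta (h : HeckeVec ρ (p - 1) a v) :
    HeckeVec ρ 0 a (a • v + ρ (matBeta p) v) := by
  have hp2 := (Fact.out : p.Prime).two_le
  have h0 := h.sum_matK
  rw [if_pos rfl, one_smul] at h0
  have h1 := h.sum_matX
  rw [if_neg (by omega), zero_smul, add_zero] at h1
  refine ⟨fun k => ?_, ?_, ?_, ?_⟩
  · rw [pow_zero, one_smul, map_add, map_smul, h.iwahori_trivial (Or.inr rfl),
      h.iwahori_matBeta_trivial (Or.inr rfl)]
  · rw [map_add, map_smul, h.pScalar, h.pScalar_smul]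
  · simp_rw [map_add, map_smul, matK_matBeta_apply]
    rw [Finset.sum_add_distrib, ← Finset.smul_sum, h1, if_neg (by omega), zero_smul, add_zero,
      ← smul_add, h0, smul_zero]
  · simp_rw [map_add, map_smul, h.matX_matBeta]
    rw [Finset.sum_add_distrib, ← Finset.smul_sum, h1, if_pos trivial, one_smul, h.matBeta_matBeta,
      smul_add, ← add_zero (a • a • v + a • ρ (matBeta p) v), ← h0]
    abel

end Twists

section Isomorphisms

variable {W W' : Type} [AddCommGroup W] [Module κ W]
  [AddCommGroup W'] [Module κ W'] {ρ : GL2Rep W}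
  {ρ' : GL2Rep W'} {r r' : ℕ} {a a' : κ} {v : W} {v' : W'}

lemma Generates.twist (hv : Generates ρ v) (χ : GL2Qp p →* κˣ) :
    Generates (twist ρ χ) v := by
  rw [Generates, eq_top_iff, ← hv, span_le]
  rintro _ ⟨g, rfl⟩
  have : ρ g v = ((χ g)⁻¹ : κˣ) • ModPLLC.twist ρ χ g v := by
    rw [twist_apply, Units.smul_def, smul_smul, ← val_mul, inv_mul_cancel, val_one,
      one_smul]
  change ρ g v ∈ _
  rw [this]
  exact Submodule.smul_mem _ _ (subset_span ⟨g, rfl⟩)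

/-- An intertwining map to a twist, viewed as an intertwining map from a twist. -/
def intertwiningMapUntwist (χ : GL2Qp p →* κˣ) (f : ρ.IntertwiningMap (twist ρ' χ⁻¹)) :
    (twist ρ χ).IntertwiningMap ρ' where
  toLinearMap := f.toLinearMap
  isIntertwining' g := by
    refine LinearMap.ext fun w => ?_
    change f ((χ g : κ) • ρ g w) = ρ' g (f w)
    rw [map_smul, f.isIntertwining, twist_apply, smul_smul, ← val_mul, inv_apply,
      mul_inv_cancel, val_one, one_smul]

lemma IsUniversal.equiv_twist (h : IsUniversal ρ r a v) (h' : IsUniversal ρ' r' a' v')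
    (χ : GL2Qp p →* κˣ) (g : GL2Qp p) (hg : ρ g (ρ g v) = v) (hg' : ρ' g (ρ' g v') = v')
    (hw : HeckeVec (twist ρ χ) r' a' (ρ g v)) (hw' : HeckeVec (twist ρ' χ⁻¹) r a (ρ' g v')) :
    Nonempty (ρ'.Equiv (twist ρ χ)) := by
  obtain ⟨f, hf⟩ := h'.exists_lift hw
  obtain ⟨f', hf'⟩ := h.exists_lift hw'
  have hf'' : ∀ w, intertwiningMapUntwist χ f' w = f' w := fun _ => rfl
  refine nonempty_equiv_of_generates h'.generates (h.generates.twist χ) f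
    (intertwiningMapUntwist χ f') (Units.ne_zero (χ g)⁻¹) (Units.ne_zero (χ g)) ?_ ?_
  · rw [hf, hf'', f'.isIntertwining, hf', twist_apply, hg', inv_apply]
  · rw [hf'', hf', f.isIntertwining, hf, twist_apply, hg]

lemma equiv_symm {G V V' : Type*} [Group G] [AddCommGroup V] [Module κ V]
    [AddCommGroup V'] [Module κ V'] {σ : Representation κ G V}
    {σ' : Representation κ G V'} (h : Nonempty (σ.Equiv σ')) : Nonempty (σ'.Equiv σ) :=
  h.map fun e => e.symm

lemma equiv_trans {G V V' V'' : Type*} [Group G] [AddCommGroup V] [Module κ V]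
    [AddCommGroup V'] [Module κ V'] [AddCommGroup V''] [Module κ V'']
    {σ : Representation κ G V} {σ' : Representation κ G V'}
    {σ'' : Representation κ G V''} (h : Nonempty (σ.Equiv σ'))
    (h' : Nonempty (σ'.Equiv σ'')) : Nonempty (σ.Equiv σ'') :=
  h.elim fun e => h'.map fun e' => e.trans e'

lemma iwahoriPi_eq_twist (r : ℕ) (a : κ) (η : QpChar) :
    iwahoriPi p r a η = twist (iwahoriQuot p r a) (η.comp det) := rfl

theorem nonempty_iwahoriPi_equiv_unramified (r : ℕ) (a : κ) (η χ : QpChar)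
    (hu : ∀ u, χ (unitQ p u) = 1) (hp : χ (pUnit p) * χ (pUnit p) = 1) :
    Nonempty ((iwahoriPi p r a η).Equiv (iwahoriPi p r (χ (pUnit p) * a) (η * χ))) := by
  have h := isUniversal_iwahoriQuot r a
  have h' := isUniversal_iwahoriQuot r ((χ (pUnit p) : κ) * a)
  have hinv : (χ.comp (det (n := Fin 2)))⁻¹
      = χ⁻¹.comp det := rfl
  have h2 := h'.heckeVec.twist_unramified (χ := χ⁻¹) (fun u => by rw [inv_apply, hu, inv_one])
    (by rw [inv_apply, ← mul_inv, hp, inv_one])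
  rw [← mul_assoc, ← val_mul, inv_apply, inv_mul_cancel, val_one,
    one_mul] at h2
  have h3 := h.equiv_twist h' (χ.comp det) 1 (by simp) (by simp)
    (by simpa using h.heckeVec.twist_unramified hu hp) (by
      rw [hinv, map_one, Module.End.one_apply]
      exact h2)
  have h4 := equiv_twist h3 ((η * χ).comp det)
  rw [twist_twist] at h4
  have e : χ.comp (det (n := Fin 2)) *
      (η * χ).comp det = η.comp det := by
    ext1 g
    simp only [MonoidHom.mul_apply, comp_apply]
    rw [mul_left_comm, ← MonoidHom.mul_apply χ χ]
    have : χ * χ = 1 := char_ext (by simpa using hp) (by simp [hu])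
    rw [this, MonoidHom.one_apply, mul_one]
  rw [e] at h4
  exact equiv_symm h4

theorem nonempty_iwahoriPi_equiv_swap {r : ℕ} (hr : r ≤ p - 1) (η χ : QpChar)
    (hu : ∀ u, (χ (unitQ p u) : κ) = toFpbar p u ^ r)
    (hp : χ (pUnit p) * χ (pUnit p) = 1) :
    Nonempty ((iwahoriPi p r 0 η).Equiv (iwahoriPi p (p - 1 - r) 0 (η * χ))) := by
  have h := isUniversal_iwahoriQuot (p := p) r 0
  have h' := isUniversal_iwahoriQuot (p := p) (p - 1 - r) 0
  have h1 := h.heckeVec.matBeta_twist hr (χ := χ⁻¹)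
    (fun u => by rw [inv_apply, ← hu, ← val_mul, inv_mul_cancel, val_one])
    (by rw [inv_apply, ← mul_inv, hp, inv_one])
  have h2 := h'.heckeVec.matBeta_twist (Nat.sub_le _ _) (χ := χ)
    (fun u => by
      rw [hu, ← pow_add, Nat.add_sub_cancel' hr, toFpbar, RingHom.comp_apply, ← map_pow,
        ZMod.pow_card_sub_one_eq_one, map_one]
      exact fun h0 => isUnit_iff_toZMod_ne_zero.1 u.isUnit h0) hp
  rw [Nat.sub_sub_self hr] at h2
  have h3 := h.equiv_twist h' (χ⁻¹.comp det) (matBeta p)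
    h.heckeVec.matBeta_matBeta h'.heckeVec.matBeta_matBeta h1 (by
      have hinv : (χ⁻¹.comp (det (n := Fin 2)))⁻¹
          = χ.comp det := by
        ext1 g; simp
      rw [hinv]
      exact h2)
  have h4 := equiv_twist h3 ((η * χ).comp det)
  rw [twist_twist] at h4
  have e : χ⁻¹.comp (det (n := Fin 2)) *
      (η * χ).comp det = η.comp det := by
    ext1 g
    simp [mul_comm]
  rw [e] at h4
  exact equiv_symm h4

theorem nonempty_iwahoriPi_zero_equiv {a : κ} (ha : a * a ≠ 1)
    (η : QpChar) :
    Nonempty ((iwahoriPi p 0 a η).Equiv (iwahoriPi p (p - 1) a η)) := by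
  have h := isUniversal_iwahoriQuot (p := p) 0 a
  have h' := isUniversal_iwahoriQuot (p := p) (p - 1) a
  obtain ⟨f, hf⟩ := h.exists_lift h'.heckeVec.add_matBeta
  obtain ⟨f', hf'⟩ := h'.exists_lift h.heckeVec.sub_matBeta
  refine equiv_twist (nonempty_equiv_of_generates h.generates h'.generates f f'
    (sub_ne_zero.2 ha) (sub_ne_zero.2 ha) ?_ ?_) _
  · rw [hf, map_add, map_smul, f'.isIntertwining, hf', map_sub, map_smul,
      h.heckeVec.matBeta_matBeta, smul_sub, sub_smul, mul_smul, one_smul]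
    abel
  · rw [hf', map_sub, map_smul, f.isIntertwining, hf, map_add, map_smul,
      h'.heckeVec.matBeta_matBeta, smul_add, sub_smul, mul_smul, one_smul]
    abel

end Isomorphisms

section NilpotentTowers

variable {k W ι : Type*} [Field k] [AddCommGroup W] [Module k W]

/-- If the vectors `Y ^ d i (u i) = v i` are linearly independent and killed by `Y`, then they span
the kernel of `Y` on the span of the vectors `Y ^ j (u i)`. -/
theorem mem_span_of_mem_ker [Fintype ι] {Y : Module.End k W} {u v : ι → W} {d : ι → ℕ}
    (huv : ∀ i, (Y ^ d i) (u i) = v i) (hv : ∀ i, Y (v i) = 0) (hli : LinearIndependent k v)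
    {x : W} (hx : x ∈ span k {w | ∃ i j, w = (Y ^ j) (u i)}) (hYx : Y x = 0) :
    x ∈ span k (Set.range v) := by
  have hzero : ∀ i m, d i < m → (Y ^ m) (u i) = 0 := by
    intro i m hm
    obtain ⟨l, rfl⟩ := Nat.exists_eq_add_of_lt hm
    rw [show d i + l + 1 = l + 1 + d i by omega, pow_add, mul_apply, huv, pow_succ,
      mul_apply, hv, map_zero]
  have key : ∀ h : ℕ, ∀ y ∈ span k {w | ∃ i j, d i ≤ j + h ∧ w = (Y ^ j) (u i)},
      Y y = 0 → y ∈ span k (Set.range v) := by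
    intro h
    induction h with
    | zero =>
      intro y hy _
      refine (span_le.2 ?_) hy
      rintro _ ⟨i, j, hj, rfl⟩
      rcases hj.lt_or_eq with hj | hj
      · change _ ∈ span k _
        rw [hzero i j hj]
        exact zero_mem _
      · have hj : d i = j := hj
        rw [← hj, huv]
        exact subset_span ⟨i, rfl⟩
    | succ h ih =>
      intro y hy hYy
      have hdec : ∃ c : ι → k, (∀ i, d i < h + 1 → c i = 0) ∧
          y - ∑ i, c i • (Y ^ (d i - (h + 1))) (u i) ∈
            span k {w | ∃ i j, d i ≤ j + h ∧ w = (Y ^ j) (u i)} := by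
        clear hYy
        induction hy using Submodule.span_induction with
        | mem y hy =>
          classical
          obtain ⟨i, j, hj, rfl⟩ := hy
          by_cases hj' : d i ≤ j + h
          · refine ⟨0, fun _ _ => rfl, ?_⟩
            have hmem : (Y ^ j) (u i) ∈ {w | ∃ i j, d i ≤ j + h ∧ w = (Y ^ j) (u i)} :=
              ⟨i, j, hj', rfl⟩
            simpa using subset_span hmem
          · refine ⟨Pi.single i 1, fun i' hi' => ?_, ?_⟩
            · rw [Pi.single_eq_of_ne]
              rintro rfl
              omega
            · rw [Finset.sum_eq_single i]
              · rw [Pi.single_eq_same, one_smul, show d i - (h + 1) = j by omega, sub_self]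
                exact zero_mem _
              · intro i' _ hi'
                rw [Pi.single_eq_of_ne hi', zero_smul]
              · simp
        | zero => exact ⟨0, fun _ _ => rfl, by simp⟩
        | add y z _ _ hy hz =>
          obtain ⟨c, hc, hy⟩ := hy
          obtain ⟨c', hc', hz⟩ := hz
          refine ⟨c + c', fun i hi => by simp [hc i hi, hc' i hi], ?_⟩
          have := add_mem hy hz
          simp only [Pi.add_apply, add_smul, Finset.sum_add_distrib]
          convert this using 1
          abel
        | smul a y _ hy =>
          obtain ⟨c, hc, hy⟩ := hy
          refine ⟨a • c, fun i hi => by simp [hc i hi], ?_⟩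
          have := Submodule.smul_mem _ a hy
          rw [smul_sub, Finset.smul_sum] at this
          simpa [mul_smul] using this
      obtain ⟨c, hc, hz⟩ := hdec
      have h1 : (Y ^ (h + 1)) (y - ∑ i, c i • (Y ^ (d i - (h + 1))) (u i)) = 0 := by
        generalize y - ∑ i, c i • (Y ^ (d i - (h + 1))) (u i) = z at hz
        have : span k {w | ∃ i j, d i ≤ j + h ∧ w = (Y ^ j) (u i)}
            ≤ LinearMap.ker (Y ^ (h + 1)) := by
          refine span_le.2 ?_
          rintro _ ⟨i, j, hj, rfl⟩
          change (Y ^ (h + 1)) ((Y ^ j) (u i)) = 0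
          rw [← mul_apply, ← pow_add]
          exact hzero i _ (by omega)
        exact this hz
      rw [map_sub, map_sum, pow_succ, mul_apply, hYy, map_zero, zero_sub,
        neg_eq_zero] at h1
      have h2 : ∑ i, c i • v i = 0 := by
        rw [← h1]
        refine Finset.sum_congr rfl fun i _ => ?_
        by_cases hi : d i < h + 1
        · rw [hc i hi, zero_smul, zero_smul, map_zero]
        · rw [← pow_succ, map_smul, ← mul_apply, ← pow_add,
            show h + 1 + (d i - (h + 1)) = d i by omega, huv]
      have h3 := Fintype.linearIndependent_iff.1 hli c h2
      refine ih y ?_ hYy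
      simpa [h3] using hz
  obtain ⟨h, hh⟩ : ∃ h, ∀ i, d i ≤ h :=
    ⟨∑ i, d i, fun i => Finset.single_le_sum (fun _ _ => Nat.zero_le _) (Finset.mem_univ i)⟩
  refine key h x ?_ hYx
  refine Submodule.span_mono ?_ hx
  rintro _ ⟨i, j, rfl⟩
  exact ⟨i, j, (hh i).trans (by omega), rfl⟩

/-- Vectors `v i` killed by `Y` which are permuted, up to scalars, by the operators `Y ^ e i * F`,
where `F Y = Y ^ q F`. -/
structure IsTower (q : ℕ) (Y F : Module.End k W) (v : ι → W) : Prop where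
  commute : F * Y = Y ^ q * F
  ker : ∀ i, Y (v i) = 0
  linearIndependent : LinearIndependent k v
  step : ∃ (σ : Equiv.Perm ι) (e : ι → ℕ) (c : ι → k), (∀ i, c i ≠ 0) ∧
    ∀ i, (Y ^ e i) (F (v i)) = c i • v (σ i)

/-- The span of the vectors `Y ^ j F ^ n v`. -/
def towerSpan (Y F : Module.End k W) (v : ι → W) : Submodule k W :=
  span k {w | ∃ i j n, w = (Y ^ j) ((F ^ n) (v i))}

namespace IsTower

variable {q : ℕ} {Y F : Module.End k W} {v : ι → W}

lemma pow_commute (h : F * Y = Y ^ q * F) (n j : ℕ) : F ^ n * Y ^ j = Y ^ (q ^ n * j) * F ^ n := by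
  have h1 : ∀ j, F * Y ^ j = Y ^ (q * j) * F := by
    intro j
    induction j with
    | zero => simp
    | succ j ih => rw [pow_succ, ← mul_assoc, ih, mul_assoc, h, ← mul_assoc, ← pow_add]; rfl
  induction n generalizing j with
  | zero => simp
  | succ n ih => rw [pow_succ', mul_assoc, ih, ← mul_assoc, h1, mul_assoc, pow_succ', mul_assoc]

lemma Y_mem {x : W} (hx : x ∈ towerSpan Y F v) : Y x ∈ towerSpan Y F v := by
  have : towerSpan Y F v ≤ (towerSpan Y F v).comap Y := by
    refine span_le.2 ?_
    rintro _ ⟨i, j, n, rfl⟩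
    refine subset_span ⟨i, j + 1, n, ?_⟩
    rw [pow_succ', mul_apply]
  exact this hx

lemma Y_pow_mem {x : W} (hx : x ∈ towerSpan Y F v) (n : ℕ) : (Y ^ n) x ∈ towerSpan Y F v := by
  induction n with
  | zero => exact hx
  | succ n ih => rw [pow_succ', mul_apply]; exact Y_mem ih

lemma F_mem (h : F * Y = Y ^ q * F) {x : W} (hx : x ∈ towerSpan Y F v) :
    F x ∈ towerSpan Y F v := by
  have : towerSpan Y F v ≤ (towerSpan Y F v).comap F := by
    refine span_le.2 ?_
    rintro _ ⟨i, j, n, rfl⟩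
    refine subset_span ⟨i, q * j, n + 1, ?_⟩
    have := pow_commute h 1 j
    rw [pow_one, pow_one] at this
    rw [← mul_apply, this, mul_apply, pow_succ' F, mul_apply]
  exact this hx

lemma F_pow_mem (h : F * Y = Y ^ q * F) {x : W} (hx : x ∈ towerSpan Y F v) (n : ℕ) :
    (F ^ n) x ∈ towerSpan Y F v := by
  induction n with
  | zero => exact hx
  | succ n ih => rw [pow_succ', mul_apply]; exact F_mem h ih

lemma exists_pow (h : IsTower q Y F v) (n : ℕ) :
    ∃ (σ : Equiv.Perm ι) (e : ι → ℕ) (c : ι → k), (∀ i, c i ≠ 0) ∧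
      ∀ i, (Y ^ e i) ((F ^ n) (v i)) = c i • v (σ i) := by
  obtain ⟨σ, e, c, hc, hs⟩ := h.step
  induction n with
  | zero => exact ⟨1, 0, 1, by simp, by simp⟩
  | succ n ih =>
    obtain ⟨σ', e', c', hc', hs'⟩ := ih
    refine ⟨σ' * σ, fun i => e' (σ i) + q ^ n * e i, fun i => c i * c' (σ i),
      fun i => mul_ne_zero (hc _) (hc' _), fun i => ?_⟩
    have e1 : Y ^ (e' (σ i) + q ^ n * e i) * F ^ (n + 1)
        = Y ^ e' (σ i) * (F ^ n * (Y ^ e i * F)) := by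
      rw [pow_add, pow_succ, ← mul_assoc, mul_assoc (Y ^ e' (σ i)), ← pow_commute h.commute]
      simp only [mul_assoc]
    rw [← mul_apply, e1]
    simp only [mul_apply]
    rw [hs, map_smul, map_smul, hs', smul_smul]
    rfl

lemma mem_of_ker [Fintype ι] (h : IsTower q Y F v) {x : W} (hx : x ∈ towerSpan Y F v) (hYx : Y x = 0) :
    x ∈ span k (Set.range v) := by
  have hlevel : ∃ n, x ∈ span k {w | ∃ i j, w = (Y ^ j) ((F ^ n) (v i))} := by
    have hmono : Monotone fun n => span k {w | ∃ i j, w = (Y ^ j) ((F ^ n) (v i))} := by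
      refine monotone_nat_of_le_succ fun n => span_le.2 ?_
      rintro _ ⟨i, j, rfl⟩
      obtain ⟨σ, e, c, hc, hs⟩ := h.step
      have h1 : v i = (c (σ.symm i))⁻¹ • (Y ^ e (σ.symm i)) (F (v (σ.symm i))) := by
        rw [hs, smul_smul, inv_mul_cancel₀ (hc _), one_smul, Equiv.apply_symm_apply]
      rw [h1, map_smul, map_smul]
      refine Submodule.smul_mem _ _ (subset_span ⟨σ.symm i, j + q ^ n * e (σ.symm i), ?_⟩)
      rw [pow_add, pow_succ, mul_apply, mul_apply,
        ← mul_apply (Y ^ (q ^ n * e (σ.symm i))), ← pow_commute h.commute,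
        mul_apply]
    clear hYx
    induction hx using Submodule.span_induction with
    | mem y hy =>
      obtain ⟨i, j, n, rfl⟩ := hy
      exact ⟨n, subset_span ⟨i, j, rfl⟩⟩
    | zero => exact ⟨0, zero_mem _⟩
    | add y z _ _ hy hz =>
      obtain ⟨n, hy⟩ := hy
      obtain ⟨m, hz⟩ := hz
      exact ⟨max n m, add_mem (hmono (le_max_left n m) hy) (hmono (le_max_right n m) hz)⟩
    | smul a y _ hy =>
      obtain ⟨n, hy⟩ := hy
      exact ⟨n, Submodule.smul_mem _ a hy⟩
  obtain ⟨n, hn⟩ := hlevel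
  obtain ⟨σ, e, c, hc, hs⟩ := h.exists_pow n
  have hli : LinearIndependent k fun i => c i • v (σ i) :=
    (h.linearIndependent.comp σ σ.injective).units_smul fun i => Units.mk0 (c i) (hc i)
  have h2 := mem_span_of_mem_ker hs (fun i => by rw [map_smul, h.ker, smul_zero]) hli hn hYx
  refine span_le.2 ?_ h2
  rintro _ ⟨i, rfl⟩
  exact Submodule.smul_mem _ _ (subset_span ⟨_, rfl⟩)

lemma exists_pow_eq_zero (h : IsTower q Y F v) {x : W} (hx : x ∈ towerSpan Y F v) :
    ∃ n, (Y ^ n) x = 0 := by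
  induction hx using Submodule.span_induction with
  | mem y hy =>
    obtain ⟨i, j, n, rfl⟩ := hy
    obtain ⟨σ, e, c, hc, hs⟩ := h.exists_pow n
    refine ⟨1 + e i, ?_⟩
    have e1 : Y ^ (1 + e i) * Y ^ j = Y ^ j * (Y * Y ^ e i) := by
      rw [← pow_succ', ← pow_add, ← pow_add]
      congr 1
      omega
    rw [← mul_apply, e1]
    simp only [mul_apply]
    rw [hs, map_smul, h.ker, smul_zero, map_zero]
  | zero => exact ⟨0, map_zero _⟩
  | add y z _ _ hy hz =>
    obtain ⟨n, hy⟩ := hy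
    obtain ⟨m, hz⟩ := hz
    refine ⟨n + m, ?_⟩
    rw [map_add, pow_add, mul_apply _ _ z, hz, map_zero, add_zero, (Commute.pow_pow_self Y n m).eq,
      mul_apply, hy, map_zero]
  | smul a y _ hy =>
    obtain ⟨n, hy⟩ := hy
    exact ⟨n, by rw [map_smul, hy, smul_zero]⟩

/-- Every nonzero vector has a nonzero multiple in the span of the `v i`. -/
lemma exists_pow_mem_span [Fintype ι] (h : IsTower q Y F v) {x : W} (hx : x ∈ towerSpan Y F v) (hx0 : x ≠ 0) :
    ∃ n, (Y ^ n) x ≠ 0 ∧ (Y ^ n) x ∈ span k (Set.range v) := by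
  classical
  have hex := h.exists_pow_eq_zero hx
  have hpos : Nat.find hex ≠ 0 := by
    intro h0
    have := Nat.find_spec hex
    rw [h0] at this
    exact hx0 this
  obtain ⟨m, hm⟩ := Nat.exists_eq_succ_of_ne_zero hpos
  have h1 := Nat.find_spec hex
  refine ⟨m, Nat.find_min hex (by omega), h.mem_of_ker (Y_pow_mem hx m) ?_⟩
  rw [← mul_apply, ← pow_succ', ← Nat.succ_eq_add_one, ← hm]
  exact h1

end IsTower

end NilpotentTowers

section Iwasawa

lemma exists_pow_mul_eq_coe (b : ℚ_[p]) : ∃ (N : ℕ) (c : ℤ_[p]), (p : ℚ_[p]) ^ N * b = c := by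
  have hp : (1 : ℝ) < p := by exact_mod_cast (Fact.out : p.Prime).one_lt
  obtain ⟨N, hN⟩ := pow_unbounded_of_one_lt ‖b‖ hp
  refine ⟨N, ⟨(p : ℚ_[p]) ^ N * b, ?_⟩, rfl⟩
  rw [norm_mul, norm_pow, Padic.norm_p, inv_pow]
  exact (inv_mul_le_one₀ (by positivity)).2 hN.le

lemma matF_zpow_mul_uni (n : ℤ) (b : ℚ_[p]) :
    matF p ^ n * uni b = uni ((p : ℚ_[p]) ^ n * b) * matF p ^ n := by
  have hinv : ∀ b : ℚ_[p], (matF p)⁻¹ * uni b = uni ((p : ℚ_[p])⁻¹ * b) * (matF p)⁻¹ := by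
    intro b
    rw [inv_mul_eq_iff_eq_mul, ← mul_assoc, matF_mul_uni, mul_assoc, mul_inv_cancel, mul_one,
      ← mul_assoc, mul_inv_cancel₀ padic_p_ne_zero, one_mul]
  induction n generalizing b with
  | zero => simp
  | succ n ih =>
    rw [zpow_add_one, mul_assoc, matF_mul_uni, ← mul_assoc, ih, mul_assoc,
      zpow_add_one₀ padic_p_ne_zero, mul_assoc]
  | pred n ih =>
    rw [zpow_sub_one, mul_assoc, hinv, ← mul_assoc, ih, mul_assoc,
      zpow_sub_one₀ padic_p_ne_zero, mul_assoc]

lemma inclK_mkK_eq (a d : ℚ_[p]) (ha : a ≠ 0) (hd : d ≠ 0) :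
    ∃ (m n : ℤ) (k : GL2Zp p), k ∈ iwahori p ∧
      mkQ a 0 0 d (by simpa using ⟨ha, hd⟩) = matF p ^ m * pScalar p ^ n * inclK p k := by
  set x : ℚ_[p]ˣ := Units.mk0 a ha
  set y : ℚ_[p]ˣ := Units.mk0 d hd
  have hx := congrArg (fun z : ℚ_[p]ˣ => (z : ℚ_[p])) (eq_pUnit_zpow_mul x)
  have hy := congrArg (fun z : ℚ_[p]ˣ => (z : ℚ_[p])) (eq_pUnit_zpow_mul y)
  simp only [val_mul, coe_unitQ, Units.val_zpow_eq_zpow_val, coe_pUnit] at hx hy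
  refine ⟨(x : ℚ_[p]).valuation - (y : ℚ_[p]).valuation, (y : ℚ_[p]).valuation,
    mkK (unitPart p x) 0 0 (unitPart p y) (by simp), by rw [mem_iwahori]; simp, ?_⟩
  have hF : ∀ n : ℤ, matF p ^ n = mkQ ((p : ℚ_[p]) ^ n) 0 0 1
      (by simpa using zpow_ne_zero n padic_p_ne_zero) := by
    intro n
    induction n with
    | zero => exact Units.ext (by simp [Matrix.one_fin_two])
    | succ n ih =>
      rw [zpow_add_one, ih]
      exact Units.ext (by simp [matF, zpow_add_one₀ padic_p_ne_zero])
    | pred n ih =>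
      rw [zpow_sub_one, ih, mul_inv_eq_iff_eq_mul]
      refine Units.ext ?_
      rw [val_mul]
      simp [matF, ← zpow_add_one₀ padic_p_ne_zero]
  have hP : ∀ n : ℤ, pScalar p ^ n = mkQ ((p : ℚ_[p]) ^ n) 0 0 ((p : ℚ_[p]) ^ n)
      (by simpa using zpow_ne_zero n padic_p_ne_zero) := by
    intro n
    induction n with
    | zero => exact Units.ext (by simp [Matrix.one_fin_two])
    | succ n ih =>
      rw [zpow_add_one, ih]
      exact Units.ext (by simp [zpow_add_one₀ padic_p_ne_zero])
    | pred n ih =>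
      rw [zpow_sub_one, ih, mul_inv_eq_iff_eq_mul]
      refine Units.ext ?_
      rw [val_mul]
      simp [← zpow_add_one₀ padic_p_ne_zero]
  rw [hF, hP]
  refine Units.ext ?_
  rw [val_mul, val_mul]
  simp only [coe_mkQ, coe_inclK_mkK]
  have h1 : a = (p : ℚ_[p]) ^ ((x : ℚ_[p]).valuation - (y : ℚ_[p]).valuation) *
      (p : ℚ_[p]) ^ (y : ℚ_[p]).valuation * ((unitPart p x : ℤ_[p]) : ℚ_[p]) := by
    rw [← zpow_add₀ padic_p_ne_zero, sub_add_cancel]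
    exact hx
  have h2 : d = (p : ℚ_[p]) ^ (y : ℚ_[p]).valuation * ((unitPart p y : ℤ_[p]) : ℚ_[p]) := hy
  ext i j
  fin_cases i <;> fin_cases j <;> simp
  · exact h1
  · exact h2

/-- Upper triangular matrices. -/
lemma exists_eq_of_upper_triangular {g : GL2Qp p} (hg : g 1 0 = 0) :
    ∃ (b : ℚ_[p]) (m n : ℤ) (k : GL2Zp p), k ∈ iwahori p ∧
      g = uni b * (matF p ^ m * pScalar p ^ n * inclK p k) := by
  have hdet := (Matrix.isUnit_iff_isUnit_det _).1 g.isUnit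
  rw [Matrix.det_fin_two, hg, mul_zero, sub_zero, isUnit_iff_ne_zero] at hdet
  obtain ⟨m, n, k, hk, e⟩ := inclK_mkK_eq (g 0 0) (g 1 1) (left_ne_zero_of_mul hdet)
    (right_ne_zero_of_mul hdet)
  refine ⟨g 0 1 / g 1 1, m, n, k, hk, ?_⟩
  rw [← e]
  refine Units.ext ?_
  rw [val_mul]
  have h1 := right_ne_zero_of_mul hdet
  ext i j
  fin_cases i <;> fin_cases j <;> simp [uni, hg, h1]

/-- The Iwasawa decomposition. -/
theorem exists_iwasawa (g : GL2Qp p) :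
    ∃ (b : ℚ_[p]) (m n : ℤ) (k : GL2Zp p),
      g = uni b * (matF p ^ m * pScalar p ^ n * inclK p k) := by
  have key : ∀ g : GL2Qp p, ‖g 1 0‖ ≤ ‖g 1 1‖ → ∃ (b : ℚ_[p]) (m n : ℤ) (k : GL2Zp p),
      g = uni b * (matF p ^ m * pScalar p ^ n * inclK p k) := by
    intro g hg
    have hdet := (Matrix.isUnit_iff_isUnit_det _).1 g.isUnit
    rw [Matrix.det_fin_two, isUnit_iff_ne_zero] at hdet
    have h1 : g 1 1 ≠ 0 := by
      intro h0
      rw [h0, norm_zero, norm_le_zero_iff] at hg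
      rw [h0, hg] at hdet
      simp at hdet
    have hc : ‖-(g 1 0 / g 1 1)‖ ≤ 1 := by
      rw [norm_neg, norm_div]
      exact div_le_one_of_le₀ hg (norm_nonneg _)
    obtain ⟨x, hx⟩ : ∃ x : ℤ_[p], (x : ℚ_[p]) = -(g 1 0 / g 1 1) := ⟨⟨_, hc⟩, rfl⟩
    have h2 : (g * inclK p (mkK 1 0 x 1 (by simp))) 1 0 = 0 := by
      rw [val_mul, Matrix.mul_apply, Fin.sum_univ_two]
      simp [hx]
      field_simp
      simp
    obtain ⟨b, m, n, k, -, e⟩ := exists_eq_of_upper_triangular h2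
    refine ⟨b, m, n, k * (mkK 1 0 x 1 (by simp))⁻¹, ?_⟩
    rw [map_mul, map_inv, ← mul_assoc _ (inclK p k), ← mul_assoc (uni b), ← e,
      mul_inv_cancel_right]
  rcases le_total ‖g 1 0‖ ‖g 1 1‖ with hg | hg
  · exact key g hg
  · have h2 : ‖(g * inclK p (matK 0)) 1 0‖ ≤ ‖(g * inclK p (matK 0)) 1 1‖ := by
      rw [val_mul, Matrix.mul_apply, Matrix.mul_apply, Fin.sum_univ_two, Fin.sum_univ_two]
      simpa [matK, teich] using hg
    obtain ⟨b, m, n, k, e⟩ := key _ h2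
    refine ⟨b, m, n, k * (matK 0)⁻¹, ?_⟩
    rw [map_mul, map_inv, ← mul_assoc _ (inclK p k), ← mul_assoc (uni b), ← e,
      mul_inv_cancel_right]

end Iwasawa

section BorelActions

variable {W : Type*} [AddCommGroup W] [Module κ W]

/-- The operator `γ - 1`, where `γ = (1, 1; 0, 1)`. -/
def opY (ρ : GL2Rep W) : Module.End κ W := ρ (uni 1) - 1

/-- The action of `(p, 0; 0, 1)`. -/
def opF (ρ : GL2Rep W) : Module.End κ W := ρ (matF p)

/-- `x` is fixed by the matrices `(1, b; 0, 1)` with `b ∈ ℤ_p`. -/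
def IsUniFixed (ρ : GL2Rep W) (x : W) : Prop :=
  ∀ b : ℤ_[p], ρ (uni (b : ℚ_[p])) x = x

variable {ρ : GL2Rep W}

lemma rho_uni_one : ρ (uni 1) = 1 + opY ρ := by rw [opY, add_sub_cancel]

lemma rho_uni_natCast (m : ℕ) : ρ (uni (m : ℚ_[p])) = (1 + opY ρ) ^ m := by
  induction m with
  | zero => rw [Nat.cast_zero, uni_zero, map_one, pow_zero]
  | succ m ih => rw [Nat.cast_add, Nat.cast_one, uni_add, map_mul, ih, rho_uni_one, pow_succ]

lemma one_add_pow_char {A : Type*} [Ring A] [Algebra κ A] (y : A) :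
    (1 + y) ^ p = 1 + y ^ p := by
  have h : (1 + X : κ[X]) ^ p = 1 + X ^ p := by rw [add_pow_char, one_pow]
  simpa using congrArg (aeval y) h

lemma sum_one_add_pow {A : Type*} [Ring A] [Algebra κ A] (y : A) :
    ∑ i ∈ Finset.range p, (1 + y) ^ i = y ^ (p - 1) := by
  have hp : p.Prime := Fact.out
  have h : ∑ i ∈ Finset.range p, (1 + X : κ[X]) ^ i = X ^ (p - 1) := by
    refine mul_right_cancel₀ X_ne_zero ?_
    have := geom_sum_mul (1 + X : κ[X]) p
    rw [add_sub_cancel_left, add_pow_char, one_pow, add_sub_cancel_left] at this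
    rw [this, ← pow_succ, Nat.sub_add_cancel hp.one_le]
  simpa using congrArg (aeval y) h

lemma opF_mul_opY : opF ρ * opY ρ = opY ρ ^ p * opF ρ := by
  have h : opF ρ * (1 + opY ρ) = (1 + opY ρ) ^ p * opF ρ := by
    rw [← rho_uni_natCast, ← rho_uni_one, opF, ← map_mul, ← map_mul, matF_mul_uni, mul_one]
  rw [one_add_pow_char, mul_add, add_mul, mul_one, one_mul] at h
  exact add_left_cancel h

lemma opF_pow (n : ℕ) : opF ρ ^ n = ρ (matF p ^ n) := (map_pow ρ _ _).symm

lemma IsUniFixed.opY_eq_zero {x : W} (hx : IsUniFixed ρ x) : opY ρ x = 0 := by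
  have := hx 1
  rw [PadicInt.coe_one] at this
  rw [opY, LinearMap.sub_apply, this, Module.End.one_apply, sub_self]

/-- On `F ^ n x` the matrix `(1, b; 0, 1)` acts through `b mod p ^ n`. -/
lemma IsUniFixed.uni_opF_pow {x : W} (hx : IsUniFixed ρ x) (b c : ℤ_[p]) (m n : ℕ)
    (h : b = m + (p : ℤ_[p]) ^ n * c) :
    ρ (uni (b : ℚ_[p])) ((opF ρ ^ n) x) = ((1 + opY ρ) ^ m) ((opF ρ ^ n) x) := by
  have e : uni (b : ℚ_[p]) * matF p ^ n = uni (m : ℚ_[p]) * (matF p ^ n * uni (c : ℚ_[p])) := by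
    have := matF_zpow_mul_uni (n : ℤ) (c : ℚ_[p])
    rw [zpow_natCast, zpow_natCast] at this
    rw [this, ← mul_assoc, ← uni_add, h]
    push_cast
    rfl
  rw [opF_pow, ← mul_apply, ← map_mul, e, map_mul, map_mul, mul_apply,
    mul_apply, hx, rho_uni_natCast]

lemma IsUniFixed.sum_matX {x : W} (hx : IsUniFixed ρ x) :
    ∑ t : ZMod p, ρ (matX t) x = (opY ρ ^ (p - 1)) (opF ρ x) := by
  have hp : p.Prime := Fact.out
  rw [← sum_one_add_pow, LinearMap.sum_apply]
  have e : ∀ t : ZMod p, ρ (matX t) x = ((1 + opY ρ) ^ t.val) (opF ρ x) := by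
    intro t
    obtain ⟨c, hc⟩ := toZMod_eq_zero_iff.1 (show toZMod (teich t - (t.val : ℤ_[p])) = 0 by
      rw [map_sub, toZMod_teich, map_natCast, ZMod.natCast_zmod_val, sub_self])
    have := hx.uni_opF_pow (teich t) c t.val 1 (by rw [pow_one, ← hc]; ring)
    rw [pow_one] at this
    rw [← this, matX_eq_uni, map_mul]
    rfl
  simp_rw [e]
  obtain ⟨q, rfl⟩ : ∃ q, p = q + 1 := ⟨p - 1, by have := hp.one_le; omega⟩
  exact Fin.sum_univ_eq_sum_range (fun i => ((1 + opY ρ) ^ i) (opF ρ x)) (q + 1)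

variable {ι : Type*} {v : ι → W}

lemma one_add_opY_pow_mem {x : W} {F : Module.End κ W} (hx : x ∈ towerSpan (opY ρ) F v)
    (m : ℕ) : ((1 + opY ρ) ^ m) x ∈ towerSpan (opY ρ) F v := by
  induction m with
  | zero => exact hx
  | succ m ih =>
    rw [pow_succ', mul_apply]
    exact add_mem ih (IsTower.Y_mem ih)

/-- The span of the vectors `(1, b; 0, 1) F ^ n v` with `b ∈ ℚ_p` and `n ∈ ℤ`. -/
def borelSpan (ρ : GL2Rep W) (v : ι → W) : Submodule κ W :=
  span κ {w | ∃ (i : ι) (b : ℚ_[p]) (n : ℤ), w = ρ (uni b * matF p ^ n) (v i)}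

lemma mem_borelSpan (i : ι) : v i ∈ borelSpan ρ v :=
  subset_span ⟨i, 0, 0, by simp [uni_zero]⟩

lemma uni_mem_borelSpan {x : W} (hx : x ∈ borelSpan ρ v) (b : ℚ_[p]) :
    ρ (uni b) x ∈ borelSpan ρ v := by
  have : borelSpan ρ v ≤ (borelSpan ρ v).comap (ρ (uni b)) := by
    refine span_le.2 ?_
    rintro _ ⟨i, c, n, rfl⟩
    refine subset_span ⟨i, b + c, n, ?_⟩
    rw [← mul_apply, ← map_mul, ← mul_assoc, uni_add]
  exact this hx

lemma matF_zpow_mem_borelSpan {x : W} (hx : x ∈ borelSpan ρ v) (m : ℤ) :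
    ρ (matF p ^ m) x ∈ borelSpan ρ v := by
  have : borelSpan ρ v ≤ (borelSpan ρ v).comap (ρ (matF p ^ m)) := by
    refine span_le.2 ?_
    rintro _ ⟨i, c, n, rfl⟩
    refine subset_span ⟨i, (p : ℚ_[p]) ^ m * c, m + n, ?_⟩
    rw [← mul_apply, ← map_mul, ← mul_assoc, matF_zpow_mul_uni, mul_assoc, zpow_add]
  exact this hx

lemma exists_opF_pow_mem_towerSpan (hv : ∀ i, IsUniFixed ρ (v i)) {x : W}
    (hx : x ∈ borelSpan ρ v) : ∃ n : ℕ, (opF ρ ^ n) x ∈ towerSpan (opY ρ) (opF ρ) v := by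
  have hmono : ∀ (x : W) (n m : ℕ), (opF ρ ^ n) x ∈ towerSpan (opY ρ) (opF ρ) v →
      (opF ρ ^ (m + n)) x ∈ towerSpan (opY ρ) (opF ρ) v := by
    intro x n m h
    rw [pow_add, mul_apply]
    exact IsTower.F_pow_mem opF_mul_opY h m
  induction hx using Submodule.span_induction with
  | mem x hx =>
    obtain ⟨i, b, n, rfl⟩ := hx
    obtain ⟨N, c, hc⟩ := exists_pow_mul_eq_coe b
    obtain ⟨M, hM⟩ : ∃ M : ℕ, (M : ℤ) = n.natAbs + N + n := ⟨(n.natAbs + N + n).toNat, by omega⟩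
    refine ⟨n.natAbs + N, ?_⟩
    have e : matF p ^ (n.natAbs + N) * (uni b * matF p ^ n)
        = uni (((p : ℤ_[p]) ^ n.natAbs * c : ℤ_[p]) : ℚ_[p]) * matF p ^ M := by
      have := matF_zpow_mul_uni ((n.natAbs + N : ℕ) : ℤ) b
      rw [zpow_natCast, zpow_natCast, pow_add (p : ℚ_[p]), mul_assoc, hc] at this
      have e2 : matF p ^ (n.natAbs + N) * matF p ^ n = matF p ^ M := by
        rw [← zpow_natCast, ← zpow_natCast _ M, ← zpow_add, hM]
        push_cast
        rfl
      rw [← mul_assoc, this, mul_assoc, e2]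
      push_cast
      rfl
    rw [opF_pow, ← mul_apply, ← map_mul, e, map_mul, mul_apply, ← opF_pow]
    set z : ℤ_[p] := (p : ℤ_[p]) ^ n.natAbs * c
    obtain ⟨d, hd⟩ := Ideal.mem_span_singleton.1 (PadicInt.appr_spec M z)
    rw [(hv i).uni_opF_pow z d (z.appr M) M (by rw [← hd]; ring)]
    exact one_add_opY_pow_mem (subset_span ⟨i, 0, M, rfl⟩) _
  | zero => exact ⟨0, by rw [map_zero]; exact zero_mem _⟩
  | add x y _ _ hx hy =>
    obtain ⟨n, hn⟩ := hx
    obtain ⟨m, hm⟩ := hy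
    refine ⟨m + n, ?_⟩
    rw [map_add]
    refine add_mem (hmono x n m hn) ?_
    rw [add_comm m n]
    exact hmono y m n hm
  | smul a x _ hx =>
    obtain ⟨n, hn⟩ := hx
    exact ⟨n, by rw [map_smul]; exact Submodule.smul_mem _ a hn⟩

lemma HeckeVec.isUniFixed {r : ℕ} {a : κ} {v : W} (h : HeckeVec ρ r a v) :
    IsUniFixed ρ v := h.uni_smul

lemma HeckeVec.isUniFixed_matBeta {r : ℕ} {a : κ} {v : W} (h : HeckeVec ρ r a v) :
    IsUniFixed ρ (ρ (matBeta p) v) := h.uni_smul_matBeta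

lemma HeckeVec.pScalar_zpow {r : ℕ} {a : κ} {v : W} (h : HeckeVec ρ r a v) (n : ℤ)
    (g : GL2Qp p) : ρ (ModPLLC.pScalar p ^ n) (ρ g v) = ρ g v :=
  rep_pScalar_zpow (h.pScalar_smul g) n

lemma HeckeVec.borelSpan_eq_top {r : ℕ} {a : κ} {v : W} (h : HeckeVec ρ r a v)
    (hv : Generates ρ v) {u : Fin 2 → W} (h0 : u 0 = v) (h1 : u 1 = ρ (inclK p (matK 0)) v) :
    borelSpan ρ u = ⊤ := by
  have hm0 : v ∈ borelSpan ρ u := h0 ▸ mem_borelSpan 0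
  have hm1 : ρ (inclK p (matK 0)) v ∈ borelSpan ρ u := h1 ▸ mem_borelSpan 1
  rw [eq_top_iff, ← hv]
  refine span_le.2 ?_
  rintro _ ⟨g, rfl⟩
  obtain ⟨b, m, n, k, rfl⟩ := exists_iwasawa g
  have key : ρ (inclK p k) v ∈ borelSpan ρ u := by
    rcases mem_iwahori_or_exists_matK k with hk | ⟨t, k', rfl⟩
    · rw [h.iwahori ⟨k, hk⟩]
      exact Submodule.smul_mem _ _ hm0
    · rw [map_mul, map_mul, mul_apply, h.iwahori, map_smul, matK_eq_uni, map_mul,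
        mul_apply]
      exact Submodule.smul_mem _ _ (uni_mem_borelSpan hm1 _)
  change ρ (uni b * (matF p ^ m * ModPLLC.pScalar p ^ n * inclK p k)) v ∈ _
  rw [map_mul, map_mul, map_mul, mul_apply, mul_apply, mul_apply,
    h.pScalar_zpow]
  exact uni_mem_borelSpan (matF_zpow_mem_borelSpan key m) b

end BorelActions

section OrdinaryVectors

variable {W : Type*} [AddCommGroup W] [Module κ W]

/-- The subspace `S` is stable under the action of `G`. -/
def IsStable {G : Type*} [Group G] (ρ : Representation κ G W)
    (S : Submodule κ W) : Prop :=
  ∀ g, ∀ x ∈ S, ρ g x ∈ S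

/-- The diagonal matrix with entries `a, d ∈ ℤ_pˣ`. -/
def diagK (a d : ℤ_[p]ˣ) : GL2Zp p := mkK a 0 0 d (by simp)

lemma diagK_mem_iwahori (a d : ℤ_[p]ˣ) : diagK a d ∈ iwahori p := by
  rw [mem_iwahori]; simp [diagK]

/-- Modulo the stable subspace `S`, the vector `x` is fixed by the integral unipotent matrices, the
torus acts on it through characters determined by `χ₁` and `χ₂`, and it is an eigenvector of the
operator `U = ∑ X_t` for the eigenvalue `χ₂(p)`. -/
structure HasDataMod (ρ : GL2Rep W) (S : Submodule κ W) (x : W)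
    (χ₁ χ₂ : QpChar) : Prop where
  uni : ∀ b : ℤ_[p], ρ (uni (b : ℚ_[p])) x - x ∈ S
  diag : ∀ a d : ℤ_[p]ˣ, ρ (inclK p (diagK a d)) x
    - ((χ₂ (unitQ p a) * χ₁ (unitQ p d) : κˣ) : κ) • x ∈ S
  center : ρ (pScalar p) x - ((χ₁ (pUnit p) * χ₂ (pUnit p) : κˣ) : κ) • x ∈ S
  sum_matX : ∑ t : ZMod p, ρ (matX t) x - (χ₂ (pUnit p) : κ) • x ∈ S

variable {ρ : GL2Rep W} {S : Submodule κ W} {x y f : W}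
  {χ₁ χ₂ χ₁' χ₂' : QpChar}

lemma HasDataMod.mono (h : HasDataMod ρ S x χ₁ χ₂) {S' : Submodule κ W} (hS : S ≤ S') :
    HasDataMod ρ S' x χ₁ χ₂ :=
  ⟨fun b => hS (h.uni b), fun a d => hS (h.diag a d), hS h.center, hS h.sum_matX⟩

lemma HasDataMod.of_sub_mem (h : HasDataMod ρ S x χ₁ χ₂) (hS : IsStable ρ S) (c : κ)
    (hy : y - c • x ∈ S) : HasDataMod ρ S y χ₁ χ₂ := by
  have key : ∀ (T : Module.End κ W) (l : κ), (∀ z ∈ S, T z ∈ S) →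
      T x - l • x ∈ S → T y - l • y ∈ S := by
    intro T l hT hx
    have e : T y - l • y = c • (T x - l • x) + (T (y - c • x) - l • (y - c • x)) := by
      rw [map_sub, map_smul]
      module
    rw [e]
    exact add_mem (S.smul_mem _ hx) (sub_mem (hT _ hy) (S.smul_mem _ hy))
  refine ⟨fun b => ?_, fun a d => key _ _ (hS _) (h.diag a d), key _ _ (hS _) h.center, ?_⟩
  · simpa using key (ρ (ModPLLC.uni (b : ℚ_[p]))) 1 (hS _) (by simpa using h.uni b)
  · have := key (∑ t : ZMod p, ρ (matX t)) (χ₂ (pUnit p) : κ)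
      (fun z hz => by
        rw [LinearMap.sum_apply]
        exact sum_mem fun t _ => hS _ _ hz)
      (by rw [LinearMap.sum_apply]; exact h.sum_matX)
    rwa [LinearMap.sum_apply] at this

/-- The characters are determined by the vector. -/
lemma HasDataMod.unique (h : HasDataMod ρ S x χ₁ χ₂) (h' : HasDataMod ρ S x χ₁' χ₂')
    (hx : x ∉ S) : χ₁ = χ₁' ∧ χ₂ = χ₂' := by
  have key : ∀ (z : W) (l l' : κˣ), z - (l : κ) • x ∈ S → z - (l' : κ) • x ∈ S →
      l = l' := by
    intro z l l' h1 h2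
    have h3 := sub_mem h2 h1
    rw [sub_sub_sub_cancel_left, ← sub_smul] at h3
    by_contra hne
    have h4 : ((l : κ) - l') ≠ 0 := sub_ne_zero.2 fun e => hne (Units.ext e)
    exact hx ((S.smul_mem_iff h4).1 h3)
  have hd := fun a d => key _ _ _ (h.diag a d) (h'.diag a d)
  have h2 : χ₂ (pUnit p) = χ₂' (pUnit p) := key _ _ _ h.sum_matX h'.sum_matX
  have hc := key _ _ _ h.center h'.center
  rw [h2] at hc
  refine ⟨char_ext (mul_right_cancel hc) fun u => ?_, char_ext h2 fun u => ?_⟩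
  · simpa using hd 1 u
  · simpa using hd u 1

lemma HasDataMod.twist (h : HasDataMod ρ S x χ₁ χ₂) (χ : QpChar) :
    HasDataMod (twist ρ (χ.comp det)) S x (χ₁ * χ) (χ₂ * χ) := by
  refine ⟨fun b => ?_, fun a d => ?_, ?_, ?_⟩
  · rw [twist_apply, comp_apply, det_uni, map_one, val_one, one_smul]
    exact h.uni b
  · rw [twist_apply, comp_apply, det_inclK]
    have e : det (diagK a d) = a * d := Units.ext (by simp [diagK])
    have := S.smul_mem (χ (unitQ p (a * d)) : κ) (h.diag a d)
    rw [smul_sub, smul_smul] at this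
    rw [e]
    convert this using 3
    rw [MonoidHom.mul_apply, MonoidHom.mul_apply, map_mul, map_mul]
    push_cast
    ring
  · rw [twist_apply, comp_apply, det_pScalar]
    have := S.smul_mem (χ (pUnit p * pUnit p) : κ) h.center
    rw [smul_sub, smul_smul] at this
    convert this using 3
    rw [MonoidHom.mul_apply, MonoidHom.mul_apply, map_mul]
    push_cast
    ring
  · simp only [twist_apply, comp_apply, det_matX]
    have := S.smul_mem (χ (pUnit p) : κ) h.sum_matX
    rw [smul_sub, smul_smul] at this
    rw [← Finset.smul_sum]
    convert this using 3
    rw [MonoidHom.mul_apply]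
    push_cast
    ring

/-- The vector `f` is an eigenvector which controls the representation: the unipotent matrices act
trivially modulo the subspace generated by `f` under the Borel subgroup, which has codimension at
most one. -/
structure IsOrdinary (ρ : GL2Rep W) (f : W)
    (χ₁ χ₂ : QpChar) : Prop where
  ne_zero : f ≠ 0
  data : HasDataMod ρ ⊥ f χ₁ χ₂
  uni_sub_mem : ∀ (b : ℚ_[p]) (w : W), ρ (uni b) w - w ∈ borelSpan ρ fun _ : Unit => f
  exists_sup : ∃ z, (borelSpan ρ fun _ : Unit => f) ⊔ span κ {z} = ⊤

lemma IsStable.opY (hS : IsStable ρ S) {x : W} (hx : x ∈ S) : opY ρ x ∈ S :=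
  sub_mem (hS _ x hx) hx

lemma IsStable.opY_pow (hS : IsStable ρ S) {x : W} (hx : x ∈ S) (n : ℕ) :
    (ModPLLC.opY ρ ^ n) x ∈ S := by
  induction n with
  | zero => exact hx
  | succ n ih => rw [pow_succ', mul_apply]; exact hS.opY ih

lemma IsStable.opF_pow (hS : IsStable ρ S) {x : W} (hx : x ∈ S) (n : ℕ) : (opF ρ ^ n) x ∈ S := by
  rw [ModPLLC.opF_pow]; exact hS _ x hx

lemma opF_pow_ne_zero {x : W} (hx : x ≠ 0) (n : ℕ) : (opF ρ ^ n) x ≠ 0 := by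
  rw [opF_pow]
  intro h
  apply hx
  rw [← ρ.inv_self_apply (matF p ^ n) x, h, map_zero]

lemma IsStable.borelSpan_le (hS : IsStable ρ S) {ι : Type*} {v : ι → W} (hv : ∀ i, v i ∈ S) :
    borelSpan ρ v ≤ S := by
  refine span_le.2 ?_
  rintro _ ⟨i, b, n, rfl⟩
  exact hS _ _ (hv i)

/-- The operator `U = Y ^ (p - 1) F` satisfies `U ^ n = Y ^ (p ^ n - 1) F ^ n`. -/
lemma opU_pow (n : ℕ) : (opY ρ ^ (p - 1) * opF ρ) ^ n = opY ρ ^ (p ^ n - 1) * opF ρ ^ n := by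
  have hp : 1 ≤ p := (Fact.out : p.Prime).one_le
  induction n with
  | zero => simp
  | succ n ih =>
    rw [pow_succ, ih, mul_assoc, ← mul_assoc (opF ρ ^ n), IsTower.pow_commute opF_mul_opY,
      mul_assoc (opY ρ ^ (p ^ n * (p - 1))), ← mul_assoc (opY ρ ^ (p ^ n - 1)), ← pow_add, ← pow_succ]
    congr 2
    have := Nat.one_le_pow n p hp
    rw [pow_succ, Nat.mul_sub, mul_one]
    have : p ^ n ≤ p ^ n * p := Nat.le_mul_of_pos_right _ hp
    omega

namespace IsOrdinary

lemma isUniFixed (h : IsOrdinary ρ f χ₁ χ₂) : IsUniFixed ρ f := fun b =>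
  sub_eq_zero.1 ((Submodule.mem_bot _).1 (h.data.uni b))

lemma isTower (h : IsOrdinary ρ f χ₁ χ₂) :
    IsTower p (opY ρ) (opF ρ) fun _ : Unit => f where
  commute := opF_mul_opY
  ker _ := h.isUniFixed.opY_eq_zero
  linearIndependent := linearIndependent_unique_iff.2 h.ne_zero
  step := ⟨1, fun _ => p - 1, fun _ => χ₂ (pUnit p), fun _ => Units.ne_zero _, fun _ => by
    rw [← h.isUniFixed.sum_matX]
    exact sub_eq_zero.1 ((Submodule.mem_bot _).1 h.data.sum_matX)⟩

/-- A stable subspace which meets the Borel span of `f` contains `f`. -/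
lemma mem_of_mem_borelSpan (h : IsOrdinary ρ f χ₁ χ₂) (hS : IsStable ρ S) (hx : x ∈ S)
    (hxA : x ∈ borelSpan ρ fun _ : Unit => f) (hx0 : x ≠ 0) : f ∈ S := by
  obtain ⟨n, hn⟩ := exists_opF_pow_mem_towerSpan (fun _ => h.isUniFixed) hxA
  obtain ⟨m, hm0, hm⟩ := h.isTower.exists_pow_mem_span hn (opF_pow_ne_zero hx0 n)
  rw [Set.range_const, Submodule.mem_span_singleton] at hm
  obtain ⟨c, hc⟩ := hm
  have hc0 : c ≠ 0 := by
    rintro rfl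
    rw [zero_smul] at hc
    exact hm0 hc.symm
  have h1 : c • f ∈ S := by
    rw [hc]
    exact hS.opY_pow (hS.opF_pow hx n) m
  exact (S.smul_mem_iff hc0).1 h1

/-- An eigenvector of `U` with nonzero eigenvalue in a subquotient has the same characters as
`f`. -/
theorem data_unique (h : IsOrdinary ρ f χ₁ χ₂) {S' : Submodule κ W} (hS : IsStable ρ S)
    (hS' : IsStable ρ S') (hx : x ∈ S) (hx' : x ∉ S')
    (hd : HasDataMod ρ S' x χ₁' χ₂') : χ₁' = χ₁ ∧ χ₂' = χ₂ := by
  have hp2 := (Fact.out : p.Prime).two_le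
  by_cases hf : f ∈ S'
  · exfalso
    have hA : (borelSpan ρ fun _ : Unit => f) ≤ S' := hS'.borelSpan_le fun _ => hf
    have h1 : ∑ t : ZMod p, ρ (matX t) x ∈ S' := by
      have e : ∀ t : ZMod p, ρ (matX t) x - ρ (matF p) x ∈ S' := by
        intro t
        rw [matX_eq_uni, map_mul]
        exact hA (h.uni_sub_mem _ _)
      have h2 := sum_mem (S := S') (t := Finset.univ) fun t _ => e t
      rw [Finset.sum_sub_distrib, Finset.sum_const, Finset.card_univ, ZMod.card,
        ← Nat.cast_smul_eq_nsmul κ, CharP.cast_eq_zero, zero_smul, sub_zero] at h2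
      exact h2
    have h2 := sub_mem h1 hd.sum_matX
    rw [sub_sub_cancel] at h2
    exact hx' ((S'.smul_mem_iff (Units.ne_zero _)).1 h2)
  have hS'A : ∀ w ∈ S', w ∈ (borelSpan ρ fun _ : Unit => f) → w = 0 := fun w hw hwA => by
    by_contra hw0
    exact hf (h.mem_of_mem_borelSpan hS' hw hwA hw0)
  have hfix : IsUniFixed ρ x := fun b =>
    sub_eq_zero.1 (hS'A _ (hd.uni b) (h.uni_sub_mem _ _))
  have hU := hfix.sum_matX
  have hUeq : ∀ n, ((opY ρ ^ (p - 1) * opF ρ) ^ n) x - (χ₂' (pUnit p) : κ) ^ n • x ∈ S' := by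
    intro n
    induction n with
    | zero => simp
    | succ n ih =>
      have h1 : (opY ρ ^ (p - 1) * opF ρ) x - (χ₂' (pUnit p) : κ) • x ∈ S' := by
        rw [mul_apply, ← hU]
        exact hd.sum_matX
      have h2 : (opY ρ ^ (p - 1) * opF ρ) (((opY ρ ^ (p - 1) * opF ρ) ^ n) x
          - (χ₂' (pUnit p) : κ) ^ n • x) ∈ S' := by
        rw [mul_apply]
        exact hS'.opY_pow (hS' _ _ ih) _
      rw [map_sub, map_smul, ← mul_apply, ← pow_succ'] at h2
      have h3 := add_mem h2 (S'.smul_mem ((χ₂' (pUnit p) : κ) ^ n) h1)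
      rw [smul_sub, smul_smul, ← pow_succ] at h3
      convert h3 using 1
      module
  have hUA : (opY ρ ^ (p - 1)) (opF ρ x) ∈ borelSpan ρ fun _ : Unit => f := by
    obtain ⟨q, hq⟩ : ∃ q, p - 1 = q + 1 := ⟨p - 2, by omega⟩
    rw [hq, pow_succ', mul_apply]
    exact h.uni_sub_mem _ _
  have hfS : f ∈ S := by
    refine h.mem_of_mem_borelSpan hS (hS.opY_pow (hS _ _ hx) _) hUA fun h0 => ?_
    have h1 := hUeq 1
    rw [pow_one, pow_one, mul_apply] at h1
    have h0' : (opY ρ ^ (p - 1)) (opF ρ x) = 0 := h0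
    rw [h0', zero_sub] at h1
    exact hx' ((S'.smul_mem_iff (Units.ne_zero _)).1 (neg_mem_iff.1 h1))
  obtain ⟨m, hm⟩ := exists_opF_pow_mem_towerSpan (fun _ => h.isUniFixed) hUA
  have h1 : ((opY ρ ^ (p - 1) * opF ρ) ^ (m + 1)) x
      ∈ towerSpan (opY ρ) (opF ρ) fun _ : Unit => f := by
    rw [pow_succ, mul_apply, opU_pow, mul_apply]
    exact IsTower.Y_pow_mem hm _
  have h2 : opY ρ (((opY ρ ^ (p - 1) * opF ρ) ^ (m + 1)) x) = 0 := by
    rw [opU_pow, ← mul_apply, ← mul_assoc, ← pow_succ',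
      Nat.sub_add_cancel (Nat.one_le_pow _ _ (by omega)),
      ← mul_one (p ^ (m + 1)), ← IsTower.pow_commute opF_mul_opY, pow_one, mul_apply,
      hfix.opY_eq_zero, map_zero]
  have h3 := h.isTower.mem_of_ker h1 h2
  rw [Set.range_const, Submodule.mem_span_singleton] at h3
  obtain ⟨c, hc⟩ := h3
  have h4 := hUeq (m + 1)
  rw [← hc] at h4
  have hne : (χ₂' (pUnit p) : κ) ^ (m + 1) ≠ 0 := pow_ne_zero _ (Units.ne_zero _)
  have hc0 : c ≠ 0 := by
    rintro rfl
    rw [zero_smul, zero_sub, neg_mem_iff] at h4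
    exact hx' ((S'.smul_mem_iff hne).1 h4)
  have h5 : f - (c⁻¹ * (χ₂' (pUnit p) : κ) ^ (m + 1)) • x ∈ S' := by
    have := S'.smul_mem c⁻¹ h4
    rwa [smul_sub, smul_smul, smul_smul, inv_mul_cancel₀ hc0, one_smul] at this
  exact (hd.of_sub_mem hS' _ h5).unique (h.data.mono bot_le) hf

lemma twist (h : IsOrdinary ρ f χ₁ χ₂) (χ : QpChar) :
    IsOrdinary (twist ρ (χ.comp det)) f (χ₁ * χ) (χ₂ * χ) := by
  have hle : (borelSpan ρ fun _ : Unit => f)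
      ≤ borelSpan (ModPLLC.twist ρ (χ.comp det)) fun _ : Unit => f := by
    refine span_le.2 ?_
    rintro _ ⟨i, b, n, rfl⟩
    have h1 : ModPLLC.twist ρ (χ.comp det) (uni b * matF p ^ n) f
        ∈ borelSpan (ModPLLC.twist ρ (χ.comp det)) fun _ : Unit => f :=
      subset_span ⟨i, b, n, rfl⟩
    rw [twist_apply] at h1
    exact (Submodule.smul_mem_iff _ (Units.ne_zero _)).1 h1
  refine ⟨h.ne_zero, h.data.twist χ, fun b w => ?_, ?_⟩
  · rw [twist_apply, comp_apply, det_uni, map_one, val_one, one_smul]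
    exact hle (h.uni_sub_mem b w)
  · obtain ⟨z, hz⟩ := h.exists_sup
    exact ⟨z, top_le_iff.1 (hz ▸ sup_le_sup_right hle _)⟩

/-- The invariant of stable subspaces which bounds the length. -/
lemma lt_of_lt (h : IsOrdinary ρ f χ₁ χ₂) {S' : Submodule κ W} (hS : IsStable ρ S)
    (hS' : IsStable ρ S') (hlt : S < S') :
    (f ∉ S ∧ f ∈ S') ∨ (((f ∈ S) ↔ f ∈ S') ∧ S ≤ (borelSpan ρ fun _ : Unit => f) ∧
      ¬ S' ≤ (borelSpan ρ fun _ : Unit => f)) := by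
  obtain ⟨z, hz⟩ := h.exists_sup
  set A := borelSpan ρ fun _ : Unit => f with hA
  have hdec : ∀ w, ∃ a ∈ A, ∃ c : κ, w = a + c • z := by
    intro w
    have hw : w ∈ A ⊔ span κ {z} := by rw [hz]; trivial
    obtain ⟨a, ha, y, hy, rfl⟩ := Submodule.mem_sup.1 hw
    obtain ⟨c, rfl⟩ := Submodule.mem_span_singleton.1 hy
    exact ⟨a, ha, c, rfl⟩
  by_cases hfS : f ∈ S
  · right
    have hAS : A ≤ S := hS.borelSpan_le fun _ => hfS
    have hAS' : A ≤ S' := hAS.trans hlt.le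
    refine ⟨iff_of_true hfS (hlt.le hfS), ?_, fun hle => ?_⟩
    · by_contra hnle
      obtain ⟨w, hw, hwA⟩ := SetLike.not_le_iff_exists.1 hnle
      obtain ⟨a, ha, c, rfl⟩ := hdec w
      have hc : c ≠ 0 := by
        rintro rfl
        rw [zero_smul, add_zero] at hwA
        exact hwA ha
      have hzS : z ∈ S := by
        refine (S.smul_mem_iff hc).1 ?_
        have := sub_mem hw (hAS ha)
        rwa [add_sub_cancel_left] at this
      refine hlt.not_ge fun w' _ => ?_
      obtain ⟨a', ha', c', rfl⟩ := hdec w'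
      exact add_mem (hAS ha') (S.smul_mem _ hzS)
    · exact hlt.not_ge (hle.trans hAS)
  · by_cases hfS' : f ∈ S'
    · exact Or.inl ⟨hfS, hfS'⟩
    right
    have hSA : ∀ T : Submodule κ W, IsStable ρ T → f ∉ T → ∀ w ∈ T, w ∈ A → w = 0 :=
      fun T hT hfT w hw hwA => by
        by_contra hw0
        exact hfT (h.mem_of_mem_borelSpan hT hw hwA hw0)
    refine ⟨iff_of_false hfS hfS', ?_, fun hle => ?_⟩
    · by_contra hnle
      obtain ⟨w, hw, hwA⟩ := SetLike.not_le_iff_exists.1 hnle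
      obtain ⟨a, ha, c, rfl⟩ := hdec w
      have hc : c ≠ 0 := by
        rintro rfl
        rw [zero_smul, add_zero] at hwA
        exact hwA ha
      refine hlt.not_ge fun w' hw' => ?_
      obtain ⟨a', ha', c', rfl⟩ := hdec w'
      have h1 : (a' + c' • z) - (c' * c⁻¹) • (a + c • z) ∈ S' :=
        sub_mem hw' (S'.smul_mem _ (hlt.le hw))
      have h2 : (a' + c' • z) - (c' * c⁻¹) • (a + c • z) = a' - (c' * c⁻¹) • a := by
        rw [smul_add, smul_smul, mul_assoc, inv_mul_cancel₀ hc, mul_one]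
        module
      have h3 := hSA S' hS' hfS' _ h1 (by
        rw [h2]
        exact sub_mem ha' (A.smul_mem _ ha))
      rw [sub_eq_zero.1 h3]
      exact S.smul_mem _ hw
    · refine hlt.not_ge fun w hw => ?_
      rw [hSA S' hS' hfS' w hw (hle hw)]
      exact zero_mem _

end IsOrdinary

end OrdinaryVectors

section OrdinaryHeckeVectors

variable {W : Type*} [AddCommGroup W] [Module κ W]
  {ρ : GL2Rep W} {r : ℕ} {a : κˣ} {v f z : W}
  {χ₁ χ₂ : QpChar}

lemma HeckeVec.hasDataMod (h : HeckeVec ρ r (a : κ) v) (hr : r ≠ 0) :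
    HasDataMod ρ ⊥ v (unrQp a⁻¹) (omegaQp p ^ r * unrQp a) := by
  refine ⟨fun b => ?_, fun c d => ?_, ?_, ?_⟩
  · rw [h.uni_smul, sub_self]
    exact zero_mem _
  · rw [h.iwahori ⟨_, diagK_mem_iwahori c d⟩]
    simp only [MonoidHom.mul_apply, pow_apply, unrQp_unitQ, mul_one]
    rw [val_pow_eq_pow_val, omegaQp_unitQ]
    simp [diagK]
  · simp only [MonoidHom.mul_apply, pow_apply, unrQp_pUnit, omegaQp_pUnit]
    rw [h.pScalar]
    simp
  · simp only [MonoidHom.mul_apply, pow_apply, unrQp_pUnit, omegaQp_pUnit]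
    have := h.sum_matX
    rw [if_neg hr, zero_smul, add_zero] at this
    rw [this]
    simp

lemma isOrdinary_of_generator (hf : f ≠ 0) (hd : HasDataMod ρ ⊥ f χ₁ χ₂)
    (hz : ∀ b : ℤ_[p], ρ (uni ((p : ℚ_[p]) * (b : ℚ_[p]))) z = z) {c : κ} (hc : c ≠ 0)
    (hFz : ρ (matF p)⁻¹ z - c • z ∈ borelSpan ρ fun _ : Unit => f) {u : Fin 2 → W}
    (hu : borelSpan ρ u = ⊤)
    (huz : ∀ i, u i ∈ (borelSpan ρ fun _ : Unit => f) ⊔ span κ {z}) :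
    IsOrdinary ρ f χ₁ χ₂ := by
  set A := borelSpan ρ fun _ : Unit => f with hA
  have hFz' : ρ (matF p) z - c⁻¹ • z ∈ A := by
    have h1 := matF_zpow_mem_borelSpan hFz 1
    rw [zpow_one, map_sub, map_smul, ρ.self_inv_apply] at h1
    have h2 := A.smul_mem (-c⁻¹) h1
    rw [smul_sub, smul_smul, neg_mul, inv_mul_cancel₀ hc, neg_smul, neg_smul, one_smul] at h2
    convert h2 using 1
    module
  have hFn : ∀ n : ℤ, ∃ e : κ, e ≠ 0 ∧ ρ (matF p ^ n) z - e • z ∈ A := by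
    intro n
    induction n with
    | zero => exact ⟨1, one_ne_zero, by simp⟩
    | succ n ih =>
      obtain ⟨e, he, h1⟩ := ih
      refine ⟨e * c⁻¹, mul_ne_zero he (inv_ne_zero hc), ?_⟩
      have h2 := matF_zpow_mem_borelSpan h1 1
      rw [map_sub, ← mul_apply, ← map_mul, ← zpow_add, map_smul, zpow_one] at h2
      have h3 := add_mem h2 (A.smul_mem e hFz')
      rw [smul_sub, smul_smul] at h3
      rw [add_comm (n : ℤ)]
      convert h3 using 1
      module
    | pred n ih =>
      obtain ⟨e, he, h1⟩ := ih
      refine ⟨e * c, mul_ne_zero he hc, ?_⟩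
      have h2 := matF_zpow_mem_borelSpan h1 (-1)
      rw [map_sub, ← mul_apply, ← map_mul, ← zpow_add, map_smul, zpow_neg_one] at h2
      have h3 := add_mem h2 (A.smul_mem e hFz)
      rw [smul_sub, smul_smul] at h3
      rw [sub_eq_neg_add (-(n : ℤ)) 1]
      rwa [sub_add_sub_cancel] at h3
  have huni : ∀ b : ℚ_[p], ρ (uni b) z - z ∈ A := by
    intro b
    obtain ⟨N, d, hN⟩ := exists_pow_mul_eq_coe b
    obtain ⟨e, he, h1⟩ := hFn (-((N : ℤ) + 1))
    have h2 : ρ (uni b) (ρ (matF p ^ (-((N : ℤ) + 1))) z) = ρ (matF p ^ (-((N : ℤ) + 1))) z := by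
      have e1 : uni b * matF p ^ (-((N : ℤ) + 1))
          = matF p ^ (-((N : ℤ) + 1)) * uni ((p : ℚ_[p]) * (d : ℚ_[p])) := by
        rw [matF_zpow_mul_uni, ← hN, ← mul_assoc (p : ℚ_[p]), ← pow_succ', ← zpow_natCast,
          ← mul_assoc, ← zpow_add₀ padic_p_ne_zero]
        simp
      rw [← mul_apply, ← map_mul, e1, map_mul, mul_apply, hz]
    have h3 := sub_mem h1 (uni_mem_borelSpan h1 b)
    rw [map_sub, h2, map_smul, sub_sub_sub_cancel_left, ← smul_sub] at h3
    exact (A.smul_mem_iff he).1 h3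
  have htop : A ⊔ span κ {z} = ⊤ := by
    rw [eq_top_iff, ← hu]
    refine span_le.2 ?_
    rintro _ ⟨i, b, n, rfl⟩
    obtain ⟨x, hx, y, hy, hxy⟩ := Submodule.mem_sup.1 (huz i)
    obtain ⟨l, rfl⟩ := Submodule.mem_span_singleton.1 hy
    obtain ⟨e, he, h1⟩ := hFn n
    have h2 : ρ (uni b * matF p ^ n) (u i) = (ρ (uni b) (ρ (matF p ^ n) x)
        + l • (ρ (uni b) (ρ (matF p ^ n) z - e • z) + e • (ρ (uni b) z - z))) + (l * e) • z := by
      rw [← hxy, map_mul, mul_apply]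
      simp only [map_add, map_sub, map_smul]
      module
    change _ ∈ A ⊔ span κ {z}
    rw [h2]
    refine add_mem (Submodule.mem_sup_left (add_mem ?_ (A.smul_mem _ (add_mem ?_
      (A.smul_mem _ (huni b)))))) (Submodule.mem_sup_right ?_)
    · exact uni_mem_borelSpan (matF_zpow_mem_borelSpan hx n) b
    · exact uni_mem_borelSpan h1 b
    · exact Submodule.smul_mem _ _ (Submodule.mem_span_singleton_self z)
  refine ⟨hf, hd, fun b w => ?_, z, htop⟩
  have hw : w ∈ A ⊔ span κ {z} := by rw [htop]; trivial
  obtain ⟨x, hx, y, hy, rfl⟩ := Submodule.mem_sup.1 hw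
  obtain ⟨l, rfl⟩ := Submodule.mem_span_singleton.1 hy
  have : ρ (uni b) (x + l • z) - (x + l • z) = (ρ (uni b) x - x) + l • (ρ (uni b) z - z) := by
    rw [map_add, map_smul]
    module
  rw [this]
  exact add_mem (sub_mem (uni_mem_borelSpan hx b) hx) (A.smul_mem _ (huni b))

lemma HeckeVec.matF_inv_matK (h : HeckeVec ρ r (a : κ) v) :
    ρ (matF p)⁻¹ (ρ (inclK p (matK 0)) v) = ρ (matBeta p) v := by
  have e : matF p * matBeta p = inclK p (matK 0) * ModPLLC.pScalar p := by
    rw [← matK_zero_mul_matBeta, mul_assoc, matBeta_mul_self]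
  have h1 : ρ (matF p) (ρ (matBeta p) v) = ρ (inclK p (matK 0)) v := by
    rw [← mul_apply, ← map_mul, e, map_mul, mul_apply, h.pScalar]
  rw [← h1, ρ.inv_self_apply]

lemma HeckeVec.matX_mem_borelSpan (t : ZMod p) :
    ρ (matX t) v ∈ borelSpan ρ fun _ : Unit => v := by
  rw [matX_eq_uni]
  exact subset_span ⟨(), _, 1, by rw [zpow_one]⟩

theorem HeckeVec.isOrdinary (h : HeckeVec ρ r (a : κ) v) (hr : r ≠ 0)
    (hg : Generates ρ v) (hv : v ≠ 0) :
    IsOrdinary ρ v (unrQp a⁻¹) (omegaQp p ^ r * unrQp a) := by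
  refine isOrdinary_of_generator (z := ρ (inclK p (matK 0)) v) (u := ![v, ρ (inclK p (matK 0)) v])
    hv (h.hasDataMod hr) (fun b => ?_) a.ne_zero ?_ (h.borelSpan_eq_top hg rfl rfl) fun i => ?_
  · have hk : mkK 1 0 ((p : ℤ_[p]) * b) 1 (by simp) ∈ ModPLLC.iwahori p := by rw [mem_iwahori]; simp
    have e : uni ((p : ℚ_[p]) * (b : ℚ_[p])) * inclK p (matK 0)
        = inclK p (matK 0) * inclK p (mkK 1 0 ((p : ℤ_[p]) * b) 1 (by simp)) := by
      refine Units.ext ?_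
      rw [val_mul, val_mul]
      simp [uni, matK, teich]
    rw [← mul_apply, ← map_mul, e, map_mul, mul_apply, h.iwahori ⟨_, hk⟩]
    simp
  · rw [h.matF_inv_matK, ← h.matBeta_add_sum_matX 0, sub_add_cancel_left, neg_mem_iff]
    exact sum_mem fun t _ => Submodule.smul_mem _ _ (HeckeVec.matX_mem_borelSpan t)
  · fin_cases i
    · exact Submodule.mem_sup_left (mem_borelSpan (v := fun _ : Unit => v) ())
    · exact Submodule.mem_sup_right (Submodule.mem_span_singleton_self _)

lemma HeckeVec.matK_zero_smul (h : HeckeVec ρ 0 (a : κ) v) (s : ZMod p) :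
    ρ (inclK p (matK s)) v = v := by
  have h1 := h.matBeta_add_sum_matX s
  have h2 := h.sum_matX
  simp only [pow_zero, one_smul, if_true] at h1 h2
  rw [add_comm, h2] at h1
  exact (smul_right_injective W a.ne_zero h1).symm

lemma omegaQp_pow_pred : omegaQp p ^ (p - 1) = 1 := by
  refine char_ext ?_ fun u => Units.ext ?_
  · rw [pow_apply, omegaQp_pUnit, one_pow, MonoidHom.one_apply]
  · rw [pow_apply, val_pow_eq_pow_val, omegaQp_unitQ, toFpbar, RingHom.comp_apply,
      ← map_pow, ZMod.pow_card_sub_one_eq_one, map_one, MonoidHom.one_apply, val_one]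
    exact isUnit_iff_toZMod_ne_zero.1 u.isUnit

theorem HeckeVec.isOrdinary_zero (h : HeckeVec ρ 0 (a : κ) v)
    (hg : Generates ρ v) (hf : (a : κ) • v - ρ (matBeta p) v ≠ 0) :
    IsOrdinary ρ ((a : κ) • v - ρ (matBeta p) v) (unrQp a⁻¹) (omegaQp p ^ 0 * unrQp a) := by
  have hp2 := (Fact.out : p.Prime).two_le
  have hd := h.sub_matBeta.hasDataMod (by omega)
  rw [omegaQp_pow_pred, ← pow_zero (omegaQp p)] at hd
  refine isOrdinary_of_generator (z := v) (u := ![v, ρ (inclK p (matK 0)) v])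
    hf hd (fun b => ?_) a.ne_zero ?_ (h.borelSpan_eq_top hg rfl rfl) fun i => ?_
  · have := h.uni_smul (p * b)
    rwa [PadicInt.coe_mul, PadicInt.coe_natCast] at this
  · have h1 := h.matF_inv_matK
    rw [h.matK_zero_smul] at h1
    rw [h1, ← neg_mem_iff, neg_sub]
    exact mem_borelSpan (v := fun _ : Unit => (a : κ) • v - ρ (matBeta p) v) ()
  · have hi : ![v, ρ (inclK p (matK 0)) v] i = v := by
      fin_cases i
      · rfl
      · exact h.matK_zero_smul 0
    rw [hi]
    exact Submodule.mem_sup_right (Submodule.mem_span_singleton_self _)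

end OrdinaryHeckeVectors

section RowFunctions

open Classical in
/-- A character of `ℚ_pˣ`, extended by zero. -/
def extChar (χ : QpChar) (c : ℚ_[p]) : κ :=
  if h : c = 0 then 0 else χ (Units.mk0 c h)

lemma extChar_mul (χ : QpChar) (s : ℚ_[p]ˣ) (c : ℚ_[p]) :
    extChar χ ((s : ℚ_[p]) * c) = χ s * extChar χ c := by
  by_cases h : c = 0
  · simp [extChar, h]
  · have : Units.mk0 ((s : ℚ_[p]) * c) (mul_ne_zero s.ne_zero h) = s * Units.mk0 c h :=
      Units.ext rfl
    rw [extChar, extChar, dif_neg h, dif_neg (mul_ne_zero s.ne_zero h), this, map_mul, val_mul]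

/-- The function of a row `(c, d)` which is `χ(c)` if `v(c) ≤ v(d)`, and zero otherwise. -/
def rowChar (χ : QpChar) (c d : ℚ_[p]) : κ :=
  if ‖d‖ ≤ ‖c‖ then extChar χ c else 0

/-- The minimum of the valuations of the entries of a row. -/
def rowVal (c d : ℚ_[p]) : ℤ := if ‖d‖ ≤ ‖c‖ then c.valuation else d.valuation

lemma norm_mul_le_iff (s : ℚ_[p]ˣ) (c d : ℚ_[p]) : ‖(s : ℚ_[p]) * d‖ ≤ ‖(s : ℚ_[p]) * c‖ ↔ ‖d‖ ≤ ‖c‖ := by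
  rw [norm_mul, norm_mul]
  exact mul_le_mul_iff_right₀ (norm_pos_iff.2 s.ne_zero)

lemma rowChar_mul (χ : QpChar) (s : ℚ_[p]ˣ) (c d : ℚ_[p]) :
    rowChar χ ((s : ℚ_[p]) * c) ((s : ℚ_[p]) * d) = χ s * rowChar χ c d := by
  simp only [rowChar, norm_mul_le_iff, extChar_mul]
  split_ifs <;> simp

lemma norm_lt_one_of_not_isUnit {z : ℤ_[p]} (h : ¬ IsUnit z) : ‖(z : ℚ_[p])‖ < 1 := by
  rw [PadicInt.padic_norm_e_of_padicInt]
  exact PadicInt.mem_nonunits.1 h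

lemma norm_eq_one_of_isUnit {z : ℤ_[p]} (h : IsUnit z) : ‖(z : ℚ_[p])‖ = 1 := by
  rw [PadicInt.padic_norm_e_of_padicInt]
  exact PadicInt.isUnit_iff.1 h

lemma coe_ne_zero_of_isUnit {z : ℤ_[p]} (h : IsUnit z) : (z : ℚ_[p]) ≠ 0 := by
  rw [← norm_ne_zero_iff, norm_eq_one_of_isUnit h]
  exact one_ne_zero

/-- A primitive row has an entry which is a unit. -/
def IsPrimitiveRow (z w : ℤ_[p]) : Prop := IsUnit z ∨ IsUnit w

lemma IsPrimitiveRow.ne_zero {z w : ℤ_[p]} (h : IsPrimitiveRow z w) :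
    (z : ℚ_[p]) ≠ 0 ∨ (w : ℚ_[p]) ≠ 0 := by
  exact h.imp (fun h => coe_ne_zero_of_isUnit h) fun h => coe_ne_zero_of_isUnit h

lemma rowVal_mul (s : ℚ_[p]ˣ) {c d : ℚ_[p]} (h : c ≠ 0 ∨ d ≠ 0) :
    rowVal ((s : ℚ_[p]) * c) ((s : ℚ_[p]) * d) = (s : ℚ_[p]).valuation + rowVal c d := by
  simp only [rowVal, norm_mul_le_iff]
  split_ifs with hcd
  · refine Padic.valuation_mul s.ne_zero ?_
    rintro rfl
    rw [norm_zero] at hcd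
    exact h.elim (fun h => h rfl) fun h => h (norm_le_zero_iff.1 hcd)
  · refine Padic.valuation_mul s.ne_zero ?_
    rintro rfl
    simp at hcd

lemma valuation_of_isUnit {z : ℤ_[p]} (h : IsUnit z) : (z : ℚ_[p]).valuation = 0 := by
  obtain ⟨u, rfl⟩ := h
  exact valuation_unitQ u

lemma IsPrimitiveRow.norm_le_iff {z w : ℤ_[p]} (h : IsPrimitiveRow z w) :
    ‖(w : ℚ_[p])‖ ≤ ‖(z : ℚ_[p])‖ ↔ IsUnit z := by
  constructor
  · intro hle
    by_contra hz
    have hw := norm_eq_one_of_isUnit (h.resolve_left hz)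
    rw [hw] at hle
    exact absurd (norm_lt_one_of_not_isUnit hz) (not_lt.2 hle)
  · intro hz
    rw [norm_eq_one_of_isUnit hz]
    exact PadicInt.norm_le_one w

lemma IsPrimitiveRow.rowVal {z w : ℤ_[p]} (h : IsPrimitiveRow z w) :
    rowVal (z : ℚ_[p]) w = 0 := by
  rw [ModPLLC.rowVal]
  split_ifs with hz <;> rw [h.norm_le_iff] at hz
  · exact valuation_of_isUnit hz
  · exact valuation_of_isUnit (h.resolve_left hz)

lemma IsPrimitiveRow.rowChar {z w : ℤ_[p]} (h : IsPrimitiveRow z w) {r : ℕ} (hr : r ≠ 0)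
    (a : κˣ) :
    rowChar (omegaQp p ^ r * unrQp a) (z : ℚ_[p]) w = toFpbar p z ^ r := by
  rw [ModPLLC.rowChar]
  split_ifs with hz <;> rw [h.norm_le_iff] at hz
  · obtain ⟨u, rfl⟩ := hz
    have hne := coe_ne_zero_of_isUnit u.isUnit
    have e : Units.mk0 ((u : ℤ_[p]) : ℚ_[p]) hne = unitQ p u := Units.ext rfl
    rw [extChar, dif_neg hne, e]
    simp [omegaQp_unitQ]
  · rw [isUnit_iff_toZMod_ne_zero, not_not] at hz
    rw [toFpbar, RingHom.comp_apply, hz, map_zero, zero_pow hr]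

lemma exists_primitive_row {c d : ℚ_[p]} (h : c ≠ 0 ∨ d ≠ 0) :
    ∃ (s : ℚ_[p]ˣ) (z w : ℤ_[p]), c = s * z ∧ d = s * w ∧ IsPrimitiveRow z w := by
  by_cases hcd : ‖d‖ ≤ ‖c‖
  · have hc : c ≠ 0 := by
      rintro rfl
      rw [norm_zero] at hcd
      exact h.elim (fun h => h rfl) fun h => h (norm_le_zero_iff.1 hcd)
    refine ⟨Units.mk0 c hc, 1, ⟨d / c, ?_⟩, by simp, ?_, Or.inl isUnit_one⟩
    · rw [norm_div]
      exact div_le_one_of_le₀ hcd (norm_nonneg _)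
    · change d = c * (d / c)
      field_simp
  · have hd : d ≠ 0 := by
      rintro rfl
      simp at hcd
    refine ⟨Units.mk0 d hd, ⟨c / d, ?_⟩, 1, ?_, by simp, Or.inr isUnit_one⟩
    · rw [norm_div]
      exact div_le_one_of_le₀ (not_le.1 hcd).le (norm_nonneg _)
    · change c = d * (c / d)
      field_simp

lemma isPrimitiveRow_iff {z w : ℤ_[p]} :
    IsPrimitiveRow z w ↔ toZMod z ≠ 0 ∨ toZMod w ≠ 0 := by
  rw [IsPrimitiveRow, isUnit_iff_toZMod_ne_zero, isUnit_iff_toZMod_ne_zero]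

lemma exists_row (x : GL2Qp p) : ∃ (s : ℚ_[p]ˣ) (z w : ℤ_[p]),
    x 1 0 = s * z ∧ x 1 1 = s * w ∧ IsPrimitiveRow z w := by
  refine exists_primitive_row ?_
  by_contra! h
  have := Matrix.GeneralLinearGroup.det_ne_zero x
  rw [Matrix.det_fin_two, h.1, h.2] at this
  simp at this

lemma IsPrimitiveRow.mul {z w : ℤ_[p]} (h : IsPrimitiveRow z w) (k : GL2Zp p) :
    IsPrimitiveRow (z * k 0 0 + w * k 1 0) (z * k 0 1 + w * k 1 1) := by
  rw [isPrimitiveRow_iff] at h ⊢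
  by_contra! hcon
  have hd := isUnit_iff_toZMod_ne_zero.1 (isUnit_det k)
  obtain ⟨h1, h2⟩ := hcon
  simp only [map_add, map_mul, map_sub] at h1 h2 hd
  rcases h with h | h
  · refine h ((mul_eq_zero.1 ?_).resolve_right hd)
    linear_combination toZMod (k 1 1 : ℤ_[p]) * h1 - toZMod (k 1 0 : ℤ_[p]) * h2
  · refine h ((mul_eq_zero.1 ?_).resolve_right hd)
    linear_combination toZMod (k 0 0 : ℤ_[p]) * h2 - toZMod (k 0 1 : ℤ_[p]) * h1

/-- The action of `G` by right translation on functions. -/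
def rightTranslation (p : ℕ) [Fact p.Prime] :
    GL2Rep (GL2Qp p → κ) where
  toFun g := LinearMap.funLeft κ κ fun x => x * g
  map_one' := by ext; simp [LinearMap.funLeft]
  map_mul' g h := by ext; simp [LinearMap.funLeft, mul_assoc]

@[simp] lemma rightTranslation_apply (g : GL2Qp p) (φ : GL2Qp p → κ) (x : GL2Qp p) :
    rightTranslation p g φ x = φ (x * g) := rfl

lemma row_mul_zero (x y : GL2Qp p) : (x * y) 1 0 = x 1 0 * y 0 0 + x 1 1 * y 1 0 := by
  rw [val_mul, Matrix.mul_apply, Fin.sum_univ_two]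

lemma row_mul_one (x y : GL2Qp p) : (x * y) 1 1 = x 1 0 * y 0 1 + x 1 1 * y 1 1 := by
  rw [val_mul, Matrix.mul_apply, Fin.sum_univ_two]

section

variable {x : GL2Qp p} {s : ℚ_[p]ˣ} {z w : ℤ_[p]}

lemma row_mul_inclK (h0 : x 1 0 = s * z) (h1 : x 1 1 = s * w) (k : GL2Zp p) :
    (x * inclK p k) 1 0 = s * ((z * k 0 0 + w * k 1 0 : ℤ_[p]) : ℚ_[p]) ∧
    (x * inclK p k) 1 1 = s * ((z * k 0 1 + w * k 1 1 : ℤ_[p]) : ℚ_[p]) := by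
  rw [row_mul_zero, row_mul_one, h0, h1, coe_inclK]
  constructor <;> simp <;> ring

lemma row_mul_pScalar (h0 : x 1 0 = s * z) (h1 : x 1 1 = s * w) :
    (x * pScalar p) 1 0 = (s * pUnit p : ℚ_[p]ˣ) * z ∧
    (x * pScalar p) 1 1 = (s * pUnit p : ℚ_[p]ˣ) * w := by
  rw [row_mul_zero, row_mul_one, h0, h1, coe_pScalar]
  constructor <;> simp <;> ring

/-- The lower row of `x X_t`: it is primitive unless `w + [t] z` is divisible by `p`. -/
lemma row_mul_matX (hrow : IsPrimitiveRow z w) (h0 : x 1 0 = s * z) (h1 : x 1 1 = s * w)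
    (t : ZMod p) :
    ∃ (s' : ℚ_[p]ˣ) (z' w' : ℤ_[p]), (x * matX t) 1 0 = s' * z' ∧ (x * matX t) 1 1 = s' * w' ∧
      IsPrimitiveRow z' w' ∧
      ((toZMod w + t * toZMod z = 0 ∧ s' = s * pUnit p ∧ z' = z) ∨
       (toZMod w + t * toZMod z ≠ 0 ∧ s' = s ∧ z' = (p : ℤ_[p]) * z)) := by
  rw [row_mul_zero, row_mul_one, h0, h1, matX, coe_mkG]
  by_cases ht : toZMod w + t * toZMod z = 0
  · obtain ⟨y, hy⟩ := toZMod_eq_zero_iff.1 (show toZMod (w + teich t * z) = 0 by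
      rw [map_add, map_mul, toZMod_teich, ht])
    have hy' : (w : ℚ_[p]) + (teich t : ℤ_[p]) * z = p * y := by exact_mod_cast congrArg _ hy
    refine ⟨s * pUnit p, z, y, ?_, ?_, ?_, Or.inl ⟨ht, rfl, rfl⟩⟩
    · simp; ring
    · simp only [val_mul, coe_pUnit]
      simp
      linear_combination (s : ℚ_[p]) * hy'
    · rw [isPrimitiveRow_iff] at hrow
      refine Or.inl (isUnit_iff_toZMod_ne_zero.2 fun hz => ?_)
      rw [hz, mul_zero, add_zero] at ht
      exact hrow.elim (fun h => h hz) fun h => h ht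
  · refine ⟨s, p * z, w + teich t * z, ?_, ?_, Or.inr (isUnit_iff_toZMod_ne_zero.2 ?_),
      Or.inr ⟨ht, rfl, rfl⟩⟩
    · simp; ring
    · simp; ring
    · rwa [map_add, map_mul, toZMod_teich]

lemma row_mul_matBeta (hrow : IsPrimitiveRow z w) (h0 : x 1 0 = s * z) (h1 : x 1 1 = s * w) :
    ∃ (s' : ℚ_[p]ˣ) (z' w' : ℤ_[p]), (x * matBeta p) 1 0 = s' * z' ∧
      (x * matBeta p) 1 1 = s' * w' ∧ IsPrimitiveRow z' w' ∧
      ((toZMod z = 0 ∧ s' = s * pUnit p ∧ z' = w) ∨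
       (toZMod z ≠ 0 ∧ s' = s ∧ z' = (p : ℤ_[p]) * w)) := by
  rw [row_mul_zero, row_mul_one, h0, h1, matBeta, coe_mkG]
  by_cases hz : toZMod z = 0
  · obtain ⟨y, rfl⟩ := toZMod_eq_zero_iff.1 hz
    rw [isPrimitiveRow_iff] at hrow
    refine ⟨s * pUnit p, w, y, ?_, ?_, Or.inl (isUnit_iff_toZMod_ne_zero.2 ?_),
      Or.inl ⟨hz, rfl, rfl⟩⟩
    · simp; ring
    · simp; ring
    · exact hrow.resolve_left fun h => h hz
  · refine ⟨s, p * w, z, ?_, ?_, Or.inr (isUnit_iff_toZMod_ne_zero.2 hz), Or.inr ⟨hz, rfl, rfl⟩⟩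
    · simp; ring
    · simp

end

lemma toFpbar_eq_zero_of {z : ℤ_[p]} (h : toZMod z = 0) : toFpbar p z = 0 := by
  rw [toFpbar, RingHom.comp_apply, h, map_zero]

lemma toFpbar_p_mul (z : ℤ_[p]) : toFpbar p (p * z) = 0 :=
  toFpbar_eq_zero_of (toZMod_eq_zero_iff.2 ⟨z, rfl⟩)

/-- The function `x ↦ χ(c) λ ^ (-val(det x))`, where `χ = ω ^ r μ_{λ²}`, on the elements with lower
row `(c, d)` such that `v(c) ≤ v(d)`. -/
def principalVec (p : ℕ) [Fact p.Prime] (r : ℕ) (a : κˣ) (x : GL2Qp p) : κ :=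
  rowChar (omegaQp p ^ r * unrQp (a ^ 2)) (x 1 0) (x 1 1)
    * (unrQp a⁻¹ (det x) : κˣ)

lemma sum_pow_ZMod {r : ℕ} (hr : r ≠ 0) (hrp : r ≤ p - 1) (u : ZMod p) :
    ∑ t : ZMod p, (u + t) ^ r = if r = p - 1 then -1 else 0 := by
  rw [Fintype.sum_equiv (Equiv.addLeft u) (fun t => (u + t) ^ r) (fun t => t ^ r) fun _ => rfl]
  split_ifs with h
  · subst h
    have h1 : ∀ t : ZMod p, t ^ (p - 1) = if t = 0 then 0 else 1 := fun t => by
      split_ifs with ht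
      · rw [ht, zero_pow hr]
      · exact ZMod.pow_card_sub_one_eq_one ht
    have h2 : ∀ t : ZMod p, t ^ (p - 1) = 1 - if t = 0 then 1 else 0 := fun t => by
      rw [h1]
      split_ifs <;> simp
    simp_rw [h2]
    rw [Finset.sum_sub_distrib, Finset.sum_ite_eq' Finset.univ (0 : ZMod p)]
    simp
  · refine FiniteField.sum_pow_lt_card_sub_one _ _ ?_
    rw [ZMod.card]
    omega

theorem heckeVec_principalVec {r : ℕ} (hr : r ≠ 0) (hrp : r ≤ p - 1) (a : κˣ) :
    HeckeVec (rightTranslation p) r (a : κ) (principalVec p r a) := by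
  have hval : ∀ (x : GL2Qp p) (s : ℚ_[p]ˣ) (z w : ℤ_[p]), x 1 0 = s * z → x 1 1 = s * w →
      IsPrimitiveRow z w → principalVec p r a x = (((omegaQp p ^ r * unrQp (a ^ 2) : QpChar) s : κˣ) : κ)
        * toFpbar p z ^ r * (unrQp a⁻¹ (det x) : κˣ) := by
    intro x s z w h0 h1 hrow
    rw [principalVec, h0, h1, rowChar_mul, hrow.rowChar hr]
  refine ⟨fun k => ?_, ?_, ?_, ?_⟩
  · ext x
    obtain ⟨s, z, w, h0, h1, hrow⟩ := exists_row x
    obtain ⟨h0', h1'⟩ := row_mul_inclK h0 h1 (k : GL2Zp p)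
    rw [rightTranslation_apply, Pi.smul_apply, hval x s z w h0 h1 hrow, hval _ _ _ _ h0' h1'
      (hrow.mul _), map_mul, det_inclK, map_mul, unrQp_unitQ, map_add, map_mul, map_mul,
      toFpbar_eq_zero_of k.2, smul_eq_mul]
    simp only [mul_one, mul_zero, add_zero, mul_pow]
    ring
  · ext x
    obtain ⟨s, z, w, h0, h1, hrow⟩ := exists_row x
    obtain ⟨h0', h1'⟩ := row_mul_pScalar h0 h1
    rw [rightTranslation_apply, hval x s z w h0 h1 hrow, hval _ _ _ _ h0' h1' hrow, map_mul det, det_pScalar]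
    simp only [map_mul, MonoidHom.mul_apply, pow_apply, unrQp_pUnit, omegaQp_pUnit]
    push_cast
    have := a.ne_zero
    field_simp
    rw [one_pow, one_mul]
  · ext x
    obtain ⟨s, z, w, h0, h1, hrow⟩ := exists_row x
    have h2 : ∀ t : ZMod p, principalVec p r a (x * inclK p (matK t))
        = (((omegaQp p ^ r * unrQp (a ^ 2) : QpChar) s : κˣ) : κ)
        * ofFp ((toZMod z * t + toZMod w) ^ r)
        * (unrQp a⁻¹ (det x) : κˣ) := by
      intro t
      obtain ⟨h0', h1'⟩ := row_mul_inclK h0 h1 (matK t)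
      rw [hval _ _ _ _ h0' h1' (hrow.mul _), map_mul, det_inclK, map_mul, unrQp_unitQ, mul_one]
      congr 2
      simp [matK, toFpbar, toZMod_teich]
    rw [Pi.add_apply, Finset.sum_apply]
    simp only [rightTranslation_apply, h2]
    rw [← Finset.sum_mul, ← Finset.mul_sum, ← map_sum, Pi.smul_apply, hval x s z w h0 h1 hrow,
      Pi.zero_apply]
    have key : ∑ t : ZMod p, (toZMod z * t + toZMod w) ^ r
        = - ((if r = p - 1 then 1 else 0) * toZMod z ^ r) := by
      by_cases hz : toZMod z = 0
      · simp [hz, hr]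
      · have : ∀ t : ZMod p, (toZMod z * t + toZMod w) ^ r
            = toZMod z ^ r * (toZMod w / toZMod z + t) ^ r := by
          intro t
          rw [← mul_pow]
          congr 1
          field_simp
          ring
        simp_rw [this]
        rw [← Finset.mul_sum, sum_pow_ZMod hr hrp]
        split_ifs <;> ring
    rw [key, smul_eq_mul, toFpbar, RingHom.comp_apply]
    split_ifs <;> simp
  · ext x
    obtain ⟨s, z, w, h0, h1, hrow⟩ := exists_row x
    have h2 : ∀ t : ZMod p, principalVec p r a (x * matX t)
        = if toZMod w + t * toZMod z = 0 then
          (a : κ) * principalVec p r a x else 0 := by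
      intro t
      obtain ⟨s', z', w', h0', h1', hrow', ⟨ht, rfl, rfl⟩ | ⟨ht, rfl, rfl⟩⟩ := row_mul_matX hrow h0 h1 t
      · rw [if_pos ht, hval _ _ _ _ h0' h1' hrow', hval x s _ w h0 h1 hrow, map_mul det, det_matX]
        simp only [map_mul, MonoidHom.mul_apply, pow_apply, unrQp_pUnit, omegaQp_pUnit]
        push_cast
        have := a.ne_zero
        field_simp
        rw [one_pow, one_mul]
      · rw [if_neg ht, hval _ _ _ _ h0' h1' hrow', toFpbar_p_mul, zero_pow hr]
        simp
    rw [if_neg hr, zero_smul, add_zero, Finset.sum_apply]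
    simp only [rightTranslation_apply, h2]
    rw [Pi.smul_apply, smul_eq_mul]
    by_cases hz : toZMod z = 0
    · rw [hval x s z w h0 h1 hrow, toFpbar_eq_zero_of hz, zero_pow hr]
      simp
    · have : ∀ t : ZMod p, toZMod w + t * toZMod z = 0 ↔
          t = - toZMod w / toZMod z := by
        intro t
        rw [eq_div_iff hz, ← sub_eq_zero (a := t * _)]
        simp [add_comm]
      simp only [this, Finset.sum_ite_eq', Finset.mem_univ, if_true]

lemma principalVec_one {r : ℕ} (hr : r ≠ 0) (a : κˣ) :
    principalVec p r a 1 = 0 ∧ principalVec p r a (inclK p (matK 0)) ≠ 0 := by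
  constructor
  · simp [principalVec, rowChar]
  · have h : principalVec p r a (inclK p (matK 0)) = toFpbar p 1 ^ r := by
      have h1 : IsPrimitiveRow (p := p) 1 0 := Or.inl isUnit_one
      have := h1.rowChar hr (a ^ 2)
      rw [principalVec, det_inclK, unrQp_unitQ, coe_inclK]
      simpa [matK] using this
    rw [h]
    simp

/-- The function `x ↦ λ ^ val(det x)`. -/
def detVec (p : ℕ) [Fact p.Prime] (a : κˣ) (x : GL2Qp p) : κ :=
  (unrQp a (det x) : κˣ)

/-- The function `x ↦ λ ^ val(det x) (2 m - val(det x))`, where `m` is the minimum of the valuations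
of the entries in the lower row. -/
def steinbergVec (p : ℕ) [Fact p.Prime] (a : κˣ) (x : GL2Qp p) : κ :=
  detVec p a x * (2 * (rowVal (x 1 0) (x 1 1) : ℤ)
    - ((det x : ℚ_[p]ˣ) : ℚ_[p]).valuation)

lemma detVec_mul (a : κˣ) (x g : GL2Qp p) :
    detVec p a (x * g) = detVec p a g * detVec p a x := by
  rw [detVec, map_mul, map_mul, val_mul, mul_comm]
  rfl

lemma valuation_det_mul (x y : GL2Qp p) :
    ((det (x * y) : ℚ_[p]ˣ) : ℚ_[p]).valuation
      = ((det x : ℚ_[p]ˣ) : ℚ_[p]).valuation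
        + ((det y : ℚ_[p]ˣ) : ℚ_[p]).valuation := by
  rw [map_mul, val_mul, Padic.valuation_mul (Units.ne_zero _) (Units.ne_zero _)]

lemma detVec_line_le (a : κˣ) (g : GL2Qp p) :
    span κ {detVec p a}
      ≤ (span κ {detVec p a}).comap (rightTranslation p g) := by
  rw [Submodule.span_singleton_le_iff_mem, Submodule.mem_comap, Submodule.mem_span_singleton]
  refine ⟨detVec p a g, ?_⟩
  ext x
  rw [rightTranslation_apply, detVec_mul]
  rfl

lemma steinbergVec_eq {x : GL2Qp p} {s : ℚ_[p]ˣ} {z w : ℤ_[p]} (h0 : x 1 0 = s * z)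
    (h1 : x 1 1 = s * w) (hrow : IsPrimitiveRow z w) (a : κˣ) :
    steinbergVec p a x = detVec p a x * (2 * ((s : ℚ_[p]).valuation : ℤ)
      - ((det x : ℚ_[p]ˣ) : ℚ_[p]).valuation) := by
  rw [steinbergVec, h0, h1, rowVal_mul s hrow.ne_zero, hrow.rowVal, add_zero]

lemma valuation_mul_pUnit (s : ℚ_[p]ˣ) :
    ((s * pUnit p : ℚ_[p]ˣ) : ℚ_[p]).valuation = (s : ℚ_[p]).valuation + 1 := by
  rw [val_mul, Padic.valuation_mul (Units.ne_zero _) (Units.ne_zero _), coe_pUnit,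
    Padic.valuation_p]

lemma steinbergVec_inclK (a : κˣ) (k : GL2Zp p) (x : GL2Qp p) :
    steinbergVec p a (x * inclK p k) = steinbergVec p a x := by
  obtain ⟨s, z, w, h0, h1, hrow⟩ := exists_row x
  obtain ⟨h0', h1'⟩ := row_mul_inclK h0 h1 k
  rw [steinbergVec_eq h0 h1 hrow, steinbergVec_eq h0' h1' (hrow.mul _), detVec_mul,
    valuation_det_mul, det_inclK, valuation_unitQ, add_zero, detVec, det_inclK, unrQp_unitQ]
  simp

lemma steinbergVec_matX {x : GL2Qp p} {s : ℚ_[p]ˣ} {z w : ℤ_[p]} (h0 : x 1 0 = s * z)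
    (h1 : x 1 1 = s * w) (hrow : IsPrimitiveRow z w) (a : κˣ) (t : ZMod p) :
    steinbergVec p a (x * matX t) = (a : κ) * (steinbergVec p a x
      + (if toZMod w + t * toZMod z = 0 then 2 else 0) * detVec p a x
      - detVec p a x) := by
  have hd : detVec p a (matX t) = a := by rw [detVec, det_matX, unrQp_pUnit]
  obtain ⟨s', z', w', h0', h1', hrow', ⟨ht, rfl, rfl⟩ | ⟨ht, rfl, rfl⟩⟩ := row_mul_matX hrow h0 h1 t
  · rw [if_pos ht, steinbergVec_eq h0' h1' hrow', steinbergVec_eq h0 h1 hrow, detVec_mul,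
      valuation_det_mul, det_matX, hd, valuation_mul_pUnit, coe_pUnit, Padic.valuation_p]
    push_cast
    ring
  · rw [if_neg ht, steinbergVec_eq h0' h1' hrow', steinbergVec_eq h0 h1 hrow, detVec_mul,
      valuation_det_mul, det_matX, hd, coe_pUnit, Padic.valuation_p]
    push_cast
    ring

lemma steinbergVec_matBeta {x : GL2Qp p} {s : ℚ_[p]ˣ} {z w : ℤ_[p]} (h0 : x 1 0 = s * z)
    (h1 : x 1 1 = s * w) (hrow : IsPrimitiveRow z w) (a : κˣ) :
    steinbergVec p a (x * matBeta p) = (a : κ) * (steinbergVec p a x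
      + (if toZMod z = 0 then 2 else 0) * detVec p a x - detVec p a x) := by
  have hd : detVec p a (matBeta p) = a := by
    rw [detVec, det_matBeta, map_mul, unrQp_pUnit, unrQp_unitQ, one_mul]
  have hv : ((det (matBeta p) : ℚ_[p]ˣ) : ℚ_[p]).valuation = 1 := by
    rw [det_matBeta, valuation_mul_pUnit, valuation_unitQ, zero_add]
  obtain ⟨s', z', w', h0', h1', hrow', ⟨hz, rfl, rfl⟩ | ⟨hz, rfl, rfl⟩⟩ := row_mul_matBeta hrow h0 h1
  · rw [if_pos hz, steinbergVec_eq h0' h1' hrow', steinbergVec_eq h0 h1 hrow, detVec_mul,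
      valuation_det_mul, hv, hd, valuation_mul_pUnit]
    push_cast
    ring
  · rw [if_neg hz, steinbergVec_eq h0' h1' hrow', steinbergVec_eq h0 h1 hrow, detVec_mul,
      valuation_det_mul, hv, hd]
    push_cast
    ring

/-- The quotient of the functions on `G` by the line generated by `λ ^ val(det)`. -/
def detQuot (p : ℕ) [Fact p.Prime] (a : κˣ) : GL2Rep
    ((GL2Qp p → κ) ⧸ span κ {detVec p a}) :=
  (rightTranslation p).quotient _ (detVec_line_le a)

lemma detQuot_mk (a : κˣ) (g : GL2Qp p) (φ : GL2Qp p → κ) :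
    detQuot p a g (Submodule.Quotient.mk φ) = Submodule.Quotient.mk (rightTranslation p g φ) := rfl

theorem heckeVec_steinbergVec {a : κˣ} (ha : (a : κ) * a = 1) (hp : 2 < p) :
    HeckeVec (detQuot p a) 0 (a : κ) (Submodule.Quotient.mk (steinbergVec p a)) := by
  refine ⟨fun k => ?_, ?_, ?_, ?_⟩
  · rw [detQuot_mk, pow_zero, one_smul]
    congr 1
    ext x
    exact steinbergVec_inclK a _ x
  · rw [detQuot_mk]
    congr 1
    ext x
    obtain ⟨s, z, w, h0, h1, hrow⟩ := exists_row x
    obtain ⟨h0', h1'⟩ := row_mul_pScalar h0 h1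
    rw [rightTranslation_apply, steinbergVec_eq h0 h1 hrow, steinbergVec_eq h0' h1' hrow, detVec_mul,
      valuation_det_mul, det_pScalar, valuation_mul_pUnit, valuation_mul_pUnit, coe_pUnit,
      Padic.valuation_p, detVec, det_pScalar, map_mul, unrQp_pUnit, val_mul, ha]
    push_cast
    ring
  · rw [if_neg (by omega), zero_smul, add_zero]
    simp only [detQuot_mk]
    have : ∀ t : ZMod p, rightTranslation p (inclK p (matK t)) (steinbergVec p a) = steinbergVec p a :=
      fun t => funext fun x => steinbergVec_inclK a _ x
    simp only [this, Finset.sum_const, Finset.card_univ, ZMod.card]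
    rw [← Nat.cast_smul_eq_nsmul κ, CharP.cast_eq_zero, zero_smul]
  · rw [if_pos rfl, one_smul]
    simp only [detQuot_mk]
    rw [← Submodule.mkQ_apply, ← Submodule.mkQ_apply]
    simp only [← Submodule.mkQ_apply]
    rw [← map_sum, ← map_add, ← map_smul, ← sub_eq_zero, ← map_sub, Submodule.mkQ_apply,
      Submodule.Quotient.mk_eq_zero, Submodule.mem_span_singleton]
    refine ⟨a, ?_⟩
    ext x
    obtain ⟨s, z, w, h0, h1, hrow⟩ := exists_row x
    simp only [Pi.smul_apply, Pi.sub_apply, Pi.add_apply, Finset.sum_apply, rightTranslation_apply,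
      steinbergVec_matX h0 h1 hrow, steinbergVec_matBeta h0 h1 hrow, smul_eq_mul]
    rw [← Finset.mul_sum, Finset.sum_sub_distrib, Finset.sum_add_distrib, ← Finset.sum_mul]
    simp only [Finset.sum_const, Finset.card_univ, ZMod.card, nsmul_eq_mul, CharP.cast_eq_zero, zero_mul]
    by_cases hz : toZMod z = 0
    · have hw : toZMod w ≠ 0 := (isPrimitiveRow_iff.1 hrow).resolve_left fun h => h hz
      simp [hz, hw]
      ring
    · have : ∀ t : ZMod p, toZMod w + t * toZMod z = 0 ↔
          t = - toZMod w / toZMod z := by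
        intro t
        rw [eq_div_iff hz, ← sub_eq_zero (a := t * _)]
        simp [add_comm]
      simp only [this, Finset.sum_ite_eq', Finset.mem_univ, if_true, if_neg hz]
      ring

lemma smul_sub_steinbergVec_ne_zero {a : κˣ} (hp : 2 < p) :
    (a : κ) • (Submodule.Quotient.mk (steinbergVec p a) :
        (GL2Qp p → κ) ⧸ span κ {detVec p a})
      - detQuot p a (matBeta p) (Submodule.Quotient.mk (steinbergVec p a)) ≠ 0 := by
  rw [detQuot_mk, ← Submodule.Quotient.mk_smul, ← Submodule.Quotient.mk_sub, Ne,
    Submodule.Quotient.mk_eq_zero, Submodule.mem_span_singleton]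
  rintro ⟨c, hc⟩
  have e0 : ((1 : GL2Qp p) 1 0 : ℚ_[p]) = (1 : ℚ_[p]ˣ) * ((0 : ℤ_[p]) : ℚ_[p]) := by simp
  have e1 : ((1 : GL2Qp p) 1 1 : ℚ_[p]) = (1 : ℚ_[p]ˣ) * ((1 : ℤ_[p]) : ℚ_[p]) := by simp
  have h1 := congrFun hc 1
  simp only [Pi.smul_apply, Pi.sub_apply, rightTranslation_apply, smul_eq_mul,
    steinbergVec_matBeta e0 e1 (Or.inr isUnit_one), map_zero, if_true] at h1
  have h2 := congrFun hc (inclK p (matK 0))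
  obtain ⟨e0', e1'⟩ := row_mul_inclK e0 e1 (matK 0)
  rw [one_mul] at e0' e1'
  have hne : ¬ toZMod (0 * matK (0 : ZMod p) 0 0 + 1 * matK (0 : ZMod p) 1 0 : ℤ_[p]) = 0 := by
    simp [matK]
  have hd : detVec p a (inclK p (matK 0)) = 1 := by rw [detVec, det_inclK, unrQp_unitQ, val_one]
  have hd1 : detVec p a 1 = 1 := by rw [detVec, map_one, map_one, val_one]
  simp only [Pi.smul_apply, Pi.sub_apply, rightTranslation_apply, smul_eq_mul,
    steinbergVec_matBeta e0' e1' (IsPrimitiveRow.mul (Or.inr isUnit_one) _), if_neg hne, hd] at h2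
  rw [hd1] at h1
  have h3 : (2 : κ) * a = 0 := by linear_combination h1 - h2
  have h4 : ((2 : ℕ) : κ) = 0 := by
    push_cast
    exact (mul_eq_zero.1 h3).resolve_right a.ne_zero
  rw [CharP.cast_eq_zero_iff κ p] at h4
  exact absurd (Nat.le_of_dvd two_pos h4) (not_le.2 hp)

end RowFunctions

section Nonvanishing

variable {W : Type*} [AddCommGroup W] [Module κ W]
  {ρ : GL2Rep W} {r : ℕ} {a : κˣ} {v : W}

lemma IsUniversal.ne_zero_of_ne_zero (h : IsUniversal ρ r (a : κ) v) (hr : r ≠ 0)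
    (hrp : r ≤ p - 1) : v ≠ 0 := by
  rintro rfl
  obtain ⟨f, hf⟩ := h.exists_lift (heckeVec_principalVec hr hrp a)
  have h1 := (principalVec_one hr a).2
  rw [map_zero] at hf
  rw [← hf] at h1
  exact h1 rfl

lemma IsUniversal.smul_sub_matBeta_ne_zero (h : IsUniversal ρ 0 (a : κ) v) (hp : 2 < p) :
    (a : κ) • v - ρ (matBeta p) v ≠ 0 := by
  intro h0
  by_cases ha : (a : κ) * a = 1
  · obtain ⟨f, hf⟩ := h.exists_lift (heckeVec_steinbergVec ha hp)
    refine smul_sub_steinbergVec_ne_zero (a := a) hp ?_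
    rw [← hf, ← map_smul, ← f.isIntertwining, ← map_sub, h0, map_zero]
  · have hr : p - 1 ≠ 0 := by omega
    have hv := heckeVec_principalVec hr le_rfl a
    obtain ⟨f, hf⟩ := h.exists_lift hv.add_matBeta
    have h1 : f ((a : κ) • v - ρ (matBeta p) v)
        = ((a : κ) * a - 1) • principalVec p (p - 1) a := by
      rw [map_sub, map_smul, f.isIntertwining, hf, map_add, map_smul, hv.matBeta_matBeta, smul_add,
        sub_smul, mul_smul, one_smul]
      abel
    rw [h0, map_zero] at h1
    have h2 := congrFun h1 (inclK p (matK 0))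
    exact mul_ne_zero (sub_ne_zero.2 ha) (principalVec_one hr a).2 h2.symm

/-- The representation `π(r, a, 1)`, with `a ≠ 0`, contains an eigenvector which controls it. -/
theorem IsUniversal.exists_isOrdinary (h : IsUniversal ρ r (a : κ) v) (hrp : r ≤ p - 1)
    (hp : 2 < p) : ∃ f, IsOrdinary ρ f (unrQp a⁻¹) (omegaQp p ^ r * unrQp a) := by
  by_cases hr : r = 0
  · subst hr
    exact ⟨_, h.heckeVec.isOrdinary_zero h.generates (h.smul_sub_matBeta_ne_zero hp)⟩
  · exact ⟨v, h.heckeVec.isOrdinary hr h.generates (h.ne_zero_of_ne_zero hr hrp)⟩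

end Nonvanishing

theorem exists_isOrdinary_iwahoriPi {p : ℕ} [Fact p.Prime] (hp : 2 < p) {r : ℕ} (hr : r ≤ p - 1)
    (a : κˣ) (η : QpChar) :
    ∃ f, IsOrdinary (iwahoriPi p r (a : κ) η) f (unrQp a⁻¹ * η) (omegaQp p ^ r * unrQp a * η) := by
  obtain ⟨f, hf⟩ := (isUniversal_iwahoriQuot r (a : κ)).exists_isOrdinary hr hp
  exact ⟨f, hf.twist η⟩

section IwahoriCosets

/-- Representatives of `K / I`. -/
def cosetRep (p : ℕ) [Fact p.Prime] : Option (ZMod p) → GL2Zp p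
  | none => 1
  | some t => matK t

lemma bijective_cosetRep :
    Function.Bijective fun i : Option (ZMod p) => (cosetRep p i : GL2Zp p ⧸ iwahori p) := by
  constructor
  · intro i j hij
    obtain ⟨k, hk, e⟩ : ∃ k ∈ iwahori p, cosetRep p j = cosetRep p i * k :=
      ⟨_, QuotientGroup.eq.1 hij, by rw [mul_inv_cancel_left]⟩
    have e0 : toZMod (cosetRep p j 0 0 : ℤ_[p])
        = toZMod (cosetRep p i 0 0 : ℤ_[p]) * toZMod (k 0 0 : ℤ_[p]) := by
      rw [e, val_mul, Matrix.mul_apply, Fin.sum_univ_two, map_add, map_mul, map_mul,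
        mem_iwahori.1 hk, mul_zero, add_zero]
    have e1 : toZMod (cosetRep p j 1 0 : ℤ_[p])
        = toZMod (cosetRep p i 1 0 : ℤ_[p]) * toZMod (k 0 0 : ℤ_[p]) := by
      rw [e, val_mul, Matrix.mul_apply, Fin.sum_univ_two, map_add, map_mul, map_mul,
        mem_iwahori.1 hk, mul_zero, add_zero]
    cases i with
    | none => cases j with
      | none => rfl
      | some t => simp [cosetRep, matK] at e1
    | some s => cases j with
      | none =>
        simp only [cosetRep, matK, coe_mkK, val_one, Matrix.one_apply_eq, map_one] at e0 e1
        simp only [Matrix.of_apply, Matrix.cons_val', Matrix.cons_val_zero, Matrix.cons_val_one,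
          Matrix.cons_val_fin_one, map_one, one_mul] at e0 e1
        rw [← e1] at e0
        simp at e0
      | some t =>
        simp only [cosetRep, matK, coe_mkK] at e0 e1
        simp only [Matrix.of_apply, Matrix.cons_val', Matrix.cons_val_zero, Matrix.cons_val_one,
          Matrix.cons_val_fin_one, map_one, one_mul, toZMod_teich] at e0 e1
        rw [← e1, mul_one] at e0
        rw [e0]
  · intro q
    induction q using QuotientGroup.induction_on with
    | H k =>
      rcases mem_iwahori_or_exists_matK k with hk | ⟨t, k', rfl⟩
      · exact ⟨none, QuotientGroup.eq.2 (by simpa [cosetRep] using hk)⟩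
      · exact ⟨some t, QuotientGroup.eq.2 (by simp [cosetRep])⟩

/-- The sum over `K / I` of a function is invariant under translation. -/
lemma sum_cosetRep {M : Type*} [AddCommMonoid M] {f : GL2Zp p → M}
    (hf : ∀ (x : GL2Zp p), ∀ k ∈ iwahori p, f (x * k) = f x) (k : GL2Zp p) :
    ∑ i : Option (ZMod p), f (k * cosetRep p i) = ∑ i : Option (ZMod p), f (cosetRep p i) := by
  let F : GL2Zp p ⧸ iwahori p → M := Quotient.lift f fun a b hab => by
    have h := QuotientGroup.leftRel_apply.1 hab
    rw [← hf a _ h, mul_inv_cancel_left]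
  let e := Equiv.ofBijective _ (bijective_cosetRep (p := p))
  refine Fintype.sum_equiv ((e.trans (MulAction.toPerm k)).trans e.symm) _ _ fun i => ?_
  have h1 : F (e ((e.trans (MulAction.toPerm k)).trans e.symm i)) = F (k • e i) := by simp
  exact h1.symm

end IwahoriCosets

section SphericalHecke

variable {r : ℕ}

/-- The linear map `v ↦ T ⟦1, v⟧`. -/
def heckeTL (p : ℕ) [Fact p.Prime] (r : ℕ) : SymV p r →ₗ[κ] cInd (symRep p r) :=
  ∑ t : ZMod p, elemL (symRep p r) (matX t) ∘ₗ
      symAct p r (redMat p !![1, -teich t; 0, (p : ℤ_[p])])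
    + elemL (symRep p r) (matAlpha p) ∘ₗ symAct p r (redMat p !![(p : ℤ_[p]), 0; 0, 1])

lemma cIndRep_heckeTL (g : GL2Qp p) (v : SymV p r) :
    cIndRep (symRep p r) g (heckeTL p r v) = heckeT p r g v := by
  rw [heckeTL, heckeT, LinearMap.add_apply, LinearMap.sum_apply, map_add, map_sum]
  simp only [LinearMap.comp_apply]
  congr 1
  · exact Finset.sum_congr rfl fun t _ => cIndRep_elem _ _ _ _
  · exact cIndRep_elem _ _ _ _

/-- The vector `⟦β, X ^ r⟧`, on which the Iwahori subgroup acts through `d ^ r`. -/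
lemma inclK_elem_matBeta {k : GL2Zp p} (hk : k ∈ iwahori p) :
    cIndRep (symRep p r) (inclK p k) (elem (symRep p r) (matBeta p) (symLin r 1 0))
      = toFpbar p (k 1 1) ^ r • elem (symRep p r) (matBeta p) (symLin r 1 0) := by
  obtain ⟨k', h1, h2, -⟩ := exists_iwahori_mul_matBeta ⟨k, hk⟩
  have hk' : toFpbar p ((k' : GL2Zp p) 1 0) = 0 := toFpbar_eq_zero_iff.2 k'.2
  have h3 : symAct p r (redMat p ((k' : GL2Zp p) : Matrix (Fin 2) (Fin 2) ℤ_[p])) (symLin r 1 0)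
      = toFpbar p (k 1 1) ^ r • symLin r 1 0 := by
    rw [symAct_symLin, ← h2, ← symLin_one_zero_smul]
    simp [redMat, hk']
  rw [cIndRep_elem, h1, elem_top_mul_inclK, h3, elem_smul]

lemma heckeTL_symLin (c d : κ) :
    heckeTL p r (symLin r c d) = ∑ t : ZMod p, (c - ofFp t * d) ^ r •
        cIndRep (symRep p r) (inclK p (matK t)) (elem (symRep p r) (matBeta p) (symLin r 1 0))
      + d ^ r • elem (symRep p r) (matBeta p) (symLin r 1 0) := by
  rw [heckeTL, LinearMap.add_apply, LinearMap.sum_apply]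
  simp only [LinearMap.comp_apply]
  congr 1
  · refine Finset.sum_congr rfl fun t _ => ?_
    change elem _ _ _ = _
    rw [redMat_hecke, symAct_symLin, cIndRep_elem, ← matX_eq, ← elem_smul, ← symLin_one_zero_smul]
    congr 2
    · simp; ring
    · simp
  · change elem _ _ _ = _
    have : symAct p r (redMat p (matK (0 : ZMod p))) (symLin r d 0) = symLin r 0 d := by
      rw [symAct_symLin]
      simp [redMat, matK, toFpbar_teich]
    rw [redMat_hecke', symAct_symLin, ← matAlpha_mul_matK_zero, elem_top_mul_inclK, ← elem_smul,
      ← map_smul, ← symLin_one_zero_smul, this]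
    congr 2 <;> simp

lemma heckeTL_equivariant (hr : r ≤ p - 1) (k : GL2Zp p) (v : SymV p r) :
    heckeTL p r (symAct p r (redMat p k) v) = cIndRep (symRep p r) (inclK p k) (heckeTL p r v) := by
  suffices H : ∀ c d : κ, heckeTL p r (symAct p r (redMat p k) (symLin r c d))
      = cIndRep (symRep p r) (inclK p k) (heckeTL p r (symLin r c d)) by
    induction v using symV_induction hr with
    | h0 => simp
    | hadd v w hv hw => simp only [map_add, hv, hw]
    | hsmul a v hv => simp only [map_smul, hv]
    | hlin t => exact H _ _
  intro c d
  set u := elem (symRep p r) (matBeta p) (symLin r 1 0) with hu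
  have hdet : ∀ x : GL2Zp p, toFpbar p (Matrix.det (x : Matrix (Fin 2) (Fin 2) ℤ_[p])) ≠ 0 :=
    fun x => (((Matrix.isUnit_iff_isUnit_det _).1 x.isUnit).map (toFpbar p)).ne_zero
  let f : κ → κ → GL2Zp p → cInd (symRep p r) := fun c d x =>
    ((d * toFpbar p (x 0 0) - c * toFpbar p (x 1 0))
      / toFpbar p (Matrix.det (x : Matrix (Fin 2) (Fin 2) ℤ_[p]))) ^ r •
      cIndRep (symRep p r) (inclK p x) u
  have hf : ∀ c d, ∀ (x : GL2Zp p), ∀ k ∈ iwahori p, f c d (x * k) = f c d x := by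
    intro c d x k hk
    have hk0 : toFpbar p (k 1 0) = 0 := toFpbar_eq_zero_iff.2 hk
    have hdk := hdet k
    have hdx := hdet x
    have hdk' : toFpbar p (Matrix.det (k : Matrix (Fin 2) (Fin 2) ℤ_[p]))
        = toFpbar p (k 0 0) * toFpbar p (k 1 1) := by
      rw [Matrix.det_fin_two, map_sub, map_mul, map_mul, hk0, mul_zero, sub_zero]
    simp only [f]
    rw [map_mul, map_mul, mul_apply, inclK_elem_matBeta hk, map_smul, smul_smul, ← mul_pow,
      val_mul, Matrix.det_mul, Matrix.mul_apply, Matrix.mul_apply, Fin.sum_univ_two,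
      Fin.sum_univ_two]
    congr 2
    simp only [map_add, map_mul, hk0, mul_zero, add_zero]
    rw [hdk'] at hdk ⊢
    have h1 := left_ne_zero_of_mul hdk
    have h2 := right_ne_zero_of_mul hdk
    field_simp
  have hsum : ∀ c d, heckeTL p r (symLin r c d) = ∑ i : Option (ZMod p), f c d (cosetRep p i) := by
    intro c d
    rw [heckeTL_symLin, Fintype.sum_option, add_comm]
    congr 1
    · simp [f, cosetRep, hu]
    · refine Finset.sum_congr rfl fun t _ => ?_
      simp only [f, cosetRep, matK, coe_mkK, Matrix.det_fin_two_of]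
      congr 2
      simp [toFpbar_teich]
      ring
  rw [symAct_symLin, hsum, hsum, map_sum, ← sum_cosetRep (hf _ _) k]
  refine Finset.sum_congr rfl fun i _ => ?_
  simp only [f]
  rw [map_mul, map_smul, map_mul, mul_apply, val_mul, Matrix.det_mul,
    Matrix.mul_apply, Matrix.mul_apply, Fin.sum_univ_two, Fin.sum_univ_two]
  congr 2
  have h1 := hdet k
  have h2 := hdet (cosetRep p i)
  rw [map_mul, div_eq_div_iff (mul_ne_zero h1 h2) h2,
    Matrix.det_fin_two (k : Matrix (Fin 2) (Fin 2) ℤ_[p])]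
  simp [redMat]
  ring

/-- The spherical Hecke operator as an endomorphism of `ind_{KZ}^G V_r`. -/
theorem exists_heckeT (hr : r ≤ p - 1) : ∃ T : Module.End κ (cInd (symRep p r)),
    ∀ g v, T (elem (symRep p r) g v) = heckeT p r g v := by
  obtain ⟨T, hT⟩ := exists_cInd_lift (σ := symRep p r) (ρ := cIndRep (symRep p r)) (heckeTL p r)
    (fun k v => heckeTL_equivariant hr k v) fun v => by
      induction heckeTL p r v using cInd_induction with
      | h0 => simp
      | hadd f f' hf hf' => rw [map_add, hf, hf']
      | hsmul a f hf => rw [map_smul, hf]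
      | helem g v =>
        have : pScalar p * g = g * pScalar p := by simpa using pScalar_zpow_mul_comm 1 g
        rw [cIndRep_elem, this, elem_mul_pScalar]
  exact ⟨T, fun g v => by rw [hT, cIndRep_heckeTL]⟩

end SphericalHecke

section Heights

variable {r : ℕ}

/-- The elements `γ(b) F ^ m` of the Borel subgroup. -/
def borelElt (b : ℚ_[p]) (m : ℤ) : GL2Qp p := uni b * matF p ^ m

lemma borelElt_inv_mul (b c : ℚ_[p]) (m n : ℤ) :
    (borelElt c n)⁻¹ * borelElt b m = borelElt ((p : ℚ_[p]) ^ (-n) * (b - c)) (m - n) := by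
  have h1 : uni c * uni (b - c) = uni b := by rw [← uni_add, add_sub_cancel]
  rw [inv_mul_eq_iff_eq_mul]
  simp only [borelElt]
  rw [mul_assoc (uni c), ← mul_assoc (matF p ^ n), matF_zpow_mul_uni, mul_assoc (uni _), ← zpow_add,
    ← mul_assoc (p ^ n : ℚ_[p]), ← zpow_add₀ padic_p_ne_zero, add_neg_cancel, zpow_zero, one_mul,
    ← mul_assoc, h1, add_sub_cancel]

lemma borelElt_mul_matX (b : ℚ_[p]) (m : ℤ) (t : ZMod p) :
    borelElt b m * matX t = borelElt (b + (p : ℚ_[p]) ^ m * ((teich t : ℤ_[p]) : ℚ_[p])) (m + 1) := by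
  rw [borelElt, borelElt, matX_eq_uni, mul_assoc, ← mul_assoc (matF p ^ m), matF_zpow_mul_uni,
    mul_assoc (uni _), ← zpow_add_one, ← mul_assoc, ← uni_add]

lemma borelElt_mul_matAlpha (b : ℚ_[p]) (m : ℤ) :
    borelElt b m * matAlpha p = borelElt b (m - 1) * pScalar p := by
  have h : matF p * matAlpha p = pScalar p := by
    refine Units.ext ?_
    rw [val_mul, coe_pScalar]
    simp [matF, matAlpha]
  rw [borelElt, borelElt, zpow_sub_one, mul_assoc, mul_assoc, mul_assoc, ← h, inv_mul_cancel_left]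

lemma coe_matF_zpow (m : ℤ) :
    (matF p ^ m : GL2Qp p) = mkQ ((p : ℚ_[p]) ^ m) 0 0 1
      (by simpa using zpow_ne_zero m padic_p_ne_zero) := by
  have hmul : ∀ a b : ℚ_[p], ∀ ha hb hab, (mkQ a 0 0 1 ha : GL2Qp p) * mkQ b 0 0 1 hb
      = mkQ (a * b) 0 0 1 hab := by
    intro a b ha hb hab
    refine Units.ext ?_
    rw [val_mul]
    simp
  have h1 : ∀ n : ℕ, (matF p ^ n : GL2Qp p) = mkQ ((p : ℚ_[p]) ^ n) 0 0 1
      (by simpa using pow_ne_zero n padic_p_ne_zero) := by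
    intro n
    induction n with
    | zero =>
      refine Units.ext ?_
      simp [Matrix.one_fin_two]
    | succ n ih =>
      refine Units.ext ?_
      rw [pow_succ, ih, val_mul]
      simp [matF, pow_succ]
  obtain ⟨n, rfl | rfl⟩ := m.eq_nat_or_neg
  · rw [zpow_natCast, h1]
    refine Units.ext ?_
    simp
  · rw [zpow_neg, inv_eq_iff_mul_eq_one, zpow_natCast, h1, hmul]
    · refine Units.ext ?_
      simp [Matrix.one_fin_two]
    · simp

lemma coe_borelElt (b : ℚ_[p]) (m : ℤ) : (borelElt b m : Matrix (Fin 2) (Fin 2) ℚ_[p])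
    = !![(p : ℚ_[p]) ^ m, b; 0, 1] := by
  rw [borelElt, val_mul, coe_matF_zpow]
  simp [uni]

lemma eq_of_borelElt_eq {b : ℚ_[p]} {m n : ℤ} {k : GL2Zp p}
    (h : borelElt b m = pScalar p ^ n * inclK p k) : m = 0 ∧ ‖b‖ ≤ 1 := by
  have hc : (pScalar p ^ n : GL2Qp p) = Matrix.GeneralLinearGroup.scalar (Fin 2) (pUnit p ^ n) :=
    (map_zpow (Matrix.GeneralLinearGroup.scalar (Fin 2)) (pUnit p) n).symm
  have hent : ∀ i j, borelElt b m i j = (p : ℚ_[p]) ^ n * (k i j : ℤ_[p]) := by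
    intro i j
    have hs : ((Matrix.GeneralLinearGroup.scalar (Fin 2) (pUnit p ^ n) : GL2Qp p) :
        Matrix (Fin 2) (Fin 2) ℚ_[p]) = ((pUnit p ^ n : ℚ_[p]ˣ) : ℚ_[p]) • 1 :=
      (Matrix.smul_one_eq_diagonal _).symm
    rw [h, hc, val_mul, hs, smul_mul_assoc, one_mul, Matrix.smul_apply, smul_eq_mul,
      Units.val_zpow_eq_zpow_val]
    rfl
  have hpn := zpow_ne_zero n (padic_p_ne_zero (p := p))
  rw [coe_borelElt] at hent
  have h10 : (k 1 0 : ℤ_[p]) = 0 := by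
    have h1 := hent 1 0
    have h2 : ((k 1 0 : ℤ_[p]) : ℚ_[p]) = 0 := by
      have : (0 : ℚ_[p]) = (p : ℚ_[p]) ^ n * (k 1 0 : ℤ_[p]) := h1
      exact (mul_eq_zero.1 this.symm).resolve_left hpn
    exact Subtype.ext h2
  have hdet := isUnit_det k
  rw [h10, mul_zero, sub_zero, IsUnit.mul_iff] at hdet
  have hv : ∀ x : ℚ_[p], ∀ z : ℤ_[p], IsUnit z → x = (p : ℚ_[p]) ^ n * z → x.valuation = n := by
    intro x z hz hx
    rw [hx, Padic.valuation_mul hpn (coe_ne_zero_of_isUnit hz), valuation_of_isUnit hz, add_zero,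
      Padic.valuation_zpow, Padic.valuation_p, mul_one]
  have h11 : n = 0 := by
    have := hv 1 _ hdet.2 (hent 1 1)
    rw [Padic.valuation_one] at this
    exact this.symm
  subst h11
  have h00 := hv ((p : ℚ_[p]) ^ m) _ hdet.1 (hent 0 0)
  rw [Padic.valuation_zpow, Padic.valuation_p, mul_one] at h00
  refine ⟨h00, ?_⟩
  have h01 : b = (p : ℚ_[p]) ^ (0 : ℤ) * (k 0 1 : ℤ_[p]) := hent 0 1
  rw [zpow_zero, one_mul] at h01
  rw [h01]
  exact PadicInt.norm_le_one _

lemma elem_borelElt_of_ne {b c : ℚ_[p]} {m n : ℤ} (h : m ≠ n) (v : SymV p r) :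
    (elem (symRep p r) (borelElt b m) v : GL2Qp p → SymV p r) (borelElt c n)⁻¹ = 0 := by
  refine elemFun_of_not _ _ ?_
  rintro ⟨j, k, e⟩
  rw [borelElt_inv_mul] at e
  exact h (sub_eq_zero.1 (eq_of_borelElt_eq e).1)

lemma elem_borelElt_of_norm {b c : ℚ_[p]} {n : ℤ} (h : ¬ ‖(p : ℚ_[p]) ^ (-n) * (b - c)‖ ≤ 1)
    (v : SymV p r) :
    (elem (symRep p r) (borelElt b n) v : GL2Qp p → SymV p r) (borelElt c n)⁻¹ = 0 := by
  refine elemFun_of_not _ _ ?_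
  rintro ⟨j, k, e⟩
  rw [borelElt_inv_mul] at e
  exact h (eq_of_borelElt_eq e).2

lemma elem_borelElt_of_eq {b c : ℚ_[p]} {n : ℤ} (d : ℤ_[p]) (h : (p : ℚ_[p]) ^ (-n) * (b - c) = d)
    (v : SymV p r) :
    (elem (symRep p r) (borelElt b n) v : GL2Qp p → SymV p r) (borelElt c n)⁻¹
      = symAct p r !![1, toFpbar p d; 0, 1] v := by
  have e : (borelElt c n)⁻¹ * borelElt b n
      = pScalar p ^ (0 : ℤ) * inclK p (mkK 1 d 0 1 (by simp)) := by
    rw [borelElt_inv_mul, h]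
    refine Units.ext ?_
    rw [coe_borelElt, zpow_zero, one_mul, coe_inclK_mkK]
    simp
  have h1 := elemFun_of_eq (symRep p r) v (h := ⟨mkK 1 d 0 1 (by simp), trivial⟩) e
  refine h1.trans ?_
  rw [symRep_apply]
  congr 2
  ext i j
  fin_cases i <;> fin_cases j <;> simp [redMat]

lemma elem_pScalar_zpow_mul (n : ℤ) (g : GL2Qp p) (v : SymV p r) :
    elem (symRep p r) (pScalar p ^ n * g) v = elem (symRep p r) g v := by
  induction n generalizing g with
  | zero => simp
  | succ n ih =>
    rw [zpow_add_one, mul_assoc, ih, ← zpow_one (pScalar p), pScalar_zpow_mul_comm, zpow_one,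
      elem_mul_pScalar]
  | pred n ih =>
    rw [zpow_sub_one, mul_assoc, ih, ← elem_mul_pScalar, ← zpow_one (pScalar p),
      ← pScalar_zpow_mul_comm, zpow_one, mul_inv_cancel_left]

lemma toZMod_eq_zero_of_norm_div_le {d : ℤ_[p]} (h : ‖(d : ℚ_[p]) / p‖ ≤ 1) :
    toZMod d = 0 := by
  by_contra hd
  rw [norm_div, norm_eq_one_of_isUnit (isUnit_iff_toZMod_ne_zero.2 hd), Padic.norm_p, one_div,
    inv_inv] at h
  have : (1 : ℝ) < p := by exact_mod_cast (Fact.out : p.Prime).one_lt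
  linarith

/-- The functions supported on the vertices of height at most `M`. -/
def heightLE (p : ℕ) [Fact p.Prime] (r : ℕ) (M : ℤ) : Submodule κ (cInd (symRep p r)) :=
  span κ {f | ∃ (b : ℚ_[p]) (m : ℤ) (v : SymV p r), m ≤ M ∧
    f = elem (symRep p r) (borelElt b m) v}

lemma heightLE_mono {M N : ℤ} (h : M ≤ N) : heightLE p r M ≤ heightLE p r N := by
  refine Submodule.span_mono ?_
  rintro _ ⟨b, m, v, hm, rfl⟩
  exact ⟨b, m, v, hm.trans h, rfl⟩

lemma exists_mem_heightLE (f : cInd (symRep p r)) : ∃ N : ℕ, f ∈ heightLE p r N := by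
  induction f using cInd_induction with
  | h0 => exact ⟨0, zero_mem _⟩
  | hadd f f' hf hf' =>
    obtain ⟨N, hN⟩ := hf
    obtain ⟨N', hN'⟩ := hf'
    exact ⟨max N N', add_mem (heightLE_mono (by simp) hN) (heightLE_mono (by simp) hN')⟩
  | hsmul a f hf =>
    obtain ⟨N, hN⟩ := hf
    exact ⟨N, Submodule.smul_mem _ a hN⟩
  | helem g v =>
    obtain ⟨b, m, n, k, rfl⟩ := exists_iwasawa g
    refine ⟨m.toNat, subset_span ⟨b, m, symAct p r (redMat p k) v, by omega, ?_⟩⟩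
    rw [← elem_top_mul_inclK]
    have e : uni b * (matF p ^ m * pScalar p ^ n * inclK p k)
        = pScalar p ^ n * (borelElt b m * inclK p k) := by
      rw [mul_assoc, ← mul_assoc (matF p ^ m), ← pScalar_zpow_mul_comm]
      simp only [borelElt]
      rw [mul_assoc (pScalar p ^ n), ← mul_assoc (uni b), ← pScalar_zpow_mul_comm]
      group
    rw [e, elem_pScalar_zpow_mul]

lemma heckeT_borelElt (b : ℚ_[p]) (m : ℤ) (v : SymV p r) :
    heckeT p r (borelElt b m) v
      = ∑ s : ZMod p, elem (symRep p r) (borelElt (b + (p : ℚ_[p]) ^ m * ((teich s : ℤ_[p]) : ℚ_[p])) (m + 1))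
          (symAct p r !![1, -ofFp s; 0, 0] v)
        + elem (symRep p r) (borelElt b (m - 1)) (symAct p r !![0, 0; 0, 1] v) := by
  rw [heckeT, borelElt_mul_matAlpha, elem_mul_pScalar, redMat_hecke']
  simp only [borelElt_mul_matX, redMat_hecke]

lemma symAct_symAct (M N : Matrix (Fin 2) (Fin 2) κ) (v : SymV p r) :
    symAct p r M (symAct p r N v) = symAct p r (M * N) v := by
  rw [map_mul, mul_apply]

variable {T : Module.End κ (cInd (symRep p r))}

/-- The values of `T f` at the vertices of maximal height. -/
lemma heckeT_apply_of_mem_heightLE (hT : ∀ g v, T (elem (symRep p r) g v) = heckeT p r g v) {M : ℤ}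
    {f : cInd (symRep p r)} (hf : f ∈ heightLE p r M) (c : ℚ_[p]) (t : ZMod p) :
    (T f : GL2Qp p → SymV p r) (borelElt (c + (p : ℚ_[p]) ^ M * ((teich t : ℤ_[p]) : ℚ_[p])) (M + 1))⁻¹
      = symAct p r !![1, -ofFp t; 0, 0]
          ((f : GL2Qp p → SymV p r) (borelElt c M)⁻¹) := by
  induction hf using Submodule.span_induction with
  | zero => simp
  | add f f' _ _ hf hf' =>
    rw [map_add, Submodule.coe_add, Submodule.coe_add, Pi.add_apply, Pi.add_apply, map_add, hf, hf']
  | smul a f _ hf =>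
    rw [map_smul, Submodule.coe_smul, Submodule.coe_smul, Pi.smul_apply, Pi.smul_apply, map_smul, hf]
  | mem f hf =>
    obtain ⟨b, m, v, hm, rfl⟩ := hf
    rw [hT, heckeT_borelElt, Submodule.coe_add, Pi.add_apply, elem_borelElt_of_ne (by omega),
      add_zero, Submodule.coe_sum, Finset.sum_apply]
    rcases hm.lt_or_eq with hm | rfl
    · rw [elem_borelElt_of_ne hm.ne, map_zero]
      exact Finset.sum_eq_zero fun s _ => elem_borelElt_of_ne (by omega) _
    · have hpm := zpow_ne_zero m (padic_p_ne_zero (p := p))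
      have key : ∀ s : ZMod p, (p : ℚ_[p]) ^ (-(m + 1)) *
          (b + (p : ℚ_[p]) ^ m * ((teich s : ℤ_[p]) : ℚ_[p])
            - (c + (p : ℚ_[p]) ^ m * ((teich t : ℤ_[p]) : ℚ_[p])))
          = ((p : ℚ_[p]) ^ (-m) * (b - c) + ((teich s : ℤ_[p]) : ℚ_[p]) - ((teich t : ℤ_[p]) : ℚ_[p])) / p := by
        intro s
        rw [zpow_neg, zpow_add_one₀ padic_p_ne_zero, zpow_neg]
        have := padic_p_ne_zero (p := p)
        field_simp
        ring
      by_cases hd : ‖(p : ℚ_[p]) ^ (-m) * (b - c)‖ ≤ 1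
      · obtain ⟨d, hd⟩ : ∃ d : ℤ_[p], (p : ℚ_[p]) ^ (-m) * (b - c) = d := ⟨⟨_, hd⟩, rfl⟩
        rw [elem_borelElt_of_eq d hd, symAct_symAct]
        have hval : ∀ s : ZMod p, ((elem (symRep p r)
            (borelElt (b + (p : ℚ_[p]) ^ m * ((teich s : ℤ_[p]) : ℚ_[p])) (m + 1))
            (symAct p r !![1, -ofFp s; 0, 0] v) : cInd (symRep p r)) :
              GL2Qp p → SymV p r)
            (borelElt (c + (p : ℚ_[p]) ^ m * ((teich t : ℤ_[p]) : ℚ_[p])) (m + 1))⁻¹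
            = if s = t - toZMod d then
              symAct p r !![1, -ofFp s; 0, 0] v else 0 := by
          intro s
          split_ifs with hs
          · obtain ⟨y, hy⟩ := toZMod_eq_zero_iff.1 (show toZMod (d + teich s - teich t) = 0 by
              rw [map_sub, map_add, toZMod_teich, toZMod_teich, hs]
              ring)
            have hy' : (d : ℚ_[p]) + ((teich s : ℤ_[p]) : ℚ_[p]) - ((teich t : ℤ_[p]) : ℚ_[p])
                = p * y := by
              exact_mod_cast congrArg _ hy
            rw [elem_borelElt_of_eq y (by rw [key, hd, hy', mul_div_cancel_left₀ _ padic_p_ne_zero]),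
              symAct_symAct]
            congr 2
            simp
          · refine elem_borelElt_of_norm (fun hle => hs ?_) _
            rw [key, hd] at hle
            have h1 : toZMod (d + teich s - teich t) = 0 :=
              toZMod_eq_zero_of_norm_div_le (by rwa [PadicInt.coe_sub, PadicInt.coe_add])
            rw [map_sub, map_add, toZMod_teich, toZMod_teich] at h1
            linear_combination h1
        rw [Finset.sum_congr rfl fun s _ => hval s, Finset.sum_ite_eq', if_pos (Finset.mem_univ _)]
        congr 2
        simp [toFpbar, sub_eq_add_neg, -algebraMap_smul]
      · rw [elem_borelElt_of_norm hd, map_zero]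
        refine Finset.sum_eq_zero fun s _ => elem_borelElt_of_norm (fun hle => hd ?_) _
        rw [key] at hle
        have h1 : ‖(p : ℚ_[p]) ^ (-m) * (b - c) + ((teich s : ℤ_[p]) : ℚ_[p])
            - ((teich t : ℤ_[p]) : ℚ_[p])‖ ≤ 1 := by
          have hp0 := padic_p_ne_zero (p := p)
          rw [← div_mul_cancel₀ (_ + _ - _) hp0, norm_mul]
          exact mul_le_one₀ hle (norm_nonneg _) Padic.norm_p_lt_one.le
        obtain ⟨y, hy⟩ : ∃ y : ℤ_[p], (y : ℚ_[p]) = (p : ℚ_[p]) ^ (-m) * (b - c)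
            + ((teich s : ℤ_[p]) : ℚ_[p]) - ((teich t : ℤ_[p]) : ℚ_[p]) := ⟨⟨_, h1⟩, rfl⟩
        have h2 : (p : ℚ_[p]) ^ (-m) * (b - c) = ((y - teich s + teich t : ℤ_[p]) : ℚ_[p]) := by
          rw [PadicInt.coe_add, PadicInt.coe_sub, hy]
          ring
        rw [h2]
        exact PadicInt.norm_le_one _

lemma dehom_symAct_hecke (hr : r ≤ p - 1) (t : ZMod p) (v : SymV p r) :
    dehom p r (symAct p r !![1, -ofFp t; 0, 0] v)
      = C ((dehom p r v).eval (ofFp t)) := by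
  induction v using symV_induction hr with
  | h0 => simp
  | hadd v w hv hw => simp only [map_add, hv, hw, eval_add]
  | hsmul a v hv => rw [map_smul, map_smul, hv, map_smul, eval_smul, smul_eq_mul, C_mul, smul_eq_C_mul]
  | hlin s =>
    rw [symAct_symLin, dehom_symLin, dehom_symLin]
    simp [sub_eq_add_neg]

lemma eq_zero_of_symAct_hecke (hr : r ≤ p - 1) {v : SymV p r}
    (h : ∀ t : ZMod p, symAct p r !![1, -ofFp t; 0, 0] v = 0) : v = 0 := by
  have hp := (Fact.out : p.Prime).one_lt
  refine dehom_injective r ?_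
  rw [map_zero]
  refine eq_zero_of_natDegree_lt_of_eval_algebraMap
    (lt_of_le_of_lt (natDegree_dehom_le v) (by omega)) fun t => ?_
  have h1 := dehom_symAct_hecke hr t v
  rw [h t, map_zero] at h1
  exact C_eq_zero.1 h1.symm

lemma sum_symAct_hecke (hr : r < p - 1) (v : SymV p r) :
    ∑ t : ZMod p, symAct p r !![1, -ofFp t; 0, 0] v = 0 := by
  refine dehom_injective r ?_
  rw [map_zero, map_sum]
  simp only [dehom_symAct_hecke hr.le]
  rw [← map_sum, C_eq_zero]
  induction v using symV_induction hr.le with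
  | h0 => simp
  | hadd v w hv hw => simp only [map_add, eval_add, Finset.sum_add_distrib, hv, hw, add_zero]
  | hsmul a v hv => simp only [map_smul, eval_smul, ← Finset.smul_sum, hv, smul_zero]
  | hlin s =>
    simp only [dehom_symLin_one, eval_pow, eval_sub, eval_X, eval_C, ← map_sub, ← map_pow]
    rw [← map_sum, Fintype.sum_equiv (Equiv.subRight s) (fun t => (t - s) ^ r) (fun t => t ^ r)
      fun _ => rfl, FiniteField.sum_pow_lt_card_sub_one _ _ (by rw [ZMod.card]; omega), map_zero]

lemma symLin_one_zero_ne_zero (r : ℕ) : symLin r (1 : κ) 0 ≠ 0 := by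
  intro h
  have h1 := congrArg (dehom p r) h
  rw [dehom_symLin, map_zero] at h1
  simp at h1

lemma cInd_eq_zero_of_borelElt {f : cInd (symRep p r)}
    (h : ∀ c m, (f : GL2Qp p → SymV p r) (borelElt c m)⁻¹ = 0) : f = 0 := by
  ext1
  funext x
  obtain ⟨b, m, n, k, e⟩ := exists_iwasawa x⁻¹
  have e' : x = pScalar p ^ (-n) * inclK p (k⁻¹) * (borelElt b m)⁻¹ := by
    rw [← inv_inv x, e, borelElt, map_inv, zpow_neg, ← mul_inv_rev, ← mul_inv_rev, inv_inj,
      ← pScalar_zpow_mul_comm n (inclK p k)]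
    group
  have h1 := cInd_mul f (-n) ⟨k⁻¹, trivial⟩ (borelElt b m)⁻¹
  rw [h, map_zero, ← e'] at h1
  exact h1

lemma mem_heightLE_of_apply_eq_zero {M : ℤ} {f : cInd (symRep p r)} (hf : f ∈ heightLE p r M)
    (h : ∀ c, (f : GL2Qp p → SymV p r) (borelElt c M)⁻¹ = 0) : f ∈ heightLE p r (M - 1) := by
  obtain ⟨f₁, f₂, rfl, h1, h2, h3⟩ : ∃ f₁ f₂, f = f₁ + f₂ ∧ f₂ ∈ heightLE p r (M - 1) ∧
      (∀ c m, m ≠ M → (f₁ : GL2Qp p → SymV p r) (borelElt c m)⁻¹ = 0) ∧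
      (∀ c, (f₂ : GL2Qp p → SymV p r) (borelElt c M)⁻¹ = 0) := by
    clear h
    induction hf using Submodule.span_induction with
    | zero => exact ⟨0, 0, by simp, zero_mem _, by simp, by simp⟩
    | add f f' _ _ hf hf' =>
      obtain ⟨f₁, f₂, rfl, h1, h2, h3⟩ := hf
      obtain ⟨f₁', f₂', rfl, h1', h2', h3'⟩ := hf'
      refine ⟨f₁ + f₁', f₂ + f₂', by abel, add_mem h1 h1', fun c m hm => ?_, fun c => ?_⟩
      · rw [Submodule.coe_add, Pi.add_apply, h2 c m hm, h2' c m hm, add_zero]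
      · rw [Submodule.coe_add, Pi.add_apply, h3, h3', add_zero]
    | smul a f _ hf =>
      obtain ⟨f₁, f₂, rfl, h1, h2, h3⟩ := hf
      refine ⟨a • f₁, a • f₂, smul_add _ _ _, Submodule.smul_mem _ a h1, fun c m hm => ?_, fun c => ?_⟩
      · rw [Submodule.coe_smul, Pi.smul_apply, h2 c m hm, smul_zero]
      · rw [Submodule.coe_smul, Pi.smul_apply, h3, smul_zero]
    | mem f hf =>
      obtain ⟨b, m, v, hm, rfl⟩ := hf
      rcases hm.lt_or_eq with hm | rfl
      · exact ⟨0, _, (zero_add _).symm, subset_span ⟨b, m, v, by omega, rfl⟩, by simp,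
          fun c => elem_borelElt_of_ne hm.ne v⟩
      · exact ⟨_, 0, (add_zero _).symm, zero_mem _, fun c n hn => elem_borelElt_of_ne hn.symm v,
          by simp⟩
  have : f₁ = 0 := by
    refine cInd_eq_zero_of_borelElt fun c m => ?_
    rcases eq_or_ne m M with rfl | hm
    · have := h c
      rwa [Submodule.coe_add, Pi.add_apply, h3, add_zero] at this
    · exact h2 c m hm
  rw [this, zero_add]
  exact h1

lemma elem_one_eq_borelElt (v : SymV p r) :
    elem (symRep p r) 1 v = elem (symRep p r) (borelElt 0 0) v := by
  rw [borelElt, uni_zero, zpow_zero, mul_one]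

/-- For `r < p - 1`, the vector `⟦1, X ^ r⟧` is not in the image of the Hecke operator `T`. -/
theorem elem_symLin_notMem (hr : r < p - 1) : elem (symRep p r) 1 (symLin r 1 0)
    ∉ span κ (sphericalRel p r 0) := by
  intro hmem
  obtain ⟨T, hT⟩ := exists_heckeT hr.le
  have hle : span κ (sphericalRel p r 0) ≤ LinearMap.range T := by
    refine span_le.2 ?_
    rintro _ ⟨g, v, rfl⟩
    exact ⟨elem (symRep p r) g v, by rw [hT, zero_smul, sub_zero]⟩
  obtain ⟨f, hf⟩ := hle hmem
  rw [elem_one_eq_borelElt] at hf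
  obtain ⟨N, hN⟩ := exists_mem_heightLE f
  have step : ∀ M : ℤ, 0 ≤ M → f ∈ heightLE p r M → f ∈ heightLE p r (M - 1) := by
    intro M hM hfM
    refine mem_heightLE_of_apply_eq_zero hfM fun c => eq_zero_of_symAct_hecke hr.le fun t => ?_
    rw [← heckeT_apply_of_mem_heightLE hT hfM, hf]
    exact elem_borelElt_of_ne (by omega) _
  have hneg : f ∈ heightLE p r (-1) := by
    induction N with
    | zero =>
      have := step _ (by simp) hN
      rwa [Nat.cast_zero, zero_sub] at this
    | succ N ih =>
      have := step _ (by positivity) hN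
      rw [Nat.cast_succ, add_sub_cancel_right] at this
      exact ih this
  have hval : ∀ t : ZMod p, symAct p r !![1, -ofFp t; 0, 0]
      ((f : GL2Qp p → SymV p r) (borelElt 0 (-1))⁻¹) = if t = 0 then symLin r 1 0 else 0 := by
    intro t
    rw [← heckeT_apply_of_mem_heightLE hT hneg, hf]
    rw [neg_add_cancel, zero_add]
    have e : (p : ℚ_[p]) ^ (-0 : ℤ) * (0 - (p : ℚ_[p]) ^ (-1 : ℤ) * ((teich t : ℤ_[p]) : ℚ_[p]))
        = - (((teich t : ℤ_[p]) : ℚ_[p]) / p) := by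
      rw [neg_zero, zpow_zero, zpow_neg_one]
      ring
    split_ifs with ht
    · subst ht
      have h0 : (teich (0 : ZMod p) : ℤ_[p]) = 0 := by simp [teich]
      rw [elem_borelElt_of_eq 0 (by rw [e, h0]; simp), symAct_symLin]
      simp
    · refine elem_borelElt_of_norm (fun hle => ht ?_) _
      rw [e, norm_neg] at hle
      rw [← toZMod_teich t]
      exact toZMod_eq_zero_of_norm_div_le hle
  have h1 := sum_symAct_hecke hr ((f : GL2Qp p → SymV p r) (borelElt 0 (-1))⁻¹)
  simp only [hval] at h1
  rw [Finset.sum_ite_eq', if_pos (Finset.mem_univ _)] at h1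
  exact symLin_one_zero_ne_zero r h1

end Heights

section Nonvanishing

variable {r : ℕ} {W : Type} [AddCommGroup W] [Module κ W]
  {ρ : GL2Rep W} {v : W}

lemma IsUniversal.ne_zero_of_lt (h : IsUniversal ρ r 0 v) (hr : r < p - 1) : v ≠ 0 := by
  rintro rfl
  obtain ⟨f, hf⟩ := h.exists_lift (isUniversal_sphericalQuot hr.le 0).heckeVec
  rw [map_zero] at hf
  exact elem_symLin_notMem hr ((Submodule.Quotient.mk_eq_zero _).1 hf.symm)

end Nonvanishing

section SupersingularVectors

/-- For `r = p - 1` the nonvanishing follows from the case `r = 0`. -/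
lemma IsUniversal.ne_zero {r : ℕ} {W : Type} [AddCommGroup W] [Module κ W]
    {ρ : GL2Rep W} {v : W} (h : IsUniversal ρ r 0 v) (hr : r ≤ p - 1) :
    v ≠ 0 := by
  have hp2 := (Fact.out : p.Prime).two_le
  rcases hr.lt_or_eq with hr | rfl
  · exact h.ne_zero_of_lt hr
  · rintro rfl
    have h0 := isUniversal_iwahoriQuot (p := p) 0 0
    have h1 := h0.heckeVec.matBeta_twist (Nat.zero_le _) (χ := 1) (by simp) (by simp)
    obtain ⟨f, hf⟩ := h.exists_lift h1
    rw [map_zero] at hf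
    refine h0.ne_zero_of_lt (by omega) ?_
    rw [← h0.heckeVec.matBeta_matBeta, ← hf, map_zero]

variable {W : Type*} [AddCommGroup W] [Module κ W]
  {ρ : GL2Rep W} {r : ℕ} {v : W}

/-- The polynomial `(X + 1) ⋯ (X + j)`. -/
def risingProd (p : ℕ) [Fact p.Prime] (j : ℕ) : κ[X] :=
  ∏ i ∈ Finset.range j, (X + C ((i : κ) + 1))

lemma monic_risingProd (j : ℕ) : (risingProd p j).Monic :=
  monic_prod_of_monic _ _ fun _ _ => monic_X_add_C _

lemma natDegree_risingProd (j : ℕ) : (risingProd p j).natDegree = j := by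
  rw [risingProd, natDegree_prod_of_monic _ _ fun _ _ => monic_X_add_C _]
  simp only [natDegree_X_add_C, Finset.sum_const, Finset.card_range, smul_eq_mul, mul_one]

lemma eval_risingProd_succ (j : ℕ) (u : κ) :
    (risingProd p (j + 1)).eval u = (risingProd p j).eval u * (u + j + 1) := by
  rw [risingProd, Finset.prod_range_succ, eval_mul, ← risingProd, eval_add, eval_X, eval_C, add_assoc]

lemma eval_risingProd_sub_one (j : ℕ) (u : κ) :
    (risingProd p (j + 1)).eval (u - 1) = (risingProd p j).eval u * u := by
  rw [risingProd, Finset.prod_range_succ', eval_mul, eval_prod, risingProd, eval_prod]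
  congr 1
  · refine Finset.prod_congr rfl fun i _ => ?_
    simp
  · simp

lemma eval_risingProd_pred (t : ZMod p) :
    (risingProd p (p - 1)).eval (ofFp t) = if t = 0 then -1 else 0 := by
  have hp2 := (Fact.out : p.Prime).two_le
  rw [risingProd, eval_prod]
  split_ifs with ht
  · subst ht
    have h1 := congrArg ofFp (ZMod.wilsons_lemma p)
    rw [← Finset.prod_range_add_one_eq_factorial] at h1
    push_cast at h1
    simpa using h1
  · have hv : t.val ≠ 0 := by rwa [Ne, ZMod.val_eq_zero]
    have hlt := ZMod.val_lt t
    refine Finset.prod_eq_zero (i := p - 1 - t.val) (Finset.mem_range.2 (by omega)) ?_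
    have h1 : ((t.val + (p - 1 - t.val + 1) : ℕ) : κ) = 0 := by
      have : t.val + (p - 1 - t.val + 1) = p := by omega
      rw [this, CharP.cast_eq_zero]
    have h2 : ((t.val : ℕ) : κ) = ofFp t := by
      rw [← map_natCast ofFp, ZMod.natCast_zmod_val]
    rw [eval_add, eval_X, eval_C, ← h2]
    push_cast at h1 ⊢
    exact h1

lemma uni_one_matX {x : W} (hx : IsUniFixed ρ x) (t : ZMod p) :
    ρ (uni 1) (ρ (matX t) x) = ρ (matX (t + 1)) x := by
  have e : uni 1 * matX t = uni (((1 + teich t : ℤ_[p])) : ℚ_[p]) * matF p := by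
    rw [matX_eq_uni, ← mul_assoc, ← uni_add]
    push_cast
    rfl
  obtain ⟨c, hc⟩ := toZMod_eq_zero_iff.1 (show toZMod (1 + teich t - teich (t + 1)) = 0 by
    rw [map_sub, map_add, toZMod_teich, toZMod_teich, map_one]
    ring)
  have e2 : (((1 + teich t : ℤ_[p])) : ℚ_[p])
      = ((teich (t + 1) : ℤ_[p]) : ℚ_[p]) + (p : ℚ_[p]) * (c : ℚ_[p]) := by
    have h : (1 + teich t : ℤ_[p]) = teich (t + 1) + (p : ℤ_[p]) * c := by rw [← hc]; ring
    rw [h, PadicInt.coe_add, PadicInt.coe_mul, PadicInt.coe_natCast]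
  rw [← mul_apply, ← map_mul, e, e2, uni_add, mul_assoc, ← matF_mul_uni, ← mul_assoc,
    ← matX_eq_uni, map_mul, mul_apply, hx]

/-- The vector `∑ P(t) X_t x`. -/
def sumEval (ρ : GL2Rep W) (x : W) : κ[X] →ₗ[κ] W :=
  ∑ t : ZMod p, (leval (ofFp t)).smulRight (ρ (matX t) x)

lemma sumEval_apply (x : W) (P : κ[X]) :
    sumEval ρ x P = ∑ t : ZMod p, P.eval (ofFp t) • ρ (matX t) x := by
  rw [sumEval, LinearMap.sum_apply]
  rfl

lemma opY_sumEval {x : W} (hx : IsUniFixed ρ x) (j : ℕ) :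
    opY ρ (sumEval ρ x (risingProd p (j + 1))) = - ((j + 1 : ℕ) : κ) • sumEval ρ x (risingProd p j) := by
  have h1 : ρ (uni 1) (sumEval ρ x (risingProd p (j + 1)))
      = ∑ t : ZMod p, (risingProd p (j + 1)).eval (ofFp t - 1)
        • ρ (matX t) x := by
    rw [sumEval_apply, map_sum]
    refine Fintype.sum_equiv (Equiv.addRight 1) _ _ fun t => ?_
    rw [map_smul, uni_one_matX hx]
    simp
  rw [opY, LinearMap.sub_apply, h1, Module.End.one_apply, sumEval_apply, sumEval_apply,
    ← Finset.sum_sub_distrib, Finset.smul_sum]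
  refine Finset.sum_congr rfl fun t _ => ?_
  rw [← sub_smul, eval_risingProd_sub_one, eval_risingProd_succ, smul_smul]
  congr 1
  push_cast
  ring

lemma sumEval_risingProd_pred (x : W) : sumEval ρ x (risingProd p (p - 1)) = - opF ρ x := by
  rw [sumEval_apply]
  simp only [eval_risingProd_pred, ite_smul, zero_smul]
  rw [Finset.sum_ite_eq', if_pos (Finset.mem_univ _), neg_smul, one_smul, matX_eq_uni]
  simp [teich, uni_zero, opF]

/-- For `a = 0`, the vector `Y ^ (p - 1 - r) F v` is a nonzero multiple of `β v`. -/
theorem HeckeVec.exists_opY_pow_opF (h : HeckeVec ρ r 0 v) (hr : r ≤ p - 1) :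
    ∃ c : κ, c ≠ 0 ∧ (opY ρ ^ (p - 1 - r)) (opF ρ v) = c • ρ (matBeta p) v := by
  have hp2 := (Fact.out : p.Prime).two_le
  have hlead : sumEval ρ v (risingProd p r) = (-1 : κ) ^ (r + 1) • ρ (matBeta p) v := by
    have h1 := linearMap_eq_coeff_smul hr (sumEval ρ v) ((-1 : κ) ^ (r + 1) • ρ (matBeta p) v)
      (fun s => by
        have h2 := h.matBeta_add_sum_matX s
        rw [zero_smul] at h2
        rw [sumEval_apply, eq_neg_of_add_eq_zero_left h2, smul_neg, ← neg_smul, pow_succ, mul_neg_one,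
          neg_neg, Finset.smul_sum]
        refine Finset.sum_congr rfl fun t _ => ?_
        rw [smul_smul, ← mul_pow, map_sub]
        simp) (natDegree_risingProd r).le
    have h3 := (monic_risingProd (p := p) r).coeff_natDegree
    rw [natDegree_risingProd] at h3
    rwa [h3, one_smul] at h1
  have key : ∀ n, r + n ≤ p - 1 → ∃ c : κ, c ≠ 0 ∧
      (opY ρ ^ n) (sumEval ρ v (risingProd p (r + n))) = c • ρ (matBeta p) v := by
    intro n
    induction n with
    | zero => exact fun _ => ⟨_, pow_ne_zero _ (neg_ne_zero.2 one_ne_zero), hlead⟩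
    | succ n ih =>
      intro hn
      obtain ⟨c, hc, e⟩ := ih (by omega)
      refine ⟨- ((r + n + 1 : ℕ) : κ) * c, mul_ne_zero (neg_ne_zero.2 ?_) hc, ?_⟩
      · rw [Ne, CharP.cast_eq_zero_iff κ p]
        exact fun hd => absurd (Nat.le_of_dvd (by omega) hd) (by omega)
      · rw [← add_assoc, pow_succ, mul_apply, opY_sumEval h.isUniFixed, map_smul, e, smul_smul]
  obtain ⟨c, hc, e⟩ := key (p - 1 - r) (by omega)
  rw [Nat.add_sub_cancel' hr, sumEval_risingProd_pred, map_neg] at e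
  exact ⟨-c, neg_ne_zero.2 hc, by rw [neg_smul, ← e, neg_neg]⟩

lemma opY_twist (χ : QpChar) :
    opY (twist ρ (χ.comp det)) = opY ρ := by
  refine LinearMap.ext fun x => ?_
  rw [opY, opY, LinearMap.sub_apply, LinearMap.sub_apply, twist_apply, comp_apply, det_uni,
    map_one, val_one, one_smul]

lemma opF_twist (χ : QpChar) (x : W) :
    opF (twist ρ (χ.comp det)) x = (χ (pUnit p) : κ) • opF ρ x := by
  rw [opF, twist_apply, comp_apply, det_matF]
  rfl

/-- The companion statement for `β v`. -/
theorem HeckeVec.exists_opY_pow_opF_matBeta (h : HeckeVec ρ r 0 v) (hr : r ≤ p - 1) :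
    ∃ c : κ, c ≠ 0 ∧ (opY ρ ^ r) (opF ρ (ρ (matBeta p) v)) = c • v := by
  have h1 := h.matBeta_twist hr (χ := (omegaQp p ^ r)⁻¹) (fun u => by
    rw [inv_apply, pow_apply, ← omegaQp_unitQ, ← val_pow_eq_pow_val,
      ← val_mul, inv_mul_cancel, val_one]) (by
    rw [inv_apply, pow_apply, omegaQp_pUnit, one_pow, inv_one, mul_one])
  obtain ⟨c, hc, e⟩ := h1.exists_opY_pow_opF (by omega)
  rw [opY_twist, opF_twist, twist_apply, h.matBeta_matBeta, map_smul, Nat.sub_sub_self hr, smul_smul] at e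
  refine ⟨(((((omegaQp p ^ r)⁻¹ : QpChar) (pUnit p))⁻¹ : κˣ) : κ) *
    (c * ((((omegaQp p ^ r)⁻¹).comp det (matBeta p) : κˣ) : κ)),
    mul_ne_zero (Units.ne_zero _) (mul_ne_zero hc (Units.ne_zero _)), ?_⟩
  rw [mul_smul, ← e, smul_smul, Units.inv_mul, one_smul]

end SupersingularVectors

section Rigidity

variable {W : Type} [AddCommGroup W] [Module κ W]
  {ρ : GL2Rep W} {r : ℕ} {v : W}

lemma unrQp_neg_one_comp_det_matBeta :
    ((unrQp (-1)).comp det (matBeta p) : κˣ) = -1 := by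
  rw [comp_apply, det_matBeta, map_mul, unrQp_unitQ, unrQp_pUnit, one_mul]

lemma IsUniversal.linearIndependent (h : IsUniversal ρ r 0 v) (hr : r ≤ p - 1) (hp : 2 < p) :
    LinearIndependent κ ![v, ρ (matBeta p) v] := by
  have hv := h.ne_zero hr
  rw [LinearIndependent.pair_iff' hv]
  intro c hc
  have h1 : (unrQp (-1 : κˣ)) (pUnit p) * (unrQp (-1 : κˣ)) (pUnit p) = 1 := by
    rw [unrQp_pUnit]
    simp
  have h2 := h.heckeVec.twist_unramified (χ := unrQp (-1)) (fun u => unrQp_unitQ _ u) h1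
  rw [mul_zero] at h2
  obtain ⟨f, hf⟩ := h.exists_lift h2
  have h3 : f (ρ (matBeta p) v) = twist ρ ((unrQp (-1)).comp det)
      (matBeta p) (f v) := by rw [f.isIntertwining]
  rw [hf, twist_apply, unrQp_neg_one_comp_det_matBeta, ← hc, map_smul, hf, Units.val_neg,
    val_one, neg_one_smul] at h3
  have h4 : ((2 : ℕ) : κ) • c • v = 0 := by
    rw [Nat.cast_smul_eq_nsmul, two_nsmul]
    nth_rewrite 1 [h3]
    rw [neg_add_cancel]
  have h5 : ((2 : ℕ) : κ) ≠ 0 := by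
    rw [Ne, CharP.cast_eq_zero_iff κ p]
    exact fun hd => absurd (Nat.le_of_dvd two_pos hd) (by omega)
  have h6 := (smul_eq_zero.1 h4).resolve_left h5
  rw [hc] at h6
  exact hv (by rw [← h.heckeVec.matBeta_matBeta, h6, map_zero])

lemma IsUniversal.isTower (h : IsUniversal ρ r 0 v) (hr : r ≤ p - 1) (hp : 2 < p) :
    IsTower p (opY ρ) (opF ρ) ![v, ρ (matBeta p) v] where
  commute := opF_mul_opY
  ker i := by
    fin_cases i
    · exact h.heckeVec.isUniFixed.opY_eq_zero
    · exact h.heckeVec.isUniFixed_matBeta.opY_eq_zero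
  linearIndependent := h.linearIndependent hr hp
  step := by
    obtain ⟨c, hc, e⟩ := h.heckeVec.exists_opY_pow_opF hr
    obtain ⟨c', hc', e'⟩ := h.heckeVec.exists_opY_pow_opF_matBeta hr
    refine ⟨Equiv.swap 0 1, ![p - 1 - r, r], ![c, c'], fun i => ?_, fun i => ?_⟩
    · fin_cases i <;> simpa
    · fin_cases i
      · simpa using e
      · simpa using e'

lemma IsUniversal.isUniFixed (h : IsUniversal ρ r 0 v) (i : Fin 2) :
    IsUniFixed ρ (![v, ρ (matBeta p) v] i) := by
  fin_cases i
  · exact h.heckeVec.isUniFixed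
  · exact h.heckeVec.isUniFixed_matBeta

lemma IsUniversal.borelSpan_eq_top (h : IsUniversal ρ r 0 v) :
    borelSpan ρ ![v, ρ (matBeta p) v] = ⊤ := by
  rw [eq_top_iff, ← h.heckeVec.borelSpan_eq_top h.generates (u := ![v, ρ (inclK p (matK 0)) v]) rfl rfl]
  refine span_le.2 ?_
  rintro _ ⟨i, b, n, rfl⟩
  fin_cases i
  · exact subset_span ⟨0, b, n, rfl⟩
  · refine subset_span ⟨1, b, n + 1, ?_⟩
    have e : ρ (inclK p (matK 0)) v = ρ (matF p) (ρ (matBeta p) v) := by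
      rw [← matK_zero_mul_matBeta, map_mul, mul_apply, h.heckeVec.matBeta_matBeta]
    change ρ _ (ρ (inclK p (matK 0)) v) = ρ _ (ρ (matBeta p) v)
    rw [e, zpow_add_one, ← mul_assoc, map_mul _ _ (matF p), mul_apply]

/-- A vector fixed by the integral unipotent matrices lies in the span of `v` and `β v` if some
iterate `Y ^ e F ^ n` maps it to a nonzero multiple of itself. -/
lemma IsUniversal.mem_span_of_iterate (h : IsUniversal ρ r 0 v) (hr : r ≤ p - 1) (hp : 2 < p) {x : W}
    (hx : IsUniFixed ρ x) (hit : ∀ n, ∃ m e, ∃ c : κ, n ≤ m ∧ c ≠ 0 ∧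
      (opY ρ ^ e) ((opF ρ ^ m) x) = c • x) :
    x ∈ span κ (Set.range ![v, ρ (matBeta p) v]) := by
  have hmem : x ∈ borelSpan ρ ![v, ρ (matBeta p) v] := by rw [h.borelSpan_eq_top]; trivial
  obtain ⟨n, hn⟩ := exists_opF_pow_mem_towerSpan h.isUniFixed hmem
  obtain ⟨m, e, c, hnm, hc, he⟩ := hit n
  refine (h.isTower hr hp).mem_of_ker ?_ hx.opY_eq_zero
  rw [← Submodule.smul_mem_iff _ hc, ← he]
  refine IsTower.Y_pow_mem ?_ _
  have := IsTower.F_pow_mem opF_mul_opY hn (m - n)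
  rwa [← mul_apply, ← pow_add, Nat.sub_add_cancel hnm] at this

lemma IsUniversal.opU_opU (h : IsUniversal ρ r 0 v) (hr : r ≤ p - 1) (hp : 2 < p) {x : W}
    (hx : x ∈ span κ (Set.range ![v, ρ (matBeta p) v])) :
    (opY ρ ^ (p - 1) * opF ρ) ((opY ρ ^ (p - 1) * opF ρ) x) = 0 := by
  obtain ⟨c, -, e⟩ := h.heckeVec.exists_opY_pow_opF hr
  obtain ⟨c', -, e'⟩ := h.heckeVec.exists_opY_pow_opF_matBeta hr
  have hY : ∀ n, n ≠ 0 → ∀ i, (opY ρ ^ n) (![v, ρ (matBeta p) v] i) = 0 := by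
    intro n hn i
    obtain ⟨n, rfl⟩ := Nat.exists_eq_succ_of_ne_zero hn
    rw [pow_succ, mul_apply, (h.isUniFixed i).opY_eq_zero, map_zero]
  have h0 := fun n hn => hY n hn 0
  have h1 := fun n hn => hY n hn 1
  simp only [Matrix.cons_val_zero, Matrix.cons_val_one] at h0 h1
  have hUv : (opY ρ ^ (p - 1) * opF ρ) v = c • (opY ρ ^ r) (ρ (matBeta p) v) := by
    rw [← map_smul, ← e, ← mul_apply (opY ρ ^ r), ← pow_add, Nat.add_sub_cancel' hr]
    rfl
  have hUw : (opY ρ ^ (p - 1) * opF ρ) (ρ (matBeta p) v) = c' • (opY ρ ^ (p - 1 - r)) v := by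
    rw [← map_smul, ← e', ← mul_apply (opY ρ ^ _), ← pow_add, Nat.sub_add_cancel hr]
    rfl
  have hle : span κ (Set.range ![v, ρ (matBeta p) v])
      ≤ LinearMap.ker ((opY ρ ^ (p - 1) * opF ρ) * (opY ρ ^ (p - 1) * opF ρ)) := by
    refine span_le.2 ?_
    rintro _ ⟨i, rfl⟩
    rw [SetLike.mem_coe, LinearMap.mem_ker, mul_apply]
    fin_cases i
    · change (opY ρ ^ (p - 1) * opF ρ) ((opY ρ ^ (p - 1) * opF ρ) v) = 0
      by_cases hr0 : r = 0
      · rw [hUv, hr0, pow_zero, Module.End.one_apply, map_smul, hUw, h0 _ (by omega), smul_zero,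
          smul_zero]
      · rw [hUv, h1 _ hr0, smul_zero, map_zero]
    · change (opY ρ ^ (p - 1) * opF ρ) ((opY ρ ^ (p - 1) * opF ρ) (ρ (matBeta p) v)) = 0
      by_cases hr0 : p - 1 - r = 0
      · rw [hUw, hr0, pow_zero, Module.End.one_apply, map_smul, hUv, h1 _ (by omega), smul_zero,
          smul_zero]
      · rw [hUw, h0 _ hr0, smul_zero, map_zero]
  exact hle hx

/-- The representation `π(r, 0, 1)` contains no eigenvector of `U` with nonzero eigenvalue. -/
theorem IsUniversal.not_hasDataMod (h : IsUniversal ρ r 0 v) (hr : r ≤ p - 1) (hp : 2 < p) {x : W}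
    (hx : x ≠ 0) {χ₁ χ₂ : QpChar} : ¬ HasDataMod ρ ⊥ x χ₁ χ₂ := by
  intro hd
  have hfix : IsUniFixed ρ x := fun b => sub_eq_zero.1 ((Submodule.mem_bot _).1 (hd.uni b))
  have hU : (opY ρ ^ (p - 1) * opF ρ) x = (χ₂ (pUnit p) : κ) • x := by
    rw [mul_apply, ← hfix.sum_matX]
    exact sub_eq_zero.1 ((Submodule.mem_bot _).1 hd.sum_matX)
  have hmem := h.mem_span_of_iterate hr hp hfix fun n =>
    ⟨n, p ^ n - 1, _, le_rfl, pow_ne_zero n (χ₂ (pUnit p)).ne_zero, by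
      rw [← mul_apply, ← opU_pow]
      induction n with
      | zero => simp
      | succ n ih => rw [pow_succ', mul_apply, ih, map_smul, hU, smul_smul, pow_succ]⟩
  have h2 := h.opU_opU hr hp hmem
  rw [hU, map_smul, hU, smul_smul] at h2
  exact hx ((smul_eq_zero.1 h2).resolve_left (mul_ne_zero (Units.ne_zero _) (Units.ne_zero _)))

lemma HeckeVec.iterate {s : ℕ} {x : W} (hx : HeckeVec ρ s 0 x) (hs : s ≤ p - 1) (n : ℕ) :
    ∃ m e, ∃ c : κ, n ≤ m ∧ c ≠ 0 ∧ (opY ρ ^ e) ((opF ρ ^ m) x) = c • x := by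
  obtain ⟨c, hc, e⟩ := hx.exists_opY_pow_opF hs
  obtain ⟨c', hc', e'⟩ := hx.exists_opY_pow_opF_matBeta hs
  refine ⟨2 * n, ?_⟩
  suffices H : ∃ (k : ℕ) (l : κ), l ≠ 0 ∧ (opY ρ ^ k) ((opF ρ ^ (2 * n)) x) = l • x by
    obtain ⟨k, l, hl, H⟩ := H
    exact ⟨k, l, by omega, hl, H⟩
  have hstep : ∃ (k : ℕ) (l : κ), l ≠ 0 ∧ (opY ρ ^ k * opF ρ ^ 2) x = l • x := by
    refine ⟨s + p * (p - 1 - s), c * c', mul_ne_zero hc hc', ?_⟩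
    have h1 := IsTower.pow_commute (opF_mul_opY (ρ := ρ)) 1 (p - 1 - s)
    rw [pow_one, pow_one] at h1
    rw [pow_add, mul_assoc, sq, ← mul_assoc (opY ρ ^ (p * _)), ← h1, mul_assoc, mul_apply,
      mul_apply, mul_apply, e, map_smul, map_smul, e', smul_smul]
  obtain ⟨k, l, hl, H⟩ := hstep
  induction n with
  | zero => exact ⟨0, 1, one_ne_zero, by simp⟩
  | succ n ih =>
    obtain ⟨k', l', hl', H'⟩ := ih
    refine ⟨k' + p ^ (2 * n) * k, l * l', mul_ne_zero hl hl', ?_⟩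
    have h1 := IsTower.pow_commute (opF_mul_opY (ρ := ρ)) (2 * n) k
    have e1 : opY ρ ^ (k' + p ^ (2 * n) * k) * opF ρ ^ (2 * (n + 1))
        = opY ρ ^ k' * opF ρ ^ (2 * n) * (opY ρ ^ k * opF ρ ^ 2) := by
      rw [mul_assoc (opY ρ ^ k'), ← mul_assoc (opF ρ ^ (2 * n)), h1, mul_add, mul_one, pow_add, pow_add]
      simp only [mul_assoc]
    rw [← mul_apply, e1, mul_apply, H, map_smul, mul_apply, H', smul_smul]

lemma HeckeVec.iterate_of_twist {s : ℕ} {x : W} {χ : QpChar}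
    (hx : HeckeVec (twist ρ (χ.comp det)) s 0 x) (hs : s ≤ p - 1) (n : ℕ) :
    ∃ m e, ∃ c : κ, n ≤ m ∧ c ≠ 0 ∧ (opY ρ ^ e) ((opF ρ ^ m) x) = c • x := by
  obtain ⟨m, e, c, hm, hc, h⟩ := hx.iterate hs n
  have h1 : (opF (twist ρ (χ.comp det)) ^ m) x
      = (χ (pUnit p) : κ) ^ m • (opF ρ ^ m) x := by
    clear h hm
    induction m with
    | zero => simp
    | succ m ih =>
      rw [pow_succ', mul_apply, ih, map_smul, opF_twist, smul_smul, ← pow_succ, pow_succ' (opF ρ)]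
      rfl
  have hne : (χ (pUnit p) : κ) ^ m ≠ 0 := pow_ne_zero _ (Units.ne_zero _)
  refine ⟨m, e, ((χ (pUnit p) : κ) ^ m)⁻¹ * c, hm, mul_ne_zero (inv_ne_zero hne) hc, ?_⟩
  rw [opY_twist, h1, map_smul] at h
  rw [mul_smul, ← h, smul_smul, inv_mul_cancel₀ hne, one_smul]

/-- The vectors in twists of `π(r, 0, 1)` which satisfy the relations of `π(s, 0, 1)`. -/
theorem IsUniversal.rigidity (h : IsUniversal ρ r 0 v) (hr : r ≤ p - 1) (hp : 2 < p) {s : ℕ}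
    (hs : s ≤ p - 1) {χ : QpChar} {x : W} (hx0 : x ≠ 0)
    (hx : HeckeVec (twist ρ (χ.comp det)) s 0 x) :
    χ (pUnit p) * χ (pUnit p) = 1 ∧
    ((∀ u, χ (unitQ p u) = 1 ∧ toFpbar p u ^ s = toFpbar p u ^ r) ∨
      (∀ u, (χ (unitQ p u) : κ) = toFpbar p u ^ s ∧ toFpbar p u ^ s * toFpbar p u ^ r = 1)) := by
  have hfix : IsUniFixed ρ x := fun b => by
    have := hx.isUniFixed b
    rwa [twist_apply, comp_apply, det_uni, map_one, val_one, one_smul] at this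
  have hmem := h.mem_span_of_iterate hr hp hfix (hx.iterate_of_twist hs)
  obtain ⟨α, α', rfl⟩ : ∃ α α' : κ, x = α • v + α' • ρ (matBeta p) v := by
    rw [Matrix.range_cons, Matrix.range_cons, Matrix.range_empty, Set.union_empty, Set.singleton_union,
      Submodule.mem_span_pair] at hmem
    obtain ⟨α, α', e⟩ := hmem
    exact ⟨α, α', e.symm⟩
  have hind := h.linearIndependent hr hp
  rw [LinearIndependent.pair_iff] at hind
  have hpair : ∀ a b a' b' : κ, a • v + b • ρ (matBeta p) v = a' • v + b' • ρ (matBeta p) v →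
      a = a' ∧ b = b' := by
    intro a b a' b' e
    have := hind (a - a') (b - b') (by
      rw [sub_smul, sub_smul, sub_add_sub_comm, e, sub_self])
    exact ⟨sub_eq_zero.1 this.1, sub_eq_zero.1 this.2⟩
  have htorus : ∀ a d : ℤ_[p]ˣ,
      (χ (unitQ p a) : κ) * χ (unitQ p d) * (α * toFpbar p a ^ r) = toFpbar p a ^ s * α ∧
      (χ (unitQ p a) : κ) * χ (unitQ p d) * (α' * toFpbar p d ^ r) = toFpbar p a ^ s * α' := by
    intro a d
    have h1 := hx.iwahori ⟨_, diagK_mem_iwahori a d⟩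
    rw [twist_apply, comp_apply, det_inclK, map_add, map_smul, map_smul,
      h.heckeVec.iwahori ⟨_, diagK_mem_iwahori a d⟩,
      h.heckeVec.iwahori_matBeta ⟨_, diagK_mem_iwahori a d⟩] at h1
    have e : det (diagK a d) = a * d := Units.ext (by simp [diagK])
    simp only [e, map_mul, val_mul, smul_add, smul_smul] at h1
    have h2 := hpair _ _ _ _ h1
    simpa [diagK] using h2
  have hcenter : (χ (pUnit p) : κ) * χ (pUnit p) = 1 := by
    have h1 := hx.pScalar
    rw [twist_apply, comp_apply, det_pScalar, map_add, map_smul, map_smul,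
      h.heckeVec.pScalar_smul, h.heckeVec.pScalar, map_mul, val_mul] at h1
    have h2 : ((χ (pUnit p) : κ) * χ (pUnit p) - 1) • (α • v + α' • ρ (matBeta p) v) = 0 := by
      rw [sub_smul, h1, one_smul, sub_self]
    exact sub_eq_zero.1 ((smul_eq_zero.1 h2).resolve_right hx0)
  refine ⟨Units.ext hcenter, ?_⟩
  by_cases hα : α = 0
  · have hα' : α' ≠ 0 := by
      rintro rfl
      exact hx0 (by rw [hα, zero_smul, zero_smul, add_zero])
    right
    intro u
    have h1 := (htorus u 1).2
    have h2 := (htorus 1 u).2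
    simp only [map_one, val_one, one_pow, one_mul, mul_one] at h1 h2
    have h1' : (χ (unitQ p u) : κ) = toFpbar p u ^ s := mul_right_cancel₀ hα' h1
    refine ⟨h1', ?_⟩
    rw [h1'] at h2
    refine mul_left_cancel₀ hα' ?_
    linear_combination h2
  · left
    intro u
    have h1 := (htorus u 1).1
    have h2 := (htorus 1 u).1
    simp only [map_one, val_one, one_pow, one_mul, mul_one] at h1 h2
    have h2' : (χ (unitQ p u) : κ) = 1 := by
      refine mul_right_cancel₀ hα ?_
      rw [h2, one_mul]
    refine ⟨Units.ext h2', mul_left_cancel₀ hα ?_⟩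
    rw [h2', one_mul] at h1
    rw [h1, mul_comm]

end Rigidity

section CompositionFactors

variable {R : Type*} [Ring R] {M M' S S' : Type*} [AddCommGroup M] [Module R M] [AddCommGroup M']
  [Module R M'] [AddCommGroup S] [Module R S] [AddCommGroup S'] [Module R S']

/-- The product of the successive quotients of a composition series. -/
abbrev gradedModule (s : CompositionSeries (Submodule R M)) : Type _ :=
  (i : Fin s.length) → (s i.succ ⧸ (s i.castSucc).submoduleOf (s i.succ))

lemma nonempty_quotient_equiv_of_iso {x y : Submodule R M × Submodule R M}
    (h : JordanHolderLattice.Iso x y) :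
    Nonempty ((x.2 ⧸ x.1.submoduleOf x.2) ≃ₗ[R] (y.2 ⧸ y.1.submoduleOf y.2)) := by
  refine JordanHolderLattice.Iso.rel
    (fun x y : Submodule R M × Submodule R M =>
      Nonempty ((x.2 ⧸ x.1.submoduleOf x.2) ≃ₗ[R] (y.2 ⧸ y.1.submoduleOf y.2)))
    ⟨LinearEquiv.refl _ _⟩ (fun ⟨e⟩ => ⟨e.symm⟩) (fun ⟨e⟩ ⟨e'⟩ => ⟨e.trans e'⟩) ?_ h
  intro a b _
  have h1 := LinearMap.quotientInfEquivSupQuotient b a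
  dsimp only
  rw [sup_comm a b, inf_comm a b]
  have h2 : Submodule.comap b.subtype (b ⊓ a) = (b ⊓ a).submoduleOf b := rfl
  exact ⟨h1.symm⟩

lemma nonempty_pi_equiv {ι ι' : Type*} {A : ι → Type*} {B : ι' → Type*} [∀ i, AddCommGroup (A i)]
    [∀ i, Module R (A i)] [∀ i, AddCommGroup (B i)] [∀ i, Module R (B i)] (f : ι ≃ ι')
    (h : ∀ i, Nonempty (A i ≃ₗ[R] B (f i))) : Nonempty ((∀ i, A i) ≃ₗ[R] ∀ j, B j) :=
  ⟨(LinearEquiv.piCongrRight fun i => (h i).some).trans (LinearEquiv.piCongrLeft R B f)⟩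

/-- The Jordan–Hölder theorem. -/
lemma nonempty_gradedModule_equiv (s s' : CompositionSeries (Submodule R M))
    (h0 : s.head = s'.head) (h1 : s.last = s'.last) :
    Nonempty (gradedModule s ≃ₗ[R] gradedModule s') := by
  obtain ⟨f, hf⟩ := CompositionSeries.jordan_holder s s' h0 h1
  exact nonempty_pi_equiv f fun i => nonempty_quotient_equiv_of_iso (hf i)

/-- The image of a composition series under an isomorphism. -/
lemma exists_map_compositionSeries (e : M ≃ₗ[R] M') (s : CompositionSeries (Submodule R M))
    (h0 : s.head = ⊥) (h1 : s.last = ⊤) :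
    ∃ s' : CompositionSeries (Submodule R M'), s'.head = ⊥ ∧ s'.last = ⊤ ∧
      Nonempty (gradedModule s ≃ₗ[R] gradedModule s') := by
  refine ⟨⟨s.length, fun i => Submodule.orderIsoMapComap e (s i), fun i =>
    (apply_covBy_apply_iff (Submodule.orderIsoMapComap e)).2 (s.step i)⟩, ?_, ?_, ?_⟩
  · change Submodule.orderIsoMapComap e s.head = ⊥
    rw [h0, OrderIso.map_bot]
  · change Submodule.orderIsoMapComap e s.last = ⊤
    rw [h1, OrderIso.map_top]
  · refine nonempty_pi_equiv (Equiv.refl _) fun i => ⟨?_⟩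
    refine Submodule.Quotient.equiv _ _ (e.submoduleMap (s i.succ)) ?_
    ext ⟨x, hx⟩
    simp only [Submodule.submoduleOf, Submodule.mem_map, Submodule.mem_comap, Submodule.subtype_apply]
    constructor
    · rintro ⟨y, hy, hy'⟩
      exact ⟨y, hy, congrArg Subtype.val hy'⟩
    · rintro ⟨y, hy, hy'⟩
      exact ⟨⟨y, (s.step i).le hy⟩, hy, Subtype.ext hy'⟩

lemma covBy_of_strictMono {α : Type*} [PartialOrder α] [BoundedOrder α] {n : α → Fin 3}
    (hn : StrictMono n) {x : α} (h0 : x ≠ ⊥) (h1 : x ≠ ⊤) : ⊥ ⋖ x ∧ x ⋖ ⊤ := by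
  have h2 := hn (bot_lt_iff_ne_bot.2 h0)
  have h3 := hn (lt_top_iff_ne_top.2 h1)
  refine ⟨⟨bot_lt_iff_ne_bot.2 h0, fun y h4 h5 => ?_⟩, ⟨lt_top_iff_ne_top.2 h1, fun y h4 h5 => ?_⟩⟩
  · have h6 := hn h4
    have h7 := hn h5
    omega
  · have h6 := hn h4
    have h7 := hn h5
    omega

lemma exists_compositionSeries_of_strictMono {n : Submodule R M → Fin 3} (hn : StrictMono n) :
    ∃ s : CompositionSeries (Submodule R M), s.head = ⊥ ∧ s.last = ⊤ := by
  have : IsNoetherian R M := (isNoetherian_iff' (R := R) (M := M)).2 hn.wellFoundedGT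
  have : IsArtinian R M := hn.wellFoundedLT
  exact exists_compositionSeries_of_isNoetherian_isArtinian R M

lemma exists_compositionSeries_of_covBy {N : Submodule R M} (h0 : ⊥ ⋖ N) (h1 : N ⋖ ⊤) :
    ∃ s : CompositionSeries (Submodule R M), s.head = ⊥ ∧ s.last = ⊤ ∧
      Nonempty (gradedModule s ≃ₗ[R] N × (M ⧸ N)) := by
  refine ⟨⟨2, ![⊥, N, ⊤], fun i => by fin_cases i; exacts [h0, h1]⟩, rfl, rfl, ?_⟩
  refine ⟨(LinearEquiv.piFinTwo R _).trans (LinearEquiv.prodCongr ?_ ?_)⟩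
  · refine Submodule.quotEquivOfEqBot _ ?_
    rw [Submodule.submoduleOf, eq_bot_iff]
    rintro ⟨x, hx⟩ hx'
    exact Subtype.ext hx'
  · refine Submodule.Quotient.equiv _ _ Submodule.topEquiv ?_
    ext x
    simp only [Submodule.mem_map]
    constructor
    · rintro ⟨y, hy, rfl⟩
      exact hy
    · intro hx
      exact ⟨⟨x, trivial⟩, hx, rfl⟩

/-- Two modules of length two which are connected by nonzero homomorphisms whose composites vanish
have the same composition factors. -/
lemma exists_compositionSeries_pair {n : Submodule R M → Fin 3} (hn : StrictMono n)
    {n' : Submodule R M' → Fin 3} (hn' : StrictMono n') (f : M →ₗ[R] M') (g : M' →ₗ[R] M)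
    (hf : f ≠ 0) (hg : g ≠ 0) (hfg : f ∘ₗ g = 0) (hgf : g ∘ₗ f = 0) :
    ∃ (s : CompositionSeries (Submodule R M)) (s' : CompositionSeries (Submodule R M')),
      s.head = ⊥ ∧ s.last = ⊤ ∧ s'.head = ⊥ ∧ s'.last = ⊤ ∧
      Nonempty (gradedModule s ≃ₗ[R] gradedModule s') := by
  have h1 : LinearMap.range g ≤ LinearMap.ker f := LinearMap.range_le_ker_iff.2 hfg
  have h2 : LinearMap.range f ≤ LinearMap.ker g := LinearMap.range_le_ker_iff.2 hgf
  have h3 : LinearMap.range g ≠ ⊥ := fun h => hg (LinearMap.range_eq_bot.1 h)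
  have h4 : LinearMap.range f ≠ ⊥ := fun h => hf (LinearMap.range_eq_bot.1 h)
  have h5 : LinearMap.ker f ≠ ⊤ := fun h => hf (LinearMap.ker_eq_top.1 h)
  have h6 : LinearMap.ker g ≠ ⊤ := fun h => hg (LinearMap.ker_eq_top.1 h)
  have c1 := covBy_of_strictMono hn (x := LinearMap.ker f)
    (fun h => h3 (eq_bot_iff.2 (h1.trans h.le))) h5
  have c2 := covBy_of_strictMono hn' (x := LinearMap.ker g)
    (fun h => h4 (eq_bot_iff.2 (h2.trans h.le))) h6
  have e1 : LinearMap.range g = LinearMap.ker f :=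
    (c1.1.eq_or_eq bot_le h1).resolve_left h3
  have e2 : LinearMap.range f = LinearMap.ker g :=
    (c2.1.eq_or_eq bot_le h2).resolve_left h4
  obtain ⟨s, hs0, hs1, ⟨e⟩⟩ := exists_compositionSeries_of_covBy c1.1 c1.2
  obtain ⟨s', hs0', hs1', ⟨e'⟩⟩ := exists_compositionSeries_of_covBy c2.1 c2.2
  have q1 : LinearMap.ker f ≃ₗ[R] M' ⧸ LinearMap.ker g :=
    (LinearEquiv.ofEq _ _ e1.symm).trans g.quotKerEquivRange.symm
  have q2 : (M ⧸ LinearMap.ker f) ≃ₗ[R] LinearMap.ker g :=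
    f.quotKerEquivRange.trans (LinearEquiv.ofEq _ _ e2)
  exact ⟨s, s', hs0, hs1, hs0', hs1',
    ⟨(e.trans ((q1.prodCongr q2).trans (LinearEquiv.prodComm R _ _))).trans e'.symm⟩⟩

end CompositionFactors

section Semisimplification

variable {k G : Type*} [CommRing k] [Group G] {V V' W W' : Type*} [AddCommGroup V] [Module k V]
  [AddCommGroup V'] [Module k V'] [AddCommGroup W] [Module k W] [AddCommGroup W'] [Module k W']
  {ρ : Representation k G V} {ρ' : Representation k G V'} {σ : Representation k G W}
  {σ' : Representation k G W'}

lemma nonempty_equiv_iff_asModule :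
    Nonempty (ρ.Equiv σ) ↔ Nonempty (ρ.asModule ≃ₗ[MonoidAlgebra k G] σ.asModule) := by
  constructor
  · rintro ⟨e⟩
    refine ⟨LinearEquiv.ofBijective
      (Representation.IntertwiningMap.equivLinearMapAsModule ρ σ e.toIntertwiningMap) e.bijective⟩
  · rintro ⟨e⟩
    exact ⟨Representation.IntertwiningMap.ofBijective
      ((Representation.IntertwiningMap.equivLinearMapAsModule ρ σ).symm e.toLinearMap) e.bijective⟩

lemma exists_representation_asModule_equiv (M : Type*) [AddCommGroup M] [Module k M]
    [Module (MonoidAlgebra k G) M] [IsScalarTower k (MonoidAlgebra k G) M] :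
    ∃ τ : Representation k G M, Nonempty (τ.asModule ≃ₗ[MonoidAlgebra k G] M) := by
  let τ : Representation k G M :=
    (Algebra.lsmul k k M : MonoidAlgebra k G →ₐ[k] _).toMonoidHom.comp (MonoidAlgebra.of _ _)
  have hτ : τ.asAlgebraHom = Algebra.lsmul k k M :=
    MonoidAlgebra.algHom_ext (fun g => τ.asAlgebraHom_single_one g) (Subsingleton.elim _ _)
  refine ⟨τ, ⟨{ τ.asModuleEquiv with map_smul' := fun m x => ?_ }⟩⟩
  change τ.asAlgebraHom m (τ.asModuleEquiv x) = _
  rw [hτ]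
  rfl

lemma IsSemisimplification.of_equiv (h : IsSemisimplification ρ σ) (e : Nonempty (ρ.Equiv ρ')) :
    IsSemisimplification ρ' σ := by
  obtain ⟨s, h0, h1, ⟨h2⟩⟩ := h
  obtain ⟨e⟩ := nonempty_equiv_iff_asModule.1 e
  obtain ⟨s', h0', h1', ⟨h2'⟩⟩ := exists_map_compositionSeries e s h0 h1
  exact ⟨s', h0', h1', ⟨h2.trans h2'⟩⟩

lemma IsSemisimplification.nonempty_equiv (h : IsSemisimplification ρ σ)
    (h' : IsSemisimplification ρ σ') : Nonempty (σ.Equiv σ') := by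
  obtain ⟨s, h0, h1, ⟨h2⟩⟩ := h
  obtain ⟨s', h0', h1', ⟨h2'⟩⟩ := h'
  obtain ⟨e⟩ := nonempty_gradedModule_equiv s s' (h0.trans h0'.symm) (h1.trans h1'.symm)
  exact nonempty_equiv_iff_asModule.2 ⟨(h2.trans e).trans h2'.symm⟩

/-- Representations with the same composition factors have the same semisimplification. -/
lemma nonempty_equiv_of_compositionSeries
    {s : CompositionSeries (Submodule (MonoidAlgebra k G) ρ.asModule)}
    {s' : CompositionSeries (Submodule (MonoidAlgebra k G) ρ'.asModule)}
    (h0 : s.head = ⊥) (h1 : s.last = ⊤) (h0' : s'.head = ⊥) (h1' : s'.last = ⊤)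
    (e : Nonempty (gradedModule s ≃ₗ[MonoidAlgebra k G] gradedModule s'))
    (h : IsSemisimplification ρ σ) (h' : IsSemisimplification ρ' σ') : Nonempty (σ.Equiv σ') := by
  obtain ⟨t, t0, t1, ⟨t2⟩⟩ := h
  obtain ⟨t', t0', t1', ⟨t2'⟩⟩ := h'
  obtain ⟨e⟩ := e
  obtain ⟨q⟩ := nonempty_gradedModule_equiv t s (t0.trans h0.symm) (t1.trans h1.symm)
  obtain ⟨q'⟩ := nonempty_gradedModule_equiv t' s' (t0'.trans h0'.symm) (t1'.trans h1'.symm)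
  exact nonempty_equiv_iff_asModule.2 ⟨(t2.trans (q.trans e)).trans (t2'.trans q').symm⟩

end Semisimplification

section OrdinarySemisimplification

variable {W W' S : Type} [AddCommGroup W] [Module κ W]
  [AddCommGroup W'] [Module κ W'] [AddCommGroup S] [Module κ S]
  {ρ : GL2Rep W} {ρ' : GL2Rep W'}
  {τ : GL2Rep S} {f : W} {χ₁ χ₂ χ₁' χ₂' : QpChar}

/-- The elements of the group ring which annihilate the vectors with data `χ₁`, `χ₂`. -/
def dataSet (χ₁ χ₂ : QpChar) : Set (MonoidAlgebra κ (GL2Qp p)) :=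
  {m | (∃ b : ℤ_[p], m = MonoidAlgebra.of _ _ (uni (b : ℚ_[p])) - 1) ∨
    (∃ a d : ℤ_[p]ˣ, m = MonoidAlgebra.of _ _ (inclK p (diagK a d)) - algebraMap κ _
      ((χ₂ (unitQ p a) * χ₁ (unitQ p d) : κˣ) : κ)) ∨
    m = MonoidAlgebra.of _ _ (pScalar p) - algebraMap κ _
      ((χ₁ (pUnit p) * χ₂ (pUnit p) : κˣ) : κ) ∨
    m = ∑ t : ZMod p, MonoidAlgebra.of _ _ (matX t) - algebraMap κ _
      (χ₂ (pUnit p) : κ)}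

lemma smul_asModule (m : MonoidAlgebra κ (GL2Qp p)) (x : ρ.asModule) :
    m • x = ρ.asAlgebraHom m (ρ.asModuleEquiv x) := rfl

lemma hasDataMod_iff (N : Submodule (MonoidAlgebra κ (GL2Qp p)) ρ.asModule) (x : W) :
    HasDataMod ρ (Subrepresentation.ofSubmodule' N).toSubmodule x χ₁ χ₂ ↔
      ∀ m ∈ dataSet χ₁ χ₂, m • (ρ.asModuleEquiv.symm x) ∈ N := by
  have e1 : ∀ g, (MonoidAlgebra.of κ (GL2Qp p) g) • (ρ.asModuleEquiv.symm x)
      = ρ.asModuleEquiv.symm (ρ g x) := fun g => by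
    rw [smul_asModule, Representation.asAlgebraHom_of]
    rfl
  have e2 : ∀ c : κ, (algebraMap κ (MonoidAlgebra κ (GL2Qp p)) c) •
      (ρ.asModuleEquiv.symm x) = ρ.asModuleEquiv.symm (c • x) := fun c => by
    rw [smul_asModule, AlgHom.commutes]
    rfl
  constructor
  · rintro ⟨h1, h2, h3, h4⟩ m (⟨b, rfl⟩ | ⟨a, d, rfl⟩ | rfl | rfl)
    · rw [sub_smul, e1, one_smul]
      exact h1 b
    · rw [sub_smul, e1, e2]
      exact h2 a d
    · rw [sub_smul, e1, e2]
      exact h3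
    · rw [sub_smul, Finset.sum_smul, Finset.sum_congr rfl fun t _ => e1 _, e2, ← map_sum]
      exact h4
  · intro h
    refine ⟨fun b => ?_, fun a d => ?_, ?_, ?_⟩
    · have := h _ (Or.inl ⟨b, rfl⟩)
      rw [sub_smul, e1, one_smul] at this
      exact this
    · have := h _ (Or.inr (Or.inl ⟨a, d, rfl⟩))
      rw [sub_smul, e1, e2] at this
      exact this
    · have := h _ (Or.inr (Or.inr (Or.inl rfl)))
      rw [sub_smul, e1, e2] at this
      exact this
    · have := h _ (Or.inr (Or.inr (Or.inr rfl)))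
      rw [sub_smul, Finset.sum_smul, Finset.sum_congr rfl fun t _ => e1 _, e2, ← map_sum] at this
      exact this

lemma hasDataMod_bot_iff (x : W) :
    HasDataMod ρ ⊥ x χ₁ χ₂ ↔ ∀ m ∈ dataSet χ₁ χ₂, m • (ρ.asModuleEquiv.symm x) = 0 := by
  have h : (Subrepresentation.ofSubmodule' (ρ := ρ) ⊥).toSubmodule = ⊥ := rfl
  rw [← h, hasDataMod_iff]
  simp only [Submodule.mem_bot]

lemma HasDataMod.map {x : W} (h : HasDataMod ρ ⊥ x χ₁ χ₂) (e : ρ.IntertwiningMap ρ') :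
    HasDataMod ρ' ⊥ (e x) χ₁ χ₂ := by
  rw [hasDataMod_bot_iff] at h ⊢
  intro m hm
  have h1 := congrArg (Representation.IntertwiningMap.equivLinearMapAsModule ρ ρ' e) (h m hm)
  rw [map_smul, map_zero] at h1
  exact h1

lemma isStable_ofSubmodule (N : Submodule (MonoidAlgebra κ (GL2Qp p)) ρ.asModule) :
    IsStable ρ (Subrepresentation.ofSubmodule' N).toSubmodule :=
  fun g _ hx => (Subrepresentation.ofSubmodule' N).apply_mem_toSubmodule g hx

lemma IsOrdinary.exists_strictMono (h : IsOrdinary ρ f χ₁ χ₂) :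
    ∃ n : Submodule (MonoidAlgebra κ (GL2Qp p)) ρ.asModule → Fin 3, StrictMono n := by
  classical
  let A := borelSpan ρ fun _ : Unit => f
  let q := fun N : Submodule (MonoidAlgebra κ (GL2Qp p)) ρ.asModule =>
    (Subrepresentation.ofSubmodule' N).toSubmodule
  refine ⟨fun N => ⟨(if f ∈ q N then 1 else 0) + if q N ≤ A then 0 else 1, by
    split_ifs <;> omega⟩, fun N N' hN => ?_⟩
  have hlt : q N < q N' := hN
  rw [Fin.mk_lt_mk]
  rcases h.lt_of_lt (isStable_ofSubmodule N) (isStable_ofSubmodule N') hlt with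
    ⟨h1, h2⟩ | ⟨h1, h2, h3⟩
  · have h3 : q N' ≤ A → q N ≤ A := hlt.le.trans
    rw [if_neg h1, if_pos h2]
    split_ifs <;> first | omega | tauto
  · rw [if_pos h2, if_neg h3]
    by_cases h4 : f ∈ q N
    · rw [if_pos h4, if_pos (h1.1 h4)]
      omega
    · rw [if_neg h4, if_neg fun h5 => h4 (h1.2 h5)]
      omega

lemma IsOrdinary.exists_isSemisimplification (h : IsOrdinary ρ f χ₁ χ₂) :
    ∃ (S : Type) (_ : AddCommGroup S) (_ : Module κ S)
      (τ : GL2Rep S), IsSemisimplification ρ τ := by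
  obtain ⟨n, hn⟩ := h.exists_strictMono
  obtain ⟨s, h0, h1⟩ := exists_compositionSeries_of_strictMono hn
  obtain ⟨τ, hτ⟩ := exists_representation_asModule_equiv (k := κ) (G := GL2Qp p)
    (gradedModule s)
  exact ⟨_, _, _, τ, s, h0, h1, hτ⟩

lemma IsSemisimplification.exists_hasDataMod (hs : IsSemisimplification ρ τ)
    (h : IsOrdinary ρ f χ₁ χ₂) : ∃ x, x ≠ 0 ∧ HasDataMod τ ⊥ x χ₁ χ₂ := by
  classical
  obtain ⟨s, h0, h1, ⟨e⟩⟩ := hs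
  have hex : ∃ j : Fin (s.length + 1), ρ.asModuleEquiv.symm f ∈ s j :=
    ⟨Fin.last _, by
      change _ ∈ s.last
      rw [h1]
      trivial⟩
  have hfd := (hasDataMod_bot_iff f).1 h.data
  obtain ⟨i, hi, hi'⟩ : ∃ i : Fin s.length, ρ.asModuleEquiv.symm f ∈ s i.succ ∧
      ρ.asModuleEquiv.symm f ∉ s i.castSucc := by
    by_contra hcon
    push Not at hcon
    have h2 : ∀ j : Fin (s.length + 1), ρ.asModuleEquiv.symm f ∈ s j →
        ρ.asModuleEquiv.symm f ∈ s 0 := by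
      intro j
      induction j using Fin.induction with
      | zero => exact id
      | succ j ih => exact fun hj => ih (hcon j hj)
    obtain ⟨j, hj⟩ := hex
    have h3 := h2 j hj
    change _ ∈ s.head at h3
    rw [h0] at h3
    exact h.ne_zero h3
  let y : s i.succ ⧸ (s i.castSucc).submoduleOf (s i.succ) :=
    Submodule.Quotient.mk ⟨ρ.asModuleEquiv.symm f, hi⟩
  have hy : y ≠ 0 := by
    intro hy
    exact hi' ((Submodule.Quotient.mk_eq_zero ((s i.castSucc).submoduleOf (s i.succ))).1 hy)
  have hyd : ∀ m ∈ dataSet χ₁ χ₂, m • y = 0 := by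
    intro m hm
    refine (Submodule.Quotient.mk_eq_zero ((s i.castSucc).submoduleOf (s i.succ))
      (x := m • ⟨ρ.asModuleEquiv.symm f, hi⟩)).2 ?_
    change m • ρ.asModuleEquiv.symm f ∈ s i.castSucc
    rw [hfd m hm]
    exact zero_mem _
  refine ⟨τ.asModuleEquiv (e.symm (Pi.single i y)), ?_, (hasDataMod_bot_iff _).2 fun m hm => ?_⟩
  · rw [Ne, LinearEquiv.map_eq_zero_iff, LinearEquiv.map_eq_zero_iff, Pi.single_eq_zero_iff]
    exact hy
  · have h2 : m • (Pi.single i y : gradedModule s) = 0 := by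
      refine funext fun j => ?_
      rw [Pi.smul_apply]
      by_cases hj : j = i
      · subst hj
        rw [Pi.single_eq_same, hyd m hm]
        rfl
      · rw [Pi.single_eq_of_ne hj, smul_zero]
        rfl
    rw [LinearEquiv.symm_apply_apply, ← map_smul, h2, map_zero]

lemma IsSemisimplification.data_unique (hs : IsSemisimplification ρ τ) (h : IsOrdinary ρ f χ₁ χ₂)
    {x : S} (hx : x ≠ 0) (hd : HasDataMod τ ⊥ x χ₁' χ₂') : χ₁' = χ₁ ∧ χ₂' = χ₂ := by
  obtain ⟨s, h0, h1, ⟨e⟩⟩ := hs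
  have hxd := (hasDataMod_bot_iff x).1 hd
  have hex : e (τ.asModuleEquiv.symm x) ≠ 0 := by
    rwa [Ne, LinearEquiv.map_eq_zero_iff, LinearEquiv.map_eq_zero_iff]
  obtain ⟨i, hi⟩ := Function.ne_iff.1 hex
  obtain ⟨⟨y, hy⟩, hy'⟩ := Submodule.Quotient.mk_surjective _ (e (τ.asModuleEquiv.symm x) i)
  refine h.data_unique (isStable_ofSubmodule (s i.succ)) (isStable_ofSubmodule (s i.castSucc))
    (x := ρ.asModuleEquiv y) hy (fun hcon => hi ?_) ((hasDataMod_iff _ _).2 fun m hm => ?_)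
  · rw [← hy']
    exact (Submodule.Quotient.mk_eq_zero _).2 hcon
  · rw [LinearEquiv.symm_apply_apply]
    have h2 : m • Submodule.Quotient.mk (p := (s i.castSucc).submoduleOf (s i.succ)) ⟨y, hy⟩ = 0 := by
      have h3 := congrFun (e.map_smul m (τ.asModuleEquiv.symm x)) i
      rw [hxd m hm, map_zero] at h3
      rw [hy']
      exact h3.symm
    rw [← Submodule.Quotient.mk_smul, Submodule.Quotient.mk_eq_zero] at h2
    exact h2

lemma IsUniversal.smul_add_matBeta_ne_zero {v : W} {a : κˣ}
    (h : IsUniversal ρ (p - 1) (a : κ) v) (hp : 2 < p) :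
    (a : κ) • v + ρ (matBeta p) v ≠ 0 := by
  intro h0
  have hr : p - 1 ≠ 0 := by omega
  obtain ⟨g, hg⟩ := h.exists_lift (heckeVec_principalVec hr le_rfl a)
  have h1 : (a : κ) • principalVec p (p - 1) a
      + rightTranslation p (matBeta p) (principalVec p (p - 1) a) = 0 := by
    rw [← hg, ← map_smul, ← g.isIntertwining, ← map_add, h0, map_zero]
  have h2 := congrFun h1 1
  rw [Pi.add_apply, Pi.smul_apply, (principalVec_one hr a).1, smul_zero, zero_add,
    rightTranslation_apply, one_mul] at h2
  have e0 : (matBeta p 1 0 : ℚ_[p]) = (pUnit p : ℚ_[p]) * ((1 : ℤ_[p]) : ℚ_[p]) := by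
    simp [matBeta, mkG, pUnit]
  have e1 : (matBeta p 1 1 : ℚ_[p]) = (pUnit p : ℚ_[p]) * ((0 : ℤ_[p]) : ℚ_[p]) := by
    simp [matBeta, mkG]
  have hrow : IsPrimitiveRow (p := p) 1 0 := Or.inl isUnit_one
  rw [principalVec, e0, e1, rowChar_mul, hrow.rowChar hr, map_one, one_pow, mul_one] at h2
  exact mul_ne_zero (Units.ne_zero _) (Units.ne_zero _) h2

/-- An intertwining map between representations is one between their twists. -/
def intertwiningMapTwist (χ : GL2Qp p →* κˣ) (f : ρ.IntertwiningMap ρ') :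
    (twist ρ χ).IntertwiningMap (twist ρ' χ) where
  toLinearMap := f.toLinearMap
  isIntertwining' g := by
    refine LinearMap.ext fun w => ?_
    change f ((χ g : κ) • ρ g w) = (χ g : κ) • ρ' g (f w)
    rw [map_smul, f.isIntertwining]

/-- The representations `π(0, ± 1, η)` and `π(p - 1, ± 1, η)` have the same semisimplification. -/
theorem nonempty_semisimplification_equiv {S' : Type} [AddCommGroup S'] [Module κ S']
    {τ' : GL2Rep S'} (hp : 2 < p) {a : κˣ}
    {η : QpChar} (h : IsSemisimplification (iwahoriPi p 0 (a : κ) η) τ)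
    (h' : IsSemisimplification (iwahoriPi p (p - 1) (a : κ) η) τ') :
    Nonempty (τ.Equiv τ') := by
  by_cases ha : (a : κ) * a = 1
  swap
  · exact h.of_equiv (nonempty_iwahoriPi_zero_equiv ha η) |>.nonempty_equiv h'
  have hu := isUniversal_iwahoriQuot (p := p) 0 (a : κ)
  have hu' := isUniversal_iwahoriQuot (p := p) (p - 1) (a : κ)
  obtain ⟨f, hf⟩ := hu.exists_lift hu'.heckeVec.add_matBeta
  obtain ⟨f', hf'⟩ := hu'.exists_lift hu.heckeVec.sub_matBeta
  have hff' : ∀ w, f (f' w) = 0 := hu'.generates.hom_ext (f := f.comp f') (f' := 0) (by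
    change f (f' _) = 0
    rw [hf', map_sub, map_smul, f.isIntertwining, hf, map_add, map_smul,
      hu'.heckeVec.matBeta_matBeta, smul_add, smul_smul, ha, one_smul]
    abel)
  have hf'f : ∀ w, f' (f w) = 0 := hu.generates.hom_ext (f := f'.comp f) (f' := 0) (by
    change f' (f _) = 0
    rw [hf, map_add, map_smul, f'.isIntertwining, hf', map_sub, map_smul,
      hu.heckeVec.matBeta_matBeta, smul_sub, smul_smul, ha, one_smul]
    abel)
  let F := Representation.IntertwiningMap.equivLinearMapAsModule (iwahoriPi p 0 (a : κ) η)
    (iwahoriPi p (p - 1) (a : κ) η)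
    (intertwiningMapTwist (η.comp det) f)
  let F' := Representation.IntertwiningMap.equivLinearMapAsModule
    (iwahoriPi p (p - 1) (a : κ) η) (iwahoriPi p 0 (a : κ) η)
    (intertwiningMapTwist (η.comp det) f')
  obtain ⟨_, ho⟩ := exists_isOrdinary_iwahoriPi (p := p) hp (Nat.zero_le _) a η
  obtain ⟨_, ho'⟩ := exists_isOrdinary_iwahoriPi (p := p) hp le_rfl a η
  obtain ⟨n, hn⟩ := ho.exists_strictMono
  obtain ⟨n', hn'⟩ := ho'.exists_strictMono
  obtain ⟨s, s', h0, h1, h0', h1', e⟩ := exists_compositionSeries_pair hn hn' F F'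
    (fun h0 => hu'.smul_add_matBeta_ne_zero hp (by
      rw [← hf]
      exact LinearMap.congr_fun h0 _))
    (fun h0 => hu.smul_sub_matBeta_ne_zero hp (by
      rw [← hf']
      exact LinearMap.congr_fun h0 _))
    (LinearMap.ext hff') (LinearMap.ext hf'f)
  exact nonempty_equiv_of_compositionSeries h0 h1 h0' h1' e h h'

end OrdinarySemisimplification

section Smooth

lemma IsSmoothChar.comp {k G H : Type*} [CommRing k] [Group G] [TopologicalSpace G] [Group H]
    [TopologicalSpace H] {χ : G →* kˣ} (h : IsSmoothChar χ) {f : H →* G} (hf : Continuous f) :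
    IsSmoothChar (χ.comp f) :=
  h.preimage hf

variable {k G V V' : Type*} [CommRing k] [Group G] [TopologicalSpace G] [IsTopologicalGroup G]
  [AddCommGroup V] [Module k V] [AddCommGroup V'] [Module k V'] {ρ : Representation k G V}
  {ρ' : Representation k G V'}

/-- The stabilizer of a vector. -/
def stabVec (ρ : Representation k G V) (v : V) : Subgroup G where
  carrier := {g | ρ g v = v}
  one_mem' := by simp
  mul_mem' := fun {g h} hg hh => by
    change ρ (g * h) v = v
    rw [map_mul, mul_apply, show ρ h v = v from hh]
    exact hg
  inv_mem' := fun {g} hg => by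
    change ρ g⁻¹ v = v
    nth_rewrite 1 [← show ρ g v = v from hg]
    rw [← mul_apply, ← map_mul, inv_mul_cancel, map_one, Module.End.one_apply]

lemma isSmoothRep_iff : IsSmoothRep ρ ↔ ∀ v, ∀ᶠ g in 𝓝 1, ρ g v = v := by
  constructor
  · intro h v
    exact (h v).mem_nhds (by simp)
  · intro h v
    exact (stabVec ρ v).isOpen_of_mem_nhds (g := 1) (h v)

lemma isSmoothChar_iff {χ : G →* kˣ} : IsSmoothChar χ ↔ ∀ᶠ g in 𝓝 1, χ g = 1 := by
  constructor
  · intro h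
    exact h.mem_nhds (map_one χ)
  · intro h
    exact χ.ker.isOpen_of_mem_nhds (g := 1) h

lemma IsSmoothChar.mul {χ χ' : G →* kˣ} (h : IsSmoothChar χ) (h' : IsSmoothChar χ') :
    IsSmoothChar (χ * χ') := by
  rw [isSmoothChar_iff] at *
  filter_upwards [h, h'] with g hg hg'
  rw [MonoidHom.mul_apply, hg, hg', mul_one]

lemma IsSmoothChar.pow {χ : G →* kˣ} (h : IsSmoothChar χ) (n : ℕ) : IsSmoothChar (χ ^ n) := by
  rw [isSmoothChar_iff] at *
  filter_upwards [h] with g hg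
  rw [pow_apply, hg, one_pow]

lemma IsSmoothRep.twist (h : IsSmoothRep ρ) {χ : G →* kˣ} (hχ : IsSmoothChar χ) :
    IsSmoothRep (twist ρ χ) := by
  rw [isSmoothRep_iff] at *
  intro v
  filter_upwards [h v, isSmoothChar_iff.1 hχ] with g hg hg'
  change (χ g : k) • ρ g v = v
  rw [hg, hg', val_one, one_smul]

lemma IsSmoothChar.isSmoothRep {χ : G →* kˣ} (h : IsSmoothChar χ) : IsSmoothRep (charRep χ) := by
  rw [isSmoothRep_iff]
  intro v
  filter_upwards [isSmoothChar_iff.1 h] with g hg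
  change (χ g : k) • v = v
  rw [hg, val_one, one_smul]

lemma IsSmoothRep.prod (h : IsSmoothRep ρ) (h' : IsSmoothRep ρ') : IsSmoothRep (ρ.prod ρ') := by
  rw [isSmoothRep_iff] at *
  rintro ⟨v, v'⟩
  filter_upwards [h v, h' v'] with g hg hg'
  exact Prod.ext hg hg'

lemma IsSmoothRep.of_equiv (h : IsSmoothRep ρ) (e : Nonempty (ρ'.Equiv ρ)) : IsSmoothRep ρ' := by
  obtain ⟨e⟩ := e
  rw [isSmoothRep_iff] at *
  intro v
  filter_upwards [h (e v)] with g hg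
  refine e.injective ?_
  refine Eq.trans ?_ hg
  exact Representation.IntertwiningMap.isIntertwining _ _ e.toIntertwiningMap g v

/-- A representation which is generated by a vector with open stabilizer is smooth. -/
lemma isSmoothRep_of_span {v : V} (hv : span k (Set.range fun g => ρ g v) = ⊤)
    (h : ∀ᶠ g in 𝓝 1, ρ g v = v) : IsSmoothRep ρ := by
  rw [isSmoothRep_iff]
  intro w
  have hw : w ∈ span k (Set.range fun g => ρ g v) := by rw [hv]; trivial
  induction hw using Submodule.span_induction with
  | mem w hw =>
    obtain ⟨x, rfl⟩ := hw
    have hc : Filter.Tendsto (fun g => x⁻¹ * g * x) (𝓝 1) (𝓝 1) := by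
      have : Continuous fun g : G => x⁻¹ * g * x := by fun_prop
      simpa using this.tendsto 1
    filter_upwards [hc.eventually h] with g hg
    nth_rewrite 2 [← hg]
    rw [← mul_apply, ← mul_apply, ← map_mul, ← map_mul]
    congr 2
    group
  | zero => simp
  | add w w' _ _ hw hw' =>
    filter_upwards [hw, hw'] with g hg hg'
    rw [map_add, hg, hg']
  | smul c w _ hw =>
    filter_upwards [hw] with g hg
    rw [map_smul, hg]

lemma IsSemisimplification.isSmoothRep (hs : IsSemisimplification ρ ρ') (h : IsSmoothRep ρ) :
    IsSmoothRep ρ' := by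
  obtain ⟨s, -, -, ⟨e⟩⟩ := hs
  rw [isSmoothRep_iff] at *
  intro x
  choose y hy using fun i => Submodule.Quotient.mk_surjective _ (e (ρ'.asModuleEquiv.symm x) i)
  have h1 : ∀ᶠ g in 𝓝 1, ∀ i, ρ g (ρ.asModuleEquiv (y i)) = ρ.asModuleEquiv (y i) :=
    Filter.eventually_all.2 fun i => h _
  filter_upwards [h1] with g hg
  have e1 : ∀ (u : ρ.asModule),
      MonoidAlgebra.of k G g • u = ρ.asModuleEquiv.symm (ρ g (ρ.asModuleEquiv u)) := by
    intro u
    rw [Representation.asModuleEquiv_symm_map_rho, LinearEquiv.symm_apply_apply]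
  have e1' : ∀ (u : ρ'.asModule),
      MonoidAlgebra.of k G g • u = ρ'.asModuleEquiv.symm (ρ' g (ρ'.asModuleEquiv u)) := by
    intro u
    rw [Representation.asModuleEquiv_symm_map_rho, LinearEquiv.symm_apply_apply]
  refine ρ'.asModuleEquiv.symm.injective (e.injective ?_)
  have e2 := e1' (ρ'.asModuleEquiv.symm x)
  rw [LinearEquiv.apply_symm_apply] at e2
  rw [← e2, map_smul]
  refine funext fun i => ?_
  rw [Pi.smul_apply, ← hy i, ← Submodule.Quotient.mk_smul]
  congr 1
  refine Subtype.ext ?_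
  change MonoidAlgebra.of k G g • (y i : ρ.asModule) = y i
  rw [e1, hg i, LinearEquiv.symm_apply_apply]

end Smooth

section SmoothGL2

lemma norm_le_one_of_sub {x y : ℚ_[p]} (hy : ‖y‖ ≤ 1) (h : ‖x - y‖ < 1) : ‖x‖ ≤ 1 := by
  have := Padic.nonarchimedean (x - y) y
  rw [sub_add_cancel] at this
  exact this.trans (max_le h.le hy)

/-- The matrices in `K` which are congruent to `1` modulo `p` form a neighbourhood of `1`. -/
lemma eventually_congruent_one :
    ∀ᶠ g : GL2Qp p in 𝓝 1, ∃ k : GL2Zp p, g = inclK p k ∧ k ∈ iwahori p ∧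
      toFpbar p (k 0 0) = 1 := by
  have hc : ∀ i j, ∀ᶠ g : GL2Qp p in 𝓝 1,
      ‖(g i j : ℚ_[p]) - (1 : Matrix (Fin 2) (Fin 2) ℚ_[p]) i j‖ < 1 := by
    intro i j
    have h1 : Continuous fun g : GL2Qp p =>
        ‖(g i j : ℚ_[p]) - (1 : Matrix (Fin 2) (Fin 2) ℚ_[p]) i j‖ := by
      have : Continuous fun g : GL2Qp p => (g i j : ℚ_[p]) :=
        (continuous_apply_apply (ρ := fun _ _ => ℚ_[p]) i j).comp
          (Units.continuous_val (M := Matrix (Fin 2) (Fin 2) ℚ_[p]))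
      fun_prop
    refine h1.tendsto 1 |>.eventually_lt_const ?_
    simp
  filter_upwards [hc 0 0, hc 0 1, hc 1 0, hc 1 1] with g h00 h01 h10 h11
  simp only [Matrix.one_apply_eq, Matrix.one_apply_ne (show (0 : Fin 2) ≠ 1 by decide),
    Matrix.one_apply_ne (show (1 : Fin 2) ≠ 0 by decide), sub_zero] at h00 h01 h10 h11
  obtain ⟨a, ha⟩ : ∃ a : ℤ_[p], (a : ℚ_[p]) = g 0 0 :=
    ⟨⟨_, norm_le_one_of_sub (by simp) h00⟩, rfl⟩
  obtain ⟨b, hb⟩ : ∃ b : ℤ_[p], (b : ℚ_[p]) = g 0 1 := ⟨⟨_, h01.le⟩, rfl⟩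
  obtain ⟨c, hc⟩ : ∃ c : ℤ_[p], (c : ℚ_[p]) = g 1 0 := ⟨⟨_, h10.le⟩, rfl⟩
  obtain ⟨d, hd⟩ : ∃ d : ℤ_[p], (d : ℚ_[p]) = g 1 1 :=
    ⟨⟨_, norm_le_one_of_sub (by simp) h11⟩, rfl⟩
  have hz : ∀ x : ℤ_[p], ‖(x : ℚ_[p])‖ < 1 → toZMod x = 0 := by
    intro x hx
    have h1 : x ∈ IsLocalRing.maximalIdeal ℤ_[p] := by
      rw [IsLocalRing.mem_maximalIdeal, PadicInt.mem_nonunits]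
      exact hx
    rw [← PadicInt.ker_toZMod] at h1
    exact h1
  have ha1 : toZMod a = 1 := by
    rw [← sub_eq_zero, ← map_one (toZMod (p := p)), ← map_sub]
    refine hz _ ?_
    rw [PadicInt.coe_sub, ha, PadicInt.coe_one]
    exact h00
  have hd1 : toZMod d = 1 := by
    rw [← sub_eq_zero, ← map_one (toZMod (p := p)), ← map_sub]
    refine hz _ ?_
    rw [PadicInt.coe_sub, hd, PadicInt.coe_one]
    exact h11
  have hc1 : toZMod c = 0 := hz c (by rwa [hc])
  have hu : IsUnit (a * d - b * c) := by
    by_contra hu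
    have h1 : a * d - b * c ∈ IsLocalRing.maximalIdeal ℤ_[p] := hu
    rw [← PadicInt.ker_toZMod, RingHom.mem_ker, map_sub, map_mul, map_mul, ha1, hd1, hc1] at h1
    simp at h1
  refine ⟨mkK a b c d hu, ?_, ?_, ?_⟩
  · ext i j
    rw [coe_inclK]
    fin_cases i <;> fin_cases j <;> simp [ha, hb, hc, hd]
  · rw [mem_iwahori]
    simpa using hc1
  · simp [toFpbar, ha1]

lemma IsSmoothChar.comp_det {η : QpChar} (hη : IsSmoothChar η) :
    IsSmoothChar (η.comp (det : GL2Qp p →* ℚ_[p]ˣ)) := by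
  exact hη.comp Matrix.GeneralLinearGroup.continuous_det

lemma isSmoothRep_iwahoriPi (r : ℕ) (a : κ) {η : QpChar}
    (hη : IsSmoothChar η) : IsSmoothRep (iwahoriPi p r a η) := by
  have h := isUniversal_iwahoriQuot (p := p) r a
  refine IsSmoothRep.twist (isSmoothRep_of_span h.generates ?_) hη.comp_det
  filter_upwards [eventually_congruent_one (p := p)] with g hg
  obtain ⟨k, rfl, hk, hk'⟩ := hg
  have := h.heckeVec.iwahori ⟨k, hk⟩
  rw [hk', one_pow, one_smul] at this
  exact this

lemma isSmoothChar_of_unitQ {χ : QpChar}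
    (h : ∀ u : ℤ_[p]ˣ, toFpbar p u = 1 → χ (unitQ p u) = 1) : IsSmoothChar χ := by
  rw [isSmoothChar_iff]
  have hc : ∀ᶠ x : ℚ_[p]ˣ in 𝓝 1, ‖(x : ℚ_[p]) - 1‖ < 1 := by
    have h1 : Continuous fun x : ℚ_[p]ˣ => ‖(x : ℚ_[p]) - 1‖ := by fun_prop
    refine h1.tendsto 1 |>.eventually_lt_const ?_
    simp
  filter_upwards [hc] with x hx
  have hx1 : ‖(x : ℚ_[p])‖ = 1 := by
    have := IsUltrametricDist.norm_add_eq_max_of_norm_ne_norm (x := (x : ℚ_[p]) - 1) (y := 1)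
      (by rw [norm_one]; exact hx.ne)
    rwa [sub_add_cancel, norm_one, max_eq_right hx.le] at this
  have hx2 : x = unitQ p (PadicInt.mkUnits hx1) := Units.ext rfl
  rw [hx2]
  refine h _ ?_
  rw [← sub_eq_zero, ← map_one (toFpbar p), ← map_sub, toFpbar_eq_zero_iff]
  have h1 : ((PadicInt.mkUnits hx1 : ℤ_[p]ˣ) : ℤ_[p]) - 1 ∈ IsLocalRing.maximalIdeal ℤ_[p] := by
    rw [IsLocalRing.mem_maximalIdeal, PadicInt.mem_nonunits]
    exact hx
  rw [← PadicInt.ker_toZMod] at h1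
  exact h1

lemma isSmoothChar_omegaQp : IsSmoothChar (omegaQp p) :=
  isSmoothChar_of_unitQ fun u hu => Units.ext (by rw [omegaQp_unitQ, hu, val_one])

lemma isSmoothChar_unrQp (a : κˣ) : IsSmoothChar (unrQp a) :=
  isSmoothChar_of_unitQ fun u _ => unrQp_unitQ a u

end SmoothGL2

section Parameters

lemma exists_toFpbar_unit (t : ZMod p) (ht : t ≠ 0) :
    ∃ u : ℤ_[p]ˣ, toFpbar p u = ofFp t := by
  have h : IsUnit (teich t : ℤ_[p]) := by
    by_contra hu
    have h1 : teich t ∈ IsLocalRing.maximalIdeal ℤ_[p] := hu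
    rw [← PadicInt.ker_toZMod, RingHom.mem_ker, toZMod_teich] at h1
    exact ht h1
  exact ⟨h.unit, by rw [IsUnit.unit_spec, toFpbar_teich]⟩

/-- There is a unit whose reduction generates `𝔽_pˣ`. -/
lemma exists_unit_pow_eq_one_iff :
    ∃ u : ℤ_[p]ˣ, ∀ n : ℕ, toFpbar p u ^ n = 1 ↔ p - 1 ∣ n := by
  obtain ⟨g, hg⟩ := IsCyclic.exists_generator (α := (ZMod p)ˣ)
  obtain ⟨u, hu⟩ := exists_toFpbar_unit (p := p) g g.ne_zero
  refine ⟨u, fun n => ?_⟩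
  have h1 : orderOf g = p - 1 := by
    rw [orderOf_eq_card_of_forall_mem_zpowers hg, Nat.card_eq_fintype_card, ZMod.card_units]
  rw [hu, ← h1, orderOf_dvd_iff_pow_eq_one, ← map_pow,
    map_eq_one_iff _ (ofFp).injective, ← val_pow_eq_pow_val,
    Units.val_eq_one]

lemma modEq_of_toFpbar_pow {r s : ℕ} (h : ∀ u : ℤ_[p]ˣ, toFpbar p u ^ r = toFpbar p u ^ s) :
    r ≡ s [MOD p - 1] := by
  obtain ⟨u, hu⟩ := exists_unit_pow_eq_one_iff (p := p)
  have hne : toFpbar p u ≠ 0 := (u.isUnit.map (toFpbar p)).ne_zero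
  wlog hrs : r ≤ s generalizing r s
  · exact (this (fun u => (h u).symm) (le_of_not_ge hrs)).symm
  rw [Nat.modEq_iff_dvd' hrs, ← hu]
  have h1 := h u
  rw [← Nat.add_sub_cancel' hrs, pow_add] at h1
  exact (mul_eq_left₀ (pow_ne_zero r hne)).1 h1.symm

/-- The semisimplification of `π(r, a, η)` depends only on its data. -/
theorem semisimplification_equiv_of_data {S S' : Type} [AddCommGroup S]
    [Module κ S] [AddCommGroup S'] [Module κ S']
    {τ : GL2Rep S} {τ' : GL2Rep S'}
    (hp : 2 < p) {r r' : ℕ} (hr : r ≤ p - 1) (hr' : r' ≤ p - 1) {a a' : κˣ}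
    {η η' : QpChar} (h : IsSemisimplification (iwahoriPi p r (a : κ) η) τ)
    (h' : IsSemisimplification (iwahoriPi p r' (a' : κ) η') τ')
    (e₁ : unrQp a⁻¹ * η = unrQp a'⁻¹ * η')
    (e₂ : omegaQp p ^ r * unrQp a * η = omegaQp p ^ r' * unrQp a' * η') :
    Nonempty (τ.Equiv τ') := by
  have e₁u : ∀ u, η (unitQ p u) = η' (unitQ p u) := fun u => by
    simpa using DFunLike.congr_fun e₁ (unitQ p u)
  have e₁p := DFunLike.congr_fun e₁ (pUnit p)
  have e₂p := DFunLike.congr_fun e₂ (pUnit p)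
  simp only [MonoidHom.mul_apply, pow_apply, unrQp_pUnit, omegaQp_pUnit, one_pow,
    one_mul] at e₁p e₂p
  have hmod : r ≡ r' [MOD p - 1] := by
    refine modEq_of_toFpbar_pow fun u => ?_
    have h1 := DFunLike.congr_fun e₂ (unitQ p u)
    simp only [MonoidHom.mul_apply, pow_apply, unrQp_unitQ, mul_one, e₁u u,
      mul_left_inj] at h1
    have h2 := congrArg (Units.val) h1
    rwa [val_pow_eq_pow_val, val_pow_eq_pow_val, omegaQp_unitQ] at h2
  set c : κˣ := a' * a⁻¹ with hc
  have hη' : η' = η * unrQp c := by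
    refine char_ext ?_ fun u => ?_
    · rw [MonoidHom.mul_apply, unrQp_pUnit, hc, mul_comm a', ← mul_assoc, mul_comm (η _), e₁p,
        mul_comm, ← mul_assoc, mul_inv_cancel, one_mul]
    · rw [MonoidHom.mul_apply, unrQp_unitQ, mul_one, e₁u]
  have hcc : c * c = 1 := by
    have h1 : η' (pUnit p) = η (pUnit p) * c := by
      rw [hη', MonoidHom.mul_apply, unrQp_pUnit]
    rw [h1] at e₂p
    have h3 : a' = c * a := by rw [hc]; group
    have h2 : a * η (pUnit p) * 1 = a * η (pUnit p) * (c * c) :=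
      calc a * η (pUnit p) * 1 = a' * (η (pUnit p) * c) := by rw [mul_one, e₂p]
        _ = (c * a) * (η (pUnit p) * c) := by rw [← h3]
        _ = a * η (pUnit p) * (c * c) := by ac_rfl
    exact (mul_left_cancel h2).symm
  have key : ∀ (r : ℕ) {S : Type} [AddCommGroup S] [Module κ S]
      {τ : GL2Rep S},
      IsSemisimplification (iwahoriPi p r (a : κ) η) τ →
      IsSemisimplification (iwahoriPi p r (a' : κ) η') τ := by
    intro r S _ _ τ h
    have h1 := nonempty_iwahoriPi_equiv_unramified (p := p) r (a : κ) η (unrQp c)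
      (fun u => unrQp_unitQ c u) (by rw [unrQp_pUnit, hcc])
    rw [unrQp_pUnit, ← val_mul, ← hη', show c * a = a' by rw [hc]; group] at h1
    exact h.of_equiv h1
  have h1 := key r h
  by_cases hrr : r = r'
  · subst hrr
    exact h1.nonempty_equiv h'
  · have h01 : (r = 0 ∧ r' = p - 1) ∨ (r = p - 1 ∧ r' = 0) := by
      rcases lt_or_gt_of_ne hrr with hlt | hlt
      · obtain ⟨m, hm⟩ := (Nat.modEq_iff_dvd' hlt.le).1 hmod
        have : m = 1 := by
          rcases m with _ | _ | m
          · omega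
          · rfl
          · have : (p - 1) * (m + 1 + 1) ≥ (p - 1) * 2 := Nat.mul_le_mul_left _ (by omega)
            omega
        subst this
        omega
      · obtain ⟨m, hm⟩ := (Nat.modEq_iff_dvd' hlt.le).1 hmod.symm
        have : m = 1 := by
          rcases m with _ | _ | m
          · omega
          · rfl
          · have : (p - 1) * (m + 1 + 1) ≥ (p - 1) * 2 := Nat.mul_le_mul_left _ (by omega)
            omega
        subst this
        omega
    rcases h01 with ⟨rfl, rfl⟩ | ⟨rfl, rfl⟩
    · exact nonempty_semisimplification_equiv hp h1 h'
    · exact equiv_symm (nonempty_semisimplification_equiv hp h' h1)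

end Parameters

section Integers

lemma isIntegral_iff_norm_le_one {x : PadicAlgCl p} : IsIntegral ℤ_[p] x ↔ ‖x‖ ≤ 1 := by
  constructor
  · rintro ⟨P, hP, hx⟩
    have h1 : (P.map (algebraMap ℤ_[p] ℚ_[p])).Monic := hP.map _
    have h2 : aeval x (P.map (algebraMap ℤ_[p] ℚ_[p])) = 0 := by
      rw [aeval_map_algebraMap]
      exact hx
    have h3 := norm_root_le_spectralValue (f := spectralAlgNorm ℚ_[p] (PadicAlgCl p))
      spectralAlgNorm_isPowMul isNonarchimedean_spectralNorm h1 h2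
    refine le_trans h3 ((spectralValue_le_one_iff h1).2 fun i => ?_)
    rw [coeff_map]
    exact (P.coeff i).2
  · intro hx
    have hint : IsIntegral ℚ_[p] x := Algebra.IsIntegral.isIntegral x
    have hm := minpoly.monic hint
    have h1 := (spectralValue_le_one_iff hm).1 hx
    have h2 : minpoly ℚ_[p] x ∈ lifts (algebraMap ℤ_[p] ℚ_[p]) := by
      rw [lifts_iff_coeff_lifts]
      exact fun i => ⟨⟨_, h1 i⟩, rfl⟩
    obtain ⟨Q, hQ, -, hQm⟩ := lifts_and_natDegree_eq_and_monic h2 hm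
    refine ⟨Q, hQm, ?_⟩
    have h3 : aeval x (Q.map (algebraMap ℤ_[p] ℚ_[p])) = 0 := by rw [hQ, minpoly.aeval]
    rwa [aeval_map_algebraMap] at h3

lemma norm_coe_le_one (x : Zpbar p) : ‖(x : PadicAlgCl p)‖ ≤ 1 := isIntegral_iff_norm_le_one.1 x.2

/-- An element of norm at most `1`, as an integer of `ℚ̄_p`. -/
def toZpbar (x : PadicAlgCl p) (hx : ‖x‖ ≤ 1) : Zpbar p := ⟨x, isIntegral_iff_norm_le_one.2 hx⟩

@[simp] lemma coe_toZpbar (x : PadicAlgCl p) (hx : ‖x‖ ≤ 1) : (toZpbar x hx : PadicAlgCl p) = x := rfl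

lemma norm_p_algCl : ‖(p : PadicAlgCl p)‖ = (p : ℝ)⁻¹ := by
  have h := PadicAlgCl.norm_extends p (p : ℚ_[p])
  rw [Padic.norm_p] at h
  rw [← h]
  simp

variable (red : Zpbar p →+* κ)

lemma red_eq_zero_iff (x : Zpbar p) : red x = 0 ↔ ‖(x : PadicAlgCl p)‖ < 1 := by
  have hp := (Fact.out : p.Prime)
  constructor
  · intro h
    refine lt_of_le_of_ne (norm_coe_le_one x) fun h1 => ?_
    have hx0 : (x : PadicAlgCl p) ≠ 0 := by
      rw [← norm_ne_zero_iff, h1]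
      exact one_ne_zero
    have h2 : ‖(x : PadicAlgCl p)⁻¹‖ ≤ 1 := by rw [norm_inv, h1, inv_one]
    have h3 : x * toZpbar _ h2 = 1 := Subtype.ext (mul_inv_cancel₀ hx0)
    have h4 := congrArg red h3
    rw [map_mul, h, zero_mul, map_one] at h4
    exact zero_ne_one h4
  · intro h
    obtain ⟨n, hn⟩ := exists_pow_lt_of_lt_one (show (0 : ℝ) < (p : ℝ)⁻¹ by
      have := hp.pos
      positivity) h
    have hp0 : (p : PadicAlgCl p) ≠ 0 := by exact_mod_cast hp.ne_zero
    have h2 : ‖(x : PadicAlgCl p) ^ n / p‖ ≤ 1 := by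
      rw [norm_div, norm_pow, norm_p_algCl, div_le_one (by have := hp.pos; positivity)]
      exact hn.le
    have h3 : x ^ n = (p : Zpbar p) * toZpbar _ h2 := Subtype.ext (by
      push_cast
      rw [coe_toZpbar, mul_div_cancel₀ _ hp0])
    have h4 := congrArg red h3
    rw [map_mul, map_natCast, CharP.cast_eq_zero, zero_mul, map_pow] at h4
    exact eq_zero_of_pow_eq_zero h4

lemma red_eq_iff (x y : Zpbar p) : red x = red y ↔ ‖(x : PadicAlgCl p) - y‖ < 1 := by
  rw [← sub_eq_zero, ← map_sub, red_eq_zero_iff]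
  rfl

lemma red_algebraMap (x : ℤ_[p]) : red (algebraMap ℤ_[p] (Zpbar p) x) = toFpbar p x := by
  have h : toZMod (x - ((toZMod x).val : ℤ_[p])) = 0 := by
    rw [map_sub, map_natCast, ZMod.natCast_zmod_val, sub_self]
  obtain ⟨y, hy⟩ := toZMod_eq_zero_iff.1 h
  rw [sub_eq_iff_eq_add] at hy
  rw [hy, map_add, map_add, map_add, map_mul, map_mul, map_mul]
  simp only [map_natCast, CharP.cast_eq_zero, zero_mul]

/-- The action of the Galois group on the integers of `ℚ̄_p`. -/
def galInt (σ : GalQp p) : Zpbar p →+* Zpbar p where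
  toFun x := toZpbar (σ x) (by rw [norm_galQp]; exact norm_coe_le_one x)
  map_one' := Subtype.ext (map_one σ)
  map_mul' x y := Subtype.ext (map_mul σ _ _)
  map_zero' := Subtype.ext (map_zero σ)
  map_add' x y := Subtype.ext (map_add σ _ _)

@[simp] lemma coe_galInt (σ : GalQp p) (x : Zpbar p) : (galInt σ x : PadicAlgCl p) = σ x := rfl

lemma isInertia_iff {σ : GalQp p} : IsInertia red σ ↔ ∀ x, red (galInt σ x) = red x :=
  ⟨fun h x => h x _ rfl, fun h x y hy => by rw [← h x]; exact congrArg red (Subtype.ext hy)⟩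

lemma coprime_pow_sub_one {n : ℕ} (hn : n ≠ 0) : p.Coprime (p ^ n - 1) := by
  have hpn : 1 < p ^ n := Nat.one_lt_pow hn (Fact.out : p.Prime).one_lt
  apply Nat.Coprime.coprime_dvd_left (dvd_pow_self p hn)
  rw [Nat.coprime_self_sub_right hpn.le]
  exact Nat.coprime_one_right _

lemma pow_sub_one_ne_zero {n : ℕ} (hn : n ≠ 0) : p ^ n - 1 ≠ 0 := by
  have hpn : 1 < p ^ n := Nat.one_lt_pow hn (Fact.out : p.Prime).one_lt
  omega

lemma eq_of_red_eq {N : ℕ} (hN : p.Coprime N) {x y : Zpbar p} (hx : x ^ N = 1) (hy : y ^ N = 1)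
    (h : red x = red y) : x = y := by
  have hN0 : N ≠ 0 := by
    rintro rfl
    exact (Fact.out : p.Prime).one_lt.ne' (by simpa using hN)
  have hx' : (x : PadicAlgCl p) ^ N = 1 := congrArg Subtype.val hx
  have hy' : (y : PadicAlgCl p) ^ N = 1 := congrArg Subtype.val hy
  have hy1 := norm_rootOfUnity hN0 hy'
  have hy0 : (y : PadicAlgCl p) ≠ 0 := by
    rw [← norm_ne_zero_iff, hy1]
    exact one_ne_zero
  have h1 : (x : PadicAlgCl p) / y = 1 := by
    refine rootOfUnity_eq_one hN (by rw [div_pow, hx', hy', div_one]) ?_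
    have h2 := (red_eq_iff red x y).1 h
    rwa [← div_self hy0, ← sub_div, norm_div, hy1, div_one]
  exact Subtype.ext ((div_eq_one_iff_eq hy0).1 h1)

/-- The reduction of a primitive root of unity of order prime to `p` is primitive. -/
lemma isPrimitiveRoot_red {N : ℕ} (hN : p.Coprime N) {x : Zpbar p}
    (hx : IsPrimitiveRoot (x : PadicAlgCl p) N) : IsPrimitiveRoot (red x) N := by
  have hx1 : x ^ N = 1 := Subtype.ext hx.pow_eq_one
  refine ⟨by rw [← map_pow, hx1, map_one], fun l hl => hx.dvd_of_pow_eq_one l ?_⟩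
  have h1 : x ^ l = 1 := eq_of_red_eq red hN (by rw [← pow_mul, mul_comm, pow_mul, hx1, one_pow])
    (one_pow N) (by rw [map_pow, hl, map_one])
  exact congrArg Subtype.val h1

lemma exists_primitiveRoot_int {N : ℕ} (hN : N ≠ 0) :
    ∃ x : Zpbar p, IsPrimitiveRoot (x : PadicAlgCl p) N := by
  have : NeZero N := ⟨hN⟩
  obtain ⟨ζ, hζ⟩ := HasEnoughRootsOfUnity.exists_primitiveRoot (PadicAlgCl p) N
  exact ⟨toZpbar ζ (norm_rootOfUnity hN hζ.pow_eq_one).le, hζ⟩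

/-- The Teichmüller lift. -/
lemma exists_root_lift {N : ℕ} (hN0 : N ≠ 0) (hN : p.Coprime N) {z : κ} (hz : z ^ N = 1) :
    ∃ x : Zpbar p, x ^ N = 1 ∧ red x = z := by
  have : NeZero N := ⟨hN0⟩
  obtain ⟨x, hx⟩ := exists_primitiveRoot_int (p := p) hN0
  obtain ⟨i, _, hi⟩ := (isPrimitiveRoot_red red hN hx).eq_pow_of_pow_eq_one hz
  have hx1 : x ^ N = 1 := Subtype.ext hx.pow_eq_one
  exact ⟨x ^ i, by rw [← pow_mul, mul_comm, pow_mul, hx1, one_pow], by rw [map_pow, hi]⟩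

lemma exists_pow_eq_self (z : κ) : ∃ n : ℕ, n ≠ 0 ∧ z ^ p ^ n = z := by
  have hint : IsIntegral (ZMod p) z := Algebra.IsIntegral.isIntegral _
  have := IntermediateField.adjoin.finiteDimensional hint
  have : Finite (IntermediateField.adjoin (ZMod p) {z}) := Module.finite_of_finite (ZMod p)
  have : Fintype (IntermediateField.adjoin (ZMod p) {z}) := Fintype.ofFinite _
  obtain ⟨n, -, hn⟩ := FiniteField.card (IntermediateField.adjoin (ZMod p) {z}) p
  refine ⟨n, n.ne_zero, ?_⟩
  have h := FiniteField.pow_card (⟨z, IntermediateField.mem_adjoin_simple_self _ _⟩ :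
    IntermediateField.adjoin (ZMod p) {z})
  rw [hn] at h
  exact congrArg Subtype.val h

/-- The action of the Galois group on the residue field. -/
lemma red_galInt {σ : GalQp p} {n m : ℕ} (hn : n ≠ 0)
    (hσ : ∀ ζ : PadicAlgCl p, ζ ^ (p ^ n - 1) = 1 → σ ζ = ζ ^ p ^ m) {x : Zpbar p}
    (hx : red x ^ p ^ n = red x) : red (galInt σ x) = red x ^ p ^ m := by
  by_cases h0 : red x = 0
  · rw [h0, zero_pow (pow_ne_zero _ (Fact.out : p.Prime).ne_zero), red_eq_zero_iff, coe_galInt,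
      norm_galQp, ← red_eq_zero_iff red, h0]
  · have hpn : 1 ≤ p ^ n := Nat.one_le_pow _ _ (Fact.out : p.Prime).pos
    have h1 : red x ^ (p ^ n - 1) = 1 := by
      refine mul_right_cancel₀ h0 ?_
      rw [one_mul, ← pow_succ, Nat.sub_add_cancel hpn, hx]
    obtain ⟨y, hy, hyx⟩ := exists_root_lift red (pow_sub_one_ne_zero hn) (coprime_pow_sub_one hn) h1
    have h2 : galInt σ y = y ^ p ^ m := Subtype.ext (by
      rw [coe_galInt, hσ _ (congrArg Subtype.val hy)]
      rfl)
    rw [← hyx, ← map_pow, ← h2, red_eq_iff, coe_galInt, coe_galInt, ← map_sub, norm_galQp,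
      ← red_eq_iff red, hyx]

/-- An automorphism which fixes all roots of unity of order prime to `p` is in the inertia group. -/
lemma isInertia_of_fixes {σ : GalQp p}
    (h : ∀ n : ℕ, n ≠ 0 → ∀ ζ : PadicAlgCl p, ζ ^ (p ^ n - 1) = 1 → σ ζ = ζ) : IsInertia red σ := by
  rw [isInertia_iff]
  intro x
  obtain ⟨n, hn, hx⟩ := exists_pow_eq_self (red x)
  have := red_galInt red (m := 0) hn (fun ζ hζ => by rw [h n hn ζ hζ, pow_zero, pow_one]) hx
  rwa [pow_zero, pow_one] at this

lemma IsInertia.fixes {red : Zpbar p →+* κ} {σ : GalQp p} (h : IsInertia red σ) {n : ℕ}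
    (hn : n ≠ 0) {ζ : PadicAlgCl p} (hζ : ζ ^ (p ^ n - 1) = 1) : σ ζ = ζ := by
  have hx : (toZpbar ζ (norm_rootOfUnity (pow_sub_one_ne_zero hn) hζ).le) ^ (p ^ n - 1) = 1 :=
    Subtype.ext hζ
  have h1 := eq_of_red_eq red (coprime_pow_sub_one hn) (by rw [← map_pow, hx, map_one]) hx
    ((isInertia_iff red).1 h _)
  exact congrArg Subtype.val h1

end Integers

section Unramified

variable (red : Zpbar p →+* κ)

lemma natDegree_minpoly_of_isPrimitiveRoot {n : ℕ} (hn : n ≠ 0) {z : κ}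
    (hz : IsPrimitiveRoot z (p ^ n - 1)) : n ≤ (minpoly (ZMod p) z).natDegree := by
  have hp := (Fact.out : p.Prime)
  have hint : IsIntegral (ZMod p) z := Algebra.IsIntegral.isIntegral _
  have := IntermediateField.adjoin.finiteDimensional hint
  have : Finite (IntermediateField.adjoin (ZMod p) {z}) := Module.finite_of_finite (ZMod p)
  have : Fintype (IntermediateField.adjoin (ZMod p) {z}) := Fintype.ofFinite _
  set d := (minpoly (ZMod p) z).natDegree with hd
  have hcard : Fintype.card (IntermediateField.adjoin (ZMod p) {z}) = p ^ d := by
    rw [Module.card_eq_pow_finrank (K := ZMod p), ZMod.card,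
      IntermediateField.adjoin.finrank hint]
  have h := FiniteField.pow_card (⟨z, IntermediateField.mem_adjoin_simple_self _ _⟩ :
    IntermediateField.adjoin (ZMod p) {z})
  rw [hcard] at h
  have h1 : z ^ p ^ d = z := congrArg Subtype.val h
  have hd0 : d ≠ 0 := (minpoly.natDegree_pos hint).ne'
  have hz0 : z ≠ 0 := hz.ne_zero (pow_sub_one_ne_zero hn)
  have hpd : 1 ≤ p ^ d := Nat.one_le_pow _ _ hp.pos
  have h2 : z ^ (p ^ d - 1) = 1 := by
    refine mul_right_cancel₀ hz0 ?_
    rw [one_mul, ← pow_succ, Nat.sub_add_cancel hpd, h1]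
  have h3 := Nat.le_of_dvd (Nat.pos_of_ne_zero (pow_sub_one_ne_zero hd0)) (hz.dvd_of_pow_eq_one _ h2)
  have h4 : 1 ≤ p ^ n := Nat.one_le_pow _ _ hp.pos
  exact (Nat.pow_le_pow_iff_right hp.one_lt).1 (by omega)

variable {red}

/-- The residue field of `ℚ_p(ζ)` has degree `n` if `ζ` is a root of unity of order `pⁿ - 1`. -/
lemma red_aeval_ne_zero {n : ℕ} (hn : n ≠ 0) {x : Zpbar p}
    (hx : IsPrimitiveRoot (x : PadicAlgCl p) (p ^ n - 1)) {f : ℤ_[p][X]} (hf : f.natDegree < n)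
    {i : ℕ} (hi : IsUnit (f.coeff i)) : red (aeval x f) ≠ 0 := by
  have hz := isPrimitiveRoot_red red (coprime_pow_sub_one hn) hx
  have hdeg := natDegree_minpoly_of_isPrimitiveRoot hn hz
  set g : (ZMod p)[X] := f.map toZMod with hg
  have h1 : red (aeval x f) = aeval (red x) g := by
    rw [aeval_def, aeval_def, hom_eval₂, hg, eval₂_map]
    congr 1
    exact RingHom.ext fun y => red_algebraMap red y
  have hg0 : g ≠ 0 := fun h0 => by
    have h2 : g.coeff i = 0 := by rw [h0, coeff_zero]
    rw [hg, coeff_map] at h2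
    exact (hi.map toZMod).ne_zero h2
  rw [h1]
  intro h2
  have h3 := natDegree_le_of_dvd (minpoly.dvd (ZMod p) (red x) h2) hg0
  have h4 : g.natDegree ≤ f.natDegree := natDegree_map_le
  omega

lemma pow_pow_mod {n : ℕ} {M : Type*} [Monoid M] {ζ : M} (hζ : ζ ^ (p ^ n - 1) = 1)
    (m : ℕ) : ζ ^ p ^ m = ζ ^ p ^ (m % n) := by
  have hpn : 1 ≤ p ^ n := Nat.one_le_pow _ _ (Fact.out : p.Prime).pos
  have h1 : ζ ^ p ^ n = ζ := by
    conv_lhs => rw [← Nat.sub_add_cancel hpn, pow_succ, hζ, one_mul]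
  have h2 : ∀ k, ζ ^ p ^ (n * k) = ζ := by
    intro k
    induction k with
    | zero => simp
    | succ k ih => rw [Nat.mul_succ, pow_add, pow_mul, ih, h1]
  conv_lhs => rw [← Nat.div_add_mod m n, pow_add, pow_mul, h2]

open Classical in
lemma rootSet_minpoly_subset {n : ℕ} (hn : n ≠ 0) {ζ : PadicAlgCl p} (hζ : ζ ^ (p ^ n - 1) = 1) :
    (minpoly ℚ_[p] ζ).rootSet (PadicAlgCl p) ⊆
      ((Finset.range n).image fun i => ζ ^ p ^ i : Finset (PadicAlgCl p)) := by
  intro y hy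
  obtain ⟨σ, hσ⟩ := minpoly.exists_algEquiv_of_root' (Algebra.IsAlgebraic.isAlgebraic ζ)
    (mem_rootSet.1 hy).2
  obtain ⟨m, hm⟩ := exists_frobenius_pow_galQp σ hn
  rw [← hσ, hm ζ hζ, pow_pow_mod hζ]
  exact Finset.mem_coe.2 (Finset.mem_image_of_mem (fun i => ζ ^ p ^ i)
    (Finset.mem_range.2 (Nat.mod_lt _ (Nat.pos_of_ne_zero hn))))

lemma ncard_rootSet_minpoly (ζ : PadicAlgCl p) :
    ((minpoly ℚ_[p] ζ).rootSet (PadicAlgCl p)).ncard = (minpoly ℚ_[p] ζ).natDegree := by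
  have hsep : (minpoly ℚ_[p] ζ).Separable :=
    (minpoly.irreducible (Algebra.IsIntegral.isIntegral ζ)).separable
  rw [← card_rootSet_eq_natDegree hsep (IsAlgClosed.splits ((minpoly ℚ_[p] ζ).map
    (algebraMap ℚ_[p] (PadicAlgCl p)))), Set.ncard_eq_toFinset_card', Set.toFinset_card]

lemma natDegree_minpoly_le {n : ℕ} (hn : n ≠ 0) {ζ : PadicAlgCl p} (hζ : ζ ^ (p ^ n - 1) = 1) :
    (minpoly ℚ_[p] ζ).natDegree ≤ n := by
  classical
  rw [← ncard_rootSet_minpoly]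
  refine (Set.ncard_le_ncard (rootSet_minpoly_subset hn hζ) (Finset.finite_toSet _)).trans ?_
  rw [Set.ncard_coe_finset]
  exact Finset.card_image_le.trans (Finset.card_range n).le

/-- The Galois group contains elements which act as the Frobenius on roots of unity of order prime
to `p`. -/
lemma exists_frobenius (red : Zpbar p →+* κ) {n : ℕ} (hn : n ≠ 0) :
    ∃ σ : GalQp p, ∀ ζ : PadicAlgCl p, ζ ^ (p ^ n - 1) = 1 → σ ζ = ζ ^ p := by
  have hp := (Fact.out : p.Prime)
  obtain ⟨x, hx⟩ := exists_primitiveRoot_int (p := p) (pow_sub_one_ne_zero (p := p) hn)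
  have : NeZero (p ^ n - 1) := ⟨pow_sub_one_ne_zero hn⟩
  suffices h : aeval ((x : PadicAlgCl p) ^ p) (minpoly ℚ_[p] (x : PadicAlgCl p)) = 0 by
    obtain ⟨σ, hσ⟩ := minpoly.exists_algEquiv_of_root' (Algebra.IsAlgebraic.isAlgebraic _) h
    refine ⟨σ, fun ζ hζ => ?_⟩
    obtain ⟨i, -, rfl⟩ := hx.eq_pow_of_pow_eq_one hζ
    rw [map_pow, hσ, pow_right_comm]
  have hm : (minpoly ℤ_[p] (x : PadicAlgCl p)).Monic := minpoly.monic x.2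
  have hmap : minpoly ℚ_[p] (x : PadicAlgCl p)
      = (minpoly ℤ_[p] (x : PadicAlgCl p)).map (algebraMap ℤ_[p] ℚ_[p]) :=
    minpoly.isIntegrallyClosed_eq_field_fractions' ℚ_[p] x.2
  set f := minpoly ℤ_[p] (x : PadicAlgCl p) with hf
  have hroot : aeval x f = 0 := Subtype.ext (by
    have := minpoly.aeval ℤ_[p] (x : PadicAlgCl p)
    rw [← hf] at this
    have h2 : ((aeval x f : Zpbar p) : PadicAlgCl p) = aeval (x : PadicAlgCl p) f :=
      (aeval_algebraMap_apply (PadicAlgCl p) x f).symm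
    rw [h2, this]
    rfl)
  have hdeg : n ≤ (minpoly ℚ_[p] (x : PadicAlgCl p)).natDegree := by
    rw [hmap, hm.natDegree_map]
    by_contra hlt
    exact red_aeval_ne_zero (red := red) hn hx (not_le.1 hlt) (i := f.natDegree)
      (by rw [coeff_natDegree, hm.leadingCoeff]; exact isUnit_one) (by rw [hroot, map_zero])
  classical
  have heq := Set.eq_of_subset_of_ncard_le (rootSet_minpoly_subset hn hx.pow_eq_one) (by
    rw [ncard_rootSet_minpoly, Set.ncard_coe_finset]
    exact (Finset.card_image_le.trans (Finset.card_range n).le).trans hdeg) (Finset.finite_toSet _)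
  have hmem : (x : PadicAlgCl p) ^ p ∈ (minpoly ℚ_[p] (x : PadicAlgCl p)).rootSet (PadicAlgCl p) := by
    rw [heq]
    have e1 := pow_pow_mod hx.pow_eq_one 1
    rw [pow_one] at e1
    rw [e1]
    exact Finset.mem_coe.2 (Finset.mem_image_of_mem (fun i => (x : PadicAlgCl p) ^ p ^ i)
      (Finset.mem_range.2 (Nat.mod_lt _ (Nat.pos_of_ne_zero hn))))
  exact (mem_rootSet.1 hmem).2

/-- The extension generated by the roots of unity of order prime to `p` is unramified. -/
lemma exists_norm_eq_zpow (red : Zpbar p →+* κ) {n : ℕ} (hn : n ≠ 0) {x : Zpbar p}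
    (hx : IsPrimitiveRoot (x : PadicAlgCl p) (p ^ n - 1)) {y : PadicAlgCl p}
    (hy : y ∈ IntermediateField.adjoin ℚ_[p] {(x : PadicAlgCl p)}) (hy0 : y ≠ 0) :
    ∃ k : ℤ, ‖y‖ = (p : ℝ) ^ k := by
  have hp := (Fact.out : p.Prime)
  have hint : IsIntegral ℚ_[p] (x : PadicAlgCl p) := Algebra.IsIntegral.isIntegral _
  obtain ⟨f, hf⟩ : ∃ f : ℚ_[p][X], f.natDegree < n ∧ y = aeval (x : PadicAlgCl p) f := by
    rw [← IntermediateField.mem_toSubalgebra,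
      IntermediateField.adjoin_simple_toSubalgebra_of_isAlgebraic hint.isAlgebraic,
      Algebra.adjoin_singleton_eq_range_aeval] at hy
    obtain ⟨g, rfl⟩ := hy
    refine ⟨g %ₘ minpoly ℚ_[p] (x : PadicAlgCl p), ?_, ?_⟩
    · exact (natDegree_modByMonic_lt g (minpoly.monic hint) (minpoly.ne_one _ _)).trans_le
        (natDegree_minpoly_le hn hx.pow_eq_one)
    · exact (aeval_modByMonic_eq_self_of_root (minpoly.aeval _ _)).symm
  obtain ⟨hfn, rfl⟩ := hf
  have hf0 : f ≠ 0 := by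
    rintro rfl
    exact hy0 (map_zero _)
  obtain ⟨i, hi, hmax⟩ := Finset.exists_max_image f.support (fun i => ‖f.coeff i‖)
    (nonempty_support_iff.2 hf0)
  have hc0 : f.coeff i ≠ 0 := mem_support_iff.1 hi
  set c := f.coeff i with hc
  have hle : ∀ j, ‖(C c⁻¹ * f).coeff j‖ ≤ 1 := by
    intro j
    rw [coeff_C_mul, norm_mul, norm_inv, inv_mul_le_one₀ (norm_pos_iff.2 hc0)]
    by_cases hj : j ∈ f.support
    · exact hmax j hj
    · rw [notMem_support_iff.1 hj, norm_zero]
      exact norm_nonneg _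
  have hl : C c⁻¹ * f ∈ lifts (algebraMap ℤ_[p] ℚ_[p]) := by
    rw [lifts_iff_coeff_lifts]
    exact fun j => ⟨⟨_, hle j⟩, rfl⟩
  obtain ⟨Q, hQ, hQd'⟩ := exists_degree_eq_of_mem_lifts hl
  have hQd := natDegree_eq_of_degree_eq hQd'
  have hQi : Q.coeff i = 1 := by
    have h1 := congrArg (fun q => q.coeff i) hQ
    simp only [coeff_map, coeff_C_mul, ← hc, inv_mul_cancel₀ hc0] at h1
    exact Subtype.ext h1
  have hQn : Q.natDegree < n := by
    rw [hQd]
    exact (natDegree_C_mul_le _ _).trans_lt hfn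
  have h1 := red_aeval_ne_zero (red := red) hn hx hQn (i := i) (by rw [hQi]; exact isUnit_one)
  rw [Ne, red_eq_zero_iff, not_lt] at h1
  have h2 : ((aeval x Q : Zpbar p) : PadicAlgCl p) = (c⁻¹ : ℚ_[p]) * aeval (x : PadicAlgCl p) f := by
    have e1 : ((aeval x Q : Zpbar p) : PadicAlgCl p) = aeval (x : PadicAlgCl p) Q :=
      (aeval_algebraMap_apply (PadicAlgCl p) x Q).symm
    rw [e1, ← aeval_map_algebraMap ℚ_[p], hQ, map_mul, aeval_C]
  have h3 : ‖((aeval x Q : Zpbar p) : PadicAlgCl p)‖ = 1 := le_antisymm (norm_coe_le_one _) h1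
  rw [h2, norm_mul, PadicAlgCl.norm_extends, norm_inv, inv_mul_eq_one₀ (norm_ne_zero_iff.2 hc0)] at h3
  exact ⟨_, h3.symm.trans (Padic.norm_eq_zpow_neg_valuation hc0)⟩

end Unramified

lemma pow_eq_one_of_level_dvd {M : Type*} [Monoid M] {p n m : ℕ} (h : n ∣ m) {ζ : M}
    (hζ : ζ ^ (p ^ n - 1) = 1) : ζ ^ (p ^ m - 1) = 1 := by
  obtain ⟨k, rfl⟩ := h
  obtain ⟨l, hl⟩ : p ^ n - 1 ∣ p ^ (n * k) - 1 := by
    have := Nat.sub_dvd_pow_sub_pow (p ^ n) 1 k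
    rwa [one_pow, ← pow_mul] at this
  rw [hl, pow_mul, hζ, one_pow]

section Inertia

/-- The automorphisms which fix the roots of unity of order `pⁿ - 1`. -/
def fixRoots (p : ℕ) [Fact p.Prime] (n : ℕ) : Set (GalQp p) :=
  {σ | ∀ ζ : PadicAlgCl p, ζ ^ (p ^ n - 1) = 1 → σ ζ = ζ}

lemma isOpen_stabilizer_algCl (x : PadicAlgCl p) : IsOpen {σ : GalQp p | σ x = x} :=
  stabilizer_isOpen_of_isIntegral (K := ℚ_[p]) x

lemma isClosed_fixRoots (n : ℕ) : IsClosed (fixRoots p n) := by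
  have : fixRoots p n = ⋂ ζ : {ζ : PadicAlgCl p // ζ ^ (p ^ n - 1) = 1},
      (MulAction.stabilizer (GalQp p) (ζ : PadicAlgCl p) : Set (GalQp p)) := by
    ext σ
    simp [fixRoots, MulAction.mem_stabilizer_iff, AlgEquiv.smul_def]
  rw [this]
  exact isClosed_iInter fun ζ => Subgroup.isClosed_of_isOpen _ (isOpen_stabilizer_algCl _)

lemma eventually_fixRoots {n : ℕ} (hn : n ≠ 0) : ∀ᶠ σ : GalQp p in 𝓝 1, σ ∈ fixRoots p n := by
  obtain ⟨x, hx⟩ := exists_primitiveRoot_int (p := p) (pow_sub_one_ne_zero (p := p) hn)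
  have : NeZero (p ^ n - 1) := ⟨pow_sub_one_ne_zero hn⟩
  filter_upwards [(isOpen_stabilizer_algCl (x : PadicAlgCl p)).mem_nhds (x := 1) rfl] with σ hσ ζ hζ
  obtain ⟨i, -, rfl⟩ := hx.eq_pow_of_pow_eq_one hζ
  rw [map_pow, show σ (x : PadicAlgCl p) = x from hσ]

lemma fixRoots_subset {n m : ℕ} (h : n ∣ m) : fixRoots p m ⊆ fixRoots p n :=
  fun _ hσ ζ hζ => hσ ζ (pow_eq_one_of_level_dvd h hζ)

variable (red : Zpbar p →+* κ)

/-- A closed set which meets all the groups of automorphisms acting trivially on the roots of unity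
of order `pⁿ - 1` meets the inertia group. -/
lemma exists_isInertia {C : Set (GalQp p)} (hC : IsClosed C)
    (h : ∀ n : ℕ, n ≠ 0 → (C ∩ fixRoots p n).Nonempty) : ∃ σ ∈ C, IsInertia red σ := by
  have h1 := IsCompact.nonempty_iInter_of_directed_nonempty_isCompact_isClosed
    (fun n : ℕ => C ∩ fixRoots p (n + 1)) (fun n m => ⟨(n + 1) * (m + 1) - 1, by
      have e : (n + 1) * (m + 1) - 1 + 1 = (n + 1) * (m + 1) := Nat.sub_add_cancel (by
        exact Nat.mul_pos (Nat.succ_pos _) (Nat.succ_pos _))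
      dsimp only
      rw [e]
      exact ⟨Set.inter_subset_inter_right _ (fixRoots_subset (dvd_mul_right _ _)),
        Set.inter_subset_inter_right _ (fixRoots_subset (dvd_mul_left _ _))⟩⟩)
    (fun n => h _ (Nat.succ_ne_zero n))
    (fun n => (hC.inter (isClosed_fixRoots _)).isCompact) (fun n => hC.inter (isClosed_fixRoots _))
  obtain ⟨σ, hσ⟩ := h1
  rw [Set.mem_iInter] at hσ
  refine ⟨σ, (hσ 0).1, isInertia_of_fixes red fun n hn => ?_⟩
  obtain ⟨k, rfl⟩ := Nat.exists_eq_succ_of_ne_zero hn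
  exact (hσ k).2

lemma norm_varpi2 : ‖varpi2 p‖ ^ (p ^ 2 - 1) = (p : ℝ)⁻¹ := by
  rw [← norm_pow, varpi2_pow, norm_p_algCl]

lemma varpi2_ne_zero : varpi2 p ≠ 0 := by
  intro h
  have h1 := varpi2_pow p
  rw [h, zero_pow (pow_sub_one_ne_zero two_ne_zero)] at h1
  exact (Fact.out : p.Prime).ne_zero (by exact_mod_cast h1.symm)

/-- The polynomial `X ^ (p² - 1) - p` is irreducible over unramified extensions. -/
lemma exists_mem_fixRoots_apply_varpi2 (red : Zpbar p →+* κ) {n : ℕ} (hn : n ≠ 0)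
    {ζ : PadicAlgCl p} (hζ : ζ ^ (p ^ 2 - 1) = 1) :
    ∃ σ ∈ fixRoots p n, σ (varpi2 p) = ζ * varpi2 p := by
  have hp := (Fact.out : p.Prime)
  obtain ⟨x, hx⟩ := exists_primitiveRoot_int (p := p) (pow_sub_one_ne_zero (p := p) hn)
  have : NeZero (p ^ n - 1) := ⟨pow_sub_one_ne_zero hn⟩
  set L := IntermediateField.adjoin ℚ_[p] {(x : PadicAlgCl p)} with hL
  have hN0 : p ^ 2 - 1 ≠ 0 := pow_sub_one_ne_zero two_ne_zero
  have hint : IsIntegral L (varpi2 p) := Algebra.IsIntegral.isIntegral _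
  have hmonic := minpoly.monic hint
  set P : L[X] := X ^ (p ^ 2 - 1) - C (p : L) with hP
  have hPm : P.Monic := monic_X_pow_sub_C _ hN0
  have haev : ∀ y : PadicAlgCl p, aeval y P = y ^ (p ^ 2 - 1) - p := by
    intro y
    rw [hP, map_sub, map_pow, aeval_X, aeval_C, map_natCast]
  have hdvd : minpoly L (varpi2 p) ∣ P := minpoly.dvd _ _ (by rw [haev, varpi2_pow, sub_self])
  have hroots : ∀ y ∈ ((minpoly L (varpi2 p)).map (algebraMap L (PadicAlgCl p))).roots,
      ‖y‖ = ‖varpi2 p‖ := by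
    intro y hy
    have h1 : aeval y (minpoly L (varpi2 p)) = 0 := by
      have := (mem_roots'.1 hy).2
      rwa [IsRoot.def, eval_map_algebraMap] at this
    have h2 : y ^ (p ^ 2 - 1) = p := by
      obtain ⟨q, hq⟩ := hdvd
      have h3 := haev y
      rw [hq, map_mul, h1, zero_mul] at h3
      exact (sub_eq_zero.1 h3.symm)
    refine (pow_left_inj₀ (norm_nonneg _) (norm_nonneg _) hN0).1 ?_
    rw [norm_varpi2, ← norm_pow, h2, norm_p_algCl]
  set m := (minpoly L (varpi2 p)).natDegree with hm
  have hsplit : ((minpoly L (varpi2 p)).map (algebraMap L (PadicAlgCl p))).Splits :=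
    IsAlgClosed.splits _
  have hnorm : ‖((minpoly L (varpi2 p)).coeff 0 : PadicAlgCl p)‖ = ‖varpi2 p‖ ^ m := by
    have h1 := hsplit.coeff_zero_eq_prod_roots_of_monic (hmonic.map _)
    rw [coeff_map] at h1
    change ‖algebraMap L (PadicAlgCl p) _‖ = _
    rw [h1, norm_mul, norm_pow, norm_neg, norm_one, one_pow, one_mul]
    have h2 : ‖((minpoly L (varpi2 p)).map (algebraMap L (PadicAlgCl p))).roots.prod‖
        = (((minpoly L (varpi2 p)).map (algebraMap L (PadicAlgCl p))).roots.map norm).prod :=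
      map_multiset_prod (normHom : PadicAlgCl p →*₀ ℝ) _
    rw [h2, Multiset.map_congr rfl hroots, Multiset.map_const', Multiset.prod_replicate]
    congr 1
    rw [← hsplit.natDegree_eq_card_roots, natDegree_map]
  have hc0 : ((minpoly L (varpi2 p)).coeff 0 : PadicAlgCl p) ≠ 0 := by
    rw [← norm_ne_zero_iff, hnorm]
    exact pow_ne_zero _ (norm_ne_zero_iff.2 varpi2_ne_zero)
  obtain ⟨k, hk⟩ := exists_norm_eq_zpow red hn hx ((minpoly L (varpi2 p)).coeff 0).2 hc0
  have hdiv : ((p ^ 2 - 1 : ℕ) : ℤ) ∣ m := by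
    rw [hnorm] at hk
    have h1 : ((p : ℝ)⁻¹) ^ m = ((p : ℝ) ^ k) ^ (p ^ 2 - 1) := by
      rw [← hk, ← norm_varpi2, ← pow_mul, ← pow_mul, mul_comm]
    have h2 : (p : ℝ) ^ (-(m : ℤ)) = (p : ℝ) ^ (k * ((p ^ 2 - 1 : ℕ) : ℤ)) := by
      rw [zpow_mul, zpow_natCast, ← h1, zpow_neg, zpow_natCast, inv_pow]
    have h3 := zpow_right_injective₀ (by exact_mod_cast hp.pos) (by exact_mod_cast hp.one_lt.ne') h2
    exact (Dvd.intro_left k h3.symm).neg_right |>.trans (by rw [neg_neg])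
  have hm0 : m ≠ 0 := (minpoly.natDegree_pos hint).ne'
  have hle : p ^ 2 - 1 ≤ m := Nat.le_of_dvd (Nat.pos_of_ne_zero hm0) (by exact_mod_cast hdiv)
  have hPeq : P = minpoly L (varpi2 p) := by
    refine (eq_of_monic_of_dvd_of_natDegree_le hmonic hPm hdvd ?_)
    rw [hP, natDegree_X_pow_sub_C]
    exact hle
  have hroot : aeval (ζ * varpi2 p) (minpoly L (varpi2 p)) = 0 := by
    rw [← hPeq, haev, mul_pow, hζ, one_mul, varpi2_pow, sub_self]
  obtain ⟨σ, hσ⟩ := minpoly.exists_algEquiv_of_root' (K := L)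
    (Algebra.IsAlgebraic.isAlgebraic (varpi2 p)) hroot
  refine ⟨σ.restrictScalars ℚ_[p], fun ξ hξ => ?_, hσ⟩
  obtain ⟨i, -, rfl⟩ := hx.eq_pow_of_pow_eq_one hξ
  rw [map_pow]
  congr 1
  exact σ.commutes ⟨(x : PadicAlgCl p), IntermediateField.mem_adjoin_simple_self _ _⟩

lemma kummer2_pow (σ : GalQp p) : kummer2 p σ ^ (p ^ 2 - 1) = 1 := by
  refine Subtype.ext ?_
  have hp : (p : PadicAlgCl p) ≠ 0 := by exact_mod_cast (Fact.out : p.Prime).ne_zero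
  change (σ (varpi2 p) / varpi2 p) ^ (p ^ 2 - 1) = 1
  rw [div_pow, ← map_pow, varpi2_pow, map_natCast, div_self hp]

lemma kummer2_mul (σ τ : GalQp p) :
    kummer2 p (σ * τ) = galInt σ (kummer2 p τ) * kummer2 p σ := by
  refine Subtype.ext ?_
  change σ (τ (varpi2 p)) / varpi2 p = σ (τ (varpi2 p) / varpi2 p) * (σ (varpi2 p) / varpi2 p)
  have h1 : σ (varpi2 p) ≠ 0 := (map_ne_zero σ).2 varpi2_ne_zero
  rw [map_div₀, div_mul_div_cancel₀ h1]

/-- The fundamental character of level `2` is surjective on inertia. -/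
lemma exists_isInertia_omega2 :
    ∃ σ : GalQp p, IsInertia red σ ∧ IsPrimitiveRoot (omega2 red σ) (p ^ 2 - 1) := by
  obtain ⟨x, hx⟩ := exists_primitiveRoot_int (p := p) (pow_sub_one_ne_zero (p := p) two_ne_zero)
  have hC : IsClosed {σ : GalQp p | σ (varpi2 p) = x * varpi2 p} := by
    obtain ⟨σ₀, -, hσ₀⟩ := exists_mem_fixRoots_apply_varpi2 red one_ne_zero hx.pow_eq_one
    have h1 := (Subgroup.isClosed_of_isOpen (MulAction.stabilizer (GalQp p) (varpi2 p))
      (isOpen_stabilizer_algCl _))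
    have h2 := h1.leftCoset σ₀
    convert h2 using 1
    ext σ
    rw [mem_leftCoset_iff]
    change σ (varpi2 p) = x * varpi2 p ↔ σ₀⁻¹ (σ (varpi2 p)) = varpi2 p
    rw [← hσ₀]
    constructor
    · intro h
      rw [h]
      exact σ₀.symm_apply_apply _
    · intro h
      have h3 := congrArg σ₀ h
      rw [← h3]
      exact (σ₀.apply_symm_apply _).symm
  obtain ⟨σ, hσ, hσ'⟩ := exists_isInertia red hC fun n hn => by
    obtain ⟨σ, h1, h2⟩ := exists_mem_fixRoots_apply_varpi2 red hn hx.pow_eq_one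
    exact ⟨σ, h2, h1⟩
  refine ⟨σ, hσ', ?_⟩
  have h1 : kummer2 p σ = x := Subtype.ext (by
    change σ (varpi2 p) / varpi2 p = x
    rw [show σ (varpi2 p) = x * varpi2 p from hσ, mul_div_cancel_right₀ _ varpi2_ne_zero])
  rw [omega2, h1]
  exact isPrimitiveRoot_red red (coprime_pow_sub_one two_ne_zero) hx

end Inertia

section QuadraticUnramified

lemma mem_galQp2_iff {σ : GalQp p} : σ ∈ galQp2 p ↔ σ ∈ fixRoots p 2 := by
  rw [galQp2, IntermediateField.mem_fixingSubgroup_iff]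
  constructor
  · intro h ζ hζ
    exact h ζ (IntermediateField.subset_adjoin _ _ hζ)
  · intro h x hx
    induction hx using IntermediateField.adjoin_induction with
    | mem x hx => exact h x hx
    | algebraMap x => exact σ.commutes x
    | add x y _ _ hx hy => rw [map_add, hx, hy]
    | mul x y _ _ hx hy => rw [map_mul, hx, hy]
    | inv x _ hx => rw [map_inv₀, hx]

lemma exists_exp_mod_two (σ : GalQp p) :
    (σ ∈ galQp2 p ∧ ∀ ζ : PadicAlgCl p, ζ ^ (p ^ 2 - 1) = 1 → σ ζ = ζ) ∨
      ∀ ζ : PadicAlgCl p, ζ ^ (p ^ 2 - 1) = 1 → σ ζ = ζ ^ p := by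
  obtain ⟨m, hm⟩ := exists_frobenius_pow_galQp σ two_ne_zero
  rcases Nat.mod_two_eq_zero_or_one m with h | h
  · left
    have h1 : σ ∈ fixRoots p 2 := fun ζ hζ => by
      rw [hm ζ hζ, pow_pow_mod hζ, h, pow_zero, pow_one]
    exact ⟨mem_galQp2_iff.2 h1, h1⟩
  · right
    intro ζ hζ
    rw [hm ζ hζ, pow_pow_mod hζ, h, pow_one]

lemma apply_of_notMem_galQp2 {σ : GalQp p} (hσ : σ ∉ galQp2 p) {ζ : PadicAlgCl p}
    (hζ : ζ ^ (p ^ 2 - 1) = 1) : σ ζ = ζ ^ p :=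
  (exists_exp_mod_two σ).resolve_left (fun h => hσ h.1) ζ hζ

lemma pow_p_pow_p {M : Type*} [Monoid M] {ζ : M} (hζ : ζ ^ (p ^ 2 - 1) = 1) : (ζ ^ p) ^ p = ζ := by
  rw [← pow_mul, ← sq, pow_pow_mod hζ 2]
  simp

lemma mul_mem_galQp2 {σ τ : GalQp p} (hσ : σ ∉ galQp2 p) (hτ : τ ∉ galQp2 p) :
    σ * τ ∈ galQp2 p := by
  rw [mem_galQp2_iff]
  intro ζ hζ
  rw [AlgEquiv.mul_apply, apply_of_notMem_galQp2 hτ hζ, map_pow, apply_of_notMem_galQp2 hσ hζ,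
    pow_p_pow_p hζ]

lemma notMem_galQp2_of_frobenius {σ : GalQp p} {n : ℕ} (hn : 2 ∣ n)
    (hσ : ∀ ζ : PadicAlgCl p, ζ ^ (p ^ n - 1) = 1 → σ ζ = ζ ^ p) : σ ∉ galQp2 p := by
  intro h
  obtain ⟨x, hx⟩ := exists_primitiveRoot_int (p := p) (pow_sub_one_ne_zero (p := p) two_ne_zero)
  have h1 := hσ _ (pow_eq_one_of_level_dvd hn hx.pow_eq_one)
  rw [mem_galQp2_iff.1 h _ hx.pow_eq_one] at h1
  have hp := (Fact.out : p.Prime).two_le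
  have hlt : 1 < p ^ 2 - 1 := by nlinarith [Nat.sub_add_cancel (Nat.one_le_pow 2 p (by omega))]
  have h2 := hx.pow_inj hlt (show p < p ^ 2 - 1 by
    nlinarith [Nat.sub_add_cancel (Nat.one_le_pow 2 p (by omega))]) ((pow_one _).trans h1)
  omega

variable (red : Zpbar p →+* κ)

lemma exists_notMem_galQp2 (red : Zpbar p →+* κ) : ∃ σ : GalQp p, σ ∉ galQp2 p := by
  obtain ⟨σ, hσ⟩ := exists_frobenius red two_ne_zero
  exact ⟨σ, notMem_galQp2_of_frobenius dvd_rfl hσ⟩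

lemma isOpen_galQp2 : IsOpen (galQp2 p : Set (GalQp p)) := by
  refine (galQp2 p).isOpen_of_mem_nhds (g := 1) ?_
  filter_upwards [eventually_fixRoots (p := p) two_ne_zero] with σ hσ
  exact mem_galQp2_iff.2 hσ

lemma IsInertia.mem_galQp2 {red : Zpbar p →+* κ} {σ : GalQp p} (h : IsInertia red σ) :
    σ ∈ galQp2 p :=
  mem_galQp2_iff.2 fun _ hζ => h.fixes two_ne_zero hζ

lemma IsInertia.conj {red : Zpbar p →+* κ} {σ : GalQp p} (h : IsInertia red σ)
    (φ : GalQp p) : IsInertia red (φ * σ * φ⁻¹) := by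
  refine isInertia_of_fixes red fun n hn ζ hζ => ?_
  have h1 : (φ⁻¹ ζ) ^ (p ^ n - 1) = 1 := by rw [← map_pow, hζ, map_one]
  rw [AlgEquiv.mul_apply, AlgEquiv.mul_apply, h.fixes hn h1]
  exact φ.apply_symm_apply ζ

lemma omega2_pow (σ : GalQp p) : omega2 red σ ^ (p ^ 2 - 1) = 1 := by
  rw [omega2, ← map_pow, kummer2_pow, map_one]

lemma galInt_of_mem {σ : GalQp p} (hσ : σ ∈ galQp2 p) {x : Zpbar p} (hx : x ^ (p ^ 2 - 1) = 1) :
    galInt σ x = x :=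
  Subtype.ext (mem_galQp2_iff.1 hσ _ (congrArg Subtype.val hx))

lemma galInt_of_notMem {σ : GalQp p} (hσ : σ ∉ galQp2 p) {x : Zpbar p}
    (hx : x ^ (p ^ 2 - 1) = 1) : galInt σ x = x ^ p :=
  Subtype.ext (apply_of_notMem_galQp2 hσ (congrArg Subtype.val hx))

lemma omega2_mul_of_mem {σ : GalQp p} (hσ : σ ∈ galQp2 p) (τ : GalQp p) :
    omega2 red (σ * τ) = omega2 red σ * omega2 red τ := by
  rw [omega2, kummer2_mul, galInt_of_mem hσ (kummer2_pow τ), map_mul, mul_comm]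
  rfl

lemma omega2_mul_of_notMem {σ : GalQp p} (hσ : σ ∉ galQp2 p) (τ : GalQp p) :
    omega2 red (σ * τ) = omega2 red σ * omega2 red τ ^ p := by
  rw [omega2, kummer2_mul, galInt_of_notMem hσ (kummer2_pow τ), map_mul, map_pow, mul_comm]
  rfl

lemma omega2_one : omega2 red (1 : GalQp p) = 1 := by
  have : kummer2 p 1 = 1 := Subtype.ext (div_self varpi2_ne_zero)
  rw [omega2, this, map_one]

lemma omega2_ne_zero (σ : GalQp p) : omega2 red σ ≠ 0 := by
  intro h
  have := omega2_pow red σ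
  rw [h, zero_pow (pow_sub_one_ne_zero two_ne_zero)] at this
  exact zero_ne_one this

lemma omega2_conj {φ σ : GalQp p} (hφ : φ ∉ galQp2 p) (hσ : σ ∈ galQp2 p) :
    omega2 red (φ * σ * φ⁻¹) = omega2 red σ ^ p := by
  have hφσ : φ * σ ∉ galQp2 p := fun h => hφ (by
    have := mul_mem h (inv_mem hσ)
    rwa [mul_inv_cancel_right] at this)
  have h1 : omega2 red φ * omega2 red φ⁻¹ ^ p = 1 := by
    rw [← omega2_mul_of_notMem red hφ, mul_inv_cancel, omega2_one]
  rw [omega2_mul_of_notMem red hφσ, omega2_mul_of_notMem red hφ, mul_right_comm, h1, one_mul]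

end QuadraticUnramified

section UnramifiedCharacters

lemma unramChar_eq {a : κˣ} {σ : GalQp p} {n m : ℕ} (hn : orderOf a ∣ n)
    (h : ∀ ζ : PadicAlgCl p, ζ ^ (p ^ n - 1) = 1 → σ ζ = ζ ^ p ^ m) :
    unramChar a σ = (a ^ m)⁻¹ := by
  exact unramChar_apply a σ m fun ζ hζ => h ζ (pow_eq_one_of_level_dvd hn hζ)

lemma unramChar_mul (a b : κˣ) : unramChar (a * b) = unramChar a * unramChar b := by
  ext1 σ
  have hn : orderOf a * orderOf b ≠ 0 := mul_ne_zero (orderOf_ne_zero a) (orderOf_ne_zero b)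
  obtain ⟨m, hm⟩ := exists_frobenius_pow_galQp σ hn
  have h : orderOf (a * b) ∣ orderOf a * orderOf b := by
    refine orderOf_dvd_of_pow_eq_one ?_
    rw [mul_pow, pow_mul, pow_orderOf_eq_one, one_pow, mul_comm (orderOf a), pow_mul,
      pow_orderOf_eq_one, one_pow, one_mul]
  rw [MonoidHom.mul_apply, unramChar_eq h hm, unramChar_eq (dvd_mul_right _ _) hm,
    unramChar_eq (dvd_mul_left _ _) hm, mul_pow, mul_inv]

lemma unramChar_eq_one {a : κˣ} {σ : GalQp p} {n : ℕ} (hn : orderOf a ∣ n)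
    (h : σ ∈ fixRoots p n) : unramChar a σ = 1 := by
  rw [unramChar_eq (m := 0) hn fun ζ hζ => by rw [h ζ hζ, pow_zero, pow_one], pow_zero, inv_one]

lemma isSmoothChar_unramChar (a : κˣ) : IsSmoothChar (unramChar a) := by
  rw [isSmoothChar_iff]
  filter_upwards [eventually_fixRoots (orderOf_ne_zero a)] with σ hσ
  exact unramChar_eq_one dvd_rfl hσ

lemma unramChar_inertia {red : Zpbar p →+* κ} (a : κˣ) {σ : GalQp p}
    (h : IsInertia red σ) : unramChar a σ = 1 :=
  unramChar_eq_one dvd_rfl fun _ hζ => h.fixes (orderOf_ne_zero a) hζ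

lemma unramChar_injective (red : Zpbar p →+* κ) {a b : κˣ}
    (h : unramChar a = unramChar b) : a = b := by
  have hn : orderOf a * orderOf b ≠ 0 := mul_ne_zero (orderOf_ne_zero a) (orderOf_ne_zero b)
  obtain ⟨σ, hσ⟩ := exists_frobenius red hn
  have h1 := DFunLike.congr_fun h σ
  rwa [unramChar_eq (m := 1) (dvd_mul_right _ _) fun ζ hζ => by rw [hσ ζ hζ, pow_one],
    unramChar_eq (m := 1) (dvd_mul_left _ _) fun ζ hζ => by rw [hσ ζ hζ, pow_one], pow_one,
    pow_one, inv_inj] at h1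

lemma orderOf_dvd_two {M : Type*} [Monoid M] {a : M} (ha : a * a = 1) : orderOf a ∣ 2 :=
  orderOf_dvd_of_pow_eq_one (by rwa [sq])

lemma unramChar_of_mem {a : κˣ} (ha : a * a = 1) {σ : GalQp p} (hσ : σ ∈ galQp2 p) :
    unramChar a σ = 1 :=
  unramChar_eq_one (orderOf_dvd_two ha) (mem_galQp2_iff.1 hσ)

lemma unramChar_of_notMem {a : κˣ} (ha : a * a = 1) {σ : GalQp p} (hσ : σ ∉ galQp2 p) :
    unramChar a σ = a := by
  rw [unramChar_eq (m := 1) (orderOf_dvd_two ha) fun ζ hζ => by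
    rw [apply_of_notMem_galQp2 hσ hζ, pow_one], pow_one]
  exact inv_eq_of_mul_eq_one_left ha

end UnramifiedCharacters

section Cyclotomic

lemma exists_omega_spec (σ : GalQp p) : ∃ k : ℕ, (omega p σ : κ) = k ∧
    ∀ ζ : PadicAlgCl p, ζ ^ p = 1 → σ ζ = ζ ^ k := by
  have hker : (cyclo p σ : ℤ_[p]) -
      (((PadicInt.toZModPow 1 (cyclo p σ : ℤ_[p])).val : ℕ) : ℤ_[p])
      ∈ RingHom.ker (PadicInt.toZModPow 1 : ℤ_[p] →+* ZMod (p ^ 1)) := by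
    rw [RingHom.mem_ker, map_sub, map_natCast, ZMod.natCast_val, ZMod.cast_id, sub_self]
  rw [PadicInt.ker_toZModPow, pow_one, Ideal.mem_span_singleton'] at hker
  obtain ⟨y, hy⟩ := hker
  refine ⟨_, ?_, fun ζ hζ =>
    cyclotomicCharacter.spec p (n := 1) (σ : PadicAlgCl p ≃+* PadicAlgCl p) ζ (by rwa [pow_one])⟩
  change toFpbar p (cyclo p σ) = _
  rw [← sub_eq_zero, ← map_natCast (toFpbar p), ← map_sub]
  refine (congrArg _ hy.symm).trans ?_
  rw [map_mul, map_natCast, CharP.cast_eq_zero, mul_zero]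

/-- The uniformizer `ζ - 1` of `ℚ_p(ζ_p)` satisfies `(ζ - 1) ^ (p - 1) ≡ -p`. -/
lemma exists_cyclotomic_uniformizer (red : Zpbar p →+* κ) :
    ∃ x r : Zpbar p, (x : PadicAlgCl p) ≠ 0 ∧ (1 + x) ^ p = 1 ∧ red x = 0 ∧ red r = 1 ∧
      x ^ (p - 1) = -(p * r) := by
  have hp := (Fact.out : p.Prime)
  obtain ⟨z, hz⟩ := exists_primitiveRoot_int (p := p) hp.ne_zero
  have hz1 : z ^ p = 1 := Subtype.ext hz.pow_eq_one
  have hx : red (z - 1) = 0 := by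
    have : (red (z - 1)) ^ p = 0 := by
      rw [map_sub, sub_pow_char, ← map_pow, hz1, map_one, one_pow, sub_self]
    exact pow_eq_zero_iff hp.ne_zero |>.1 this
  have hx0 : z - 1 ≠ 0 := fun h => hz.ne_one hp.one_lt (congrArg Subtype.val (sub_eq_zero.1 h))
  refine ⟨z - 1, ∑ k ∈ Finset.Ioo 0 p, (z - 1) ^ (k - 1) * 1 ^ (p - k - 1) * ↑(p.choose k / p),
    fun h => hx0 (Subtype.ext h), by rw [add_sub_cancel, hz1], hx, ?_, ?_⟩
  · rw [map_sum, Finset.sum_eq_single 1]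
    · simp [Nat.div_self hp.pos]
    · intro k hk hk1
      rw [Finset.mem_Ioo] at hk
      rw [map_mul, map_mul, map_pow, hx, zero_pow (by omega), zero_mul, zero_mul]
    · intro h
      exact absurd (Finset.mem_Ioo.2 ⟨one_pos, hp.one_lt⟩) h
  · have h := add_pow_prime_eq hp (z - 1) 1
    rw [sub_add_cancel, hz1, one_pow, mul_one] at h
    set r := ∑ k ∈ Finset.Ioo 0 p, (z - 1) ^ (k - 1) * 1 ^ (p - k - 1) * ((p.choose k / p : ℕ) : Zpbar p)
    have h1 : (z - 1) * ((z - 1) ^ (p - 1) + p * r) = 0 := by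
      have h2 : (z - 1) ^ p = (z - 1) * (z - 1) ^ (p - 1) := by
        rw [← pow_succ', Nat.sub_add_cancel hp.one_le]
      linear_combination -h - h2
    exact eq_neg_of_add_eq_zero_left ((mul_eq_zero.1 h1).resolve_left hx0)

/-- The relation between the fundamental characters of levels `1` and `2`. -/
lemma omega_eq_omega2 (hp2 : p ≠ 2) (red : Zpbar p →+* κ) (σ : GalQp p) :
    (σ ∈ galQp2 p → (omega p σ : κ) = omega2 red σ ^ (p + 1)) ∧
      (σ ∉ galQp2 p → (omega p σ : κ) = -omega2 red σ ^ (p + 1)) := by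
  have hp := (Fact.out : p.Prime)
  have hodd : Odd p := hp.odd_of_ne_two hp2
  obtain ⟨x, r, hx0, hx1, hxr, hr, hpow⟩ := exists_cyclotomic_uniformizer red
  have hpp : (p + 1) * (p - 1) = p ^ 2 - 1 := by
    have := Nat.sq_sub_sq p 1
    rwa [one_pow, eq_comm] at this
  have hw0 : varpi2 p ^ (p + 1) ≠ 0 := pow_ne_zero _ varpi2_ne_zero
  have hp0 : (p : PadicAlgCl p) ≠ 0 := by exact_mod_cast hp.ne_zero
  have hu : ((x : PadicAlgCl p) / varpi2 p ^ (p + 1)) ^ (p - 1) = -(r : PadicAlgCl p) := by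
    rw [div_pow, ← pow_mul, hpp, varpi2_pow, div_eq_iff hp0]
    exact (congrArg Subtype.val hpow).trans (by push_cast; ring)
  let u : Zpbar p := ⟨x / varpi2 p ^ (p + 1),
    IsIntegral.of_pow (n := p - 1) (by have := hp.two_le; omega) (by rw [hu]; exact (-r).2)⟩
  have hu1 : u ^ (p - 1) = -r := Subtype.ext hu
  have hru : red u ^ (p - 1) = -1 := by rw [← map_pow, hu1, map_neg, hr]
  have hru0 : red u ≠ 0 := by
    intro h
    rw [h, zero_pow (by have := hp.two_le; omega)] at hru
    exact one_ne_zero (neg_eq_zero.1 hru.symm)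
  have hrup : red u ^ p = -red u := by
    rw [← pow_sub_one_mul hp.ne_zero, hru, neg_one_mul]
  have hrupp : red u ^ p ^ 2 = red u := by
    rw [sq, pow_mul, hrup, hodd.neg_pow, hrup, neg_neg]
  obtain ⟨k, hk, hσ⟩ := exists_omega_spec σ
  have h1 : (σ x : PadicAlgCl p) = (∑ i ∈ Finset.range k, (1 + x : PadicAlgCl p) ^ i) * x := by
    have h2 := hσ (1 + x) (congrArg Subtype.val hx1)
    have h3 := geom_sum_mul (1 + x : PadicAlgCl p) k
    rw [map_add, map_one] at h2
    rw [add_sub_cancel_left, ← h2, add_sub_cancel_left] at h3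
    exact h3.symm
  have hkey : galInt σ u * kummer2 p σ ^ (p + 1) = (∑ i ∈ Finset.range k, (1 + x) ^ i) * u := by
    refine Subtype.ext ?_
    push_cast
    change σ (x / varpi2 p ^ (p + 1)) * (σ (varpi2 p) / varpi2 p) ^ (p + 1)
      = _ * ((x : PadicAlgCl p) / varpi2 p ^ (p + 1))
    have hσ0 : σ (varpi2 p) ≠ 0 := (map_ne_zero σ).2 varpi2_ne_zero
    rw [map_div₀, map_pow, h1, div_pow]
    field_simp
  have hred := congrArg red hkey
  rw [map_mul, map_mul, map_pow, map_sum] at hred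
  simp only [map_pow, map_add, map_one, hxr, add_zero, one_pow, Finset.sum_const,
    Finset.card_range, nsmul_eq_mul, mul_one, ← hk] at hred
  constructor
  · intro h
    have h2 := red_galInt red (m := 0) two_ne_zero (σ := σ)
      (fun ζ hζ => by rw [mem_galQp2_iff.1 h ζ hζ, pow_zero, pow_one]) hrupp
    rw [h2, pow_zero, pow_one, mul_comm] at hred
    exact (mul_right_cancel₀ hru0 hred).symm
  · intro h
    have h2 := red_galInt red (m := 1) two_ne_zero (σ := σ)
      (fun ζ hζ => by rw [apply_of_notMem_galQp2 h hζ, pow_one]) hrupp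
    rw [h2, pow_one, hrup, neg_mul, mul_comm, ← neg_mul] at hred
    exact (mul_right_cancel₀ hru0 hred).symm

end Cyclotomic

section ArtinMap

lemma continuous_unitQ : Continuous (unitQ p) :=
  Continuous.units_map _ (show Continuous fun x : ℤ_[p] => (x : ℚ_[p]) from continuous_subtype_val)

lemma continuous_cyclo : Continuous (cyclo p) :=
  cyclotomicCharacter.continuous p ℚ_[p] (PadicAlgCl p)

lemma galChar_apply (η : QpChar) (σ : GalQp p) :
    galChar η σ = η (unitQ p (cyclo p σ)) * unramChar (η (pUnit p)) σ := rfl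

lemma isSmoothChar_galChar {η : QpChar} (h : IsSmoothChar η) :
    IsSmoothChar (galChar η) :=
  (h.comp (f := (unitQ p).comp (cyclo p)) (continuous_unitQ.comp continuous_cyclo)).mul
    (isSmoothChar_unramChar _)

lemma galChar_mul (η η' : QpChar) : galChar (η * η') = galChar η * galChar η' := by
  ext1 σ
  rw [MonoidHom.mul_apply, galChar_apply, galChar_apply, galChar_apply, MonoidHom.mul_apply,
    MonoidHom.mul_apply, unramChar_mul, MonoidHom.mul_apply, mul_mul_mul_comm]

lemma unramChar_one : unramChar (1 : κˣ) = 1 := by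
  ext1 σ
  obtain ⟨m, hm⟩ := exists_frobExp (1 : κˣ) σ
  rw [unramChar_apply _ _ _ hm, one_pow, inv_one, MonoidHom.one_apply]

lemma unramChar_pow_apply (a : κˣ) (n : ℕ) (σ : GalQp p) :
    unramChar (a ^ n) σ = unramChar a σ ^ n := by
  induction n with
  | zero => rw [pow_zero, unramChar_one, MonoidHom.one_apply, pow_zero]
  | succ n ih => rw [pow_succ, unramChar_mul, MonoidHom.mul_apply, ih, pow_succ]

lemma galChar_omegaQp : galChar (omegaQp p) = omega p := by
  ext σ
  rw [galChar_apply, omegaQp_pUnit, unramChar_one, MonoidHom.one_apply, mul_one, omegaQp_unitQ]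
  rfl

lemma galChar_unrQp (a : κˣ) : galChar (unrQp a) = unramChar a := by
  ext1 σ
  rw [galChar_apply, unrQp_unitQ, unrQp_pUnit, one_mul]

lemma galChar_pow (η : QpChar) (n : ℕ) : galChar (η ^ n) = galChar η ^ n := by
  ext1 σ
  rw [galChar_apply, pow_apply, pow_apply, pow_apply, galChar_apply,
    mul_pow, unramChar_pow_apply]

/-- A smooth character of `ℚ_pˣ` with values in `𝔽̄_pˣ` is trivial on principal units. -/
lemma IsSmoothChar.eq_one_of_toFpbar {η : QpChar} (h : IsSmoothChar η) {u : ℤ_[p]ˣ}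
    (hu : toFpbar p u = 1) : η (unitQ p u) = 1 := by
  have h1 : (p : ℤ_[p]) ∣ (u : ℤ_[p]) - 1 := by
    have h2 : toZMod ((u : ℤ_[p]) - 1) = 0 :=
      (ofFp).injective (by
        rw [map_zero]
        change toFpbar p _ = 0
        rw [map_sub, map_one, hu, sub_self])
    obtain ⟨y, hy⟩ := toZMod_eq_zero_iff.1 h2
    exact ⟨y, hy⟩
  have hlim : Filter.Tendsto (fun n : ℕ => unitQ p u ^ p ^ n) Filter.atTop (𝓝 1) := by
    rw [Units.isEmbedding_val₀.tendsto_nhds_iff, tendsto_iff_norm_sub_tendsto_zero]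
    refine squeeze_zero (fun _ => norm_nonneg _) (g := fun n : ℕ => ((p : ℝ)⁻¹) ^ n) (fun n => ?_)
      (tendsto_pow_atTop_nhds_zero_of_lt_one (by positivity) (inv_lt_one_of_one_lt₀
        (by exact_mod_cast (Fact.out : p.Prime).one_lt)))
    obtain ⟨y, hy⟩ := dvd_sub_pow_of_dvd_sub h1 n
    rw [one_pow] at hy
    have h2 : ‖((u : ℤ_[p]) : ℚ_[p]) ^ p ^ n - 1‖ = ‖(u : ℤ_[p]) ^ p ^ n - 1‖ := by
      rw [← PadicInt.padic_norm_e_of_padicInt]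
      push_cast
      rfl
    change ‖((u : ℤ_[p]) : ℚ_[p]) ^ p ^ n - 1‖ ≤ _
    rw [h2, hy, norm_mul, norm_pow, PadicInt.norm_p, pow_succ, mul_assoc]
    refine mul_le_of_le_one_right (by positivity) ?_
    exact mul_le_one₀ (inv_le_one_of_one_le₀ (by exact_mod_cast (Fact.out : p.Prime).one_le))
      (norm_nonneg _) (PadicInt.norm_le_one y)
  obtain ⟨n, hn⟩ := (hlim.eventually (isSmoothChar_iff.1 h)).exists
  rw [map_pow] at hn
  have h3 : ((η (unitQ p u) : κˣ) : κ) ^ p ^ n = 1 ^ p ^ n := by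
    rw [← val_pow_eq_pow_val, hn, val_one, one_pow]
  refine Units.ext (iterateFrobenius_inj κ p n ?_)
  rwa [iterateFrobenius_def, iterateFrobenius_def, val_one]

/-- A smooth character of `ℚ_pˣ` with values in `𝔽̄_pˣ` is the product of a power of `ω` and an
unramified character. -/
lemma IsSmoothChar.exists_eq {η : QpChar} (h : IsSmoothChar η) :
    ∃ i : ℕ, η = omegaQp p ^ i * unrQp (η (pUnit p)) := by
  have hp := (Fact.out : p.Prime)
  obtain ⟨u, hu⟩ := exists_unit_pow_eq_one_iff (p := p)
  have hprim : IsPrimitiveRoot (toFpbar p u) (p - 1) :=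
    ⟨(hu _).2 dvd_rfl, fun l hl => (hu l).1 hl⟩
  have : NeZero (p - 1) := ⟨by have := hp.two_le; omega⟩
  have h1 : ((η (unitQ p u) : κˣ) : κ) ^ (p - 1) = 1 := by
    rw [← val_pow_eq_pow_val, ← map_pow, ← map_pow, h.eq_one_of_toFpbar, val_one]
    rw [val_pow_eq_pow_val, map_pow, hprim.pow_eq_one]
  obtain ⟨i, -, hi⟩ := hprim.eq_pow_of_pow_eq_one h1
  refine ⟨i, char_ext ?_ fun v => ?_⟩
  · rw [MonoidHom.mul_apply, pow_apply, omegaQp_pUnit, one_pow, one_mul, unrQp_pUnit]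
  · have h2 : toFpbar p v ^ (p - 1) = 1 := by
      change ofFp (toZMod (v : ℤ_[p])) ^ (p - 1) = 1
      rw [← map_pow, ZMod.pow_card_sub_one_eq_one (v.isUnit.map toZMod).ne_zero, map_one]
    obtain ⟨j, -, hj⟩ := hprim.eq_pow_of_pow_eq_one h2
    have h3 : η (unitQ p (v * (u ^ j)⁻¹)) = 1 := by
      refine h.eq_one_of_toFpbar ?_
      have h4 : ((u ^ j : ℤ_[p]ˣ) : ℤ_[p]) * ((u ^ j)⁻¹ : ℤ_[p]ˣ) = 1 := Units.mul_inv _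
      rw [val_mul, map_mul, ← hj, ← map_pow, ← map_mul, ← val_pow_eq_pow_val, h4,
        map_one]
    rw [map_mul, map_mul, map_inv, map_inv, mul_inv_eq_one] at h3
    refine Units.ext ?_
    rw [MonoidHom.mul_apply, unrQp_unitQ, mul_one, pow_apply, val_pow_eq_pow_val,
      omegaQp_unitQ, h3, map_pow, map_pow, val_pow_eq_pow_val, ← hi, ← hj, ← pow_mul,
      ← pow_mul, mul_comm]

lemma galChar_eq {i : ℕ} {a : κˣ} :
    galChar (omegaQp p ^ i * unrQp a) = omega p ^ i * unramChar a := by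
  rw [galChar_mul, galChar_pow, galChar_omegaQp, galChar_unrQp]

/-- An element of inertia on which `ω₂` and `ω` have maximal order. -/
lemma exists_inertia_generator (hp2 : p ≠ 2) (red : Zpbar p →+* κ) :
    ∃ σ : GalQp p, IsInertia red σ ∧ IsPrimitiveRoot (omega2 red σ) (p ^ 2 - 1) ∧
      (omega p σ : κ) = omega2 red σ ^ (p + 1) ∧
      IsPrimitiveRoot (omega p σ : κ) (p - 1) := by
  obtain ⟨σ, hσ, h⟩ := exists_isInertia_omega2 red
  have h1 := (omega_eq_omega2 hp2 red σ).1 hσ.mem_galQp2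
  refine ⟨σ, hσ, h, h1, ?_⟩
  rw [h1]
  refine h.pow (Nat.pos_of_ne_zero (pow_sub_one_ne_zero two_ne_zero)) ?_
  have := Nat.sq_sub_sq p 1
  rwa [one_pow] at this

lemma omegaQp_pow_congr {i j : ℕ} (h : i ≡ j [MOD p - 1]) : omegaQp p ^ i = omegaQp p ^ j := by
  ext1 x
  have h1 := DFunLike.congr_fun (omegaQp_pow_pred (p := p)) x
  rw [pow_apply, MonoidHom.one_apply] at h1
  rw [pow_apply, pow_apply, pow_eq_pow_iff_modEq]
  exact h.of_dvd (orderOf_dvd_of_pow_eq_one h1)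

lemma galChar_injective (hp2 : p ≠ 2) (red : Zpbar p →+* κ) {η η' : QpChar}
    (h : IsSmoothChar η) (h' : IsSmoothChar η') (e : galChar η = galChar η') : η = η' := by
  obtain ⟨i, hi⟩ := h.exists_eq
  obtain ⟨j, hj⟩ := h'.exists_eq
  obtain ⟨σ, hσ, -, -, hω⟩ := exists_inertia_generator hp2 red
  rw [hi, hj, galChar_eq, galChar_eq] at e
  have h1 := DFunLike.congr_fun e σ
  rw [MonoidHom.mul_apply, MonoidHom.mul_apply, unramChar_inertia _ hσ, unramChar_inertia _ hσ,
    mul_one, mul_one, pow_apply, pow_apply, pow_eq_pow_iff_modEq,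
    ← orderOf_units, ← hω.eq_orderOf] at h1
  have h2 := omegaQp_pow_congr (p := p) h1
  have h3 : unramChar (η (pUnit p)) = unramChar (η' (pUnit p)) := by
    rw [← galChar_omegaQp, ← galChar_pow, ← galChar_pow, h2] at e
    exact mul_left_cancel e
  rw [hi, hj, h2, unramChar_injective red h3]

end ArtinMap

section Induced

lemma conj_mem_galQp2 (g : GalQp p) {h : GalQp p} (hh : h ∈ galQp2 p) :
    g * h * g⁻¹ ∈ galQp2 p := by
  rw [mem_galQp2_iff] at hh ⊢
  intro ζ hζ
  rw [AlgEquiv.mul_apply, AlgEquiv.mul_apply, hh _ (by rw [← map_pow, hζ, map_one])]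
  exact g.apply_symm_apply ζ

lemma conj_notMem_galQp2 (g : GalQp p) {h : GalQp p} (hh : h ∉ galQp2 p) :
    g * h * g⁻¹ ∉ galQp2 p := fun h1 => hh (by
  have := conj_mem_galQp2 g⁻¹ h1
  rwa [inv_inv, mul_assoc, inv_mul_cancel_right, inv_mul_cancel_left] at this)

/-- Conjugation by `g` on `Gal(ℚ̄_p/ℚ_{p²})`. -/
def conjQp2 (g : GalQp p) : galQp2 p →* galQp2 p where
  toFun h := ⟨g * h * g⁻¹, conj_mem_galQp2 g h.2⟩
  map_one' := Subtype.ext (by simp)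
  map_mul' h h' := Subtype.ext (by simp)

lemma continuous_conjQp2 (g : GalQp p) : Continuous (conjQp2 g) :=
  Continuous.subtype_mk ((continuous_const.mul continuous_subtype_val).mul continuous_const) _

variable {χ χ' : galQp2 p →* κˣ}

lemma indQp2_equivariant (f : Representation.coindV (galQp2 p).subtype (charRep χ)) (h : galQp2 p)
    (g : GalQp p) : f.1 (h * g) = χ h * f.1 g := f.2 h g

lemma indQp2_conj (f : Representation.coindV (galQp2 p).subtype (charRep χ)) (h : galQp2 p)
    (g : GalQp p) : f.1 (g * h) = χ (conjQp2 g h) * f.1 g := by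
  rw [← indQp2_equivariant f]
  exact congrArg f.1 (inv_mul_cancel_right (g * (h : GalQp p)) g).symm

lemma mul_inv_mem_galQp2 {g φ : GalQp p} (hg : g ∉ galQp2 p) (hφ : φ ∉ galQp2 p) :
    g * φ⁻¹ ∈ galQp2 p := mul_mem_galQp2 hg fun h => hφ (inv_mem_iff.1 h)

open Classical in
/-- The coordinates `f ↦ (f(1), f(φ))` of the induced representation. -/
def indCoord (χ : galQp2 p →* κˣ) {φ : GalQp p} (hφ : φ ∉ galQp2 p) :
    Representation.coindV (galQp2 p).subtype (charRep χ) ≃ₗ[κ] (Fin 2 → κ) where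
  toFun f := ![f.1 1, f.1 φ]
  map_add' f f' := by ext i; fin_cases i <;> rfl
  map_smul' c f := by ext i; fin_cases i <;> rfl
  invFun v := ⟨fun g => if h : g ∈ galQp2 p then χ ⟨g, h⟩ * v 0 else
    χ ⟨g * φ⁻¹, mul_inv_mem_galQp2 h hφ⟩ * v 1, fun h g => by
      change dite _ _ _ = (χ h : κ) * dite _ _ _
      by_cases hg : g ∈ galQp2 p
      · have h1 : (galQp2 p).subtype h * g ∈ galQp2 p := mul_mem h.2 hg
        rw [dif_pos hg, dif_pos h1, ← mul_assoc, ← val_mul, ← map_mul]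
        rfl
      · have h1 : (galQp2 p).subtype h * g ∉ galQp2 p := fun h1 =>
          hg ((Subgroup.mul_mem_cancel_left _ h.2).1 h1)
        rw [dif_neg hg, dif_neg h1, ← mul_assoc, ← val_mul, ← map_mul]
        congr 4⟩
  left_inv f := by
    refine Subtype.ext (funext fun g => ?_)
    change (if h : g ∈ galQp2 p then (χ ⟨g, h⟩ : κ) * f.1 1 else
      χ ⟨g * φ⁻¹, mul_inv_mem_galQp2 h hφ⟩ * f.1 φ) = f.1 g
    split_ifs with h
    · rw [← indQp2_equivariant, mul_one]
    · rw [← indQp2_equivariant, inv_mul_cancel_right]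
  right_inv v := by
    ext i
    fin_cases i
    · change (if h : (1 : GalQp p) ∈ galQp2 p then (χ ⟨1, h⟩ : κ) * v 0 else _) = v 0
      rw [dif_pos (one_mem _), show (⟨1, one_mem _⟩ : galQp2 p) = 1 from rfl, map_one,
        val_one, one_mul]
    · change (if h : φ ∈ galQp2 p then (χ ⟨φ, h⟩ : κ) * v 0 else
        χ ⟨φ * φ⁻¹, mul_inv_mem_galQp2 h hφ⟩ * v 1) = v 1
      rw [dif_neg hφ, show (⟨φ * φ⁻¹, mul_inv_mem_galQp2 hφ hφ⟩ : galQp2 p) = 1 from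
        Subtype.ext (mul_inv_cancel φ), map_one, val_one, one_mul]

lemma det_of_coord {k V : Type*} [Field k] [AddCommGroup V] [Module k V] (e : V ≃ₗ[k] (Fin 2 → k))
    (f : V →ₗ[k] V) (M : Matrix (Fin 2) (Fin 2) k) (h : ∀ v, e (f v) = M.mulVec (e v)) :
    LinearMap.det f = M.det := by
  rw [← LinearMap.det_conj f e, ← LinearMap.det_toLin']
  congr 1
  ext1 i
  refine LinearMap.ext fun c => ?_
  change e (f (e.symm _)) = _
  rw [h, LinearEquiv.apply_symm_apply]
  rfl

lemma det_indQp2_of_mem (χ : galQp2 p →* κˣ) {g : GalQp p} (hg : g ∉ galQp2 p)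
    (h : galQp2 p) : LinearMap.det (indQp2 χ h) = χ h * χ (conjQp2 g h) := by
  rw [det_of_coord (indCoord χ hg) _ !![(χ h : κ), 0; 0, χ (conjQp2 g h)], Matrix.det_fin_two_of,
    mul_zero, sub_zero]
  intro f
  ext i
  fin_cases i
  · change f.1 (1 * h) = _
    rw [one_mul, ← mul_one (h : GalQp p), indQp2_equivariant]
    simp [indCoord, Matrix.mulVec, dotProduct]
  · change f.1 (g * h) = _
    rw [indQp2_conj]
    simp [indCoord, Matrix.mulVec, dotProduct]

lemma det_indQp2_of_notMem (χ : galQp2 p →* κˣ) {σ : GalQp p} (hσ : σ ∉ galQp2 p) :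
    LinearMap.det (indQp2 χ σ) = -χ ⟨σ * σ, mul_mem_galQp2 hσ hσ⟩ := by
  rw [det_of_coord (indCoord χ hσ) _ !![0, 1; (χ ⟨σ * σ, mul_mem_galQp2 hσ hσ⟩ : κ), 0],
    Matrix.det_fin_two_of, mul_zero, zero_sub, one_mul]
  intro f
  ext i
  fin_cases i
  · change f.1 (1 * σ) = _
    rw [one_mul]
    simp [indCoord, Matrix.mulVec, dotProduct]
  · change f.1 (σ * σ) = _
    have := indQp2_equivariant f ⟨σ * σ, mul_mem_galQp2 hσ hσ⟩ 1
    rw [mul_one] at this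
    rw [this]
    simp [indCoord, Matrix.mulVec, dotProduct]

lemma isSmoothRep_indQp2 (red : Zpbar p →+* κ) (h : IsSmoothChar χ) :
    IsSmoothRep (indQp2 χ) := by
  rw [isSmoothRep_iff]
  intro f
  obtain ⟨φ, hφ⟩ := exists_notMem_galQp2 red
  have hH : IsOpen (galQp2 p : Set (GalQp p)) := isOpen_galQp2
  have h1 : ∀ᶠ σ : GalQp p in 𝓝 1, ∃ hσ : σ ∈ galQp2 p, χ ⟨σ, hσ⟩ = 1 ∧
      χ (conjQp2 φ ⟨σ, hσ⟩) = 1 := by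
    have h2 := (isSmoothChar_iff.1 h).and (isSmoothChar_iff.1 (h.comp (continuous_conjQp2 φ)))
    rw [nhds_subtype_eq_comap, Filter.eventually_comap] at h2
    filter_upwards [h2, hH.mem_nhds (one_mem _)] with σ hσ hσ'
    exact ⟨hσ', hσ ⟨σ, hσ'⟩ rfl⟩
  filter_upwards [h1] with σ hσ
  obtain ⟨hσ, h2, h3⟩ := hσ
  refine (indCoord χ hφ).injective ?_
  ext i
  fin_cases i
  · change f.1 (1 * (⟨σ, hσ⟩ : galQp2 p)) = f.1 1
    have := indQp2_equivariant f ⟨σ, hσ⟩ 1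
    rw [h2, val_one, one_mul, mul_one] at this
    rwa [one_mul]
  · change f.1 (φ * (⟨σ, hσ⟩ : galQp2 p)) = f.1 φ
    rw [indQp2_conj, h3, val_one, one_mul]

/-- The isomorphisms between twists of induced representations. -/
theorem nonempty_twist_indQp2_equiv_iff (red : Zpbar p →+* κ) {ψ ψ' : GalQp p →* κˣ} :
    Nonempty ((twist (indQp2 χ) ψ).Equiv (twist (indQp2 χ') ψ')) ↔
      ∃ g : GalQp p, ∀ h : galQp2 p, χ' (conjQp2 g h) * ψ' h = χ h * ψ h := by
  obtain ⟨φ, hφ⟩ := exists_notMem_galQp2 red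
  constructor
  · rintro ⟨e⟩
    set f := (indCoord χ hφ).symm ![1, 0] with hf
    have hf1 : indCoord χ hφ f = ![1, 0] := LinearEquiv.apply_symm_apply _ _
    have e0 : f.1 1 = 1 := congrFun hf1 0
    have e1 : f.1 φ = 0 := congrFun hf1 1
    have hf0 : f ≠ 0 := fun h0 => by
      rw [h0] at e0
      exact zero_ne_one e0
    have hF0 : (e f).1 ≠ 0 := fun h0 =>
      hf0 ((EquivLike.injective e) ((Subtype.ext h0 : e f = 0).trans (map_zero e).symm))
    obtain ⟨g, hg⟩ := Function.ne_iff.1 hF0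
    refine ⟨g, fun h => ?_⟩
    have h1 : twist (indQp2 χ) ψ (h : GalQp p) f = ((χ h * ψ h : κˣ) : κ) • f := by
      refine (indCoord χ hφ).injective ?_
      ext i
      fin_cases i
      · change (ψ h : κ) * f.1 (1 * h) = (χ h * ψ h : κˣ) * f.1 1
        have := indQp2_equivariant f h 1
        rw [mul_one] at this
        rw [one_mul, this, val_mul]
        ring
      · change (ψ h : κ) * f.1 (φ * h) = (χ h * ψ h : κˣ) * f.1 φ
        rw [indQp2_conj, e1, mul_zero, mul_zero, mul_zero]
    have h2 := Representation.IntertwiningMap.isIntertwining _ _ e.toIntertwiningMap (h : GalQp p) f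
    rw [h1, map_smul] at h2
    have h3 : ((χ h * ψ h : κˣ) : κ) * (e f).1 g
        = (ψ' h : κ) * (e f).1 (g * h) := congrFun (congrArg Subtype.val h2) g
    rw [indQp2_conj, ← mul_assoc] at h3
    refine Units.ext ((mul_right_cancel₀ hg h3).symm ▸ ?_)
    rw [val_mul, mul_comm]
  · rintro ⟨g, hg⟩
    let c : GalQp p →* κˣ := ψ' * ψ⁻¹
    have hc : ∀ σ, (ψ σ : κ) * c σ = ψ' σ := fun σ => by
      rw [← val_mul]
      congr 1
      change ψ σ * (ψ' σ * (ψ σ)⁻¹) = _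
      rw [mul_comm, inv_mul_cancel_right]
    let T : Representation.coindV (galQp2 p).subtype (charRep χ') →ₗ[κ]
        Representation.coindV (galQp2 p).subtype (charRep χ) :=
      { toFun := fun f => ⟨fun x => (c x : κ) * f.1 (g * x), fun h x => by
          change (c (h * x) : κ) * f.1 (g * (h * x)) = χ h * (c x * f.1 (g * x))
          have h1 : g * (h * x) = conjQp2 g h * (g * x) := by
            change _ = g * h * g⁻¹ * (g * x)
            group
          have h2 : (χ h : κ) = χ' (conjQp2 g h) * c h := by
            rw [← val_mul]
            congr 1
            change _ = _ * (ψ' h * (ψ h)⁻¹)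
            rw [← mul_assoc, hg, mul_inv_cancel_right]
          rw [h1, indQp2_equivariant, h2, map_mul, val_mul]
          ring⟩
        map_add' := fun f f' => Subtype.ext (funext fun x => mul_add _ _ _)
        map_smul' := fun a f => Subtype.ext (funext fun x => mul_left_comm _ _ _) }
    have hT : Function.Injective T := by
      rw [injective_iff_map_eq_zero]
      intro f hf
      refine Subtype.ext (funext fun x => ?_)
      have h1 : (c (g⁻¹ * x) : κ) * f.1 (g * (g⁻¹ * x)) = 0 :=
        congrFun (congrArg Subtype.val hf) (g⁻¹ * x)
      rw [mul_inv_cancel_left] at h1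
      exact (mul_eq_zero.1 h1).resolve_left (Units.ne_zero _)
    have hfd := Module.Finite.equiv (indCoord χ' hφ).symm
    have hfd' := Module.Finite.equiv (indCoord χ hφ).symm
    refine equiv_symm ⟨Representation.Equiv.mk (T.linearEquivOfInjective hT (by
      rw [(indCoord χ' hφ).finrank_eq, (indCoord χ hφ).finrank_eq])) fun σ => ?_⟩
    refine LinearMap.ext fun f => Subtype.ext (funext fun x => ?_)
    change (c x : κ) * ((ψ' σ : κ) * f.1 (g * x * σ))
      = (ψ σ : κ) * ((c (x * σ) : κ) * f.1 (g * (x * σ)))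
    rw [← hc, map_mul, val_mul, mul_assoc g]
    ring

end Induced

section FundamentalCharacter

variable (red : Zpbar p →+* κ)

/-- The character `ω₂` of `Gal(ℚ̄_p/ℚ_{p²})` defined by `ϖ`. -/
def omega2Char : galQp2 p →* κˣ where
  toFun σ := Units.mk0 (omega2 red σ) (omega2_ne_zero red σ)
  map_one' := Units.ext (omega2_one red)
  map_mul' σ τ := Units.ext (omega2_mul_of_mem red σ.2 τ)

lemma isSmoothChar_omega2Char : IsSmoothChar (omega2Char red) := by
  rw [isSmoothChar_iff]
  have h := (isOpen_stabilizer_algCl (varpi2 p)).mem_nhds (x := 1) rfl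
  filter_upwards [continuous_subtype_val.tendsto (1 : galQp2 p) h] with σ hσ
  refine Units.ext ?_
  change red (kummer2 p σ) = 1
  have h1 : kummer2 p (σ : GalQp p) = 1 := Subtype.ext (by
    change (σ : GalQp p) (varpi2 p) / varpi2 p = 1
    rw [show (σ : GalQp p) (varpi2 p) = varpi2 p from hσ, div_self varpi2_ne_zero])
  rw [h1, map_one]

lemma omega_of_mem (hp2 : p ≠ 2) (h : galQp2 p) : omega p h = omega2Char red h ^ (p + 1) :=
  Units.ext (by
    rw [(omega_eq_omega2 hp2 red h).1 h.2, val_pow_eq_pow_val]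
    rfl)

lemma omega2Char_conj {g : GalQp p} (hg : g ∉ galQp2 p) (h : galQp2 p) :
    omega2Char red (conjQp2 g h) = omega2Char red h ^ p :=
  Units.ext (by
    rw [val_pow_eq_pow_val]
    exact omega2_conj red hg h.2)

lemma omega2Char_mul_self (hp2 : p ≠ 2) {σ : GalQp p} (hσ : σ ∉ galQp2 p) :
    omega2Char red ⟨σ * σ, mul_mem_galQp2 hσ hσ⟩ = -omega p σ :=
  Units.ext (by
    rw [Units.val_neg, (omega_eq_omega2 hp2 red σ).2 hσ, neg_neg, pow_succ']
    exact omega2_mul_of_notMem red hσ σ)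

lemma omega_pow_pred (σ : GalQp p) : omega p σ ^ (p - 1) = 1 := by
  have h := DFunLike.congr_fun (omegaQp_pow_pred (p := p)) (unitQ p (cyclo p σ))
  rw [pow_apply, MonoidHom.one_apply] at h
  have h1 : omega p σ = omegaQp p (unitQ p (cyclo p σ)) := Units.ext (omegaQp_unitQ _).symm
  rw [h1, h]

lemma char_conj {G A : Type*} [Group G] [CommGroup A] (χ : G →* A) (g h : G) :
    χ (g * h * g⁻¹) = χ h := by
  rw [map_mul, map_mul, map_inv, mul_comm, inv_mul_cancel_left]

variable {red} {χ χ' : galQp2 p →* κˣ} {c : ℕ}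

lemma isOmega2Extension_iff : IsOmega2Extension red c χ ↔ IsSmoothChar χ ∧
    (∀ σ : galQp2 p, IsInertia red (σ : GalQp p) → χ σ = omega2Char red σ ^ c) ∧
    (∀ (σ : GalQp p) (hσ : σ ∉ galQp2 p), χ ⟨σ * σ, mul_mem_galQp2 hσ hσ⟩ = -omega p σ ^ c) ∧
    ∀ g ∉ galQp2 p, ∀ h : galQp2 p, χ h * χ (conjQp2 g h) = omega p h ^ c := by
  have h1 : (∀ σ : galQp2 p, IsInertia red (σ : GalQp p) →
      (χ σ : κ) = omega2 red (σ : GalQp p) ^ c) ↔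
      ∀ σ : galQp2 p, IsInertia red (σ : GalQp p) → χ σ = omega2Char red σ ^ c :=
    forall₂_congr fun σ _ => by
      rw [← Units.val_inj, val_pow_eq_pow_val]
      rfl
  have h2 : (∀ σ : GalQp p, LinearMap.det (indQp2 χ σ) = ((omega p σ ^ c : κˣ) : κ)) ↔
      (∀ (σ : GalQp p) (hσ : σ ∉ galQp2 p), χ ⟨σ * σ, mul_mem_galQp2 hσ hσ⟩ = -omega p σ ^ c) ∧
      ∀ g ∉ galQp2 p, ∀ h : galQp2 p, χ h * χ (conjQp2 g h) = omega p h ^ c := by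
    constructor
    · refine fun h => ⟨fun σ hσ => Units.ext ?_, fun g hg σ => Units.ext ?_⟩
      · rw [Units.val_neg, ← h, det_indQp2_of_notMem χ hσ, neg_neg]
      · rw [← h, det_indQp2_of_mem χ hg, val_mul]
    · rintro ⟨h, h'⟩ σ
      by_cases hσ : σ ∈ galQp2 p
      · obtain ⟨g, hg⟩ := exists_notMem_galQp2 red
        rw [← h' g hg ⟨σ, hσ⟩, val_mul]
        exact det_indQp2_of_mem χ hg ⟨σ, hσ⟩
      · rw [det_indQp2_of_notMem χ hσ, h σ hσ, Units.val_neg, neg_neg]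
  rw [IsOmega2Extension, h1, h2]

/-- The extension of `ω₂ ^ c` exists. -/
theorem exists_isOmega2Extension (hp2 : p ≠ 2) (red : Zpbar p →+* κ) (c : ℕ) :
    ∃ χ : galQp2 p →* κˣ, IsOmega2Extension red c χ := by
  obtain ⟨z, hz⟩ := IsAlgClosed.exists_pow_nat_eq ((-1 : κ) ^ (c + 1)) two_pos
  have hz0 : z ≠ 0 := by
    rintro rfl
    rw [zero_pow two_ne_zero] at hz
    exact pow_ne_zero (c + 1) (neg_ne_zero.2 one_ne_zero) hz.symm
  set a := Units.mk0 z hz0 with ha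
  have ha2 : a * a = (-1) ^ (c + 1) := Units.ext (by
    rw [val_mul, ha, Units.val_mk0, ← sq, hz]
    simp)
  have ha4 : a * a * (a * a) = 1 := by
    rw [ha2, ← mul_pow, neg_mul_neg, one_mul, one_pow]
  have hsq : ∀ σ : GalQp p, unramChar a σ * unramChar a σ = unramChar (a * a) σ := fun σ => by
    rw [unramChar_mul, MonoidHom.mul_apply]
  refine ⟨omega2Char red ^ c * (unramChar a).comp (galQp2 p).subtype, isOmega2Extension_iff.2
    ⟨((isSmoothChar_omega2Char red).pow c).mul
      ((isSmoothChar_unramChar a).comp continuous_subtype_val), fun σ hσ => ?_, fun σ hσ => ?_,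
      fun g hg h => ?_⟩⟩
  · change omega2Char red σ ^ c * unramChar a σ = _
    rw [unramChar_inertia a hσ, mul_one]
  · change omega2Char red _ ^ c * unramChar a (σ * σ) = _
    rw [omega2Char_mul_self red hp2 hσ, map_mul, hsq, unramChar_of_notMem ha4 hσ, ha2, neg_pow,
      mul_right_comm, ← pow_add, ← add_assoc, pow_succ, ← two_mul, pow_mul, neg_one_sq, one_pow,
      one_mul, neg_one_mul]
  · change omega2Char red h ^ c * unramChar a h * (omega2Char red _ ^ c * unramChar a (g * h * g⁻¹))
      = _
    rw [char_conj, omega2Char_conj red hg, mul_mul_mul_comm, hsq, unramChar_of_mem ha4 h.2, mul_one,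
      omega_of_mem red hp2, ← mul_pow, ← pow_succ']

/-- A smooth character of `Gal(ℚ̄_p/ℚ_{p²})` is determined by its values on inertia and on the
squares of elements which induce the Frobenius of `ℚ_{p²}`. -/
theorem galQp2_char_ext (hs : IsSmoothChar χ) (hs' : IsSmoothChar χ')
    (hi : ∀ σ : galQp2 p, IsInertia red (σ : GalQp p) → χ σ = χ' σ)
    (hq : ∀ (σ : GalQp p) (hσ : σ ∉ galQp2 p),
      χ ⟨σ * σ, mul_mem_galQp2 hσ hσ⟩ = χ' ⟨σ * σ, mul_mem_galQp2 hσ hσ⟩) : χ = χ' := by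
  set S : Subgroup (GalQp p) := (χ.eqLocus χ').map (galQp2 p).subtype with hS
  have hmem : ∀ h : galQp2 p, (h : GalQp p) ∈ S ↔ χ h = χ' h := fun h =>
    ⟨fun ⟨h', h1, h2⟩ => Subtype.ext h2 ▸ h1, fun h1 => ⟨h, h1, rfl⟩⟩
  have hSo : IsOpen (S : Set (GalQp p)) := by
    refine S.isOpen_of_mem_nhds (g := 1) ?_
    have h1 := (isSmoothChar_iff.1 hs).and (isSmoothChar_iff.1 hs')
    rw [nhds_subtype_eq_comap, Filter.eventually_comap] at h1
    filter_upwards [h1, isOpen_galQp2.mem_nhds (one_mem (galQp2 p))] with σ hσ hσ'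
    obtain ⟨h2, h3⟩ := hσ ⟨σ, hσ'⟩ rfl
    exact (hmem ⟨σ, hσ'⟩).2 (h2.trans h3.symm)
  have hC : IsClosed ((galQp2 p : Set (GalQp p)) \ S) :=
    (Subgroup.isClosed_of_isOpen _ isOpen_galQp2).sdiff hSo
  obtain ⟨n, hn, hCn⟩ : ∃ n : ℕ, n ≠ 0 ∧ ∀ h : galQp2 p, (h : GalQp p) ∈ fixRoots p n →
      χ h = χ' h := by
    by_contra! hcon
    obtain ⟨σ, hσ, hσ'⟩ := exists_isInertia red hC fun n hn => by
      obtain ⟨h, h1, h2⟩ := hcon n hn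
      exact ⟨h, ⟨h.2, fun h3 => h2 ((hmem h).1 h3)⟩, h1⟩
    exact hσ.2 ((hmem ⟨σ, hσ.1⟩).2 (hi ⟨σ, hσ.1⟩ hσ'))
  have h2n : 2 * n ≠ 0 := mul_ne_zero two_ne_zero hn
  obtain ⟨φ, hφ⟩ := exists_frobenius red h2n
  have hφH := notMem_galQp2_of_frobenius (dvd_mul_right 2 n) hφ
  have hφS : φ * φ ∈ S := (hmem ⟨φ * φ, mul_mem_galQp2 hφH hφH⟩).2 (hq φ hφH)
  have hφm : ∀ m : ℕ, ∀ ζ : PadicAlgCl p, ζ ^ (p ^ (2 * n) - 1) = 1 → (φ ^ m) ζ = ζ ^ p ^ m := by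
    intro m
    induction m with
    | zero => intro ζ _; rw [pow_zero, pow_zero, pow_one, AlgEquiv.one_apply]
    | succ m ih => intro ζ hζ; rw [pow_succ', AlgEquiv.mul_apply, ih ζ hζ, map_pow, hφ ζ hζ,
        ← pow_mul, ← pow_succ']
  ext1 h
  obtain ⟨m, hm⟩ := exists_frobenius_pow_galQp (h : GalQp p) h2n
  have hk : (φ ^ m)⁻¹ * h ∈ fixRoots p (2 * n) := fun ζ hζ => by
    rw [AlgEquiv.mul_apply, hm ζ hζ, ← hφm m ζ hζ]
    exact (φ ^ m).symm_apply_apply ζ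
  have hkH : (φ ^ m)⁻¹ * h ∈ galQp2 p := mem_galQp2_iff.2 (fixRoots_subset (dvd_mul_right 2 n) hk)
  have hkS : (φ ^ m)⁻¹ * h ∈ S :=
    (hmem ⟨_, hkH⟩).2 (hCn ⟨_, hkH⟩ (fixRoots_subset (dvd_mul_left n 2) hk))
  have hφmH : φ ^ m ∈ galQp2 p := by
    have := mul_mem h.2 (inv_mem hkH)
    rwa [mul_inv_rev, inv_inv, mul_inv_cancel_left] at this
  have hφmS : φ ^ m ∈ S := by
    rcases Nat.even_or_odd' m with ⟨j, rfl | rfl⟩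
    · rw [pow_mul, sq]
      exact pow_mem hφS j
    · rw [pow_succ, pow_mul, sq] at hφmH
      exact absurd ((Subgroup.mul_mem_cancel_left _ (pow_mem (mul_mem_galQp2 hφH hφH) j)).1 hφmH) hφH
  have := mul_mem hφmS hkS
  rw [mul_inv_cancel_left] at this
  exact (hmem h).1 this

lemma IsOmega2Extension.unique (h : IsOmega2Extension red c χ) (h' : IsOmega2Extension red c χ') :
    χ = χ' := by
  obtain ⟨hs, hi, hq, -⟩ := isOmega2Extension_iff.1 h
  obtain ⟨hs', hi', hq', -⟩ := isOmega2Extension_iff.1 h'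
  exact galQp2_char_ext hs hs' (fun σ hσ => by rw [hi σ hσ, hi' σ hσ]) fun σ hσ => by
    rw [hq σ hσ, hq' σ hσ]

lemma conjQp2_mul_self (g : GalQp p) {σ : GalQp p} (hσ : σ ∉ galQp2 p) :
    conjQp2 g ⟨σ * σ, mul_mem_galQp2 hσ hσ⟩ = ⟨g * σ * g⁻¹ * (g * σ * g⁻¹),
      mul_mem_galQp2 (conj_notMem_galQp2 g hσ) (conj_notMem_galQp2 g hσ)⟩ :=
  Subtype.ext (by
    change g * (σ * σ) * g⁻¹ = _
    group)

lemma IsOmega2Extension.conj_mul_self (h : IsOmega2Extension red c χ) (g : GalQp p) {σ : GalQp p}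
    (hσ : σ ∉ galQp2 p) :
    χ (conjQp2 g ⟨σ * σ, mul_mem_galQp2 hσ hσ⟩) = -omega p σ ^ c := by
  rw [conjQp2_mul_self g hσ, (isOmega2Extension_iff.1 h).2.2.1 _ (conj_notMem_galQp2 g hσ), char_conj]

/-- The conjugate of the extension of `ω₂ ^ (s + 1)` is, up to a power of `ω`, the extension of
`ω₂ ^ (r + 1)`, if `r + s = p - 1`. -/
lemma IsOmega2Extension.conj_eq (hp2 : p ≠ 2) {r s : ℕ} (hrs : r + s = p - 1)
    (h : IsOmega2Extension red (r + 1) χ) (h' : IsOmega2Extension red (s + 1) χ') {g : GalQp p}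
    (hg : g ∉ galQp2 p) (τ : galQp2 p) : χ' (conjQp2 g τ) * omega p τ ^ r = χ τ := by
  have hp := (Fact.out : p.Prime).two_le
  obtain ⟨hs, hi, hq, -⟩ := isOmega2Extension_iff.1 h
  obtain ⟨hs', hi', -, -⟩ := isOmega2Extension_iff.1 h'
  have homega : IsSmoothChar (omega p) := galChar_omegaQp (p := p) ▸
    isSmoothChar_galChar isSmoothChar_omegaQp
  suffices e : χ'.comp (conjQp2 g) * (omega p ^ r).comp (galQp2 p).subtype = χ from
    DFunLike.congr_fun e τ
  refine galQp2_char_ext (red := red) ((hs'.comp (continuous_conjQp2 g)).mul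
    ((homega.pow r).comp continuous_subtype_val)) hs (fun σ hσ => ?_) fun σ hσ => ?_
  · change χ' (conjQp2 g σ) * omega p σ ^ r = χ σ
    have h1 : p * (s + 1) + (p + 1) * r = (p ^ 2 - 1) + (r + 1) := by
      obtain ⟨q, rfl⟩ : ∃ q, p = q + 1 := ⟨p - 1, by omega⟩
      obtain rfl : q = r + s := by omega
      zify [Nat.one_le_pow 2 (r + s + 1) (by omega)]
      ring
    have h2 : omega2Char red σ ^ (p ^ 2 - 1) = 1 := Units.ext (by
      rw [val_pow_eq_pow_val]
      exact omega2_pow red σ)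
    rw [hi' _ (hσ.conj g), hi σ hσ, omega2Char_conj red hg, omega_of_mem red hp2, ← pow_mul,
      ← pow_mul, ← pow_add, h1, pow_add, h2, one_mul]
  · change χ' (conjQp2 g _) * omega p (σ * σ) ^ r = _
    rw [h'.conj_mul_self g hσ, hq σ hσ, map_mul, neg_mul, ← sq, ← pow_mul, ← pow_add,
      show s + 1 + 2 * r = (p - 1) + (r + 1) by omega, pow_add, omega_pow_pred, one_mul]

end FundamentalCharacter

section GaloisIsomorphisms

variable {red : Zpbar p →+* κ} {χ χ' : galQp2 p →* κˣ}

/-- The parameters `(r, η)` and `(s, η')` give isomorphic supersingular representations. -/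
def SupersingularRel (p : ℕ) [Fact p.Prime] (r : ℕ) (η : QpChar) (s : ℕ)
    (η' : QpChar) : Prop :=
  ∃ b : κˣ, b * b = 1 ∧ ((s = r ∧ η' = η * unrQp b) ∨
    (r + s = p - 1 ∧ η' = η * (omegaQp p ^ r * unrQp b)))

lemma eq_one_of_unramChar_notMem (red : Zpbar p →+* κ) {b : κˣ}
    (h : ∀ σ ∉ galQp2 p, unramChar b σ = 1) : b = 1 := by
  obtain ⟨φ, hφ⟩ := exists_frobenius red (mul_ne_zero two_ne_zero (orderOf_ne_zero b))
  have h1 := h φ (notMem_galQp2_of_frobenius (dvd_mul_right _ _) hφ)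
  rwa [unramChar_eq (m := 1) (dvd_mul_left _ _) fun ζ hζ => by rw [hφ ζ hζ, pow_one], pow_one,
    inv_eq_one] at h1

lemma conjQp2_of_mem {g : GalQp p} (hg : g ∈ galQp2 p) (h : galQp2 p) :
    χ (conjQp2 g h) = χ h := char_conj χ ⟨g, hg⟩ h

lemma galChar_twist (η : QpChar) (r : ℕ) (b : κˣ) (σ : GalQp p) :
    galChar (η * (omegaQp p ^ r * unrQp b)) σ = galChar η σ * (omega p σ ^ r * unramChar b σ) := by
  rw [galChar_mul, galChar_eq]
  rfl

lemma galChar_twist_unr (η : QpChar) (b : κˣ) (σ : GalQp p) :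
    galChar (η * unrQp b) σ = galChar η σ * unramChar b σ := by
  rw [galChar_mul, galChar_unrQp]
  rfl

lemma supersingular_weights {r s i j : ℕ} (hr : r ≤ p - 1) (hs : s ≤ p - 1)
    (h : s + 1 + (p + 1) * j ≡ r + 1 + (p + 1) * i [MOD p ^ 2 - 1]) :
    s = r ∧ j ≡ i [MOD p - 1] := by
  obtain ⟨q, rfl⟩ : ∃ q, p = q + 1 := ⟨p - 1, by have := (Fact.out : p.Prime).one_le; omega⟩
  have e : (q + 1) ^ 2 - 1 = (q + 1 + 1) * q := by
    zify [Nat.one_le_pow 2 (q + 1) (by omega)]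
    ring
  rw [e, Nat.modEq_iff_dvd] at h
  obtain ⟨k, hk⟩ := h
  push_cast at hk
  have h1 : (q + 2 : ℤ) ∣ (r : ℤ) - s := ⟨q * k - i + j, by linear_combination hk⟩
  have h2 := Int.eq_zero_of_abs_lt_dvd h1 (abs_lt.2 ⟨by omega, by omega⟩)
  refine ⟨by omega, ?_⟩
  rw [Nat.add_sub_cancel, Nat.modEq_iff_dvd]
  exact ⟨k, mul_left_cancel₀ (show (q + 2 : ℤ) ≠ 0 by omega) (by linear_combination hk - h2)⟩

lemma supersingular_weights_conj {r s i j : ℕ} (hr : r ≤ p - 1) (hs : s ≤ p - 1)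
    (h : p * (s + 1) + (p + 1) * j ≡ r + 1 + (p + 1) * i [MOD p ^ 2 - 1]) :
    r + s = p - 1 ∧ j ≡ i + r [MOD p - 1] := by
  obtain ⟨q, rfl⟩ : ∃ q, p = q + 1 := ⟨p - 1, by have := (Fact.out : p.Prime).one_le; omega⟩
  have h1 : q + 1 + 1 ∣ (r + s + 2) := by
    have e : (q + 1) ^ 2 - 1 = (q + 1 + 1) * q := by
      zify [Nat.one_le_pow 2 (q + 1) (by omega)]
      ring
    rw [e, Nat.modEq_iff_dvd] at h
    obtain ⟨k, hk⟩ := h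
    push_cast at hk
    zify
    exact ⟨q * k - i + j + s + 1, by linear_combination hk⟩
  have h2 : r + s = q := by
    obtain ⟨k, hk⟩ := h1
    rcases k with _ | _ | k
    · omega
    · omega
    · have h3 : (q + 1 + 1) * (k + 1 + 1) = (q + 1 + 1) * k + 2 * (q + 1 + 1) := by ring
      have h4 := Nat.zero_le ((q + 1 + 1) * k)
      omega
  refine ⟨h2, (supersingular_weights (i := i + r) (s := r) hr hr ?_).2⟩
  have h3 : (q + 1) * (s + 1) + (q + 1 + 1) * j + (q + 1 + 1) * r
      = (q + 1) ^ 2 - 1 + (r + 1 + (q + 1 + 1) * j) := by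
    subst h2
    zify [Nat.one_le_pow 2 (r + s + 1) (by omega)]
    ring
  have h4 := (h.add_right ((q + 1 + 1) * r)).symm
  rw [h3, add_assoc (r + 1), ← mul_add] at h4
  exact (h4.trans (Nat.add_modEq_left)).symm

theorem nonempty_equiv_iff_supersingularRel (hp2 : p ≠ 2) {r s : ℕ} (hr : r ≤ p - 1)
    (hs : s ≤ p - 1) {η η' : QpChar} (hη : IsSmoothChar η) (hη' : IsSmoothChar η')
    (h : IsOmega2Extension red (r + 1) χ) (h' : IsOmega2Extension red (s + 1) χ') :
    Nonempty ((twist (indQp2 χ) (galChar η)).Equiv (twist (indQp2 χ') (galChar η'))) ↔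
      SupersingularRel p r η s η' := by
  rw [nonempty_twist_indQp2_equiv_iff red]
  constructor
  · rintro ⟨g, hg⟩
    have hsq : ∀ σ ∉ galQp2 p, omega p σ ^ (s + 1) * (galChar η' σ * galChar η' σ)
        = omega p σ ^ (r + 1) * (galChar η σ * galChar η σ) := fun σ hσ => by
      have h1 := hg ⟨σ * σ, mul_mem_galQp2 hσ hσ⟩
      rw [h'.conj_mul_self g hσ, (isOmega2Extension_iff.1 h).2.2.1 σ hσ, neg_mul, neg_mul,
        neg_inj, map_mul, map_mul] at h1
      exact h1
    obtain ⟨i, hi⟩ := hη.exists_eq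
    obtain ⟨j, hj⟩ := hη'.exists_eq
    obtain ⟨σ, hσ, hprim, -, -⟩ := exists_inertia_generator hp2 red
    set x : galQp2 p := ⟨σ, hσ.mem_galQp2⟩ with hx
    have hord : orderOf (omega2Char red x) = p ^ 2 - 1 := by
      rw [← orderOf_units]
      exact hprim.eq_orderOf.symm
    have hgal : ∀ {i : ℕ} {a : κˣ},
        galChar (omegaQp p ^ i * unrQp a) x = omega2Char red x ^ ((p + 1) * i) := fun {i a} => by
      rw [galChar_eq, MonoidHom.mul_apply, unramChar_inertia a hσ, mul_one, pow_apply,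
        omega_of_mem red hp2, ← pow_mul]
    have h1 := hg x
    rw [hi, hj, hgal, hgal, (isOmega2Extension_iff.1 h).2.1 x hσ,
      (isOmega2Extension_iff.1 h').2.1 _ (hσ.conj g), ← pow_add] at h1
    refine ⟨η' (pUnit p) * (η (pUnit p))⁻¹, ?_⟩
    set b := η' (pUnit p) * (η (pUnit p))⁻¹ with hb
    have hbp : ∀ k, omegaQp p ^ (i + k) = omegaQp p ^ j → η' = η * (omegaQp p ^ k * unrQp b) :=
      fun k hk => char_ext (by
        simp [omegaQp_pUnit, hb]) fun u => by
        rw [hi, hj, ← hk]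
        simp [pow_add]
    have hbb : ∀ k, η' = η * (omegaQp p ^ k * unrQp b) →
        (∀ σ, omega p σ ^ (s + 1 + 2 * k) = omega p σ ^ (r + 1)) → b * b = 1 := by
      intro k hk hk'
      refine eq_one_of_unramChar_notMem red fun τ hτ => ?_
      have h2 := hsq τ hτ
      rw [hk, galChar_twist, ← hk' τ] at h2
      rw [unramChar_mul, MonoidHom.mul_apply]
      refine mul_left_cancel (a := omega p τ ^ (s + 1 + 2 * k) * (galChar η τ * galChar η τ)) ?_
      rw [mul_one]
      refine Eq.trans ?_ h2
      rw [pow_add _ (s + 1), two_mul, pow_add _ k k, mul_mul_mul_comm (galChar η τ),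
        mul_mul_mul_comm (omega p τ ^ k), mul_right_comm (omega p τ ^ (s + 1)), mul_assoc, mul_assoc]
    by_cases hgH : g ∈ galQp2 p
    · have e : omega2Char red (conjQp2 g x) = omega2Char red x := conjQp2_of_mem hgH x
      rw [e, ← pow_add, pow_eq_pow_iff_modEq, hord] at h1
      obtain ⟨rfl, h3⟩ := supersingular_weights hr hs h1
      have h4 := hbp 0 (omegaQp_pow_congr h3.symm)
      refine ⟨hbb 0 h4 fun _ => rfl, Or.inl ⟨rfl, ?_⟩⟩
      rw [h4]
      refine MonoidHom.ext fun x => ?_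
      change η x * (omegaQp p x ^ 0 * unrQp b x) = η x * unrQp b x
      rw [pow_zero, one_mul]
    · rw [omega2Char_conj red hgH, ← pow_mul, ← pow_add, pow_eq_pow_iff_modEq, hord] at h1
      obtain ⟨h2, h3⟩ := supersingular_weights_conj hr hs h1
      have h4 := hbp r (omegaQp_pow_congr h3.symm)
      refine ⟨hbb r h4 fun τ => ?_, Or.inr ⟨h2, h4⟩⟩
      rw [show s + 1 + 2 * r = (p - 1) + (r + 1) by omega, pow_add, omega_pow_pred, one_mul]
  · rintro ⟨b, hb, ⟨rfl, rfl⟩ | ⟨hrs, rfl⟩⟩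
    · refine ⟨1, fun τ => ?_⟩
      rw [conjQp2_of_mem (one_mem _), h.unique h', galChar_twist_unr, unramChar_of_mem hb τ.2,
        mul_one]
    · obtain ⟨g, hg⟩ := exists_notMem_galQp2 red
      refine ⟨g, fun τ => ?_⟩
      rw [galChar_twist, unramChar_of_mem hb τ.2, mul_one, mul_left_comm, h.conj_eq hp2 hrs h' hg,
        mul_comm]

lemma reducibleGal_apply (r : ℕ) (a : κˣ) (η : QpChar) (σ : GalQp p)
    (v : κ × κ) : reducibleGal r a η σ v =
      ((galChar (omegaQp p ^ (r + 1) * unrQp a * η) σ : κ) * v.1,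
        (galChar (unrQp a⁻¹ * η) σ : κ) * v.2) := by
  rw [galChar_mul, galChar_eq, galChar_mul, galChar_unrQp]
  refine Prod.ext ?_ ?_
  · change (galChar η σ : κ) * ((unramChar a σ * omega p σ ^ (r + 1) : κˣ) * v.1)
      = (omega p σ ^ (r + 1) * unramChar a σ * galChar η σ : κˣ) * v.1
    push_cast
    ring
  · change (galChar η σ : κ) * (unramChar a⁻¹ σ * v.2)
      = (unramChar a⁻¹ σ * galChar η σ : κˣ) * v.2
    push_cast
    ring

/-- An induced representation contains no line stable under the Galois group. -/
lemma not_exists_line_twist_indQp2 (hp2 : p ≠ 2) {r : ℕ} (hr : r ≤ p - 1)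
    (h : IsOmega2Extension red (r + 1) χ) {ψ A : GalQp p →* κˣ}
    {f : Representation.coindV (galQp2 p).subtype (charRep χ)}
    (hf : ∀ σ, twist (indQp2 χ) ψ σ f = (A σ : κ) • f) : f = 0 := by
  by_contra hf0
  obtain ⟨g, hg⟩ := Function.ne_iff.1 (fun h0 : f.1 = 0 => hf0 (Subtype.ext h0))
  have h1 : ∀ τ : galQp2 p, ψ τ * χ (conjQp2 g τ) = A τ := fun τ => by
    have h2 : (ψ τ : κ) * f.1 (g * τ) = A τ * f.1 g :=
      congrFun (congrArg Subtype.val (hf τ)) g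
    rw [indQp2_conj, ← mul_assoc, ← val_mul] at h2
    exact Units.ext (mul_right_cancel₀ hg h2)
  have h2 : ∀ τ : galQp2 p, χ τ = A τ * (ψ τ)⁻¹ := fun τ => by
    have h3 := h1 (conjQp2 g⁻¹ τ)
    have h4 : conjQp2 g (conjQp2 g⁻¹ τ) = τ := Subtype.ext (by
      change g * (g⁻¹ * τ * g⁻¹⁻¹) * g⁻¹ = τ
      group)
    have h5 : ∀ B : GalQp p →* κˣ, B (conjQp2 g⁻¹ τ : galQp2 p) = B τ :=
      fun B => char_conj B g⁻¹ τ
    rw [h4, h5, h5] at h3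
    rw [← h3, mul_comm (ψ _), mul_inv_cancel_right]
  obtain ⟨σ, hσ, hprim, -, -⟩ := exists_inertia_generator hp2 red
  obtain ⟨φ, hφ⟩ := exists_notMem_galQp2 red
  set x : galQp2 p := ⟨σ, hσ.mem_galQp2⟩ with hx
  have h3 : χ (conjQp2 φ x) = χ x := by
    have h5 : ∀ B : GalQp p →* κˣ, B (conjQp2 φ x : galQp2 p) = B x :=
      fun B => char_conj B φ x
    rw [h2, h2, h5, h5]
  obtain ⟨-, hi, -, -⟩ := isOmega2Extension_iff.1 h
  have hord : orderOf (omega2Char red x) = p ^ 2 - 1 := by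
    rw [← orderOf_units]
    exact hprim.eq_orderOf.symm
  rw [hi x hσ, hi _ (hσ.conj φ), omega2Char_conj red hφ, ← pow_mul, pow_eq_pow_iff_modEq, hord] at h3
  have h4 := (supersingular_weights_conj (i := 0) (j := 0) hr hr (by simpa using h3))
  have h5 : 0 ≡ 0 + r [MOD p - 1] := h4.2
  have h6 := (Nat.modEq_zero_iff_dvd).1 ((zero_add r) ▸ h5.symm)
  have hp := (Fact.out : p.Prime).two_le
  have := Nat.le_of_dvd (by omega) h6
  omega

lemma not_nonempty_twist_indQp2_equiv_reducibleGal (hp2 : p ≠ 2) {r : ℕ} (hr : r ≤ p - 1)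
    (h : IsOmega2Extension red (r + 1) χ) {ψ : GalQp p →* κˣ} {s : ℕ} {a : κˣ}
    {η : QpChar} :
    ¬ Nonempty ((reducibleGal s a η).Equiv (twist (indQp2 χ) ψ)) := by
  rintro ⟨e⟩
  have h1 := not_exists_line_twist_indQp2 hp2 hr h (ψ := ψ) (f := e (1, 0))
    (A := galChar (omegaQp p ^ (s + 1) * unrQp a * η)) fun σ => by
      rw [← map_smul, ← e.coe_toIntertwiningMap, ← Representation.IntertwiningMap.isIntertwining,
        reducibleGal_apply, mul_zero]
      congr 1
      exact Prod.ext rfl (mul_zero _).symm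
  have h2 := EquivLike.injective e (h1.trans (map_zero e).symm)
  exact one_ne_zero (congrArg Prod.fst h2)

lemma reducibleGal_char_mem (hp2 : p ≠ 2) (red : Zpbar p →+* κ) {r s : ℕ} {a b : κˣ}
    {η η' : QpChar} (hη : IsSmoothChar η) (hη' : IsSmoothChar η')
    (e : (reducibleGal r a η).Equiv (reducibleGal s b η')) :
    (omegaQp p ^ (r + 1) * unrQp a * η = omegaQp p ^ (s + 1) * unrQp b * η' ∨
      omegaQp p ^ (r + 1) * unrQp a * η = unrQp b⁻¹ * η') ∧
    (unrQp a⁻¹ * η = omegaQp p ^ (s + 1) * unrQp b * η' ∨ unrQp a⁻¹ * η = unrQp b⁻¹ * η') := by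
  have key : ∀ (v : κ × κ) (A : QpChar), IsSmoothChar A → v ≠ 0 →
      (∀ σ, reducibleGal r a η σ v = (galChar A σ : κ) • v) →
      A = omegaQp p ^ (s + 1) * unrQp b * η' ∨ A = unrQp b⁻¹ * η' := by
    intro v A hA hv h
    have h1 : ∀ σ, reducibleGal s b η' σ (e v) = (galChar A σ : κ) • e v := fun σ => by
      rw [← map_smul, ← h, ← e.coe_toIntertwiningMap, Representation.IntertwiningMap.isIntertwining]
    have h2 : e v ≠ 0 := fun h0 => hv (EquivLike.injective e (h0.trans (map_zero e).symm))
    by_cases h3 : (e v).1 = 0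
    · right
      have h4 : (e v).2 ≠ 0 := fun h4 => h2 (Prod.ext h3 h4)
      refine galChar_injective hp2 red hA ((isSmoothChar_unrQp _).mul hη') (MonoidHom.ext fun σ =>
        Units.ext (mul_right_cancel₀ h4 ?_))
      have h5 := h1 σ
      rw [reducibleGal_apply] at h5
      exact (congrArg Prod.snd h5).symm
    · left
      refine galChar_injective hp2 red hA (((isSmoothChar_omegaQp.pow _).mul
        (isSmoothChar_unrQp _)).mul hη') (MonoidHom.ext fun σ => Units.ext (mul_right_cancel₀ h3 ?_))
      have h5 := h1 σ
      rw [reducibleGal_apply] at h5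
      exact (congrArg Prod.fst h5).symm
  constructor
  · refine key (1, 0) _ (((isSmoothChar_omegaQp.pow _).mul (isSmoothChar_unrQp _)).mul hη)
      (fun h => one_ne_zero (congrArg Prod.fst h)) fun σ => ?_
    rw [reducibleGal_apply]
    exact Prod.ext rfl ((mul_zero _).trans (mul_zero _).symm)
  · refine key (0, 1) _ ((isSmoothChar_unrQp _).mul hη)
      (fun h => one_ne_zero (congrArg Prod.snd h)) fun σ => ?_
    rw [reducibleGal_apply]
    exact Prod.ext ((mul_zero _).trans (mul_zero _).symm) rfl

/-- The unordered pairs of characters of `ℚ_pˣ` attached to `(r, a, η)` and `(s, b, η')` coincide. -/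
def ReducibleRel (p : ℕ) [Fact p.Prime] (r : ℕ) (a : κˣ) (η : QpChar) (s : ℕ)
    (b : κˣ) (η' : QpChar) : Prop :=
  (omegaQp p ^ (r + 1) * unrQp a * η = omegaQp p ^ (s + 1) * unrQp b * η' ∧
    unrQp a⁻¹ * η = unrQp b⁻¹ * η') ∨
  (omegaQp p ^ (r + 1) * unrQp a * η = unrQp b⁻¹ * η' ∧
    unrQp a⁻¹ * η = omegaQp p ^ (s + 1) * unrQp b * η')

lemma pair_eq_of_mem {α : Type*} {x y x' y' : α} (h : (x = x' ∨ x = y') ∧ (y = x' ∨ y = y'))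
    (h' : (x' = x ∨ x' = y) ∧ (y' = x ∨ y' = y)) : (x = x' ∧ y = y') ∨ (x = y' ∧ y = x') := by
  grind

theorem nonempty_equiv_iff_reducibleRel (hp2 : p ≠ 2) (red : Zpbar p →+* κ) {r s : ℕ}
    {a b : κˣ} {η η' : QpChar} (hη : IsSmoothChar η)
    (hη' : IsSmoothChar η') :
    Nonempty ((reducibleGal r a η).Equiv (reducibleGal s b η')) ↔ ReducibleRel p r a η s b η' := by
  constructor
  · rintro ⟨e⟩
    exact pair_eq_of_mem (reducibleGal_char_mem hp2 red hη hη' e)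
      (reducibleGal_char_mem hp2 red hη' hη e.symm)
  · rintro (⟨h1, h2⟩ | ⟨h1, h2⟩)
    · have : reducibleGal r a η = reducibleGal s b η' := by
        refine MonoidHom.ext fun σ => LinearMap.ext fun v => ?_
        rw [reducibleGal_apply, reducibleGal_apply, h1, h2]
      rw [this]
      exact ⟨Representation.Equiv.refl _⟩
    · refine ⟨Representation.Equiv.mk (LinearEquiv.prodComm _ _ _) fun σ => LinearMap.ext fun v => ?_⟩
      change (reducibleGal r a η σ v).swap = reducibleGal s b η' σ v.swap
      rw [reducibleGal_apply, reducibleGal_apply, h1, h2]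
      rfl

lemma isSmoothRep_reducibleGal (r : ℕ) (a : κˣ) {η : QpChar}
    (hη : IsSmoothChar η) : IsSmoothRep (reducibleGal r a η) := by
  have homega : IsSmoothChar (omega p) := galChar_omegaQp (p := p) ▸
    isSmoothChar_galChar isSmoothChar_omegaQp
  exact IsSmoothRep.twist (((isSmoothChar_unramChar a).mul (homega.pow _)).isSmoothRep.prod
    (isSmoothChar_unramChar a⁻¹).isSmoothRep) (isSmoothChar_galChar hη)

end GaloisIsomorphisms

section Supersingular

theorem nonempty_iwahoriPi_equiv_iff (hp : 2 < p) {r s : ℕ} (hr : r ≤ p - 1) (hs : s ≤ p - 1)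
    (η η' : QpChar) :
    Nonempty ((iwahoriPi p r 0 η).Equiv (iwahoriPi p s 0 η')) ↔ SupersingularRel p r η s η' := by
  constructor
  · intro h
    have hu := isUniversal_iwahoriQuot (p := p) r 0
    have hu' := isUniversal_iwahoriQuot (p := p) s 0
    set χ := η * η'⁻¹ with hχ
    have h1 := equiv_twist h (η'⁻¹.comp det)
    rw [iwahoriPi_eq_twist, iwahoriPi_eq_twist, twist_twist, twist_twist] at h1
    have e1 : η.comp (det (n := Fin 2)) *
        η'⁻¹.comp det = χ.comp det := rfl
    have e2 : η'.comp (det (n := Fin 2)) *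
        η'⁻¹.comp det = 1 := by
      ext1 g
      exact mul_inv_cancel _
    rw [e1, e2, twist_one] at h1
    obtain ⟨e⟩ := equiv_symm h1
    have hx0 : e.toIntertwiningMap (Submodule.Quotient.mk (elem (dRep p s) (matBeta p) 1)) ≠ 0 :=
      fun h0 => hu'.ne_zero hs (EquivLike.injective e (h0.trans (map_zero e).symm))
    obtain ⟨hχp, hcases⟩ := hu.rigidity hr hp hs hx0 (hu'.heckeVec.map e.toIntertwiningMap)
    have hη' : ∀ x, η' x = η x * (χ x)⁻¹ := fun x => by
      rw [hχ, MonoidHom.mul_apply, inv_apply, mul_inv, inv_inv, mul_inv_cancel_left]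
    clear_value χ
    have hχp' : (χ (pUnit p))⁻¹ = χ (pUnit p) := inv_eq_of_mul_eq_one_left hχp
    have hunr : (∀ u, χ (unitQ p u) = 1) → η' = η * unrQp (χ (pUnit p)) := fun h2 =>
      char_ext (by rw [hη', hχp', MonoidHom.mul_apply, unrQp_pUnit]) fun u => by
        rw [hη', h2, inv_one, MonoidHom.mul_apply, unrQp_unitQ]
    have hram : (∀ u, (χ (unitQ p u) : κ) * toFpbar p u ^ r = 1) →
        η' = η * (omegaQp p ^ r * unrQp (χ (pUnit p))) := fun h2 =>
      char_ext (by
        rw [hη', hχp', MonoidHom.mul_apply, MonoidHom.mul_apply, pow_apply, omegaQp_pUnit,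
          one_pow, one_mul, unrQp_pUnit]) fun u => by
        rw [hη', MonoidHom.mul_apply, MonoidHom.mul_apply, pow_apply, unrQp_unitQ, mul_one]
        congr 1
        refine inv_eq_of_mul_eq_one_right (Units.ext ?_)
        rw [val_mul, val_pow_eq_pow_val, omegaQp_unitQ, h2, val_one]
    have hpow : ∀ u : ℤ_[p]ˣ, toFpbar p u ^ (p - 1) = 1 := fun u => by
      rw [← omegaQp_unitQ, ← val_pow_eq_pow_val, ← pow_apply, omegaQp_pow_pred,
        MonoidHom.one_apply, val_one]
    refine ⟨χ (pUnit p), hχp, ?_⟩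
    rcases hcases with hA | hB
    · have h2 := modEq_of_toFpbar_pow fun u => (hA u).2
      have hone := fun u => (hA u).1
      by_cases hsr : s = r
      · exact Or.inl ⟨hsr, hunr hone⟩
      · have h3 : r + s = p - 1 ∧ (r = 0 ∨ r = p - 1) := by
          rcases Nat.lt_or_ge s (p - 1) with h4 | h4 <;> rcases Nat.lt_or_ge r (p - 1) with h5 | h5
          · exact absurd (Nat.ModEq.eq_of_lt_of_lt h2 h4 h5) hsr
          · obtain rfl : r = p - 1 := le_antisymm hr h5
            have : s = 0 := Nat.ModEq.eq_of_lt_of_lt (h2.trans (by simp [Nat.ModEq])) h4 (by omega)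
            omega
          · obtain rfl : s = p - 1 := le_antisymm hs h4
            have : r = 0 :=
              Nat.ModEq.eq_of_lt_of_lt (h2.symm.trans (by simp [Nat.ModEq])) h5 (by omega)
            omega
          · omega
        refine Or.inr ⟨h3.1, hram fun u => ?_⟩
        rw [hone, val_one, one_mul]
        rcases h3.2 with h4 | h4
        · rw [h4, pow_zero]
        · rw [h4, hpow]
    · have h2 : s + r ≡ 0 [MOD p - 1] := modEq_of_toFpbar_pow fun u => by
        rw [pow_add, (hB u).2, pow_zero]
      obtain ⟨k, hk⟩ := (Nat.modEq_zero_iff_dvd).1 h2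
      rcases k with _ | _ | k
      · refine Or.inl ⟨by omega, hunr fun u => Units.ext ?_⟩
        rw [(hB u).1, show s = 0 by omega, pow_zero, val_one]
      · refine Or.inr ⟨by omega, hram fun u => ?_⟩
        rw [(hB u).1, (hB u).2]
      · have h3 : (p - 1) * (k + 1 + 1) = (p - 1) * k + 2 * (p - 1) := by ring
        have h4 := Nat.zero_le ((p - 1) * k)
        refine Or.inl ⟨by omega, hunr fun u => Units.ext ?_⟩
        rw [(hB u).1, show s = p - 1 by omega, hpow, val_one]
  · rintro ⟨b, hb, ⟨rfl, rfl⟩ | ⟨hrs, rfl⟩⟩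
    · have h := nonempty_iwahoriPi_equiv_unramified s 0 η (unrQp b) (unrQp_unitQ b)
        (by rwa [unrQp_pUnit])
      rwa [mul_zero] at h
    · obtain rfl : s = p - 1 - r := by omega
      refine nonempty_iwahoriPi_equiv_swap hr η _ (fun u => ?_) ?_
      · rw [MonoidHom.mul_apply, unrQp_unitQ, mul_one, pow_apply,
          val_pow_eq_pow_val, omegaQp_unitQ]
      · rwa [MonoidHom.mul_apply, unrQp_pUnit, pow_apply, omegaQp_pUnit, one_pow, one_mul]

lemma not_hasDataMod_iwahoriPi (hp : 2 < p) {r : ℕ} (hr : r ≤ p - 1)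
    {η χ₁ χ₂ : QpChar} {x} (hx : x ≠ 0) :
    ¬ HasDataMod (iwahoriPi p r 0 η) ⊥ x χ₁ χ₂ := by
  intro h
  have h1 := h.twist η⁻¹
  rw [iwahoriPi_eq_twist, twist_twist] at h1
  have e : η.comp (det (n := Fin 2)) *
      η⁻¹.comp det = 1 := by
    ext1 g
    exact mul_inv_cancel _
  rw [e, twist_one] at h1
  exact (isUniversal_iwahoriQuot (p := p) r 0).not_hasDataMod hr hp hx h1

end Supersingular

lemma bracket_le {p : ℕ} (hp : 2 < p) (z : ℤ) : bracket p z ≤ p - 1 := by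
  have h : z % ((p : ℤ) - 1) < (p : ℤ) - 1 := Int.emod_lt_of_pos _ (by omega)
  rw [bracket]
  omega

section Reducible

variable {S S' T T' W W' : Type} [AddCommGroup S] [Module κ S]
  [AddCommGroup S'] [Module κ S'] [AddCommGroup T] [Module κ T]
  [AddCommGroup T'] [Module κ T'] [AddCommGroup W] [Module κ W]
  [AddCommGroup W'] [Module κ W']
  {τ : GL2Rep S} {τ' : GL2Rep S'}
  {υ : GL2Rep T} {υ' : GL2Rep T'}
  {ρ : GL2Rep W} {ρ' : GL2Rep W'}

lemma nonempty_prod_equiv_prod (h : Nonempty (τ.Equiv υ)) (h' : Nonempty (τ'.Equiv υ')) :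
    Nonempty ((τ.prod τ').Equiv (υ.prod υ')) := by
  obtain ⟨e⟩ := h
  obtain ⟨e'⟩ := h'
  refine ⟨Representation.Equiv.mk (LinearEquiv.prodCongr e.toLinearEquiv e'.toLinearEquiv) fun g =>
    LinearMap.ext fun v => Prod.ext ?_ ?_⟩
  · exact Representation.IntertwiningMap.isIntertwining _ _ e.toIntertwiningMap g v.1
  · exact Representation.IntertwiningMap.isIntertwining _ _ e'.toIntertwiningMap g v.2

lemma nonempty_prod_equiv_comm : Nonempty ((τ.prod τ').Equiv (τ'.prod τ)) :=
  ⟨Representation.Equiv.mk (LinearEquiv.prodComm _ _ _) fun _ => rfl⟩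

/-- The inclusion of the first factor. -/
def prodInl (τ : GL2Rep S) (τ' : GL2Rep S') :
    τ.IntertwiningMap (τ.prod τ') where
  toLinearMap := LinearMap.inl _ _ _
  isIntertwining' g := LinearMap.ext fun _ => Prod.ext rfl (map_zero (τ' g)).symm

/-- The inclusion of the second factor. -/
def prodInr (τ : GL2Rep S) (τ' : GL2Rep S') :
    τ'.IntertwiningMap (τ.prod τ') where
  toLinearMap := LinearMap.inr _ _ _
  isIntertwining' g := LinearMap.ext fun _ => Prod.ext (map_zero (τ g)).symm rfl

variable {f : W} {f' : W'} {χ₁ χ₂ χ₁' χ₂' χ χ' : QpChar}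

lemma HasDataMod.eq_or_eq (hs : IsSemisimplification ρ τ) (h : IsOrdinary ρ f χ₁ χ₂)
    (hs' : IsSemisimplification ρ' τ') (h' : IsOrdinary ρ' f' χ₁' χ₂') {x : S × S'} (hx : x ≠ 0)
    (hd : HasDataMod (τ.prod τ') ⊥ x χ χ') : χ = χ₁ ∨ χ = χ₁' := by
  by_cases h1 : x.1 = 0
  · exact Or.inr (hs'.data_unique h' (fun h2 => hx (Prod.ext h1 h2))
      (hd.map ⟨LinearMap.snd _ _ _, fun _ => rfl⟩)).1
  · exact Or.inl (hs.data_unique h h1 (hd.map ⟨LinearMap.fst _ _ _, fun _ => rfl⟩)).1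

/-- The representation `Π` is isomorphic to
`π(r, a, η)^ss ⊕ π([p-3-r], a⁻¹, η ω^{r+1})^ss`. -/
def IsReduciblePi (r : ℕ) (a : κˣ) (η : QpChar)
    (ρ : GL2Rep W) : Prop :=
  ∃ (S S' : Type) (_ : AddCommGroup S) (_ : Module κ S) (_ : AddCommGroup S')
    (_ : Module κ S') (τ : GL2Rep S)
    (τ' : GL2Rep S'),
    IsSemisimplification (iwahoriPi p r a η) τ ∧
    IsSemisimplification
      (iwahoriPi p (bracket p (p - 3 - r)) (a⁻¹ : κˣ) (η * omegaQp p ^ (r + 1))) τ' ∧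
    Nonempty (ρ.Equiv (τ.prod τ'))

variable {r s : ℕ} {a b : κˣ} {η η' : QpChar}

lemma omegaQp_pow_bracket (hp : 2 < p) (r : ℕ) (x : ℚ_[p]ˣ) :
    omegaQp p x ^ bracket p (p - 3 - r) * omegaQp p x ^ (r + 1) = (omegaQp p x)⁻¹ := by
  refine eq_inv_of_mul_eq_one_left ?_
  have h1 : ((bracket p (p - 3 - r) : ℕ) : ℤ) = ((p : ℤ) - 3 - r) % ((p : ℤ) - 1) :=
    Int.toNat_of_nonneg (Int.emod_nonneg _ (by omega))
  have h2 : p - 1 ∣ bracket p (p - 3 - r) + (r + 1) + 1 := by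
    zify [show 1 ≤ p by omega]
    rw [h1]
    have h3 := Int.emod_add_mul_ediv ((p : ℤ) - 3 - r) ((p : ℤ) - 1)
    exact ⟨1 - ((p : ℤ) - 3 - r) / ((p : ℤ) - 1), by linear_combination h3⟩
  obtain ⟨k, hk⟩ := h2
  have h4 := DFunLike.congr_fun (omegaQp_pow_pred (p := p)) x
  rw [pow_apply, MonoidHom.one_apply] at h4
  rw [← pow_add, ← pow_succ, hk, pow_mul, h4, one_pow]

lemma fst_snd_data : omegaQp p ^ r * unrQp a * η
    = omegaQp p ^ (r + 1) * unrQp a * η * (omegaQp p)⁻¹ := by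
  refine MonoidHom.ext fun x => ?_
  change omegaQp p x ^ r * unrQp a x * η x
    = omegaQp p x ^ (r + 1) * unrQp a x * η x * (omegaQp p x)⁻¹
  rw [pow_succ, mul_right_comm _ (omegaQp p x), mul_right_comm _ (omegaQp p x),
    mul_inv_cancel_right]

lemma snd_fst_data : unrQp a⁻¹⁻¹ * (η * omegaQp p ^ (r + 1))
    = omegaQp p ^ (r + 1) * unrQp a * η := by
  rw [inv_inv]
  refine MonoidHom.ext fun x => ?_
  change unrQp a x * (η x * omegaQp p x ^ (r + 1)) = omegaQp p x ^ (r + 1) * unrQp a x * η x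
  rw [← mul_assoc, mul_comm, mul_assoc]

lemma snd_snd_data (hp : 2 < p) :
    omegaQp p ^ bracket p (p - 3 - r) * unrQp a⁻¹ * (η * omegaQp p ^ (r + 1))
      = unrQp a⁻¹ * η * (omegaQp p)⁻¹ := by
  refine MonoidHom.ext fun x => ?_
  change omegaQp p x ^ bracket p (p - 3 - r) * unrQp a⁻¹ x * (η x * omegaQp p x ^ (r + 1))
    = unrQp a⁻¹ x * η x * (omegaQp p x)⁻¹
  rw [← omegaQp_pow_bracket hp r, mul_comm (η x), mul_mul_mul_comm, mul_comm]

lemma exists_isSemisimplification_iwahoriPi (hp : 2 < p) (hr : r ≤ p - 1) (a : κˣ)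
    (η : QpChar) : ∃ (S : Type) (_ : AddCommGroup S) (_ : Module κ S)
      (τ : GL2Rep S),
      IsSemisimplification (iwahoriPi p r (a : κ) η) τ := by
  obtain ⟨_, h⟩ := exists_isOrdinary_iwahoriPi hp hr a η
  exact h.exists_isSemisimplification

theorem IsReduciblePi.nonempty_equiv_iff (hp : 2 < p) (hr : r ≤ p - 1) (hs : s ≤ p - 1)
    (h : IsReduciblePi r a η ρ) (h' : IsReduciblePi s b η' ρ') :
    Nonempty (ρ.Equiv ρ') ↔ ReducibleRel p r a η s b η' := by
  obtain ⟨S, S', _, _, _, _, τ, τ', h1, h2, e⟩ := h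
  obtain ⟨T, T', _, _, _, _, υ, υ', h1', h2', e'⟩ := h'
  have hb := bracket_le hp ((p : ℤ) - 3 - r)
  have hb' := bracket_le hp ((p : ℤ) - 3 - s)
  constructor
  · intro h
    have key := equiv_trans (equiv_trans (equiv_symm e) h) e'
    obtain ⟨f₁, o₁⟩ := exists_isOrdinary_iwahoriPi hp hr a η
    obtain ⟨f₂, o₂⟩ := exists_isOrdinary_iwahoriPi hp hb a⁻¹ (η * omegaQp p ^ (r + 1))
    obtain ⟨f₁', o₁'⟩ := exists_isOrdinary_iwahoriPi hp hs b η'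
    obtain ⟨f₂', o₂'⟩ := exists_isOrdinary_iwahoriPi hp hb' b⁻¹ (η' * omegaQp p ^ (s + 1))
    rw [snd_fst_data] at o₂ o₂'
    have hmem : ∀ {S S' T T' : Type} [AddCommGroup S] [Module κ S] [AddCommGroup S']
        [Module κ S'] [AddCommGroup T] [Module κ T] [AddCommGroup T']
        [Module κ T'] {τ : GL2Rep S}
        {τ' : GL2Rep S'} {υ : GL2Rep T}
        {υ' : GL2Rep T'}
        (e : (τ.prod τ').Equiv (υ.prod υ')) {x : S × S'} (_ : x ≠ 0) {χ χ'}
        (_ : HasDataMod (τ.prod τ') ⊥ x χ χ'), e x ≠ 0 ∧ HasDataMod (υ.prod υ') ⊥ (e x) χ χ' :=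
      fun e _ hx _ _ hd => ⟨fun h0 => hx (EquivLike.injective e (h0.trans (map_zero e).symm)),
        hd.map e.toIntertwiningMap⟩
    have hl : ∀ {S S' : Type} [AddCommGroup S] [Module κ S] [AddCommGroup S']
        [Module κ S'] {τ : GL2Rep S}
        (τ' : GL2Rep S') {χ χ'},
        (∃ x, x ≠ 0 ∧ HasDataMod τ ⊥ x χ χ') → ∃ x, x ≠ 0 ∧ HasDataMod (τ.prod τ') ⊥ x χ χ' :=
      fun τ' _ _ ⟨x, hx, hd⟩ =>
        ⟨(x, 0), fun h0 => hx (congrArg Prod.fst h0), hd.map (prodInl _ τ')⟩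
    have hr' : ∀ {S S' : Type} [AddCommGroup S] [Module κ S] [AddCommGroup S']
        [Module κ S'] (τ : GL2Rep S)
        {τ' : GL2Rep S'} {χ χ'},
        (∃ x, x ≠ 0 ∧ HasDataMod τ' ⊥ x χ χ') → ∃ x, x ≠ 0 ∧ HasDataMod (τ.prod τ') ⊥ x χ χ' :=
      fun τ _ _ _ ⟨x, hx, hd⟩ =>
        ⟨(0, x), fun h0 => hx (congrArg Prod.snd h0), hd.map (prodInr τ _)⟩
    obtain ⟨k⟩ := key
    obtain ⟨x₁, hx₁, hd₁⟩ := hl τ' (h1.exists_hasDataMod o₁)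
    obtain ⟨x₂, hx₂, hd₂⟩ := hr' τ (h2.exists_hasDataMod o₂)
    obtain ⟨y₁, hy₁, hc₁⟩ := hl υ' (h1'.exists_hasDataMod o₁')
    obtain ⟨y₂, hy₂, hc₂⟩ := hr' υ (h2'.exists_hasDataMod o₂')
    have q₁ := hmem k hx₁ hd₁
    have q₂ := hmem k hx₂ hd₂
    have q₁' := hmem k.symm hy₁ hc₁
    have q₂' := hmem k.symm hy₂ hc₂
    exact pair_eq_of_mem ⟨(q₂.2.eq_or_eq h1' o₁' h2' o₂' q₂.1).symm,
      (q₁.2.eq_or_eq h1' o₁' h2' o₂' q₁.1).symm⟩ ⟨(q₂'.2.eq_or_eq h1 o₁ h2 o₂ q₂'.1).symm,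
      (q₁'.2.eq_or_eq h1 o₁ h2 o₂ q₁'.1).symm⟩
  · intro h
    suffices key : Nonempty ((τ.prod τ').Equiv (υ.prod υ')) from
      equiv_trans (equiv_trans e key) (equiv_symm e')
    rcases h with ⟨ha, hb₂⟩ | ⟨ha, hb₂⟩
    · exact nonempty_prod_equiv_prod
        (semisimplification_equiv_of_data hp hr hs h1 h1' hb₂
          (by rw [fst_snd_data (r := r), fst_snd_data (r := s), ha]))
        (semisimplification_equiv_of_data hp hb hb' h2 h2'
          (by rw [snd_fst_data, snd_fst_data, ha]) (by rw [snd_snd_data hp, snd_snd_data hp, hb₂]))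
    · exact equiv_trans (nonempty_prod_equiv_prod
        (semisimplification_equiv_of_data hp hr hb' h1 h2'
          (by rw [snd_fst_data, hb₂]) (by rw [fst_snd_data, snd_snd_data hp, ha]))
        (semisimplification_equiv_of_data hp hb hs h2 h1'
          (by rw [snd_fst_data, ha]) (by rw [snd_snd_data hp, fst_snd_data, hb₂])))
        nonempty_prod_equiv_comm

lemma IsReduciblePi.exists_hasDataMod (hp : 2 < p) (hr : r ≤ p - 1) (h : IsReduciblePi r a η ρ)
    (e' : Nonempty (ρ.Equiv ρ')) : ∃ x, x ≠ 0 ∧ ∃ χ₁ χ₂, HasDataMod ρ' ⊥ x χ₁ χ₂ := by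
  obtain ⟨S, S', _, _, _, _, τ, τ', h1, -, e⟩ := h
  obtain ⟨k⟩ := equiv_trans (equiv_symm e) e'
  obtain ⟨f₁, o₁⟩ := exists_isOrdinary_iwahoriPi hp hr a η
  obtain ⟨x, hx, hd⟩ := h1.exists_hasDataMod o₁
  refine ⟨_, fun h0 => hx ?_, _, _, (hd.map (prodInl τ τ')).map k.toIntertwiningMap⟩
  exact congrArg Prod.fst (EquivLike.injective k (h0.trans (map_zero k).symm))

lemma IsReduciblePi.not_nonempty_equiv (hp : 2 < p) (hr : r ≤ p - 1) (hs : s ≤ p - 1)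
    (h : IsReduciblePi r a η ρ) : ¬ Nonempty (ρ.Equiv (iwahoriPi p s 0 η')) := by
  intro e'
  obtain ⟨x, hx, χ₁, χ₂, hd⟩ := h.exists_hasDataMod hp hr e'
  exact not_hasDataMod_iwahoriPi hp hs hx hd

lemma IsReduciblePi.isSmoothRep (hη : IsSmoothChar η) (h : IsReduciblePi r a η ρ) :
    IsSmoothRep ρ := by
  obtain ⟨S, S', _, _, _, _, τ, τ', h1, h2, e⟩ := h
  have hη' : IsSmoothChar (η * omegaQp p ^ (r + 1)) := hη.mul (isSmoothChar_omegaQp.pow _)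
  have h3 := isSmoothRep_iwahoriPi r (a : κ) hη
  have h4 := isSmoothRep_iwahoriPi (bracket p (p - 3 - r)) ((a⁻¹ : κˣ) : κ) hη'
  have h5 : IsSmoothRep τ := h1.isSmoothRep h3
  have h6 : IsSmoothRep τ' := h2.isSmoothRep h4
  exact (h5.prod h6).of_equiv e

variable {red : Zpbar p →+* κ} {V : Type} [AddCommGroup V] [Module κ V]
  {σ : Representation κ (GalQp p) V}

/-- Breuil's correspondence in terms of Iwahori induction. -/
theorem breuilLLC_iff (hp : 2 < p) : BreuilLLC red σ ρ ↔
    (∃ (r : ℕ) (η : QpChar) (χ : galQp2 p →* κˣ),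
      r ≤ p - 1 ∧ IsSmoothChar η ∧ IsOmega2Extension red (r + 1) χ ∧
      Nonempty (σ.Equiv (twist (indQp2 χ) (galChar η))) ∧
      Nonempty (ρ.Equiv (iwahoriPi p r 0 η))) ∨
    (∃ (r : ℕ) (a : κˣ) (η : QpChar),
      r ≤ p - 1 ∧ IsSmoothChar η ∧ Nonempty (σ.Equiv (reducibleGal r a η)) ∧
      IsReduciblePi r a η ρ) := by
  have hs : ∀ {r : ℕ} (_ : r ≤ p - 1) (a : κ) (η : QpChar),
      Nonempty ((sphericalPi p r a η).Equiv (iwahoriPi p r a η)) := fun hr a η =>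
    equiv_symm (nonempty_iwahoriPi_equiv_sphericalPi hr a η)
  have hb := fun r : ℕ => bracket_le hp ((p : ℤ) - 3 - r)
  constructor
  · rintro (⟨r, η, χ, hr, hη, hχ, e, e'⟩ |
      ⟨r, a, η, hr, hη, e, S, S', i₁, i₂, i₃, i₄, τ, τ', h1, h2, e'⟩)
    · exact Or.inl ⟨r, η, χ, hr, hη, hχ, e, equiv_trans e' (hs hr 0 η)⟩
    · exact Or.inr ⟨r, a, η, hr, hη, e, S, S', i₁, i₂, i₃, i₄, τ, τ', h1.of_equiv (hs hr _ _),
        h2.of_equiv (hs (hb r) _ _), e'⟩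
  · rintro (⟨r, η, χ, hr, hη, hχ, e, e'⟩ |
      ⟨r, a, η, hr, hη, e, S, S', i₁, i₂, i₃, i₄, τ, τ', h1, h2, e'⟩)
    · exact Or.inl ⟨r, η, χ, hr, hη, hχ, e, equiv_trans e' (equiv_symm (hs hr 0 η))⟩
    · exact Or.inr ⟨r, a, η, hr, hη, e, S, S', i₁, i₂, i₃, i₄, τ, τ',
        h1.of_equiv (equiv_symm (hs hr _ _)),
        h2.of_equiv (equiv_symm (hs (hb r) _ _)), e'⟩

end Reducible

end

end ModPLLC

open ModPLLC in
theorem mainTheorem5 (p : ℕ) [Fact p.Prime] (hp : 5 ≤ p) (red : Zpbar p →+* Fpbar p) :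
    -- the image of `ind(ω₂^{r+1}) ⊗ η` is the isomorphism class of `π(r, 0, η)`
    (∀ (r : ℕ) (η : ℚ_[p]ˣ →* (Fpbar p)ˣ), r ≤ p - 1 → IsSmoothChar η →
      (∃ χ : galQp2 p →* (Fpbar p)ˣ, IsOmega2Extension red (r + 1) χ) ∧
      ∀ χ : galQp2 p →* (Fpbar p)ˣ, IsOmega2Extension red (r + 1) χ →
        ∀ (W : Type) [AddCommGroup W] [Module (Fpbar p) W]
          (Pi : Representation (Fpbar p) (GL2Qp p) W),
          BreuilLLC red (twist (indQp2 χ) (galChar η)) Pi ↔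
            Nonempty (Pi.Equiv (iwahoriPi p r 0 η))) ∧
    -- the image of `(μ_a ω^{r+1} ⊕ μ_{a⁻¹}) ⊗ η` is the isomorphism class of
    -- `π(r, a, η)^ss ⊕ π([p-3-r], a⁻¹, η ω^{r+1})^ss`
    (∀ (r : ℕ) (a : (Fpbar p)ˣ) (η : ℚ_[p]ˣ →* (Fpbar p)ˣ), r ≤ p - 1 → IsSmoothChar η →
      (∃ (S S' : Type) (_ : AddCommGroup S) (_ : Module (Fpbar p) S) (_ : AddCommGroup S')
        (_ : Module (Fpbar p) S') (τ : Representation (Fpbar p) (GL2Qp p) S)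
        (τ' : Representation (Fpbar p) (GL2Qp p) S'),
        IsSemisimplification (iwahoriPi p r a η) τ ∧
        IsSemisimplification
          (iwahoriPi p (bracket p (p - 3 - r)) (a⁻¹ : (Fpbar p)ˣ) (η * omegaQp p ^ (r + 1))) τ') ∧
      ∀ (S S' : Type) [AddCommGroup S] [Module (Fpbar p) S] [AddCommGroup S']
        [Module (Fpbar p) S'] (τ : Representation (Fpbar p) (GL2Qp p) S)
        (τ' : Representation (Fpbar p) (GL2Qp p) S'),
        IsSemisimplification (iwahoriPi p r a η) τ →
        IsSemisimplification
          (iwahoriPi p (bracket p (p - 3 - r)) (a⁻¹ : (Fpbar p)ˣ) (η * omegaQp p ^ (r + 1))) τ' →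
        ∀ (W : Type) [AddCommGroup W] [Module (Fpbar p) W]
          (Pi : Representation (Fpbar p) (GL2Qp p) W),
          BreuilLLC red (reducibleGal r a η) Pi ↔ Nonempty (Pi.Equiv (τ.prod τ'))) ∧
    -- this is a one-to-one correspondence between isomorphism classes of smooth representations
    (∀ (V V' W W' : Type) [AddCommGroup V] [Module (Fpbar p) V] [AddCommGroup V']
      [Module (Fpbar p) V'] [AddCommGroup W] [Module (Fpbar p) W] [AddCommGroup W']
      [Module (Fpbar p) W'] (ρ : Representation (Fpbar p) (GalQp p) V)
      (ρ' : Representation (Fpbar p) (GalQp p) V') (Pi : Representation (Fpbar p) (GL2Qp p) W)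
      (Pi' : Representation (Fpbar p) (GL2Qp p) W'),
      BreuilLLC red ρ Pi → BreuilLLC red ρ' Pi' →
        IsSmoothRep ρ ∧ IsSmoothRep Pi ∧ (Nonempty (ρ.Equiv ρ') ↔ Nonempty (Pi.Equiv Pi'))) := by

  have h2 : 2 < p := by omega
  have hp2 : p ≠ 2 := by omega
  refine ⟨fun r η hr hη => ⟨exists_isOmega2Extension hp2 red (r + 1), fun χ hχ W _ _ Pi => ?_⟩,
    fun r a η hr hη => ⟨?_, fun S S' _ _ _ _ τ τ' h1 h1' W _ _ Pi => ?_⟩,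
    fun V V' W W' _ _ _ _ _ _ _ _ ρ ρ' Pi Pi' h h' => ?_⟩
  · rw [breuilLLC_iff h2]
    constructor
    · rintro (⟨s, η', χ', hs, hη', hχ', e, e'⟩ | ⟨s, b, η', hs, hη', e, e'⟩)
      · exact equiv_trans e' (equiv_symm ((nonempty_iwahoriPi_equiv_iff h2 hr hs
          η η').2 ((nonempty_equiv_iff_supersingularRel hp2 hr hs hη hη' hχ hχ').1 e)))
      · exact absurd (equiv_symm e) (not_nonempty_twist_indQp2_equiv_reducibleGal hp2 hr hχ)
    · exact fun e => Or.inl ⟨r, η, χ, hr, hη, hχ, ⟨Representation.Equiv.refl _⟩, e⟩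
  · obtain ⟨S, i₁, i₂, τ, h1⟩ := exists_isSemisimplification_iwahoriPi h2 hr a η
    obtain ⟨S', i₃, i₄, τ', h1'⟩ := exists_isSemisimplification_iwahoriPi h2
      (bracket_le h2 ((p : ℤ) - 3 - r)) a⁻¹ (η * omegaQp p ^ (r + 1))
    exact ⟨S, S', i₁, i₂, i₃, i₄, τ, τ', h1, h1'⟩
  · rw [breuilLLC_iff h2]
    have hPi : IsReduciblePi r a η (τ.prod τ') :=
      ⟨S, S', _, _, _, _, τ, τ', h1, h1', ⟨Representation.Equiv.refl _⟩⟩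
    constructor
    · rintro (⟨s, η', χ', hs, hη', hχ', e, e'⟩ | ⟨s, b, η', hs, hη', e, e'⟩)
      · exact absurd e (not_nonempty_twist_indQp2_equiv_reducibleGal hp2 hs hχ')
      · exact equiv_symm ((hPi.nonempty_equiv_iff h2 hr hs e').2
          ((nonempty_equiv_iff_reducibleRel hp2 red hη hη').1 e))
    · exact fun e => Or.inr ⟨r, a, η, hr, hη, ⟨Representation.Equiv.refl _⟩,
        S, S', _, _, _, _, τ, τ', h1, h1', e⟩
  · rw [breuilLLC_iff h2] at h h'
    refine ⟨?_, ?_, ?_⟩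
    · rcases h with ⟨r, η, χ, hr, hη, hχ, e, -⟩ | ⟨r, a, η, hr, hη, e, -⟩
      · exact ((isSmoothRep_indQp2 red hχ.1).twist (isSmoothChar_galChar hη)).of_equiv e
      · exact (isSmoothRep_reducibleGal r a hη).of_equiv e
    · rcases h with ⟨r, η, χ, hr, hη, hχ, -, e⟩ | ⟨r, a, η, hr, hη, -, e⟩
      · exact (isSmoothRep_iwahoriPi r 0 hη).of_equiv e
      · exact e.isSmoothRep hη
    · rcases h with ⟨r, η, χ, hr, hη, hχ, e, f⟩ | ⟨r, a, η, hr, hη, e, f⟩ <;>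
        rcases h' with ⟨s, η', χ', hs, hη', hχ', e', f'⟩ | ⟨s, b, η', hs, hη', e', f'⟩
      · have key := (nonempty_equiv_iff_supersingularRel hp2 hr hs hη hη' hχ hχ').trans
          (nonempty_iwahoriPi_equiv_iff h2 hr hs η η').symm
        exact ⟨fun i => equiv_trans f (equiv_trans (key.1 (equiv_trans
          (equiv_symm e) (equiv_trans i e'))) (equiv_symm f')),
          fun i => equiv_trans e (equiv_trans (key.2 (equiv_trans
          (equiv_symm f) (equiv_trans i f'))) (equiv_symm e'))⟩
      · exact ⟨fun i => absurd (equiv_trans (equiv_symm e')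
          (equiv_trans (equiv_symm i) e))
          (not_nonempty_twist_indQp2_equiv_reducibleGal hp2 hr hχ),
          fun i => absurd (equiv_trans (equiv_symm i) f)
          (f'.not_nonempty_equiv h2 hs hr)⟩
      · exact ⟨fun i => absurd (equiv_trans (equiv_symm e)
          (equiv_trans i e'))
          (not_nonempty_twist_indQp2_equiv_reducibleGal hp2 hs hχ'),
          fun i => absurd (equiv_trans i f') (f.not_nonempty_equiv h2 hr hs)⟩
      · have key := (nonempty_equiv_iff_reducibleRel hp2 red hη hη').trans
          (f.nonempty_equiv_iff h2 hr hs f').symm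
        exact ⟨fun i => key.1 (equiv_trans (equiv_symm e)
          (equiv_trans i e')), fun i => equiv_trans e
          (equiv_trans (key.2 i) (equiv_symm e'))⟩
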